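/- **Setting.** Let $\Omega\subset\mathbb R^3\times\mathbb R$ be open and let $S=(S^1,S^2):\Omega\to\mathbb R^2$, $(x,y_3)\mapsto S(x,y_3)$, be $C^\infty$. Put $\mathcal M=\{(x,y): (x,y_3)\in\Omega,\ (y_1,y_2)=S(x,y_3)\}$, with coordinates $(x,y_3)$, and use the coordinates $(x,\tau,y_3)$, $(x,y_3)\in\Omega$, $\tau\in\mathbb R^2\setminus\{0\}$, on $(N^*\mathcal M)'$ without its zero section. In these coordinates the projections to the two cotangent spaces are $$\pi_L(x,\tau,y_3)=(x,\ \tau_1S^1_x+\tau_2S^2_x),\qquad \pi_R(x,\tau,y_3)=(S(x,y_3),\,y_3,\,\tau,\,-\tau_1S^1_{y_3}-\tau_2S^2_{y_3}).$$ For a $C^\infty$ map $g$ between manifolds of equal dimension whose differential has corank at most $1$ and such that $d(\det dg)\neq0$ wherever $\det dg=0$, a *kernel field* is a nowhere vanishing smooth (locally defined) vector field $V$ with $V_P\in\ker dg_P$ at all $P$ with $\det dg_P=0$. The only singularities of $g$ are *Whitney folds* if $V(\det dg)\ne0$ on $\{\det dg=0\}$ for every kernel field $V$; $g$ is a *blowdown*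 if every kernel field is tangent to $\{\det dg=0\}$ at the points of that hypersurface. Assume: * $\mathcal M\to\mathbb R^3$, $(x,y_3)\mapsto (S(x,y_3),y_3)$, is a submersion; * the only singularities of $\pi_L$ are Whitney folds, and $\pi_R$ is a blowdown; * the projection $(x,\tau,y_3)\mapsto(x,y_3)$, restricted to the hypersurface $\mathcal L=\{\det d\pi_L=0\}$, is a submersion onto $\mathcal M$. Let $\Delta^i=\det(S^1_x,S^2_x,S^i_{xy_3})$, $i=1,2$, and $\tau\cdot\Delta=\tau_1\Delta^1+\tau_2\Delta^2$. Let $\chi_0\in C_c^\infty(\mathbb R)$ be real-valued, supported in $[\frac14,4]$, with $\sum_{j\in\mathbb Z}\chi_0(2^js)=1$ for all $s>0$. Let $\chi_L,\chi_R\in C_c^\infty(\mathbb R^3)$ be real-valued with $(x,y_3)\in\Omega$ whenever $x\in\operatorname{supp}\chi_L$ and $y\in\operatorname{supp}\chi_R$. For $\varepsilon>0$, integers $k\ge1$ and $0\le\ell\le\ell_0:=\lfloor k/(2+\varepsilon)\rfloor$, and a choice of sign $\pm$, let $$a_{k,\ell,\pm}(x,y_3,\tau)=\begin{cases}\chi_0\big(2^{\ell-k}(\pm\tau\cdot\Delta(x,y_3))\big),&\ell<\ell_0,\\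 1-\sum_{0\le m<\ell_0}\chi_0\big(2^{m-k}(\pm\tau\cdot\Delta(x,y_3))\big),&\ell=\ell_0,\end{cases}$$ $$\mathcal R_{k,\ell,\pm}f(x)=\chi_L(x)\int_{\mathbb R^2}\int_{\mathbb R^3}e^{i\tau\cdot(S(x,y_3)-(y_1,y_2))}\chi_R(y)f(y)\,\chi_0(2^{-k}|\tau|)\,a_{k,\ell,\pm}(x,y_3,\tau)\,dy\,d\tau .$$ **Proposition 4.2.** For every $\varepsilon>0$ there is a constant $C>0$ (depending only on $\varepsilon,S,\Omega,\chi_0,\chi_L,\chi_R$) such that for all $k\ge1$, all $0\le\ell\le\ell_0=\lfloor k/(2+\varepsilon)\rfloor$, both signs $\pm$ and all $f\in L^2(\mathbb R^3;\mathbb C)$ one has $\mathcal R_{k,\ell,\pm}f\in L^2(\mathbb R^3)$ and $$\|\mathcal R_{k,\ell,\pm}f\|_{L^2}\le C\,2^{(\ell-k)/2+\ell\varepsilon}\,\|f\|_{L^2}.$$ Moreover, for every finite collection $\mathcal I$ of intervals of length $2^{-\ell}$ with pairwise disjoint interiors, writing $f_I(y)=f(y)\mathbf 1_I(y_3)$,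 $$\Big\|\sum_{I\in\mathcal I}\mathcal R_{k,\ell,\pm}f_I\Big\|_{L^2}\le C\,2^{(\ell-k)/2+\ell\varepsilon}\Big(\sum_{I\in\mathcal I}\|f_I\|_{L^2}^2\Big)^{1/2}.$$ -/

import Mathlib

open MeasureTheory
open scoped ContDiff ENNReal

noncomputable section

namespace FoldBlowdown

/-! ### Whitney folds and blowdowns for maps of `ℝⁿ` to itself, on an open set `X` -/

/-- The Jacobian determinant `det dg`. -/
def jac {n : ℕ} (g : (Fin n → ℝ) → (Fin n → ℝ)) (P : Fin n → ℝ) : ℝ :=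
  (fderiv ℝ g P).det

/-- `g` is `C^∞` on `X`, `dg` has corank at most one, and `d(det dg) ≠ 0` wherever
`det dg = 0`; so `{P ∈ X | det dg P = 0}` is a smooth hypersurface, with tangent space
`ker d(det dg)_P`. -/
structure HasSimpleSingularities {n : ℕ} (g : (Fin n → ℝ) → (Fin n → ℝ))
    (X : Set (Fin n → ℝ)) : Prop where
  smooth : ContDiffOn ℝ ∞ g X
  corank_le_one : ∀ P ∈ X, Module.finrank ℝ (LinearMap.ker (fderiv ℝ g P).toLinearMap) ≤ 1
  d_jac_ne_zero : ∀ P ∈ X, jac g P = 0 → fderiv ℝ (jac g) P ≠ 0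

/-- `V` is a kernel field of `g` on `U`: a nowhere vanishing smooth vector field with
`V P ∈ ker dg_P` at each point where `det dg` vanishes. -/
structure IsKernelField {n : ℕ} (g V : (Fin n → ℝ) → (Fin n → ℝ))
    (U : Set (Fin n → ℝ)) : Prop where
  smooth : ContDiffOn ℝ ∞ V U
  ne_zero : ∀ P ∈ U, V P ≠ 0
  mem_ker : ∀ P ∈ U, jac g P = 0 → fderiv ℝ g P (V P) = 0

/-- The only singularities of `g` on `X` are Whitney folds: `V (det dg) ≠ 0` on `det dg = 0`
for every (locally defined) kernel field `V`. -/
structure IsWhitneyFold {n : ℕ} (g : (Fin n → ℝ) → (Fin n → ℝ))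
    (X : Set (Fin n → ℝ)) : Prop extends HasSimpleSingularities g X where
  transversal : ∀ U ⊆ X, IsOpen U → ∀ V, IsKernelField g V U →
    ∀ P ∈ U, jac g P = 0 → fderiv ℝ (jac g) P (V P) ≠ 0

/-- `g` is a blowdown on `X`: every (locally defined) kernel field is tangential to the
hypersurface `det dg = 0` along that hypersurface. -/
structure IsBlowdown {n : ℕ} (g : (Fin n → ℝ) → (Fin n → ℝ))
    (X : Set (Fin n → ℝ)) : Prop extends HasSimpleSingularities g X where
  tangential : ∀ U ⊆ X, IsOpen U → ∀ V, IsKernelField g V U →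
    ∀ P ∈ U, jac g P = 0 → fderiv ℝ (jac g) P (V P) = 0

/-! ### The canonical relation of the family of curves `y' = S(x, y₃)`

`S : ℝ³ × ℝ → ℝ²`, and `x₁, x₂, x₃` are `x 0, x 1, x 2`. The twisted conormal bundle of
`{(x, y) | (y₁, y₂) = S(x, y₃)}` has the coordinates `P = (x₁, x₂, x₃, τ₁, τ₂, y₃)`. -/

/-- `∂S^i/∂x_j`. -/
def dx (S : (Fin 3 → ℝ) × ℝ → (Fin 2 → ℝ)) (i : Fin 2) (j : Fin 3)
    (z : (Fin 3 → ℝ) × ℝ) : ℝ :=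
  fderiv ℝ (fun w => S w i) z (Pi.single j 1, 0)

/-- `∂S^i/∂y₃`. -/
def dy (S : (Fin 3 → ℝ) × ℝ → (Fin 2 → ℝ)) (i : Fin 2) (z : (Fin 3 → ℝ) × ℝ) : ℝ :=
  fderiv ℝ (fun w => S w i) z (0, 1)

/-- `∂²S^i/∂x_j∂y₃`. -/
def dxdy (S : (Fin 3 → ℝ) × ℝ → (Fin 2 → ℝ)) (i : Fin 2) (j : Fin 3)
    (z : (Fin 3 → ℝ) × ℝ) : ℝ :=
  fderiv ℝ (dx S i j) z (0, 1)

/-- `Δ^i = det (S^1_x, S^2_x, S^i_{x y₃})`, the three vectors being the columns. -/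
def Delta (S : (Fin 3 → ℝ) × ℝ → (Fin 2 → ℝ)) (i : Fin 2) (z : (Fin 3 → ℝ) × ℝ) : ℝ :=
  Matrix.det (Matrix.of fun j : Fin 3 => ![dx S 0 j z, dx S 1 j z, dxdy S i j z])

/-- The base coordinates `(x, y₃)` of `P = (x, τ, y₃)`. -/
def base (P : Fin 6 → ℝ) : (Fin 3 → ℝ) × ℝ := (![P 0, P 1, P 2], P 5)

/-- The points `(x, τ, y₃)` of the twisted conormal bundle with `(x, y₃) ∈ Ω`, without the
zero section. -/
def conormal (Ω : Set ((Fin 3 → ℝ) × ℝ)) : Set (Fin 6 → ℝ) :=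
  {P | base P ∈ Ω ∧ (P 3, P 4) ≠ (0, 0)}

/-- `π_L : (x, τ, y₃) ↦ (x, τ₁ S^1_x + τ₂ S^2_x)`. -/
def piL (S : (Fin 3 → ℝ) × ℝ → (Fin 2 → ℝ)) (P : Fin 6 → ℝ) : Fin 6 → ℝ :=
  ![P 0, P 1, P 2,
    P 3 * dx S 0 0 (base P) + P 4 * dx S 1 0 (base P),
    P 3 * dx S 0 1 (base P) + P 4 * dx S 1 1 (base P),
    P 3 * dx S 0 2 (base P) + P 4 * dx S 1 2 (base P)]

/-- `π_R : (x, τ, y₃) ↦ (S(x, y₃), y₃, τ, -(τ₁ S^1_{y₃} + τ₂ S^2_{y₃}))`. -/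
def piR (S : (Fin 3 → ℝ) × ℝ → (Fin 2 → ℝ)) (P : Fin 6 → ℝ) : Fin 6 → ℝ :=
  ![S (base P) 0, S (base P) 1, P 5, P 3, P 4,
    -(P 3 * dy S 0 (base P) + P 4 * dy S 1 (base P))]

/-- The geometric assumptions on `S` over the open set `Ω` of points `(x, y₃)`. In the
coordinates `(x, y₃)` of the incidence manifold `M`, the projection to `Ω_L` is
`(x, y₃) ↦ x`, trivially a submersion, and the projection to `Ω_R` is
`(x, y₃) ↦ (S(x, y₃), y₃)`. -/
structure IsAdmissible (S : (Fin 3 → ℝ) × ℝ → (Fin 2 → ℝ))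
    (Ω : Set ((Fin 3 → ℝ) × ℝ)) : Prop where
  isOpen : IsOpen Ω
  smooth : ContDiffOn ℝ ∞ S Ω
  /-- `M → Ω_R` is a submersion. -/
  submersion_right : ∀ z ∈ Ω, Function.Surjective
    (fderiv ℝ (fun w : (Fin 3 → ℝ) × ℝ => (S w, w.2)) z)
  fold_left : IsWhitneyFold (piL S) (conormal Ω)
  blowdown_right : IsBlowdown (piR S) (conormal Ω)
  /-- The projection `(x, τ, y₃) ↦ (x, y₃)`, restricted to the hypersurface where
  `det dπ_L = 0`, is a submersion onto `M`: each vector at `(x, y₃)` is the image of a vector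
  tangent to that hypersurface. -/
  submersion_singular : ∀ P ∈ conormal Ω, jac (piL S) P = 0 →
    ∀ v : (Fin 3 → ℝ) × ℝ, ∃ w : Fin 6 → ℝ, fderiv ℝ (jac (piL S)) P w = 0 ∧ base w = v

/-! ### The dyadic pieces of the operator -/

/-- A dyadic partition of unity on `(0, ∞)`. -/
structure IsDyadicCutoff (χ₀ : ℝ → ℝ) : Prop where
  smooth : ContDiff ℝ ∞ χ₀
  support : Function.support χ₀ ⊆ Set.Icc (1 / 4) 4
  sum_eq_one : ∀ s : ℝ, 0 < s → HasSum (fun j : ℤ => χ₀ ((2 : ℝ) ^ j * s)) 1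

/-- `ℓ₀ = ⌊k / (2 + ε)⌋`. -/
def ell0 (ε : ℝ) (k : ℕ) : ℕ := ⌊(k : ℝ) / (2 + ε)⌋₊

/-- `a_{k,ℓ,±}(x, y₃, τ)` at `z = (x, y₃)`, where `s = ±1` is the sign. -/
def symbol (χ₀ : ℝ → ℝ) (S : (Fin 3 → ℝ) × ℝ → (Fin 2 → ℝ)) (ε : ℝ) (k ℓ : ℕ) (s : ℝ)
    (z : (Fin 3 → ℝ) × ℝ) (τ : Fin 2 → ℝ) : ℝ :=
  if ℓ < ell0 ε k then
    χ₀ ((2 : ℝ) ^ ((ℓ : ℤ) - (k : ℤ)) * (s * (τ 0 * Delta S 0 z + τ 1 * Delta S 1 z)))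
  else
    1 - ∑ m ∈ Finset.range (ell0 ε k),
      χ₀ ((2 : ℝ) ^ ((m : ℤ) - (k : ℤ)) * (s * (τ 0 * Delta S 0 z + τ 1 * Delta S 1 z)))

/-- The operator `R_{k,ℓ,±}`,
`R f(x) = χ_L(x) ∫∫ e^{iτ·(S(x,y₃)-y')} χ_R(y) f(y) χ₀(2^{-k}|τ|) a_{k,ℓ,±}(x,y₃,τ) dy dτ`. -/
def R (χ₀ : ℝ → ℝ) (χL χR : (Fin 3 → ℝ) → ℝ) (S : (Fin 3 → ℝ) × ℝ → (Fin 2 → ℝ))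
    (ε : ℝ) (k ℓ : ℕ) (s : ℝ) (f : (Fin 3 → ℝ) → ℂ) (x : Fin 3 → ℝ) : ℂ :=
  (χL x : ℂ) * ∫ τ : Fin 2 → ℝ, ∫ y : Fin 3 → ℝ,
    Complex.exp (Complex.I *
        ((τ 0 * (S (x, y 2) 0 - y 0) + τ 1 * (S (x, y 2) 1 - y 1) : ℝ) : ℂ)) *
      (χR y : ℂ) * f y *
      (χ₀ ((2 : ℝ) ^ (-(k : ℤ)) * Real.sqrt (τ 0 ^ 2 + τ 1 ^ 2)) : ℂ) *
      (symbol χ₀ S ε k ℓ s (x, y 2) τ : ℂ)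

/-- `f_I(y) = f(y) 1_I(y₃)`. -/
def slab (I : Set ℝ) (f : (Fin 3 → ℝ) → ℂ) : (Fin 3 → ℝ) → ℂ :=
  Set.indicator {y | y 2 ∈ I} f

/-- `I` is an interval (with or without its end points) of length `δ`. -/
def IsIntervalOfLength (δ : ℝ) (I : Set ℝ) : Prop :=
  ∃ a : ℝ, Set.Ioo a (a + δ) ⊆ I ∧ I ⊆ Set.Icc a (a + δ)

end FoldBlowdown

end

/-! Put λ = 2^k and h = 2^{-ℓ}, and rescale τ = λθ, so that θ runs over a fixed annulus and the
symbol localizes θ·Δ to size h. A Fourier transform in y' = (y₁, y₂), which contributes λ^{-2} to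
the squared norm, turns the operator into an oscillatory integral operator T with phase λ θ·S(x,t),
acting on functions of z = (θ,t) with t = y₃. The kernel of T*T is an integral over x with phase
λ(θ'·S(x,t') - θ·S(x,t)), and everything rests on its decay in z' - z.

Geometry. Both projections have the Jacobian τ·Δ (`jac_piL`, `jac_piR`), and the hypotheses reduce
to pointwise facts (`GeometryAt`). Let n = S^1_x × S^2_x. Then n and Δ do not vanish; the blowdown
condition becomes n·∇_x Δ^i = κ Δ^i with a smooth κ; the fold condition says that, for fixed x, the
map (θ,t) ↦ (θ·S_x, θ·Δ) is an immersion.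

Near times, |t' - t| ≲ h. If |θ' - θ| dominates |t' - t|, the x-gradient of the phase difference has
size |z' - z|; the cutoffs live at scale h, so each integration by parts gains λh|z' - z|. Otherwise
one differentiates along n(x,t). The phase difference then has derivative (t' - t)(θ'·Δ(x,t') + O(t'
- t)), of size h|t' - t| where θ'·Δ has size h, and by the blowdown identity the field n does not
feel the scale h of the cutoffs in θ·Δ; the gain is λh|t' - t|
(`IsModel.exists_transport_phase_bound`). In addition x is restricted to a tube |S(x,t_I) - w| ≲ h,
to which n is almost tangent and whose volume is O(h²). The kernel is thus O(h²(1 + λh|z' -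
z|)^{-6}), and Schur's test gives the squared norm λ⁴ · λ^{-2} · h²(λh)^{-3} = λ^{-1}h^{-1} =
2^{ℓ-k}, where λ⁴ is the square of the Jacobian of τ = λθ. Averaging over w removes the tube: data
with y' away from w contribute O((λh²)^{-N}), by integration by parts in θ
(`IsModel.exists_short_interval_estimate`).

Far times, Ch ≤ |t' - t| ≤ δ. Both curvatures are O(h), so the immersion property bounds the
x-gradient of the phase difference below by c|z' - z|, and each integration by parts gains at least
λh². As ℓ ≤ k/(2+ε), λh² is at least a fixed positive power of λ; distant slabs are therefore almost
orthogonal (`IsModel.exists_far_pairing_bound`), and only neighbouring slabs matter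
(`IsModel.exists_long_interval_estimate`).

Central piece. At ℓ = ℓ₀ there is no lower bound for θ·Δ. Slabs of length q = (λh)^{-1} need no
decay in t, and each has about h/q = λh² neighbours; the squared norm becomes O(h), which exceeds
λ^{-1}h^{-1} by O(2^{εℓ₀}) only. Since the symbol at ℓ₀ subtracts cutoffs of one sign, it also
contains the dyadic pieces of the other sign and a piece at scale 1. These are of the noncentral
type, and their norms form a geometric sum (`IsModel.exists_decomposition`).

The inequality for slabs is the first inequality applied to the sum of the f_I, whose norm is the ℓ²
sum of theirs. -/

noncomputable section

namespace FoldBlowdown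

/-! ### Nonstationary phase along a vector field -/

/-- The divergence of a vector field on `ℝᵈ`. -/
def divergence {d : ℕ} (X : (Fin d → ℝ) → (Fin d → ℝ)) (x : Fin d → ℝ) : ℝ :=
  ∑ j, fderiv ℝ X x (Pi.single j 1) j

/-- The transpose of the derivation X is -(X + div X); coordinatewise integration by parts needs
only the compact support of b. -/
theorem integral_vectorField_by_parts {d : ℕ} {X : (Fin d → ℝ) → (Fin d → ℝ)}
    {e : (Fin d → ℝ) → ℂ} {b : (Fin d → ℝ) → ℝ} (hX : ContDiff ℝ ∞ X) (he : ContDiff ℝ ∞ e)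
    (hb : ContDiff ℝ ∞ b) (hc : HasCompactSupport b) :
    ∫ x, b x • fderiv ℝ e x (X x) =
      -∫ x, (fderiv ℝ b x (X x) + divergence X x * b x) • e x := by
  have hXj : ∀ j, ContDiff ℝ ∞ fun x => X x j := fun j => contDiff_pi.1 hX j
  have hf : ∀ j, ContDiff ℝ ∞ fun x => X x j * b x := fun j => (hXj j).mul hb
  have hfc : ∀ j, HasCompactSupport fun x => X x j * b x := fun j => hc.mul_left
  have hde : ∀ v, Continuous fun x => fderiv ℝ e x v := fun v =>
    (he.continuous_fderiv (by simp)).clm_apply continuous_const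
  have hdf : ∀ j v, Continuous fun x => fderiv ℝ (fun x => X x j * b x) x v := fun j v =>
    ((hf j).continuous_fderiv (by simp)).clm_apply continuous_const
  have i1 : ∀ j, Integrable fun x => (X x j * b x) • fderiv ℝ e x (Pi.single j 1) := fun j =>
    ((hf j).continuous.smul (hde _)).integrable_of_hasCompactSupport ((hfc j).smul_right)
  have i2 : ∀ j, Integrable fun x =>
      fderiv ℝ (fun x => X x j * b x) x (Pi.single j 1) • e x := fun j =>
    ((hdf j _).smul he.continuous).integrable_of_hasCompactSupport
      (((hfc j).fderiv_apply ℝ _).smul_right)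
  have key : ∀ j, ∫ x, (X x j * b x) • fderiv ℝ e x (Pi.single j 1) =
      -∫ x, fderiv ℝ (fun x => X x j * b x) x (Pi.single j 1) • e x := fun j => by
    apply integral_smul_fderiv_eq_neg_fderiv_smul_of_integrable (i2 j) (i1 j)
    · exact ((hf j).continuous.smul he.continuous).integrable_of_hasCompactSupport
        ((hfc j).smul_right)
    · exact fun x _ => ((hf j).differentiable (by simp)) x
    · exact fun x _ => (he.differentiable (by simp)) x
  have expand : ∀ {G : Type} [NormedAddCommGroup G] [NormedSpace ℝ G]
      (L : (Fin d → ℝ) →L[ℝ] G) (v : Fin d → ℝ), L v = ∑ j, v j • L (Pi.single j 1) := by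
    intro G _ _ L v
    conv_lhs => rw [pi_eq_sum_univ' v]
    simp [map_sum, map_smul]
  have l1 : ∀ x, b x • fderiv ℝ e x (X x) =
      ∑ j, (X x j * b x) • fderiv ℝ e x (Pi.single j 1) := by
    intro x
    rw [expand, Finset.smul_sum]
    simp_rw [smul_smul, mul_comm]
  have l2 : ∀ x, (fderiv ℝ b x (X x) + divergence X x * b x) • e x =
      ∑ j, fderiv ℝ (fun x => X x j * b x) x (Pi.single j 1) • e x := by
    intro x
    rw [← Finset.sum_smul, expand (fderiv ℝ b x), divergence, Finset.sum_mul,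
      ← Finset.sum_add_distrib]
    congr 1
    refine Finset.sum_congr rfl fun j _ => ?_
    have h1 : fderiv ℝ (fun x => X x j) x (Pi.single j 1) = fderiv ℝ X x (Pi.single j 1) j := by
      rw [fderiv_apply ((hX.differentiable (by simp)) x)]
      rfl
    rw [fderiv_fun_mul (((hXj j).differentiable (by simp)) x) ((hb.differentiable (by simp)) x)]
    simp [h1]
    ring
  simp_rw [l1, l2]
  rw [integral_finsetSum _ fun j _ => i1 j, integral_finsetSum _ fun j _ => i2 j,
    ← Finset.sum_neg_distrib]
  exact Finset.sum_congr rfl fun j _ => key j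

/-- A smooth function on the line which agrees with the inverse away from `(-c, c)`. -/
theorem exists_smooth_inverse {c : ℝ} (hc : 0 < c) :
    ∃ ι : ℝ → ℝ, ContDiff ℝ ∞ ι ∧ ∀ v, c ≤ |v| → ι v * v = 1 := by
  have hpos : ∀ v : ℝ, 0 < v ^ 2 + expNegInvGlue (c ^ 2 - v ^ 2) := by
    intro v
    rcases eq_or_ne v 0 with rfl | hv
    · have := expNegInvGlue.pos_of_pos (x := c ^ 2 - 0 ^ 2) (by simpa using pow_pos hc 2)
      positivity
    · exact add_pos_of_pos_of_nonneg (by positivity) (expNegInvGlue.nonneg _)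
  -- The added term vanishes for |v| ≥ c and is positive at v = 0, so the denominator has no zero.
  refine ⟨fun v => v / (v ^ 2 + expNegInvGlue (c ^ 2 - v ^ 2)), ?_, fun v hv => ?_⟩
  · refine ContDiff.div contDiff_id ?_ fun v => (hpos v).ne'
    exact (contDiff_id.pow 2).add (expNegInvGlue.contDiff.comp (by fun_prop))
  · have h0 : expNegInvGlue (c ^ 2 - v ^ 2) = 0 := by
      apply expNegInvGlue.zero_of_nonpos
      nlinarith [abs_nonneg v, sq_abs v]
    have hv0 : v ≠ 0 := by
      rintro rfl
      simp at hv
      linarith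
    simp only [h0]
    field_simp
    ring

/-- Uniformity in all the scales is obtained by a closed calculus. The amplitude is a fixed function
G of coordinates Y(x); the field X acts on functions of Y as the fixed field V, its divergence is
δ(Y), and its action on the phase is Λ f(Y). One integration by parts therefore gains Λ^{-1} and
replaces G by another fixed smooth function of Y, so that induction applies. Every parameter is
carried by Y, which stays in the compact set K on the support, and the constant depends only on K
and the fixed functions. -/
theorem exists_nonstationary_bound {d : ℕ} {F : Type} [NormedAddCommGroup F] [NormedSpace ℝ F]
    {V : F → F} {δ f : F → ℝ} (hV : ContDiff ℝ ∞ V) (hδ : ContDiff ℝ ∞ δ)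
    (hf : ContDiff ℝ ∞ f) {c : ℝ} (hc : 0 < c) {K : Set F} (hK : IsCompact K) (N : ℕ)
    {G : F → ℝ} (hG : ContDiff ℝ ∞ G) :
    ∃ C : ℝ, 0 ≤ C ∧ ∀ (Λ : ℝ) (Φ a : (Fin d → ℝ) → ℝ) (X : (Fin d → ℝ) → (Fin d → ℝ))
      (Y : (Fin d → ℝ) → F) (U W : Set (Fin d → ℝ)),
      Λ ≠ 0 → ContDiff ℝ ∞ Φ → ContDiff ℝ ∞ X → ContDiff ℝ ∞ Y → IsOpen U → IsCompact W →
      W ⊆ U → (∀ x ∈ U, a x = G (Y x)) → (∀ x ∉ W, a x = 0) →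
      (∀ x ∈ U, fderiv ℝ Y x (X x) = V (Y x)) → (∀ x ∈ U, divergence X x = δ (Y x)) →
      (∀ x ∈ U, fderiv ℝ Φ x (X x) = Λ * f (Y x)) → (∀ x ∈ W, Y x ∈ K) →
      (∀ x ∈ W, c ≤ |f (Y x)|) →
      ‖∫ x, Complex.exp (Complex.I * (Φ x : ℂ)) * (a x : ℂ)‖ ≤
        C * |Λ|⁻¹ ^ N * volume.real W := by
  induction N generalizing G with
  | zero =>
    obtain ⟨C, hC⟩ := hK.exists_bound_of_continuousOn hG.continuous.continuousOn
    refine ⟨max C 0, le_max_right _ _, ?_⟩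
    intro Λ Φ a X Y U W hΛ hΦ hX hY hU hW hWU haU haW _ _ _ hYK _
    have hint : ∫ x, Complex.exp (Complex.I * (Φ x : ℂ)) * (a x : ℂ) =
        ∫ x in W, Complex.exp (Complex.I * (Φ x : ℂ)) * (a x : ℂ) := by
      symm
      apply setIntegral_eq_integral_of_forall_compl_eq_zero
      intro x hx
      simp [haW x hx]
    rw [hint, pow_zero, mul_one]
    refine norm_setIntegral_le_of_norm_le_const hW.measure_lt_top fun x hx => ?_
    rw [norm_mul, mul_comm Complex.I, Complex.norm_exp_ofReal_mul_I, one_mul, haU x (hWU hx)]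
    simpa using (hC _ (hYK x hx)).trans (le_max_left C 0)
  | succ N ih =>
    obtain ⟨ι, hι, hιc⟩ := exists_smooth_inverse hc
    set G' : F → ℝ := fun y => ι (f y) * G y with hG'
    have hG's : ContDiff ℝ ∞ G' := (hι.comp hf).mul hG
    -- The transpose of X applied to G/f, again as a function of Y.
    set G₁ : F → ℝ := fun y => fderiv ℝ G' y (V y) + δ y * G' y with hG₁
    have hG₁s : ContDiff ℝ ∞ G₁ :=
      ((hG's.fderiv_right (m := ∞) (by simp)).clm_apply hV).add (hδ.mul hG's)
    obtain ⟨C, hC0, hC⟩ := ih hG₁s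
    refine ⟨C, hC0, ?_⟩
    intro Λ Φ a X Y U W hΛ hΦ hX hY hU hW hWU haU haW hDY hdiv hDΦ hYK hlow
    set b : (Fin d → ℝ) → ℝ := fun x => ι (f (Y x)) * a x with hb
    -- The amplitude is G(Y) on U and zero off W; these two open sets cover the space.
    have haS : ContDiff ℝ ∞ a := by
      rw [contDiff_iff_contDiffAt]
      intro x
      by_cases hx : x ∈ U
      · exact (hG.comp hY).contDiffAt.congr_of_eventuallyEq
          (Filter.eventually_of_mem (hU.mem_nhds hx) haU)
      · have hx' : x ∈ Wᶜ := fun h => hx (hWU h)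
        exact (contDiff_const (c := (0 : ℝ))).contDiffAt.congr_of_eventuallyEq
          (Filter.eventually_of_mem (hW.isClosed.isOpen_compl.mem_nhds hx') haW)
    have hbS : ContDiff ℝ ∞ b := ((hι.comp hf).comp hY).mul haS
    have hbW : ∀ x ∉ W, b x = 0 := fun x hx => by simp [hb, haW x hx]
    have hbc : HasCompactSupport b := HasCompactSupport.intro hW hbW
    set a₁ : (Fin d → ℝ) → ℝ := fun x => fderiv ℝ b x (X x) + divergence X x * b x with ha₁
    have heS : ContDiff ℝ ∞ fun x => Complex.exp (Complex.I * (Φ x : ℂ)) :=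
      (contDiff_const.mul (Complex.ofRealCLM.contDiff.comp hΦ)).cexp
    have hde : ∀ x v, fderiv ℝ (fun x => Complex.exp (Complex.I * (Φ x : ℂ))) x v =
        Complex.exp (Complex.I * (Φ x : ℂ)) * (Complex.I * (fderiv ℝ Φ x v : ℝ)) := by
      intro x v
      have h1 : HasFDerivAt Φ (fderiv ℝ Φ x) x := ((hΦ.differentiable (by simp)) x).hasFDerivAt
      have h2 := ((Complex.ofRealCLM.hasFDerivAt.comp x h1).const_mul Complex.I).cexp
      have h3 := h2.fderiv
      simp only [Function.comp_def, Complex.ofRealCLM_apply] at h3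
      rw [h3]
      simp
    have e1 : ∀ x, b x • fderiv ℝ (fun x => Complex.exp (Complex.I * (Φ x : ℂ))) x (X x) =
        (Complex.I * Λ) * (Complex.exp (Complex.I * (Φ x : ℂ)) * (a x : ℂ)) := by
      intro x
      rw [hde]
      by_cases hx : x ∈ W
      · have h1 := hιc _ (hlow x hx)
        rw [hDΦ x (hWU hx), hb, Complex.real_smul]
        have h2 : (ι (f (Y x)) : ℂ) * (f (Y x) : ℂ) = 1 := by exact_mod_cast h1
        push_cast
        linear_combination (Complex.exp (Complex.I * (Φ x : ℂ)) * Complex.I * Λ * a x) * h2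
      · simp [hb, haW x hx]
    have h1 := integral_vectorField_by_parts hX heS hbS hbc
    simp_rw [e1] at h1
    rw [integral_const_mul] at h1
    have h2 := hC Λ Φ a₁ X Y U W hΛ hΦ hX hY hU hW hWU ?_ ?_ hDY hdiv hDΦ hYK hlow
    · have h3 : ∫ x, (fderiv ℝ b x (X x) + divergence X x * b x) •
          Complex.exp (Complex.I * (Φ x : ℂ)) =
          ∫ x, Complex.exp (Complex.I * (Φ x : ℂ)) * (a₁ x : ℂ) := by
        congr 1 with x
        rw [Complex.real_smul, mul_comm]
      rw [h3] at h1
      have h4 := congrArg norm h1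
      rw [norm_mul, norm_neg, norm_mul, Complex.norm_I, one_mul, Complex.norm_real,
        Real.norm_eq_abs] at h4
      have hΛ' : 0 < |Λ| := abs_pos.2 hΛ
      have h5 : ‖∫ x, Complex.exp (Complex.I * (Φ x : ℂ)) * (a x : ℂ)‖ =
          |Λ|⁻¹ * ‖∫ x, Complex.exp (Complex.I * (Φ x : ℂ)) * (a₁ x : ℂ)‖ := by
        rw [← h4]; field_simp
      rw [h5]
      calc _ ≤ |Λ|⁻¹ * (C * |Λ|⁻¹ ^ N * volume.real W) := by gcongr
        _ = _ := by ring
    · intro x hx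
      have hev : b =ᶠ[nhds x] fun x => G' (Y x) :=
        Filter.eventually_of_mem (hU.mem_nhds hx) fun y hy => by simp [hb, hG', haU y hy]
      have hG'd : DifferentiableAt ℝ G' (Y x) := (hG's.differentiable (by simp)) _
      have hYd : DifferentiableAt ℝ Y x := (hY.differentiable (by simp)) x
      simp only [ha₁, hG₁]
      rw [hev.fderiv_eq, hev.eq_of_nhds, hdiv x hx, ← hDY x hx]
      have := fderiv_comp x hG'd hYd
      simp only [Function.comp_def] at this
      rw [this]
      rfl
    · intro x hx
      have hev : b =ᶠ[nhds x] fun _ => (0 : ℝ) :=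
        Filter.eventually_of_mem (hW.isClosed.isOpen_compl.mem_nhds hx) hbW
      simp only [ha₁]
      rw [hev.fderiv_eq, hev.eq_of_nhds]
      simp

/-! ### Smooth divided differences -/

/-- Differentiation under the integral sign. The target space varies in the induction because the
derivative takes values in a space of linear maps. -/
theorem contDiff_nat_integral_unitInterval {E : Type} [NormedAddCommGroup E] [NormedSpace ℝ E]
    [FiniteDimensional ℝ E] (n : ℕ) :
    ∀ {F : Type} [NormedAddCommGroup F] [NormedSpace ℝ F] [CompleteSpace F] {f : E × ℝ → F},
      ContDiff ℝ ∞ f → ContDiff ℝ n fun p => ∫ q in (0 : ℝ)..1, f (p, q) := by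
  induction n with
  | zero =>
    intro F _ _ _ f hf
    refine contDiff_zero.2 ?_
    exact intervalIntegral.continuous_parametric_intervalIntegral_of_continuous'
      (f := fun p q => f (p, q)) hf.continuous 0 1
  | succ n ih =>
    intro F _ _ _ f hf
    have hdf : ContDiff ℝ ∞ fun z : E × ℝ =>
        (fderiv ℝ f z).comp (ContinuousLinearMap.inl ℝ E ℝ) :=
      (hf.fderiv_right (m := ∞) (by simp)).clm_comp contDiff_const
    have hder : ∀ p, HasFDerivAt (fun p => ∫ q in (0 : ℝ)..1, f (p, q))
        (∫ q in (0 : ℝ)..1, (fderiv ℝ f (p, q)).comp (ContinuousLinearMap.inl ℝ E ℝ)) p := by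
      intro p
      obtain ⟨C, hC⟩ := ((isCompact_closedBall p 1).prod (isCompact_Icc (a := (0 : ℝ))
        (b := 1))).exists_bound_of_continuousOn hdf.continuous.continuousOn
      refine (intervalIntegral.hasFDerivAt_integral_of_dominated_of_fderiv_le
        (F := fun p q => f (p, q))
        (F' := fun p q => (fderiv ℝ f (p, q)).comp (ContinuousLinearMap.inl ℝ E ℝ))
        (bound := fun _ => C) (s := Metric.closedBall p 1)
        (Metric.closedBall_mem_nhds p one_pos) ?_ ?_ ?_ ?_ ?_ ?_)
      · exact Filter.Eventually.of_forall fun p' =>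
          (hf.continuous.comp (by fun_prop : Continuous fun q : ℝ => (p', q))).aestronglyMeasurable
      · exact (hf.continuous.comp
          (by fun_prop : Continuous fun q : ℝ => (p, q))).intervalIntegrable 0 1
      · exact (hdf.continuous.comp
          (by fun_prop : Continuous fun q : ℝ => (p, q))).aestronglyMeasurable
      · refine Filter.Eventually.of_forall fun q hq p' hp' => ?_
        rw [Set.uIoc_of_le zero_le_one] at hq
        exact hC (p', q) ⟨hp', hq.1.le, hq.2⟩
      · simp
      · refine Filter.Eventually.of_forall fun q _ p' _ => ?_
        have h1 : HasFDerivAt f (fderiv ℝ f (p', q)) (p', q) :=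
          ((hf.differentiable (by simp)) _).hasFDerivAt
        have h2 : HasFDerivAt (fun p : E => (p, q)) (ContinuousLinearMap.inl ℝ E ℝ) p' :=
          hasFDerivAt_prodMk_left p' q
        exact h1.comp p' h2
    rw [show ((n + 1 : ℕ) : WithTop ℕ∞) = (n : WithTop ℕ∞) + 1 by simp,
      contDiff_succ_iff_fderiv]
    refine ⟨fun p => (hder p).differentiableAt, by simp, ?_⟩
    rw [show (fderiv ℝ fun p => ∫ q in (0 : ℝ)..1, f (p, q)) = fun p =>
      ∫ q in (0 : ℝ)..1, (fderiv ℝ f (p, q)).comp (ContinuousLinearMap.inl ℝ E ℝ) from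
        funext fun p => (hder p).fderiv]
    exact ih hdf

/-- Hadamard's lemma. It extracts exact factors t' - t whose cofactors remain smooth up to the
diagonal, so that they can enter the fixed functions of the nonstationary phase bound. -/
theorem exists_smooth_dividedDifference {E F : Type} [NormedAddCommGroup E] [NormedSpace ℝ E]
    [FiniteDimensional ℝ E] [NormedAddCommGroup F] [NormedSpace ℝ F] [CompleteSpace F]
    {f : E × ℝ → F} (hf : ContDiff ℝ ∞ f) :
    ∃ H : E × ℝ × ℝ → F, ContDiff ℝ ∞ H ∧
      (∀ x t t', f (x, t') - f (x, t) = (t' - t) • H (x, t, t')) ∧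
      ∀ x t, H (x, t, t) = fderiv ℝ f (x, t) (0, 1) := by
  set g : (E × ℝ × ℝ) × ℝ → F := fun p =>
    fderiv ℝ f (p.1.1, p.1.2.1 + p.2 * (p.1.2.2 - p.1.2.1)) (0, 1) with hg
  have hgs : ContDiff ℝ ∞ g := by
    have h1 : ContDiff ℝ ∞ (fderiv ℝ f) := hf.fderiv_right (by simp)
    exact (h1.comp (by fun_prop)).clm_apply contDiff_const
  refine ⟨fun p => ∫ q in (0 : ℝ)..1, g (p, q), ?_, ?_, ?_⟩
  · exact contDiff_infty.2 fun n => contDiff_nat_integral_unitInterval n hgs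
  · intro x t t'
    have hd : ∀ q ∈ Set.uIcc (0 : ℝ) 1, HasDerivAt (fun q : ℝ => f (x, t + q * (t' - t)))
        ((t' - t) • g ((x, t, t'), q)) q := by
      intro q _
      have h1 : HasFDerivAt f (fderiv ℝ f (x, t + q * (t' - t))) (x, t + q * (t' - t)) :=
        ((hf.differentiable (by simp)) _).hasFDerivAt
      have h2 : HasDerivAt (fun q : ℝ => (x, t + q * (t' - t))) ((0 : E), t' - t) q := by
        refine (hasDerivAt_const q x).prodMk ?_
        simpa using ((hasDerivAt_id q).mul_const (t' - t)).const_add t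
      have h3 := h1.comp_hasDerivAt q h2
      have h4 : ((0 : E), t' - t) = (t' - t) • ((0 : E), (1 : ℝ)) := by ext <;> simp
      rw [h4, map_smul] at h3
      exact h3
    have hi : Continuous fun q : ℝ => (t' - t) • g ((x, t, t'), q) :=
      continuous_const.smul (hgs.continuous.comp (by fun_prop))
    have := intervalIntegral.integral_eq_sub_of_hasDerivAt hd (hi.intervalIntegrable 0 1)
    rw [intervalIntegral.integral_smul] at this
    rw [this]
    simp
  · intro x t
    simp [hg]

end FoldBlowdown
end

noncomputable section

namespace FoldBlowdown

/-! ### The geometry of the family of curves at a point -/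

/-- The vector `S^1_x × S^2_x`, which spans the kernel of `S_x`. -/
def nrm (S : (Fin 3 → ℝ) × ℝ → (Fin 2 → ℝ)) (z : (Fin 3 → ℝ) × ℝ) : Fin 3 → ℝ :=
  ![dx S 0 1 z * dx S 1 2 z - dx S 0 2 z * dx S 1 1 z,
    dx S 0 2 z * dx S 1 0 z - dx S 0 0 z * dx S 1 2 z,
    dx S 0 0 z * dx S 1 1 z - dx S 0 1 z * dx S 1 0 z]

theorem sum_nrm_mul_dx (S : (Fin 3 → ℝ) × ℝ → (Fin 2 → ℝ)) (i : Fin 2)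
    (z : (Fin 3 → ℝ) × ℝ) : ∑ j, nrm S z j * dx S i j z = 0 := by
  fin_cases i <;> simp [nrm, Fin.sum_univ_three] <;> ring

theorem Delta_eq_sum (S : (Fin 3 → ℝ) × ℝ → (Fin 2 → ℝ)) (i : Fin 2)
    (z : (Fin 3 → ℝ) × ℝ) : Delta S i z = ∑ j, nrm S z j * dxdy S i j z := by
  simp [Delta, Matrix.det_fin_three, nrm, Fin.sum_univ_three]
  ring

/-- The pointwise content of the geometric assumptions. -/
structure GeometryAt (S : (Fin 3 → ℝ) × ℝ → (Fin 2 → ℝ)) (z : (Fin 3 → ℝ) × ℝ) : Prop where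
  nrm_ne_zero : nrm S z ≠ 0
  Delta_ne_zero : Delta S 0 z ≠ 0 ∨ Delta S 1 z ≠ 0
  blowdown : ∀ θ : Fin 2 → ℝ, θ ≠ 0 → θ 0 * Delta S 0 z + θ 1 * Delta S 1 z = 0 →
    ∑ j, nrm S z j * (θ 0 * fderiv ℝ (Delta S 0) z (Pi.single j 1, 0) +
      θ 1 * fderiv ℝ (Delta S 1) z (Pi.single j 1, 0)) = 0
  fold : ∀ θ : Fin 2 → ℝ, θ ≠ 0 → ∀ (u : Fin 2 → ℝ) (s : ℝ),
    (∀ j, u 0 * dx S 0 j z + u 1 * dx S 1 j z +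
      s * (θ 0 * dxdy S 0 j z + θ 1 * dxdy S 1 j z) = 0) →
    u 0 * Delta S 0 z + u 1 * Delta S 1 z + s * (θ 0 * fderiv ℝ (Delta S 0) z (0, 1) +
      θ 1 * fderiv ℝ (Delta S 1) z (0, 1)) = 0 → u = 0 ∧ s = 0

section Smoothness

variable {S : (Fin 3 → ℝ) × ℝ → (Fin 2 → ℝ)} {Ω : Set ((Fin 3 → ℝ) × ℝ)}

theorem contDiffOn_fderiv_apply_of_isOpen {E : Type} [NormedAddCommGroup E] [NormedSpace ℝ E]
    {f : E → ℝ} {s : Set E} (hs : IsOpen s) (hf : ContDiffOn ℝ ∞ f s) (v : E) :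
    ContDiffOn ℝ ∞ (fun z => fderiv ℝ f z v) s :=
  (hf.fderiv_of_isOpen hs (m := ∞) (by simp)).clm_apply contDiffOn_const

theorem contDiffOn_component (hS : ContDiffOn ℝ ∞ S Ω) (i : Fin 2) :
    ContDiffOn ℝ ∞ (fun w => S w i) Ω := contDiffOn_pi.1 hS i

theorem contDiffOn_dx (hΩ : IsOpen Ω) (hS : ContDiffOn ℝ ∞ S Ω) (i : Fin 2) (j : Fin 3) :
    ContDiffOn ℝ ∞ (dx S i j) Ω :=
  contDiffOn_fderiv_apply_of_isOpen hΩ (contDiffOn_component hS i) _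

theorem contDiffOn_dy (hΩ : IsOpen Ω) (hS : ContDiffOn ℝ ∞ S Ω) (i : Fin 2) :
    ContDiffOn ℝ ∞ (dy S i) Ω :=
  contDiffOn_fderiv_apply_of_isOpen hΩ (contDiffOn_component hS i) _

theorem contDiffOn_dxdy (hΩ : IsOpen Ω) (hS : ContDiffOn ℝ ∞ S Ω) (i : Fin 2) (j : Fin 3) :
    ContDiffOn ℝ ∞ (dxdy S i j) Ω :=
  contDiffOn_fderiv_apply_of_isOpen hΩ (contDiffOn_dx hΩ hS i j) _

theorem contDiffOn_nrm_apply (hΩ : IsOpen Ω) (hS : ContDiffOn ℝ ∞ S Ω) (j : Fin 3) :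
    ContDiffOn ℝ ∞ (fun z => nrm S z j) Ω := by
  have h := fun i j => contDiffOn_dx hΩ hS i j
  fin_cases j
  · exact ((h 0 1).mul (h 1 2)).sub ((h 0 2).mul (h 1 1))
  · exact ((h 0 2).mul (h 1 0)).sub ((h 0 0).mul (h 1 2))
  · exact ((h 0 0).mul (h 1 1)).sub ((h 0 1).mul (h 1 0))

theorem contDiffOn_Delta (hΩ : IsOpen Ω) (hS : ContDiffOn ℝ ∞ S Ω) (i : Fin 2) :
    ContDiffOn ℝ ∞ (Delta S i) Ω := by
  rw [show Delta S i = fun z => ∑ j, nrm S z j * dxdy S i j z from funext (Delta_eq_sum S i)]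
  exact ContDiffOn.sum fun j _ => (contDiffOn_nrm_apply hΩ hS j).mul (contDiffOn_dxdy hΩ hS i j)

end Smoothness

/-- `base` as a continuous linear map. -/
def baseL : (Fin 6 → ℝ) →L[ℝ] (Fin 3 → ℝ) × ℝ :=
  LinearMap.toContinuousLinearMap
    { toFun := base
      map_add' := fun P Q => by
        refine Prod.ext ?_ rfl
        ext j
        fin_cases j <;> rfl
      map_smul' := fun c P => by
        refine Prod.ext ?_ rfl
        ext j
        fin_cases j <;> rfl }

@[simp] theorem baseL_apply (P : Fin 6 → ℝ) : baseL P = base P := rfl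

theorem hasFDerivAt_comp_base {f : (Fin 3 → ℝ) × ℝ → ℝ} {P : Fin 6 → ℝ}
    (hf : DifferentiableAt ℝ f (base P)) :
    HasFDerivAt (fun P => f (base P)) ((fderiv ℝ f (base P)).comp baseL) P :=
  (show HasFDerivAt f (fderiv ℝ f (base P)) (baseL P) from hf.hasFDerivAt).comp P
    baseL.hasFDerivAt

theorem fderiv_comp_base {f : (Fin 3 → ℝ) × ℝ → ℝ} {P : Fin 6 → ℝ}
    (hf : DifferentiableAt ℝ f (base P)) (w : Fin 6 → ℝ) :
    fderiv ℝ (fun P => f (base P)) P w = fderiv ℝ f (base P) (base w) := by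
  rw [(hasFDerivAt_comp_base hf).fderiv]; rfl

theorem fderiv_tau_combination {f g : (Fin 3 → ℝ) × ℝ → ℝ} {P : Fin 6 → ℝ}
    (hf : DifferentiableAt ℝ f (base P)) (hg : DifferentiableAt ℝ g (base P)) (w : Fin 6 → ℝ) :
    fderiv ℝ (fun P : Fin 6 → ℝ => P 3 * f (base P) + P 4 * g (base P)) P w =
      w 3 * f (base P) + w 4 * g (base P) +
        (P 3 * fderiv ℝ f (base P) (base w) + P 4 * fderiv ℝ g (base P) (base w)) := by
  have h3 : HasFDerivAt (fun P : Fin 6 → ℝ => P 3) (ContinuousLinearMap.proj 3) P :=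
    hasFDerivAt_apply (𝕜 := ℝ) (3 : Fin 6) P
  have h4 : HasFDerivAt (fun P : Fin 6 → ℝ => P 4) (ContinuousLinearMap.proj 4) P :=
    hasFDerivAt_apply (𝕜 := ℝ) (4 : Fin 6) P
  have h := (h3.mul (hasFDerivAt_comp_base hf)).add (h4.mul (hasFDerivAt_comp_base hg))
  have h' := h.fderiv
  simp only [Pi.mul_def, Pi.add_def] at h'
  rw [h']
  simp
  ring

theorem differentiableAt_tau_combination {f g : (Fin 3 → ℝ) × ℝ → ℝ} {P : Fin 6 → ℝ}
    (hf : DifferentiableAt ℝ f (base P)) (hg : DifferentiableAt ℝ g (base P)) :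
    DifferentiableAt ℝ (fun P : Fin 6 → ℝ => P 3 * f (base P) + P 4 * g (base P)) P := by
  have h3 : HasFDerivAt (fun P : Fin 6 → ℝ => P 3) (ContinuousLinearMap.proj 3) P :=
    hasFDerivAt_apply (𝕜 := ℝ) (3 : Fin 6) P
  have h4 : HasFDerivAt (fun P : Fin 6 → ℝ => P 4) (ContinuousLinearMap.proj 4) P :=
    hasFDerivAt_apply (𝕜 := ℝ) (4 : Fin 6) P
  exact ((h3.mul (hasFDerivAt_comp_base hf)).add
    (h4.mul (hasFDerivAt_comp_base hg))).differentiableAt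

theorem det_fin_six_of_unit_rows_012 (r s t : Fin 6 → ℝ) :
    Matrix.det (Matrix.of ![Pi.single 0 1, Pi.single 1 1, Pi.single 2 1, r, s, t]) =
      Matrix.det (Matrix.of ![![r 3, r 4, r 5], ![s 3, s 4, s 5], ![t 3, t 4, t 5]]) := by
  rw [Matrix.det_succ_row_zero, Fin.sum_univ_succ, Finset.sum_eq_zero]
  · rw [Matrix.det_succ_row_zero, Fin.sum_univ_succ, Finset.sum_eq_zero]
    · rw [Matrix.det_succ_row_zero, Fin.sum_univ_succ, Finset.sum_eq_zero]
      · simp [Matrix.det_fin_three, Matrix.submatrix]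
      · intro i _; fin_cases i <;> simp [Matrix.submatrix, Fin.succAbove, Pi.single_apply]
    · intro i _; fin_cases i <;> simp [Matrix.submatrix, Fin.succAbove, Pi.single_apply]
  · intro i _; fin_cases i <;> simp

theorem det_fin_six_of_unit_rows_534 (r s t : Fin 6 → ℝ) :
    Matrix.det (Matrix.of ![r, s, Pi.single 5 1, Pi.single 3 1, Pi.single 4 1, t]) =
      -Matrix.det (Matrix.of ![![r 0, r 1, r 2], ![s 0, s 1, s 2], ![t 0, t 1, t 2]]) := by
  rw [Matrix.det_succ_row _ 2, Finset.sum_eq_single 5]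
  · rw [Matrix.det_succ_row _ 2, Finset.sum_eq_single 3]
    · rw [Matrix.det_succ_row _ 2, Finset.sum_eq_single 3]
      · simp [Matrix.det_fin_three, Matrix.submatrix, Fin.succAbove]
        ring
      · intro i _ hi; fin_cases i <;> simp [Matrix.submatrix, Fin.succAbove, Pi.single_apply] at *
      · simp
    · intro i _ hi; fin_cases i <;> simp [Matrix.submatrix, Fin.succAbove, Pi.single_apply] at *
    · simp
  · intro i _ hi; fin_cases i <;> simp [Matrix.submatrix, Fin.succAbove, Pi.single_apply] at *
  · simp

theorem det_eq_det_of_rows (L : (Fin 6 → ℝ) →L[ℝ] (Fin 6 → ℝ)) :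
    L.det = Matrix.det (Matrix.of fun a b => L (Pi.single b 1) a) := by
  rw [ContinuousLinearMap.det, ← LinearMap.det_toMatrix']
  congr 1

theorem fderiv_apply_component {g : (Fin 6 → ℝ) → (Fin 6 → ℝ)} {P : Fin 6 → ℝ}
    (hg : ∀ a, DifferentiableAt ℝ (fun P => g P a) P) (w : Fin 6 → ℝ) (a : Fin 6) :
    fderiv ℝ g P w a = fderiv ℝ (fun P => g P a) P w := by
  rw [fderiv_apply (differentiableAt_pi.2 hg)]
  rfl

section Jacobians

variable {S : (Fin 3 → ℝ) × ℝ → (Fin 2 → ℝ)} {Ω : Set ((Fin 3 → ℝ) × ℝ)}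

theorem differentiableAt_of_contDiffOn {E : Type} [NormedAddCommGroup E] [NormedSpace ℝ E]
    {f : E → ℝ} {s : Set E} (hs : IsOpen s) (hf : ContDiffOn ℝ ∞ f s) {z : E} (hz : z ∈ s) :
    DifferentiableAt ℝ f z :=
  (hf.differentiableOn (by simp)).differentiableAt (hs.mem_nhds hz)

theorem base_single_of_lt (j : Fin 3) :
    base (Pi.single (Fin.castLE (by norm_num) j) 1) = (Pi.single j 1, 0) := by
  refine Prod.ext ?_ ?_
  · ext i; fin_cases j <;> fin_cases i <;> simp [base]
  · fin_cases j <;> simp [base]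

theorem fderiv_piL_apply (hΩ : IsOpen Ω) (hS : ContDiffOn ℝ ∞ S Ω) {P : Fin 6 → ℝ}
    (hP : base P ∈ Ω) (w : Fin 6 → ℝ) :
    fderiv ℝ (piL S) P w = ![w 0, w 1, w 2,
      w 3 * dx S 0 0 (base P) + w 4 * dx S 1 0 (base P) +
        (P 3 * fderiv ℝ (dx S 0 0) (base P) (base w) +
          P 4 * fderiv ℝ (dx S 1 0) (base P) (base w)),
      w 3 * dx S 0 1 (base P) + w 4 * dx S 1 1 (base P) +
        (P 3 * fderiv ℝ (dx S 0 1) (base P) (base w) +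
          P 4 * fderiv ℝ (dx S 1 1) (base P) (base w)),
      w 3 * dx S 0 2 (base P) + w 4 * dx S 1 2 (base P) +
        (P 3 * fderiv ℝ (dx S 0 2) (base P) (base w) +
          P 4 * fderiv ℝ (dx S 1 2) (base P) (base w))] := by
  have hd : ∀ i j, DifferentiableAt ℝ (dx S i j) (base P) := fun i j =>
    differentiableAt_of_contDiffOn hΩ (contDiffOn_dx hΩ hS i j) hP
  have hg : ∀ a, DifferentiableAt ℝ (fun P => piL S P a) P := by
    intro a
    fin_cases a
    · exact differentiableAt_apply (𝕜 := ℝ) (0 : Fin 6) P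
    · exact differentiableAt_apply (𝕜 := ℝ) (1 : Fin 6) P
    · exact differentiableAt_apply (𝕜 := ℝ) (2 : Fin 6) P
    · exact differentiableAt_tau_combination (hd 0 0) (hd 1 0)
    · exact differentiableAt_tau_combination (hd 0 1) (hd 1 1)
    · exact differentiableAt_tau_combination (hd 0 2) (hd 1 2)
  have hp : ∀ b : Fin 6, fderiv ℝ (fun P : Fin 6 → ℝ => P b) P w = w b := fun b => by
    rw [(hasFDerivAt_apply (𝕜 := ℝ) b P).fderiv]; rfl
  ext a
  rw [fderiv_apply_component hg]
  fin_cases a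
  · exact hp 0
  · exact hp 1
  · exact hp 2
  · exact fderiv_tau_combination (hd 0 0) (hd 1 0) w
  · exact fderiv_tau_combination (hd 0 1) (hd 1 1) w
  · exact fderiv_tau_combination (hd 0 2) (hd 1 2) w

theorem fderiv_piR_apply (hΩ : IsOpen Ω) (hS : ContDiffOn ℝ ∞ S Ω) {P : Fin 6 → ℝ}
    (hP : base P ∈ Ω) (w : Fin 6 → ℝ) :
    fderiv ℝ (piR S) P w = ![fderiv ℝ (fun w => S w 0) (base P) (base w),
      fderiv ℝ (fun w => S w 1) (base P) (base w), w 5, w 3, w 4,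
      -(w 3 * dy S 0 (base P) + w 4 * dy S 1 (base P) +
        (P 3 * fderiv ℝ (dy S 0) (base P) (base w) +
          P 4 * fderiv ℝ (dy S 1) (base P) (base w)))] := by
  have hd : ∀ i, DifferentiableAt ℝ (dy S i) (base P) := fun i =>
    differentiableAt_of_contDiffOn hΩ (contDiffOn_dy hΩ hS i) hP
  have hc : ∀ i, DifferentiableAt ℝ (fun w => S w i) (base P) := fun i =>
    differentiableAt_of_contDiffOn hΩ (contDiffOn_component hS i) hP
  have hg : ∀ a, DifferentiableAt ℝ (fun P => piR S P a) P := by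
    intro a
    fin_cases a
    · exact (hasFDerivAt_comp_base (hc 0)).differentiableAt
    · exact (hasFDerivAt_comp_base (hc 1)).differentiableAt
    · exact differentiableAt_apply (𝕜 := ℝ) (5 : Fin 6) P
    · exact differentiableAt_apply (𝕜 := ℝ) (3 : Fin 6) P
    · exact differentiableAt_apply (𝕜 := ℝ) (4 : Fin 6) P
    · exact (differentiableAt_tau_combination (hd 0) (hd 1)).neg
  have hp : ∀ b : Fin 6, fderiv ℝ (fun P : Fin 6 → ℝ => P b) P w = w b := fun b => by
    rw [(hasFDerivAt_apply (𝕜 := ℝ) b P).fderiv]; rfl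
  ext a
  rw [fderiv_apply_component hg]
  fin_cases a
  · exact fderiv_comp_base (hc 0) w
  · exact fderiv_comp_base (hc 1) w
  · exact hp 5
  · exact hp 3
  · exact hp 4
  · have h := fderiv_tau_combination (hd 0) (hd 1) w
    refine Eq.trans ?_ (congrArg Neg.neg h)
    have : (fun P => piR S P 5) = -fun P : Fin 6 → ℝ =>
        P 3 * dy S 0 (base P) + P 4 * dy S 1 (base P) := rfl
    simp only [Fin.reduceFinMk]
    rw [this, fderiv_neg]
    rfl

/-- The rows of the x-components are unit rows, which leaves the 3×3 minor in (τ, y₃) with columns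
S^1_x, S^2_x and τ·S_{xy₃}. -/
theorem jac_piL (hΩ : IsOpen Ω) (hS : ContDiffOn ℝ ∞ S Ω) {P : Fin 6 → ℝ} (hP : base P ∈ Ω) :
    jac (piL S) P = P 3 * Delta S 0 (base P) + P 4 * Delta S 1 (base P) := by
  have b3 : base (Pi.single 3 1) = 0 := by
    refine Prod.ext ?_ ?_
    · ext i; fin_cases i <;> simp [base]
    · simp [base]
  have b4 : base (Pi.single 4 1) = 0 := by
    refine Prod.ext ?_ ?_
    · ext i; fin_cases i <;> simp [base]
    · simp [base]
  have b5 : base (Pi.single 5 1) = (0, 1) := by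
    refine Prod.ext ?_ ?_
    · ext i; fin_cases i <;> simp [base]
    · simp [base]
  rw [jac, det_eq_det_of_rows]
  set L := fderiv ℝ (piL S) P
  have hL := fun w => fderiv_piL_apply hΩ hS hP w
  have hM : (Matrix.of fun a b => L (Pi.single b 1) a) = Matrix.of ![Pi.single 0 1,
      Pi.single 1 1, Pi.single 2 1, fun b => L (Pi.single b 1) 3, fun b => L (Pi.single b 1) 4,
      fun b => L (Pi.single b 1) 5] := by
    ext a b
    fin_cases a
    · simp [L, hL, Pi.single_apply, eq_comm]
    · simp [L, hL, Pi.single_apply, eq_comm]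
    · simp [L, hL, Pi.single_apply, eq_comm]
    · rfl
    · rfl
    · rfl
  rw [hM, det_fin_six_of_unit_rows_012, Delta_eq_sum, Delta_eq_sum, Matrix.det_fin_three]
  simp [L, hL, b3, b4, b5, Fin.sum_univ_three, nrm, dxdy]
  ring

theorem fderiv_dy_single (hΩ : IsOpen Ω) (hS : ContDiffOn ℝ ∞ S Ω) {z : (Fin 3 → ℝ) × ℝ}
    (hz : z ∈ Ω) (i : Fin 2) (j : Fin 3) :
    fderiv ℝ (dy S i) z (Pi.single j 1, 0) = dxdy S i j z := by
  have hc : ContDiffAt ℝ ∞ (fun w => S w i) z :=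
    (contDiffOn_component hS i).contDiffAt (hΩ.mem_nhds hz)
  have hsymm : IsSymmSndFDerivAt ℝ (fun w => S w i) z :=
    hc.isSymmSndFDerivAt (by
      rw [minSmoothness_of_isRCLikeNormedField]
      exact WithTop.coe_le_coe.2 (le_top : (2 : ℕ∞) ≤ ⊤))
  have hd : DifferentiableAt ℝ (fderiv ℝ fun w => S w i) z :=
    (hc.fderiv_right (m := ∞) (by simp)).differentiableAt (by simp)
  have h1 : ∀ v w, fderiv ℝ (fun z => fderiv ℝ (fun w => S w i) z v) z w =
      fderiv ℝ (fderiv ℝ fun w => S w i) z w v := fun v w => by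
    rw [fderiv_clm_apply hd (differentiableAt_const v)]
    simp
  exact (h1 _ _).trans ((hsymm.eq _ _).trans (h1 _ _).symm)

theorem clm_apply_prod (L : (Fin 3 → ℝ) × ℝ →L[ℝ] ℝ) (v : Fin 3 → ℝ) (s : ℝ) :
    L (v, s) = ∑ j, v j * L (Pi.single j 1, 0) + s * L (0, 1) := by
  have h1 : ((v, s) : (Fin 3 → ℝ) × ℝ) =
      ∑ j, v j • ((Pi.single j 1 : Fin 3 → ℝ), (0 : ℝ)) + s • ((0 : Fin 3 → ℝ), (1 : ℝ)) := by
    refine Prod.ext ?_ ?_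
    · ext i
      fin_cases i <;> simp [Fin.sum_univ_three]
    · simp [Fin.sum_univ_three]
  rw [h1, map_add, map_sum]
  simp only [map_smul, smul_eq_mul]

/-- What remains is the minor in x with rows S^1_x, S^2_x and -τ·S_{y₃x}; its sign cancels the sign
of the permutation of the unit rows. With `jac_piL` this shows that both projections are singular on
the same set τ·Δ = 0. -/
theorem jac_piR (hΩ : IsOpen Ω) (hS : ContDiffOn ℝ ∞ S Ω) {P : Fin 6 → ℝ} (hP : base P ∈ Ω) :
    jac (piR S) P = P 3 * Delta S 0 (base P) + P 4 * Delta S 1 (base P) := by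
  have b : ∀ j : Fin 3, base (Pi.single (Fin.castLE (by norm_num) j) 1) = (Pi.single j 1, 0) :=
    base_single_of_lt
  have b0 : base (Pi.single 0 1) = (Pi.single 0 1, 0) := b 0
  have b1 : base (Pi.single 1 1) = (Pi.single 1 1, 0) := b 1
  have b2 : base (Pi.single 2 1) = (Pi.single 2 1, 0) := b 2
  rw [jac, det_eq_det_of_rows]
  set L := fderiv ℝ (piR S) P
  have hL := fun w => fderiv_piR_apply hΩ hS hP w
  have hM : (Matrix.of fun a b => L (Pi.single b 1) a) = Matrix.of ![fun b => L (Pi.single b 1) 0,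
      fun b => L (Pi.single b 1) 1, Pi.single 5 1, Pi.single 3 1, Pi.single 4 1,
      fun b => L (Pi.single b 1) 5] := by
    ext a b
    fin_cases a
    · rfl
    · rfl
    · simp [L, hL, Pi.single_apply, eq_comm]
    · simp [L, hL, Pi.single_apply, eq_comm]
    · simp [L, hL, Pi.single_apply, eq_comm]
    · rfl
  rw [hM, det_fin_six_of_unit_rows_534, Delta_eq_sum, Delta_eq_sum, Matrix.det_fin_three]
  simp [L, hL, b0, b1, b2, Fin.sum_univ_three, nrm, fderiv_dy_single hΩ hS hP, ← dx.eq_1]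
  ring

theorem isOpen_conormal (hΩ : IsOpen Ω) : IsOpen (conormal Ω) := by
  refine (hΩ.preimage baseL.continuous).inter ?_
  exact isOpen_ne.preimage (by fun_prop : Continuous fun P : Fin 6 → ℝ => (P 3, P 4))

theorem fderiv_jac_eq (hΩ : IsOpen Ω) (hS : ContDiffOn ℝ ∞ S Ω)
    {g : (Fin 6 → ℝ) → (Fin 6 → ℝ)}
    (hg : ∀ P, base P ∈ Ω → jac g P = P 3 * Delta S 0 (base P) + P 4 * Delta S 1 (base P))
    {P : Fin 6 → ℝ} (hP : base P ∈ Ω) (w : Fin 6 → ℝ) :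
    fderiv ℝ (jac g) P w = w 3 * Delta S 0 (base P) + w 4 * Delta S 1 (base P) +
      (P 3 * fderiv ℝ (Delta S 0) (base P) (base w) +
        P 4 * fderiv ℝ (Delta S 1) (base P) (base w)) := by
  have hd : ∀ i, DifferentiableAt ℝ (Delta S i) (base P) := fun i =>
    differentiableAt_of_contDiffOn hΩ (contDiffOn_Delta hΩ hS i) hP
  have hev : jac g =ᶠ[nhds P] fun P => P 3 * Delta S 0 (base P) + P 4 * Delta S 1 (base P) :=
    Filter.eventually_of_mem ((hΩ.preimage baseL.continuous).mem_nhds hP) hg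
  rw [hev.fderiv_eq, fderiv_tau_combination (hd 0) (hd 1)]

/-- The point of the conormal bundle with given coordinates. -/
def conormalPoint (z : (Fin 3 → ℝ) × ℝ) (θ : Fin 2 → ℝ) : Fin 6 → ℝ :=
  ![z.1 0, z.1 1, z.1 2, θ 0, θ 1, z.2]

@[simp] theorem base_conormalPoint (z : (Fin 3 → ℝ) × ℝ) (θ : Fin 2 → ℝ) :
    base (conormalPoint z θ) = z := by
  refine Prod.ext ?_ rfl
  ext j
  fin_cases j <;> rfl

theorem conormalPoint_mem {z : (Fin 3 → ℝ) × ℝ} (hz : z ∈ Ω) {θ : Fin 2 → ℝ} (hθ : θ ≠ 0) :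
    conormalPoint z θ ∈ conormal Ω := by
  refine ⟨by simpa using hz, fun h => hθ ?_⟩
  have h0 : θ 0 = 0 := congrArg Prod.fst h
  have h1 : θ 1 = 0 := congrArg Prod.snd h
  ext i
  fin_cases i
  · exact h0
  · exact h1

theorem eq_zero_of_combination_eq_zero {z : (Fin 3 → ℝ) × ℝ} (hn : nrm S z ≠ 0) {u v : ℝ}
    (h : ∀ j, u * dx S 0 j z + v * dx S 1 j z = 0) : u = 0 ∧ v = 0 := by
  have h0 := h 0
  have h1 := h 1
  have h2 := h 2
  have n0 : nrm S z 0 = dx S 0 1 z * dx S 1 2 z - dx S 0 2 z * dx S 1 1 z := rfl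
  have n1 : nrm S z 1 = dx S 0 2 z * dx S 1 0 z - dx S 0 0 z * dx S 1 2 z := rfl
  have n2 : nrm S z 2 = dx S 0 0 z * dx S 1 1 z - dx S 0 1 z * dx S 1 0 z := rfl
  have hu : ∀ j, u * nrm S z j = 0 := by
    refine Fin.forall_fin_succ.2 ⟨?_, Fin.forall_fin_two.2 ⟨?_, ?_⟩⟩
    · rw [n0]; linear_combination h1 * dx S 1 2 z - h2 * dx S 1 1 z
    · change u * nrm S z 1 = 0
      rw [n1]; linear_combination h2 * dx S 1 0 z - h0 * dx S 1 2 z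
    · change u * nrm S z 2 = 0
      rw [n2]; linear_combination h0 * dx S 1 1 z - h1 * dx S 1 0 z
  have hv : ∀ j, v * nrm S z j = 0 := by
    refine Fin.forall_fin_succ.2 ⟨?_, Fin.forall_fin_two.2 ⟨?_, ?_⟩⟩
    · rw [n0]; linear_combination h2 * dx S 0 1 z - h1 * dx S 0 2 z
    · change v * nrm S z 1 = 0
      rw [n1]; linear_combination h0 * dx S 0 2 z - h2 * dx S 0 0 z
    · change v * nrm S z 2 = 0
      rw [n2]; linear_combination h1 * dx S 0 0 z - h0 * dx S 0 1 z
  obtain ⟨j, hj⟩ := Function.ne_iff.1 hn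
  exact ⟨(mul_eq_zero.1 (hu j)).resolve_right hj, (mul_eq_zero.1 (hv j)).resolve_right hj⟩

end Jacobians

section Admissible

variable {S : (Fin 3 → ℝ) × ℝ → (Fin 2 → ℝ)} {Ω : Set ((Fin 3 → ℝ) × ℝ)}

/-- If n = 0, there is (a,b) ≠ 0 with aS^1_x + bS^2_x = 0. Surjectivity gives v with S_x v = (a,b),
and pairing with (a,b) yields a² + b² = 0. -/
theorem nrm_ne_zero_of_surjective {z : (Fin 3 → ℝ) × ℝ} (hS : DifferentiableAt ℝ S z)
    (hs : Function.Surjective (fderiv ℝ (fun w : (Fin 3 → ℝ) × ℝ => (S w, w.2)) z)) :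
    nrm S z ≠ 0 := by
  intro hn
  have hdep : ¬LinearIndependent ℝ ![fun j => dx S 0 j z, fun j => dx S 1 j z] := by
    rw [← crossProduct_ne_zero_iff_linearIndependent, not_not, ← hn]
    simp [crossProduct, nrm]
  rw [LinearIndependent.pair_iff] at hdep
  push Not at hdep
  obtain ⟨a, b, hab, hne⟩ := hdep
  obtain ⟨⟨v, s⟩, hw⟩ := hs (![a, b], 0)
  have hd : fderiv ℝ (fun w : (Fin 3 → ℝ) × ℝ => (S w, w.2)) z =
      (fderiv ℝ S z).prod (ContinuousLinearMap.snd ℝ _ _) :=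
    (hS.hasFDerivAt.prodMk hasFDerivAt_snd).fderiv
  rw [hd] at hw
  have hs0 : s = 0 := congrArg Prod.snd hw
  have hSv : fderiv ℝ S z (v, s) = ![a, b] := congrArg Prod.fst hw
  subst hs0
  have hcomp : ∀ i, ∑ j, v j * dx S i j z = (![a, b] : Fin 2 → ℝ) i := by
    intro i
    have h1 : fderiv ℝ (fun w => S w i) z (v, 0) = fderiv ℝ S z (v, 0) i := by
      rw [fderiv_apply hS]; rfl
    rw [← hSv, ← h1, clm_apply_prod]
    simp [dx]
  have h0 := hcomp 0
  have h1 := hcomp 1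
  simp [Fin.sum_univ_three] at h0 h1
  have c := fun j => congrFun hab j
  simp at c
  have : a ^ 2 + b ^ 2 = 0 := by
    linear_combination (-a) * h0 + (-b) * h1 + v 0 * c 0 + v 1 * c 1 + v 2 * c 2
  have ha : a = 0 := by nlinarith [sq_nonneg a, sq_nonneg b]
  have hb : b = 0 := by nlinarith [sq_nonneg a, sq_nonneg b]
  exact hne ha hb

theorem IsAdmissible.nrm_ne_zero (hS : IsAdmissible S Ω) {z : (Fin 3 → ℝ) × ℝ} (hz : z ∈ Ω) :
    nrm S z ≠ 0 :=
  nrm_ne_zero_of_surjective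
    ((hS.smooth.differentiableOn (by simp)).differentiableAt (hS.isOpen.mem_nhds hz))
    (hS.submersion_right z hz)

/-- If Δ vanished at z, every covector over z would be singular, and there the differential of τ·Δ
would depend on the base component of a vector only. Every base vector lifts to a tangent vector of
the singular set, so the differential would be zero, contrary to the simplicity of the
singularities. -/
theorem IsAdmissible.Delta_ne_zero (hS : IsAdmissible S Ω) {z : (Fin 3 → ℝ) × ℝ} (hz : z ∈ Ω) :
    Delta S 0 z ≠ 0 ∨ Delta S 1 z ≠ 0 := by
  by_contra! h
  set P := conormalPoint z ![1, 0]
  have hb : base P = z := base_conormalPoint _ _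
  have hP : P ∈ conormal Ω := conormalPoint_mem hz fun h => by simpa using congrFun h 0
  have hj : jac (piL S) P = 0 := by
    rw [jac_piL hS.isOpen hS.smooth hP.1, hb, h.1, h.2]
    simp
  have hder := fun w => fderiv_jac_eq hS.isOpen hS.smooth
    (fun P hP => jac_piL hS.isOpen hS.smooth hP) hP.1 w
  rw [hb, h.1, h.2] at hder
  apply hS.fold_left.d_jac_ne_zero P hP hj
  ext w
  obtain ⟨w', hw', hbw⟩ := hS.submersion_singular P hP hj (base w)
  rw [hder, hbw] at hw'
  rw [hder]
  simpa using hw'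

/-- The field with x-component n and no other component is a kernel field of π_R: S_x n = 0, and the
remaining component of its image is -τ·Δ, which is zero on the singular set. Tangency to τ·Δ = 0 is
the asserted identity. -/
theorem IsAdmissible.blowdown_at (hS : IsAdmissible S Ω) {z : (Fin 3 → ℝ) × ℝ} (hz : z ∈ Ω)
    {θ : Fin 2 → ℝ} (hθ : θ ≠ 0) (h0 : θ 0 * Delta S 0 z + θ 1 * Delta S 1 z = 0) :
    ∑ j, nrm S z j * (θ 0 * fderiv ℝ (Delta S 0) z (Pi.single j 1, 0) +
      θ 1 * fderiv ℝ (Delta S 1) z (Pi.single j 1, 0)) = 0 := by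
  have hΩ := hS.isOpen
  have hs := hS.smooth
  set V : (Fin 6 → ℝ) → (Fin 6 → ℝ) := fun Q =>
    ![nrm S (base Q) 0, nrm S (base Q) 1, nrm S (base Q) 2, 0, 0, 0] with hV
  have hbV : ∀ Q, base (V Q) = (nrm S (base Q), 0) := by
    intro Q
    refine Prod.ext ?_ rfl
    ext j
    fin_cases j <;> rfl
  have hker : IsKernelField (piR S) V (conormal Ω) := by
    refine ⟨?_, ?_, ?_⟩
    · have hn : ∀ j, ContDiffOn ℝ ∞ (fun Q => nrm S (base Q) j) (conormal Ω) := fun j =>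
        (contDiffOn_nrm_apply hΩ hs j).comp baseL.contDiff.contDiffOn fun Q hQ => hQ.1
      refine contDiffOn_pi.2 fun a => ?_
      fin_cases a
      · exact hn 0
      · exact hn 1
      · exact hn 2
      · exact contDiffOn_const
      · exact contDiffOn_const
      · exact contDiffOn_const
    · intro Q hQ h
      have h1 := hbV Q
      rw [h, ← baseL_apply, map_zero] at h1
      exact hS.nrm_ne_zero hQ.1 (congrArg Prod.fst h1).symm
    · intro Q hQ hj
      rw [jac_piR hΩ hs hQ.1] at hj
      rw [fderiv_piR_apply hΩ hs hQ.1, hbV]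
      have e1 : ∀ i, fderiv ℝ (fun w => S w i) (base Q) (nrm S (base Q), 0) = 0 := fun i => by
        rw [clm_apply_prod, zero_mul, add_zero]
        exact sum_nrm_mul_dx S i (base Q)
      have e2 : ∀ i, fderiv ℝ (dy S i) (base Q) (nrm S (base Q), 0) = Delta S i (base Q) :=
        fun i => by
          rw [clm_apply_prod, zero_mul, add_zero, Delta_eq_sum]
          simp_rw [fderiv_dy_single hΩ hs hQ.1]
      rw [e1, e1, e2, e2, hj]
      ext a
      fin_cases a <;> simp [hV]
  set P := conormalPoint z θ
  have hb : base P = z := base_conormalPoint _ _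
  have hP : P ∈ conormal Ω := conormalPoint_mem hz hθ
  have hj : jac (piR S) P = 0 := by
    rw [jac_piR hΩ hs hP.1, hb]
    exact h0
  have := hS.blowdown_right.tangential _ subset_rfl (isOpen_conormal hΩ) V hker P hP hj
  rw [fderiv_jac_eq hΩ hs (fun P hP => jac_piR hΩ hs hP) hP.1, hbV, hb,
    clm_apply_prod (fderiv ℝ (Delta S 0) z), clm_apply_prod (fderiv ℝ (Delta S 1) z)] at this
  simp only [Fin.sum_univ_three] at this ⊢
  have v3 : V P 3 = 0 := rfl
  have v4 : V P 4 = 0 := rfl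
  have p3 : P 3 = θ 0 := rfl
  have p4 : P 4 = θ 1 := rfl
  rw [v3, v4, p3, p4] at this
  linear_combination this

/-- A vector c orthogonal to n = a × b lies in the span of a and b. Cramer's rule with denominator
|n|² gives coefficients that are smooth also where c leaves the span, as needed for a kernel field
defined on an open set. -/
theorem gram_expansion {a₀ a₁ a₂ b₀ b₁ b₂ c₀ c₁ c₂ n₀ n₁ n₂ : ℝ}
    (h₀ : n₀ = a₁ * b₂ - a₂ * b₁) (h₁ : n₁ = a₂ * b₀ - a₀ * b₂) (h₂ : n₂ = a₀ * b₁ - a₁ * b₀)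
    (hc : n₀ * c₀ + n₁ * c₁ + n₂ * c₂ = 0) (hn : n₀ ^ 2 + n₁ ^ 2 + n₂ ^ 2 ≠ 0) :
    (((c₁ * b₂ - c₂ * b₁) * n₀ + (c₂ * b₀ - c₀ * b₂) * n₁ + (c₀ * b₁ - c₁ * b₀) * n₂) /
        (n₀ ^ 2 + n₁ ^ 2 + n₂ ^ 2) * a₀ +
      ((a₁ * c₂ - a₂ * c₁) * n₀ + (a₂ * c₀ - a₀ * c₂) * n₁ + (a₀ * c₁ - a₁ * c₀) * n₂) /
        (n₀ ^ 2 + n₁ ^ 2 + n₂ ^ 2) * b₀ = c₀) ∧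
    (((c₁ * b₂ - c₂ * b₁) * n₀ + (c₂ * b₀ - c₀ * b₂) * n₁ + (c₀ * b₁ - c₁ * b₀) * n₂) /
        (n₀ ^ 2 + n₁ ^ 2 + n₂ ^ 2) * a₁ +
      ((a₁ * c₂ - a₂ * c₁) * n₀ + (a₂ * c₀ - a₀ * c₂) * n₁ + (a₀ * c₁ - a₁ * c₀) * n₂) /
        (n₀ ^ 2 + n₁ ^ 2 + n₂ ^ 2) * b₁ = c₁) ∧
    (((c₁ * b₂ - c₂ * b₁) * n₀ + (c₂ * b₀ - c₀ * b₂) * n₁ + (c₀ * b₁ - c₁ * b₀) * n₂) /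
        (n₀ ^ 2 + n₁ ^ 2 + n₂ ^ 2) * a₂ +
      ((a₁ * c₂ - a₂ * c₁) * n₀ + (a₂ * c₀ - a₀ * c₂) * n₁ + (a₀ * c₁ - a₁ * c₀) * n₂) /
        (n₀ ^ 2 + n₁ ^ 2 + n₂ ^ 2) * b₂ = c₂) := by
  refine ⟨?_, ?_, ?_⟩ <;> field_simp <;> subst h₀ h₁ h₂
  · linear_combination (-(a₁ * b₂ - a₂ * b₁)) * hc
  · linear_combination (-(a₂ * b₀ - a₀ * b₂)) * hc
  · linear_combination (-(a₀ * b₁ - a₁ * b₀)) * hc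

/-- On the singular set τ·S_{xy₃} = α₀S^1_x + α₁S^2_x, so ∂_{y₃} - α·∂_τ is a kernel field of π_L.
The two equations together say that s times its derivative of τ·Δ is zero; the fold condition forces
s = 0, and the independence of S^1_x and S^2_x forces u = 0. -/
theorem IsAdmissible.fold_at (hS : IsAdmissible S Ω) {z : (Fin 3 → ℝ) × ℝ} (hz : z ∈ Ω)
    {θ : Fin 2 → ℝ} (hθ : θ ≠ 0) (u : Fin 2 → ℝ) (s : ℝ)
    (h : ∀ j, u 0 * dx S 0 j z + u 1 * dx S 1 j z +
      s * (θ 0 * dxdy S 0 j z + θ 1 * dxdy S 1 j z) = 0)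
    (h' : u 0 * Delta S 0 z + u 1 * Delta S 1 z + s * (θ 0 * fderiv ℝ (Delta S 0) z (0, 1) +
      θ 1 * fderiv ℝ (Delta S 1) z (0, 1)) = 0) : u = 0 ∧ s = 0 := by
  have hΩ := hS.isOpen
  have hs := hS.smooth
  suffices hs0 : s = 0 by
    subst hs0
    have := eq_zero_of_combination_eq_zero (hS.nrm_ne_zero hz) (u := u 0) (v := u 1)
      fun j => by simpa using h j
    refine ⟨?_, rfl⟩
    ext i
    fin_cases i
    · exact this.1
    · exact this.2
  -- Off the singular set, pairing the first equation with n annihilates the u-terms and leaves s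
  -- θ·Δ = 0.
  by_cases h0 : θ 0 * Delta S 0 z + θ 1 * Delta S 1 z = 0
  swap
  · have h1 := sum_nrm_mul_dx S 0 z
    have h2 := sum_nrm_mul_dx S 1 z
    rw [Delta_eq_sum, Delta_eq_sum] at h0
    simp only [Fin.sum_univ_three] at h0 h1 h2
    refine (mul_eq_zero.1 (?_ : s * _ = 0)).resolve_right h0
    linear_combination nrm S z 0 * h 0 + nrm S z 1 * h 1 + nrm S z 2 * h 2 - u 0 * h1 - u 1 * h2
  set cc : Fin 3 → (Fin 6 → ℝ) → ℝ := fun j Q =>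
    Q 3 * dxdy S 0 j (base Q) + Q 4 * dxdy S 1 j (base Q) with hcc
  set a : Fin 3 → (Fin 6 → ℝ) → ℝ := fun j Q => dx S 0 j (base Q) with ha
  set b : Fin 3 → (Fin 6 → ℝ) → ℝ := fun j Q => dx S 1 j (base Q) with hb
  set n : Fin 3 → (Fin 6 → ℝ) → ℝ := fun j Q => nrm S (base Q) j with hn
  set nn : (Fin 6 → ℝ) → ℝ := fun Q => n 0 Q ^ 2 + n 1 Q ^ 2 + n 2 Q ^ 2 with hnn
  set α₀ : (Fin 6 → ℝ) → ℝ := fun Q => ((cc 1 Q * b 2 Q - cc 2 Q * b 1 Q) * n 0 Q +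
    (cc 2 Q * b 0 Q - cc 0 Q * b 2 Q) * n 1 Q +
    (cc 0 Q * b 1 Q - cc 1 Q * b 0 Q) * n 2 Q) / nn Q with hα₀
  set α₁ : (Fin 6 → ℝ) → ℝ := fun Q => ((a 1 Q * cc 2 Q - a 2 Q * cc 1 Q) * n 0 Q +
    (a 2 Q * cc 0 Q - a 0 Q * cc 2 Q) * n 1 Q +
    (a 0 Q * cc 1 Q - a 1 Q * cc 0 Q) * n 2 Q) / nn Q with hα₁
  have hbase : ContDiffOn ℝ ∞ base (conormal Ω) := baseL.contDiff.contDiffOn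
  have hmaps : Set.MapsTo base (conormal Ω) Ω := fun Q hQ => hQ.1
  have ha_s : ∀ j, ContDiffOn ℝ ∞ (a j) (conormal Ω) := fun j =>
    (contDiffOn_dx hΩ hs 0 j).comp hbase hmaps
  have hb_s : ∀ j, ContDiffOn ℝ ∞ (b j) (conormal Ω) := fun j =>
    (contDiffOn_dx hΩ hs 1 j).comp hbase hmaps
  have hn_s : ∀ j, ContDiffOn ℝ ∞ (n j) (conormal Ω) := fun j =>
    (contDiffOn_nrm_apply hΩ hs j).comp hbase hmaps
  have hp_s : ∀ i : Fin 6, ContDiffOn ℝ ∞ (fun Q : Fin 6 → ℝ => Q i) (conormal Ω) := fun i =>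
    (contDiff_apply ℝ ℝ i).contDiffOn
  have hc_s : ∀ j, ContDiffOn ℝ ∞ (cc j) (conormal Ω) := fun j =>
    ((hp_s 3).mul ((contDiffOn_dxdy hΩ hs 0 j).comp hbase hmaps)).add
      ((hp_s 4).mul ((contDiffOn_dxdy hΩ hs 1 j).comp hbase hmaps))
  have hnn_s : ContDiffOn ℝ ∞ nn (conormal Ω) :=
    (((hn_s 0).pow 2).add ((hn_s 1).pow 2)).add ((hn_s 2).pow 2)
  have hnn0 : ∀ Q ∈ conormal Ω, nn Q ≠ 0 := by
    intro Q hQ h0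
    apply hS.nrm_ne_zero hQ.1
    have h0' : n 0 Q ^ 2 + n 1 Q ^ 2 + n 2 Q ^ 2 = 0 := h0
    ext j
    fin_cases j
    · exact pow_eq_zero_iff two_ne_zero |>.1
        (by nlinarith [sq_nonneg (n 0 Q), sq_nonneg (n 1 Q), sq_nonneg (n 2 Q)] :
          n 0 Q ^ 2 = 0)
    · exact pow_eq_zero_iff two_ne_zero |>.1
        (by nlinarith [sq_nonneg (n 0 Q), sq_nonneg (n 1 Q), sq_nonneg (n 2 Q)] :
          n 1 Q ^ 2 = 0)
    · exact pow_eq_zero_iff two_ne_zero |>.1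
        (by nlinarith [sq_nonneg (n 0 Q), sq_nonneg (n 1 Q), sq_nonneg (n 2 Q)] :
          n 2 Q ^ 2 = 0)
  have hα₀_s : ContDiffOn ℝ ∞ α₀ (conormal Ω) :=
    ContDiffOn.div ((((((hc_s 1).mul (hb_s 2)).sub ((hc_s 2).mul (hb_s 1))).mul (hn_s 0)).add
      ((((hc_s 2).mul (hb_s 0)).sub ((hc_s 0).mul (hb_s 2))).mul (hn_s 1))).add
      ((((hc_s 0).mul (hb_s 1)).sub ((hc_s 1).mul (hb_s 0))).mul (hn_s 2))) hnn_s hnn0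
  have hα₁_s : ContDiffOn ℝ ∞ α₁ (conormal Ω) :=
    ContDiffOn.div ((((((ha_s 1).mul (hc_s 2)).sub ((ha_s 2).mul (hc_s 1))).mul (hn_s 0)).add
      ((((ha_s 2).mul (hc_s 0)).sub ((ha_s 0).mul (hc_s 2))).mul (hn_s 1))).add
      ((((ha_s 0).mul (hc_s 1)).sub ((ha_s 1).mul (hc_s 0))).mul (hn_s 2))) hnn_s hnn0
  have hspan : ∀ Q ∈ conormal Ω, Q 3 * Delta S 0 (base Q) + Q 4 * Delta S 1 (base Q) = 0 →
      ∀ j, α₀ Q * a j Q + α₁ Q * b j Q = cc j Q := by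
    intro Q hQ hσ j
    have h1 : n 0 Q * cc 0 Q + n 1 Q * cc 1 Q + n 2 Q * cc 2 Q = 0 := by
      rw [Delta_eq_sum, Delta_eq_sum] at hσ
      simp only [Fin.sum_univ_three] at hσ
      simp only [hcc, hn]
      linear_combination hσ
    have n0 : n 0 Q = a 1 Q * b 2 Q - a 2 Q * b 1 Q := rfl
    have n1 : n 1 Q = a 2 Q * b 0 Q - a 0 Q * b 2 Q := rfl
    have n2 : n 2 Q = a 0 Q * b 1 Q - a 1 Q * b 0 Q := rfl
    have hq : n 0 Q ^ 2 + n 1 Q ^ 2 + n 2 Q ^ 2 ≠ 0 := hnn0 Q hQ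
    have hg := gram_expansion n0 n1 n2 h1 hq
    revert j
    exact Fin.forall_fin_succ.2 ⟨hg.1, Fin.forall_fin_two.2 ⟨hg.2.1, hg.2.2⟩⟩
  set V : (Fin 6 → ℝ) → (Fin 6 → ℝ) := fun Q => ![0, 0, 0, -α₀ Q, -α₁ Q, 1] with hV
  have hbV : ∀ Q, base (V Q) = (0, 1) := by
    intro Q
    refine Prod.ext ?_ rfl
    ext j
    fin_cases j <;> rfl
  have hker : IsKernelField (piL S) V (conormal Ω) := by
    refine ⟨?_, ?_, ?_⟩
    · refine contDiffOn_pi.2 fun i => ?_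
      fin_cases i
      · exact contDiffOn_const
      · exact contDiffOn_const
      · exact contDiffOn_const
      · exact hα₀_s.neg
      · exact hα₁_s.neg
      · exact contDiffOn_const
    · intro Q _ hQ0
      exact one_ne_zero (congrFun hQ0 5)
    · intro Q hQ hj
      rw [jac_piL hΩ hs hQ.1] at hj
      have hsp := hspan Q hQ hj
      have hsp' : ∀ j, -α₀ Q * dx S 0 j (base Q) + -α₁ Q * dx S 1 j (base Q) +
        (Q 3 * fderiv ℝ (dx S 0 j) (base Q) (0, 1) + Q 4 * fderiv ℝ (dx S 1 j) (base Q) (0, 1))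
          = 0 := fun j => by
        have := hsp j
        simp only [ha, hb, hcc, dxdy] at this
        linear_combination -this
      rw [fderiv_piL_apply hΩ hs hQ.1, hbV]
      ext i
      fin_cases i
      · rfl
      · rfl
      · rfl
      · exact hsp' 0
      · exact hsp' 1
      · exact hsp' 2
  set P := conormalPoint z θ
  have hbP : base P = z := base_conormalPoint _ _
  have hP : P ∈ conormal Ω := conormalPoint_mem hz hθ
  have p3 : P 3 = θ 0 := rfl
  have p4 : P 4 = θ 1 := rfl
  have hj0 : P 3 * Delta S 0 (base P) + P 4 * Delta S 1 (base P) = 0 := by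
    rw [hbP]
    exact h0
  have hj : jac (piL S) P = 0 := by rw [jac_piL hΩ hs hP.1, hj0]
  have htr := hS.fold_left.transversal _ subset_rfl (isOpen_conormal hΩ) V hker P hP hj
  rw [fderiv_jac_eq hΩ hs (fun P hP => jac_piL hΩ hs hP) hP.1, hbV, hbP] at htr
  have v3 : V P 3 = -α₀ P := rfl
  have v4 : V P 4 = -α₁ P := rfl
  rw [v3, v4, p3, p4] at htr
  have hsp := hspan P hP hj0
  simp only [ha, hb, hcc, hbP, p3, p4] at hsp
  -- Substituting the expansion of τ·S_{xy₃} into the first equation gives u = -sα, by independence.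
  have huv := eq_zero_of_combination_eq_zero (hS.nrm_ne_zero hz) (u := u 0 + s * α₀ P)
    (v := u 1 + s * α₁ P) fun j => by linear_combination h j + s * hsp j
  refine (mul_eq_zero.1 (?_ : s * _ = 0)).resolve_right htr
  linear_combination h' - Delta S 0 z * huv.1 - Delta S 1 z * huv.2

theorem IsAdmissible.geometryAt (hS : IsAdmissible S Ω) {z : (Fin 3 → ℝ) × ℝ} (hz : z ∈ Ω) :
    GeometryAt S z :=
  ⟨hS.nrm_ne_zero hz, hS.Delta_ne_zero hz, fun _ hθ h => hS.blowdown_at hz hθ h,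
    fun _ hθ u s h h' => hS.fold_at hz hθ u s h h'⟩

end Admissible

end FoldBlowdown
end

noncomputable section

namespace FoldBlowdown

/-! ### Extension to globally smooth families -/

/-- Multiplication by a cutoff equal to 1 near K. Agreement on a neighbourhood, not only on K, makes
all derivatives agree there. -/
theorem exists_contDiff_extension {E F : Type} [NormedAddCommGroup E] [NormedSpace ℝ E]
    [FiniteDimensional ℝ E] [NormedAddCommGroup F] [NormedSpace ℝ F] {K Ω : Set E}
    (hK : IsCompact K) (hΩ : IsOpen Ω) (hKΩ : K ⊆ Ω) {f : E → F} (hf : ContDiffOn ℝ ∞ f Ω) :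
    ∃ g : E → F, ContDiff ℝ ∞ g ∧ ∃ O, IsOpen O ∧ K ⊆ O ∧ O ⊆ Ω ∧ ∀ z ∈ O, g z = f z := by
  obtain ⟨ρ, h0, h1, -⟩ := exists_contMDiffMap_zero_one_nhds_of_isClosed (n := (⊤ : ℕ∞))
    (modelWithCornersSelf ℝ E) (M := E) hΩ.isClosed_compl hK.isClosed
    (Set.disjoint_left.2 fun x hx hx' => hx (hKΩ hx'))
  have hρ : ContDiff ℝ ∞ ρ := ρ.contMDiff.contDiff
  refine ⟨fun z => ρ z • f z, ?_, interior {z | ρ z = 1} ∩ Ω, isOpen_interior.inter hΩ, ?_,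
    Set.inter_subset_right, ?_⟩
  · rw [contDiff_iff_contDiffAt]
    intro z
    by_cases hz : z ∈ Ω
    · exact hρ.contDiffAt.smul (hf.contDiffAt (hΩ.mem_nhds hz))
    · have h2 : ∀ᶠ x in nhds z, ρ x = 0 := (Filter.eventually_of_mem h0 fun x hx => hx).filter_mono
        (nhds_le_nhdsSet hz)
      refine (contDiff_const (c := (0 : F))).contDiffAt.congr_of_eventuallyEq ?_
      filter_upwards [h2] with x hx
      simp [hx]
  · exact fun z hz => ⟨mem_interior_iff_mem_nhds.2 ((nhds_le_nhdsSet hz) h1), hKΩ hz⟩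
  · intro z hz
    have : ρ z = 1 := interior_subset (s := {z | ρ z = 1}) hz.1
    simp [this]

/-- A globally smooth family of curves which has the right geometry on an open neighbourhood
`O` of `Kx ×ˢ Kt`; there `κ` is the factor in `n · ∇Δ = κ Δ`. -/
structure IsModel (S : (Fin 3 → ℝ) × ℝ → (Fin 2 → ℝ)) (Kx : Set (Fin 3 → ℝ)) (Kt : Set ℝ)
    (O : Set ((Fin 3 → ℝ) × ℝ)) (κ : (Fin 3 → ℝ) × ℝ → ℝ) : Prop where
  smooth : ContDiff ℝ ∞ S
  smooth_kappa : ContDiff ℝ ∞ κ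
  compact_x : IsCompact Kx
  compact_t : IsCompact Kt
  isOpen : IsOpen O
  subset : Kx ×ˢ Kt ⊆ O
  geometry : ∀ z ∈ O, GeometryAt S z
  kappa : ∀ z ∈ O, ∀ i, ∑ j, nrm S z j * fderiv ℝ (Delta S i) z (Pi.single j 1, 0) =
    κ z * Delta S i z

section Germs

variable {S S' : (Fin 3 → ℝ) × ℝ → (Fin 2 → ℝ)} {O : Set ((Fin 3 → ℝ) × ℝ)}

theorem dx_eqOn (hO : IsOpen O) (h : ∀ z ∈ O, S' z = S z) (i : Fin 2) (j : Fin 3) :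
    ∀ z ∈ O, dx S' i j z = dx S i j z := fun z hz => by
  have : (fun w => S' w i) =ᶠ[nhds z] fun w => S w i :=
    Filter.eventually_of_mem (hO.mem_nhds hz) fun w hw => by simp [h w hw]
  rw [dx, dx, this.fderiv_eq]

theorem fderiv_eqOn {f g : (Fin 3 → ℝ) × ℝ → ℝ} (hO : IsOpen O) (h : ∀ z ∈ O, f z = g z) :
    ∀ z ∈ O, fderiv ℝ f z = fderiv ℝ g z := fun _ hz =>
  Filter.EventuallyEq.fderiv_eq (Filter.eventually_of_mem (hO.mem_nhds hz) h)

theorem dxdy_eqOn (hO : IsOpen O) (h : ∀ z ∈ O, S' z = S z) (i : Fin 2) (j : Fin 3) :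
    ∀ z ∈ O, dxdy S' i j z = dxdy S i j z := fun z hz => by
  rw [dxdy, dxdy, fderiv_eqOn hO (dx_eqOn hO h i j) z hz]

theorem Delta_eqOn (hO : IsOpen O) (h : ∀ z ∈ O, S' z = S z) (i : Fin 2) :
    ∀ z ∈ O, Delta S' i z = Delta S i z := fun z hz => by
  simp only [Delta, dx_eqOn hO h _ _ z hz, dxdy_eqOn hO h _ _ z hz]

theorem nrm_eqOn (hO : IsOpen O) (h : ∀ z ∈ O, S' z = S z) :
    ∀ z ∈ O, nrm S' z = nrm S z := fun z hz => by
  simp only [nrm, dx_eqOn hO h _ _ z hz]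

theorem GeometryAt.congr (hO : IsOpen O) (h : ∀ z ∈ O, S' z = S z) {z : (Fin 3 → ℝ) × ℝ}
    (hz : z ∈ O) (hg : GeometryAt S z) : GeometryAt S' z := by
  have h1 := fun i j => dx_eqOn hO h i j z hz
  have h2 := fun i j => dxdy_eqOn hO h i j z hz
  have h3 := fun i => Delta_eqOn hO h i z hz
  have h4 := fun i => fderiv_eqOn hO (Delta_eqOn hO h i) z hz
  have h5 := nrm_eqOn hO h z hz
  refine ⟨by rw [h5]; exact hg.nrm_ne_zero, by rw [h3, h3]; exact hg.Delta_ne_zero, ?_, ?_⟩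
  · simp only [h3, h4, h5]
    exact hg.blowdown
  · simp only [h1, h2, h3, h4]
    exact hg.fold

end Germs

/-- Replacing S by a globally smooth map removes the domain from all later smoothness statements.
The factor κ is the usable form of the blowdown condition: it controls n·∇Δ off the singular set as
well. -/
theorem IsAdmissible.exists_model {S : (Fin 3 → ℝ) × ℝ → (Fin 2 → ℝ)}
    {Ω : Set ((Fin 3 → ℝ) × ℝ)} (hS : IsAdmissible S Ω) {Kx : Set (Fin 3 → ℝ)} {Kt : Set ℝ}
    (hx : IsCompact Kx) (ht : IsCompact Kt) (hK : Kx ×ˢ Kt ⊆ Ω) :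
    ∃ S' O κ, IsModel S' Kx Kt O κ ∧ ∀ z ∈ O, S' z = S z := by
  obtain ⟨S', hS', O, hO, hKO, hOΩ, heq⟩ :=
    exists_contDiff_extension (hx.prod ht) hS.isOpen hK hS.smooth
  have hgeo : ∀ z ∈ O, GeometryAt S' z := fun z hz =>
    (hS.geometryAt (hOΩ hz)).congr hO heq hz
  have hs := hS'.contDiffOn (s := O)
  set D : Fin 2 → (Fin 3 → ℝ) × ℝ → ℝ := fun i z =>
    ∑ j, nrm S' z j * fderiv ℝ (Delta S' i) z (Pi.single j 1, 0) with hD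
  have hDs : ∀ i, ContDiffOn ℝ ∞ (D i) O := fun i => ContDiffOn.sum fun j _ =>
    (contDiffOn_nrm_apply hO hs j).mul
      (contDiffOn_fderiv_apply_of_isOpen hO (contDiffOn_Delta hO hs i) _)
  have hne : ∀ z ∈ O, Delta S' 0 z ^ 2 + Delta S' 1 z ^ 2 ≠ 0 := by
    intro z hz h0
    have p0 := sq_nonneg (Delta S' 0 z)
    have p1 := sq_nonneg (Delta S' 1 z)
    rcases (hgeo z hz).Delta_ne_zero with h | h
    · exact h ((pow_eq_zero_iff two_ne_zero).1 (by linarith))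
    · exact h ((pow_eq_zero_iff two_ne_zero).1 (by linarith))
  -- The vector D = n·∇Δ will turn out to be parallel to Δ, so the factor is the projection
  -- coefficient (D·Δ)/|Δ|², smooth because Δ ≠ 0.
  have hκ : ContDiffOn ℝ ∞ (fun z => (Delta S' 0 z * D 0 z + Delta S' 1 z * D 1 z) /
      (Delta S' 0 z ^ 2 + Delta S' 1 z ^ 2)) O :=
    (((contDiffOn_Delta hO hs 0).mul (hDs 0)).add ((contDiffOn_Delta hO hs 1).mul (hDs 1))).div
      (((contDiffOn_Delta hO hs 0).pow 2).add ((contDiffOn_Delta hO hs 1).pow 2)) hne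
  obtain ⟨κ, hκs, O', hO', hKO', hO'O, hκeq⟩ :=
    exists_contDiff_extension (hx.prod ht) hO hKO hκ
  refine ⟨S', O', κ, ⟨hS', hκs, hx, ht, hO', hKO', fun z hz => hgeo z (hO'O hz), ?_⟩,
    fun z hz => heq z (hO'O hz)⟩
  intro z hz i
  -- The covector perpendicular to Δ is singular at z; the blowdown identity for it says that D is
  -- parallel to Δ.
  have hb := (hgeo z (hO'O hz)).blowdown ![-Delta S' 1 z, Delta S' 0 z] ?_ ?_
  · have hn := hne z (hO'O hz)
    have hb' : -Delta S' 1 z * D 0 z + Delta S' 0 z * D 1 z = 0 := by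
      rw [← hb]
      simp only [hD, Fin.sum_univ_three, Matrix.cons_val_zero, Matrix.cons_val_one]
      ring
    rw [hκeq z hz]
    change D i z = _
    rw [div_mul_eq_mul_div, eq_div_iff hn]
    revert i
    refine Fin.forall_fin_two.2 ⟨?_, ?_⟩
    · linear_combination -Delta S' 1 z * hb'
    · linear_combination Delta S' 0 z * hb'
  · intro h
    rcases (hgeo z (hO'O hz)).Delta_ne_zero with h' | h'
    · exact h' (by simpa using congrFun h 1)
    · exact h' (by simpa using congrFun h 0)
  · simp
    ring

/-! ### Lower bounds for differences -/

/-- An injective differential on a finite-dimensional space is bounded below by 1/K, and strict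
differentiability makes the error at most half of that, uniformly in the parameter p near its
centre. -/
theorem exists_local_antilipschitz {E P G : Type} [NormedAddCommGroup E] [NormedSpace ℝ E]
    [FiniteDimensional ℝ E] [NormedAddCommGroup P] [NormedSpace ℝ P] [NormedAddCommGroup G]
    [NormedSpace ℝ G] {F : E × P → G} (hF : ContDiff ℝ ∞ F) {z₀ : E × P}
    (hinj : ∀ u : E, fderiv ℝ F z₀ (u, 0) = 0 → u = 0) :
    ∃ c > 0, ∃ ε > 0, ∀ x x' p, dist (x, p) z₀ < ε → dist (x', p) z₀ < ε →
      c * ‖x - x'‖ ≤ ‖F (x, p) - F (x', p)‖ := by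
  set A : E →L[ℝ] G := (fderiv ℝ F z₀).comp (ContinuousLinearMap.inl ℝ E P) with hA
  obtain ⟨K, hK, hKA⟩ := A.toLinearMap.exists_antilipschitzWith
    (LinearMap.ker_eq_bot'.2 fun u hu => hinj u (by simpa [hA] using hu))
  have hK' : (0 : ℝ) < K := hK
  have hst : HasStrictFDerivAt F (fderiv ℝ F z₀) z₀ :=
    hF.contDiffAt.hasStrictFDerivAt (by simp)
  have h1 := hst.isLittleO.def (c := 1 / (2 * K)) (by positivity)
  rw [nhds_prod_eq, Filter.eventually_prod_iff] at h1
  obtain ⟨pa, hpa, pb, hpb, hab⟩ := h1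
  obtain ⟨ε₁, hε₁, h₁⟩ := Metric.eventually_nhds_iff.1 hpa
  obtain ⟨ε₂, hε₂, h₂⟩ := Metric.eventually_nhds_iff.1 hpb
  refine ⟨1 / (2 * K), by positivity, min ε₁ ε₂, lt_min hε₁ hε₂, fun x x' p hx hx' => ?_⟩
  have h3 := hab (h₁ (hx.trans_le (min_le_left _ _))) (h₂ (hx'.trans_le (min_le_right _ _)))
  have h4 : ((x, p) : E × P) - (x', p) = (x - x', 0) := by simp
  simp only [h4] at h3
  have h5 : ‖((x - x', 0) : E × P)‖ = ‖x - x'‖ := by simp [Prod.norm_mk]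
  rw [h5] at h3
  have h6 : ‖x - x'‖ ≤ K * ‖fderiv ℝ F z₀ (x - x', 0)‖ := by
    have := hKA.le_mul_dist (x - x') 0
    rw [map_zero, dist_zero_right, dist_zero_right] at this
    exact this
  have h7 : ‖fderiv ℝ F z₀ (x - x', 0)‖ ≤ ‖F (x, p) - F (x', p)‖ +
      1 / (2 * K) * ‖x - x'‖ := by
    have h := norm_sub_norm_le (fderiv ℝ F z₀ (x - x', 0)) (F (x, p) - F (x', p))
    rw [norm_sub_rev (fderiv ℝ F z₀ (x - x', 0))] at h
    linarith
  have h8 : (1 / K) * ‖x - x'‖ ≤ ‖fderiv ℝ F z₀ (x - x', 0)‖ := by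
    rw [div_mul_eq_mul_div, div_le_iff₀ hK']
    linarith
  have h9 : (1 / (K : ℝ)) = 1 / (2 * K) + 1 / (2 * K) := by field_simp; norm_num
  rw [h9] at h8
  linarith

/-- Compactness; balls of half the radius leave room for x', which need not satisfy (x', p) ∈ K. -/
theorem exists_uniform_antilipschitz {E P G : Type} [NormedAddCommGroup E] [NormedSpace ℝ E]
    [FiniteDimensional ℝ E] [NormedAddCommGroup P] [NormedSpace ℝ P] [NormedAddCommGroup G]
    [NormedSpace ℝ G] {F : E × P → G} (hF : ContDiff ℝ ∞ F) {K : Set (E × P)}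
    (hK : IsCompact K) (hinj : ∀ z ∈ K, ∀ u : E, fderiv ℝ F z (u, 0) = 0 → u = 0) :
    ∃ c > 0, ∃ δ > 0, ∀ x x' p, (x, p) ∈ K → ‖x - x'‖ < δ →
      c * ‖x - x'‖ ≤ ‖F (x, p) - F (x', p)‖ := by
  refine hK.induction_on (p := fun s => ∃ c > 0, ∃ δ > 0, ∀ x x' p, (x, p) ∈ s →
    ‖x - x'‖ < δ → c * ‖x - x'‖ ≤ ‖F (x, p) - F (x', p)‖) ?_ ?_ ?_ ?_
  · exact ⟨1, one_pos, 1, one_pos, fun x x' p h => absurd h (Set.notMem_empty _)⟩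
  · rintro s t hst ⟨c, hc, δ, hδ, h⟩
    exact ⟨c, hc, δ, hδ, fun x x' p hx => h x x' p (hst hx)⟩
  · rintro s t ⟨c, hc, δ, hδ, h⟩ ⟨c', hc', δ', hδ', h'⟩
    refine ⟨min c c', lt_min hc hc', min δ δ', lt_min hδ hδ', ?_⟩
    rintro x x' p (hx | hx) hxx
    · exact (mul_le_mul_of_nonneg_right (min_le_left _ _) (norm_nonneg _)).trans
        (h x x' p hx (hxx.trans_le (min_le_left _ _)))
    · exact (mul_le_mul_of_nonneg_right (min_le_right _ _) (norm_nonneg _)).trans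
        (h' x x' p hx (hxx.trans_le (min_le_right _ _)))
  · intro z hz
    obtain ⟨c, hc, ε, hε, h⟩ := exists_local_antilipschitz hF (hinj z hz)
    refine ⟨Metric.ball z (ε / 2), mem_nhdsWithin_of_mem_nhds
      (Metric.ball_mem_nhds z (by positivity)), c, hc, ε / 2, by positivity,
      fun x x' p hx hxx => h x x' p ?_ ?_⟩
    · exact (Metric.mem_ball.1 hx).trans (by linarith)
    · have h1 : dist (x', p) (x, p) < ε / 2 := by
        rw [dist_comm, dist_eq_norm]
        simpa [Prod.norm_mk] using hxx
      have h2 := Metric.mem_ball.1 hx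
      linarith [dist_triangle (x', p) (x, p) z]

section GlobalSmoothness

variable {S : (Fin 3 → ℝ) × ℝ → (Fin 2 → ℝ)}

theorem contDiff_dx (hS : ContDiff ℝ ∞ S) (i : Fin 2) (j : Fin 3) : ContDiff ℝ ∞ (dx S i j) :=
  contDiffOn_univ.1 (contDiffOn_dx isOpen_univ hS.contDiffOn i j)

theorem contDiff_nrm (hS : ContDiff ℝ ∞ S) : ContDiff ℝ ∞ (nrm S) :=
  contDiff_pi.2 fun j => contDiffOn_univ.1 (contDiffOn_nrm_apply isOpen_univ hS.contDiffOn j)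

theorem contDiff_Delta (hS : ContDiff ℝ ∞ S) (i : Fin 2) : ContDiff ℝ ∞ (Delta S i) :=
  contDiffOn_univ.1 (contDiffOn_Delta isOpen_univ hS.contDiffOn i)

theorem contDiff_component (hS : ContDiff ℝ ∞ S) (i : Fin 2) : ContDiff ℝ ∞ fun z => S z i :=
  contDiff_pi.1 hS i

end GlobalSmoothness

/-- The gradient in `x` of `θ · S(x, t)` at `z = (x, t)`. -/
def phaseGrad (S : (Fin 3 → ℝ) × ℝ → (Fin 2 → ℝ)) (θ : Fin 2 → ℝ) (z : (Fin 3 → ℝ) × ℝ) :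
    Fin 3 → ℝ :=
  fun j => θ 0 * dx S 0 j z + θ 1 * dx S 1 j z

/-- The rotational curvature `θ · Δ`. -/
def curv (S : (Fin 3 → ℝ) × ℝ → (Fin 2 → ℝ)) (θ : Fin 2 → ℝ) (z : (Fin 3 → ℝ) × ℝ) : ℝ :=
  θ 0 * Delta S 0 z + θ 1 * Delta S 1 z

/-- The frequencies `θ` with `1/4 ≤ |θ| ≤ 4`. -/
def freqAnnulus : Set (Fin 2 → ℝ) :=
  {θ | 1 / 4 ≤ Real.sqrt (θ 0 ^ 2 + θ 1 ^ 2) ∧ Real.sqrt (θ 0 ^ 2 + θ 1 ^ 2) ≤ 4}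

theorem norm_le_of_mem_freqAnnulus {θ : Fin 2 → ℝ} (h : θ ∈ freqAnnulus) : ‖θ‖ ≤ 4 := by
  refine (pi_norm_le_iff_of_nonneg (by norm_num)).2 (Fin.forall_fin_two.2 ⟨?_, ?_⟩)
  · exact (Real.abs_le_sqrt (by nlinarith [sq_nonneg (θ 1)])).trans h.2
  · exact (Real.abs_le_sqrt (by nlinarith [sq_nonneg (θ 0)])).trans h.2

theorem ne_zero_of_mem_freqAnnulus {θ : Fin 2 → ℝ} (h : θ ∈ freqAnnulus) : θ ≠ 0 := by
  rintro rfl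
  have := h.1
  norm_num at this

theorem isClosed_freqAnnulus : IsClosed freqAnnulus := by
  have h : Continuous fun θ : Fin 2 → ℝ => Real.sqrt (θ 0 ^ 2 + θ 1 ^ 2) := by fun_prop
  exact (isClosed_le continuous_const h).inter (isClosed_le h continuous_const)

theorem isCompact_freqAnnulus : IsCompact freqAnnulus :=
  (isCompact_closedBall (0 : Fin 2 → ℝ) 4).of_isClosed_subset isClosed_freqAnnulus
    fun θ h => by simpa using norm_le_of_mem_freqAnnulus h

theorem fderiv_linear_combination {g₀ g₁ : (Fin 3 → ℝ) × ℝ → ℝ} (h₀ : ContDiff ℝ ∞ g₀)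
    (h₁ : ContDiff ℝ ∞ g₁) (w : ((Fin 2 → ℝ) × ℝ) × (Fin 3 → ℝ)) (u : Fin 2 → ℝ) (s : ℝ) :
    HasFDerivAt (fun w : ((Fin 2 → ℝ) × ℝ) × (Fin 3 → ℝ) =>
        w.1.1 0 * g₀ (w.2, w.1.2) + w.1.1 1 * g₁ (w.2, w.1.2))
      (fderiv ℝ (fun w : ((Fin 2 → ℝ) × ℝ) × (Fin 3 → ℝ) =>
        w.1.1 0 * g₀ (w.2, w.1.2) + w.1.1 1 * g₁ (w.2, w.1.2)) w) w ∧
    fderiv ℝ (fun w : ((Fin 2 → ℝ) × ℝ) × (Fin 3 → ℝ) =>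
        w.1.1 0 * g₀ (w.2, w.1.2) + w.1.1 1 * g₁ (w.2, w.1.2)) w ((u, s), 0) =
      u 0 * g₀ (w.2, w.1.2) + u 1 * g₁ (w.2, w.1.2) +
        s * (w.1.1 0 * fderiv ℝ g₀ (w.2, w.1.2) (0, 1) +
          w.1.1 1 * fderiv ℝ g₁ (w.2, w.1.2) (0, 1)) := by
  set Q : (((Fin 2 → ℝ) × ℝ) × (Fin 3 → ℝ)) →L[ℝ] (Fin 3 → ℝ) × ℝ :=
    (ContinuousLinearMap.snd ℝ _ _).prod
      ((ContinuousLinearMap.snd ℝ _ _).comp (ContinuousLinearMap.fst ℝ _ _)) with hQ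
  set T : Fin 2 → ((((Fin 2 → ℝ) × ℝ) × (Fin 3 → ℝ)) →L[ℝ] ℝ) := fun i =>
    (ContinuousLinearMap.proj (R := ℝ) (φ := fun _ : Fin 2 => ℝ) i).comp
      ((ContinuousLinearMap.fst ℝ _ _).comp (ContinuousLinearMap.fst ℝ _ _)) with hT
  have e : ∀ {g : (Fin 3 → ℝ) × ℝ → ℝ}, ContDiff ℝ ∞ g →
      HasFDerivAt (fun w => g (Q w)) ((fderiv ℝ g (Q w)).comp Q) w := fun {g} hg =>
    ((hg.differentiable (by simp)) (Q w)).hasFDerivAt.comp w Q.hasFDerivAt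
  have h := ((T 0).hasFDerivAt.mul (e h₀)).add ((T 1).hasFDerivAt.mul (e h₁)) (x := w)
  have h' : HasFDerivAt (fun w : ((Fin 2 → ℝ) × ℝ) × (Fin 3 → ℝ) =>
    w.1.1 0 * g₀ (w.2, w.1.2) + w.1.1 1 * g₁ (w.2, w.1.2)) _ w := h
  refine ⟨h'.differentiableAt.hasFDerivAt, ?_⟩
  rw [h'.fderiv]
  have hs : ∀ L : (Fin 3 → ℝ) × ℝ →L[ℝ] ℝ, L (0, s) = s * L (0, 1) := fun L => by
    rw [← smul_eq_mul, ← map_smul]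
    simp
  simp [hQ, hT, hs]
  ring

section LowerBounds

variable {S : (Fin 3 → ℝ) × ℝ → (Fin 2 → ℝ)} {Kx : Set (Fin 3 → ℝ)} {Kt : Set ℝ}
  {O : Set ((Fin 3 → ℝ) × ℝ)} {κ : (Fin 3 → ℝ) × ℝ → ℝ}

/-- The field `GeometryAt.fold` is precisely the injectivity of the differential in (θ,t) of the map
(θ·S_x, θ·Δ). -/
theorem IsModel.exists_immersion_bound (hM : IsModel S Kx Kt O κ) :
    ∃ c > 0, ∃ δ > 0, ∀ x ∈ Kx, ∀ t ∈ Kt, ∀ θ ∈ freqAnnulus, ∀ (θ' : Fin 2 → ℝ) (t' : ℝ),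
      ‖(θ, t) - (θ', t')‖ < δ → c * ‖(θ, t) - (θ', t')‖ ≤
        max ‖phaseGrad S θ (x, t) - phaseGrad S θ' (x, t')‖
          |curv S θ (x, t) - curv S θ' (x, t')| := by
  set F : ((Fin 2 → ℝ) × ℝ) × (Fin 3 → ℝ) → (Fin 3 → ℝ) × ℝ := fun w =>
    (phaseGrad S w.1.1 (w.2, w.1.2), curv S w.1.1 (w.2, w.1.2)) with hF
  have h1 : ∀ i j, ContDiff ℝ ∞ (dx S i j) := contDiff_dx hM.smooth
  have h2 : ∀ i, ContDiff ℝ ∞ (Delta S i) := contDiff_Delta hM.smooth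
  have hcomb : ∀ {g₀ g₁ : (Fin 3 → ℝ) × ℝ → ℝ}, ContDiff ℝ ∞ g₀ → ContDiff ℝ ∞ g₁ →
      ContDiff ℝ ∞ fun w : ((Fin 2 → ℝ) × ℝ) × (Fin 3 → ℝ) =>
        w.1.1 0 * g₀ (w.2, w.1.2) + w.1.1 1 * g₁ (w.2, w.1.2) := by
    intro g₀ g₁ h₀ h₁
    have k₀ := h₀.comp (by fun_prop :
      ContDiff ℝ ∞ fun w : ((Fin 2 → ℝ) × ℝ) × (Fin 3 → ℝ) => (w.2, w.1.2))
    have k₁ := h₁.comp (by fun_prop :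
      ContDiff ℝ ∞ fun w : ((Fin 2 → ℝ) × ℝ) × (Fin 3 → ℝ) => (w.2, w.1.2))
    simp only [Function.comp_def] at k₀ k₁
    fun_prop
  have hFs : ContDiff ℝ ∞ F :=
    (contDiff_pi.2 fun j => hcomb (h1 0 j) (h1 1 j)).prodMk (hcomb (h2 0) (h2 1))
  have hinj : ∀ z ∈ (freqAnnulus ×ˢ Kt) ×ˢ Kx, ∀ u : (Fin 2 → ℝ) × ℝ,
      fderiv ℝ F z (u, 0) = 0 → u = 0 := by
    rintro ⟨⟨θ, t⟩, x⟩ ⟨⟨hθ, ht⟩, hx⟩ ⟨u, s⟩ h0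
    have hz : (x, t) ∈ O := hM.subset ⟨hx, ht⟩
    have hd : HasFDerivAt F (ContinuousLinearMap.prod (ContinuousLinearMap.pi fun j => _) _)
        ((θ, t), x) := (hasFDerivAt_pi.2 fun j =>
      (fderiv_linear_combination (h1 0 j) (h1 1 j) ((θ, t), x) u s).1).prodMk
      (fderiv_linear_combination (h2 0) (h2 1) ((θ, t), x) u s).1
    rw [hd.fderiv] at h0
    have e1 := fun j => congrFun (congrArg Prod.fst h0) j
    have e2 := congrArg Prod.snd h0
    have := (hM.geometry _ hz).fold θ (ne_zero_of_mem_freqAnnulus hθ) u s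
      (fun j => (fderiv_linear_combination (h1 0 j) (h1 1 j) ((θ, t), x) u s).2.symm.trans (e1 j))
      ((fderiv_linear_combination (h2 0) (h2 1) ((θ, t), x) u s).2.symm.trans e2)
    rw [this.1, this.2]
    rfl
  obtain ⟨c, hc, δ, hδ, h⟩ := exists_uniform_antilipschitz hFs
    ((isCompact_freqAnnulus.prod hM.compact_t).prod hM.compact_x) hinj
  refine ⟨c, hc, δ, hδ, fun x hx t ht θ hθ θ' t' hd => ?_⟩
  exact h (θ, t) (θ', t') x ⟨⟨hθ, ht⟩, hx⟩ hd

theorem phaseGrad_sub (θ θ' : Fin 2 → ℝ) (z : (Fin 3 → ℝ) × ℝ) :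
    phaseGrad S (θ - θ') z = phaseGrad S θ z - phaseGrad S θ' z := by
  ext j
  simp [phaseGrad]
  ring

theorem IsModel.exists_rank_bound (hM : IsModel S Kx Kt O κ) :
    ∃ c > 0, ∀ z ∈ Kx ×ˢ Kt, ∀ u : Fin 2 → ℝ, c * ‖u‖ ≤ ‖phaseGrad S u z‖ := by
  have hK : IsCompact ((Metric.sphere (0 : Fin 2 → ℝ) 1) ×ˢ (Kx ×ˢ Kt)) :=
    (isCompact_sphere _ _).prod (hM.compact_x.prod hM.compact_t)
  have hcont : Continuous fun p : (Fin 2 → ℝ) × ((Fin 3 → ℝ) × ℝ) => phaseGrad S p.1 p.2 := by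
    refine continuous_pi fun j => ?_
    have h0 := (contDiff_dx hM.smooth 0 j).continuous
    have h1 := (contDiff_dx hM.smooth 1 j).continuous
    simp only [phaseGrad]
    fun_prop
  have hpos : ∀ p ∈ (Metric.sphere (0 : Fin 2 → ℝ) 1) ×ˢ (Kx ×ˢ Kt),
      0 < ‖phaseGrad S p.1 p.2‖ := by
    rintro ⟨u, z⟩ ⟨hu, hz⟩
    rw [norm_pos_iff]
    intro h0
    have h1 : u 0 = 0 ∧ u 1 = 0 :=
      eq_zero_of_combination_eq_zero ((hM.geometry z (hM.subset hz)).nrm_ne_zero)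
        fun j => congrFun h0 j
    have hu0 : u = 0 := by
      ext i
      fin_cases i
      · exact h1.1
      · exact h1.2
    have hu1 : ‖u‖ = 1 := by simpa using hu
    rw [hu0, norm_zero] at hu1
    exact zero_ne_one hu1
  obtain ⟨c, hc, h⟩ := hK.exists_forall_le' hcont.norm.continuousOn hpos
  refine ⟨c, hc, fun z hz u => ?_⟩
  rcases eq_or_ne u 0 with rfl | hu
  · simp
  · have hu' : 0 < ‖u‖ := norm_pos_iff.2 hu
    have h1 := h (‖u‖⁻¹ • u, z) ⟨by simp [norm_smul, hu'.ne'], hz⟩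
    have h2 : phaseGrad S (‖u‖⁻¹ • u) z = ‖u‖⁻¹ • phaseGrad S u z := by
      ext j
      simp [phaseGrad]
      ring
    simp only [h2, norm_smul, norm_inv, norm_norm] at h1
    rwa [le_inv_mul_iff₀ hu', mul_comm] at h1

theorem IsModel.exists_lipschitz_phaseGrad (hM : IsModel S Kx Kt O κ) :
    ∃ C ≥ 0, ∀ x ∈ Kx, ∀ t ∈ Kt, ∀ t' ∈ Kt, ∀ θ ∈ freqAnnulus,
      ‖phaseGrad S θ (x, t') - phaseGrad S θ (x, t)‖ ≤ C * |t' - t| := by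
  have hd : ∀ i j, ∃ C, ∀ x ∈ Kx, ∀ t ∈ Kt, ∀ t' ∈ Kt,
      |dx S i j (x, t') - dx S i j (x, t)| ≤ C * |t' - t| := by
    intro i j
    obtain ⟨H, hH, hH', -⟩ := exists_smooth_dividedDifference (contDiff_dx hM.smooth i j)
    obtain ⟨C, hC⟩ := (hM.compact_x.prod (hM.compact_t.prod
      hM.compact_t)).exists_bound_of_continuousOn hH.continuous.continuousOn
    refine ⟨C, fun x hx t ht t' ht' => ?_⟩
    rw [hH', smul_eq_mul, abs_mul, mul_comm]
    exact mul_le_mul_of_nonneg_right (hC _ ⟨hx, ht, ht'⟩) (abs_nonneg _)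
  choose C hC using hd
  refine ⟨∑ i, ∑ j, 4 * |C i j|, by positivity, fun x hx t ht t' ht' θ hθ => ?_⟩
  have hC' : ∀ i j, |dx S i j (x, t') - dx S i j (x, t)| ≤ |C i j| * |t' - t| := fun i j =>
    (hC i j x hx t ht t' ht').trans (mul_le_mul_of_nonneg_right (le_abs_self _) (abs_nonneg _))
  have hθ4 : ∀ i, |θ i| ≤ 4 := fun i =>
    (norm_le_pi_norm θ i).trans (norm_le_of_mem_freqAnnulus hθ)
  refine (pi_norm_le_iff_of_nonneg (by positivity)).2 fun j => ?_
  have h1 : (phaseGrad S θ (x, t') - phaseGrad S θ (x, t)) j =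
      ∑ i, θ i * (dx S i j (x, t') - dx S i j (x, t)) := by
    simp [phaseGrad, Fin.sum_univ_two]
    ring
  rw [h1, Finset.sum_mul, Real.norm_eq_abs]
  refine (Finset.abs_sum_le_sum_abs _ _).trans (Finset.sum_le_sum fun i _ => ?_)
  rw [abs_mul]
  calc |θ i| * |dx S i j (x, t') - dx S i j (x, t)| ≤ 4 * (|C i j| * |t' - t|) :=
        mul_le_mul (hθ4 i) (hC' i j) (abs_nonneg _) (by norm_num)
    _ = (4 * |C i j|) * |t' - t| := by ring
    _ ≤ _ := mul_le_mul_of_nonneg_right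
        (Finset.single_le_sum (f := fun j => 4 * |C i j|) (fun j _ => by positivity)
          (Finset.mem_univ j)) (abs_nonneg _)

/-- The lower bounds on the `x`-gradient of the phase difference. -/
theorem IsModel.exists_gradient_bound (hM : IsModel S Kx Kt O κ) :
    ∃ c > 0, ∃ δ > 0, ∃ C ≥ 1, ∀ x ∈ Kx, ∀ t ∈ Kt, ∀ t' ∈ Kt, ∀ θ ∈ freqAnnulus,
      ∀ θ' ∈ freqAnnulus,
      (C * |t' - t| ≤ ‖θ' - θ‖ → c * ‖(θ', t') - (θ, t)‖ ≤
        ‖phaseGrad S θ' (x, t') - phaseGrad S θ (x, t)‖) ∧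
      (|t' - t| ≤ δ → ∀ b, |curv S θ (x, t)| ≤ b → |curv S θ' (x, t')| ≤ b →
        C * b ≤ ‖(θ', t') - (θ, t)‖ → c * ‖(θ', t') - (θ, t)‖ ≤
          ‖phaseGrad S θ' (x, t') - phaseGrad S θ (x, t)‖) := by
  obtain ⟨c₀, hc₀, δ₀, hδ₀, h₀⟩ := hM.exists_immersion_bound
  obtain ⟨c₁, hc₁, h₁⟩ := hM.exists_rank_bound
  obtain ⟨L, hL, h₂⟩ := hM.exists_lipschitz_phaseGrad
  -- The term 2L/c₁ makes the change of the gradient caused by t' - t at most half of the change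
  -- caused by θ' - θ. The term 4/c₀ keeps the difference of the curvatures, at most 2b, below c₀r.
  -- The term 1 makes |t' - t| ≤ |θ' - θ| in the first case.
  set C := 1 + 2 * L / c₁ + 4 / c₀ with hC
  have hC1 : 1 ≤ C := by
    have : 0 ≤ 2 * L / c₁ + 4 / c₀ := by positivity
    linarith
  have hCL : 2 * L / c₁ ≤ C := by
    have : 0 ≤ 4 / c₀ := by positivity
    linarith
  have hC0 : 4 / c₀ ≤ C := by
    have : 0 ≤ 2 * L / c₁ := by positivity
    linarith
  have hCpos : 0 < C := by linarith
  refine ⟨min (c₁ / 2) c₀, lt_min (by positivity) hc₀, δ₀ / (2 * C), by positivity, C, hC1, ?_⟩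
  intro x hx t ht t' ht' θ hθ θ' hθ'
  have hnorm : ‖(θ', t') - (θ, t)‖ = max ‖θ' - θ‖ |t' - t| := by
    rw [Prod.mk_sub_mk, Prod.norm_mk, Real.norm_eq_abs]
  have first : C * |t' - t| ≤ ‖θ' - θ‖ → min (c₁ / 2) c₀ * ‖(θ', t') - (θ, t)‖ ≤
      ‖phaseGrad S θ' (x, t') - phaseGrad S θ (x, t)‖ := by
    intro h
    have h3 := h₁ (x, t') ⟨hx, ht'⟩ (θ' - θ)
    have h4 := h₂ x hx t ht t' ht' θ hθ
    have h5 : phaseGrad S θ' (x, t') - phaseGrad S θ (x, t) =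
        phaseGrad S (θ' - θ) (x, t') + (phaseGrad S θ (x, t') - phaseGrad S θ (x, t)) := by
      rw [phaseGrad_sub]
      abel
    have h6 : |t' - t| ≤ ‖θ' - θ‖ :=
      (le_mul_of_one_le_left (abs_nonneg _) hC1).trans h
    have h7 : L * |t' - t| ≤ c₁ / 2 * ‖θ' - θ‖ := by
      have : 2 * L / c₁ * |t' - t| ≤ ‖θ' - θ‖ :=
        (mul_le_mul_of_nonneg_right hCL (abs_nonneg _)).trans h
      calc L * |t' - t| = c₁ / 2 * (2 * L / c₁ * |t' - t|) := by field_simp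
        _ ≤ _ := by gcongr
    rw [hnorm, max_eq_left h6, h5]
    have h8 : ‖phaseGrad S (θ' - θ) (x, t')‖ - ‖phaseGrad S θ (x, t') - phaseGrad S θ (x, t)‖ ≤
        ‖phaseGrad S (θ' - θ) (x, t') + (phaseGrad S θ (x, t') - phaseGrad S θ (x, t))‖ := by
      have := norm_sub_norm_le (phaseGrad S (θ' - θ) (x, t'))
        (-(phaseGrad S θ (x, t') - phaseGrad S θ (x, t)))
      rwa [norm_neg, sub_neg_eq_add] at this
    have h9 : min (c₁ / 2) c₀ * ‖θ' - θ‖ ≤ c₁ / 2 * ‖θ' - θ‖ :=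
      mul_le_mul_of_nonneg_right (min_le_left _ _) (norm_nonneg _)
    linarith
  refine ⟨first, fun hs b hb hb' hr => ?_⟩
  rcases le_or_gt (C * |t' - t|) ‖θ' - θ‖ with h | h
  · exact first h
  set r := ‖(θ', t') - (θ, t)‖ with hrdef
  rcases eq_or_lt_of_le (norm_nonneg ((θ', t') - (θ, t))) with hr0 | hr0
  · rw [← hrdef] at hr0
    rw [← hr0, mul_zero]
    exact norm_nonneg _
  have hrC : r ≤ C * |t' - t| := by
    rw [hnorm]
    exact max_le h.le (le_mul_of_one_le_left (abs_nonneg _) hC1)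
  -- Here |θ' - θ| is controlled by |t' - t|, so smallness of |t' - t| alone brings the pair into
  -- the range of the immersion bound.
  have hrδ : r < δ₀ := by
    have : C * |t' - t| ≤ δ₀ / 2 := by
      calc C * |t' - t| ≤ C * (δ₀ / (2 * C)) := by gcongr
        _ = δ₀ / 2 := by field_simp
    linarith
  have h3 := h₀ x hx t' ht' θ' hθ' θ t hrδ
  rw [← hrdef] at h3
  -- The curvature component is too small to realize the maximum in the immersion bound, hence the
  -- gradient component does.
  have h4 : |curv S θ' (x, t') - curv S θ (x, t)| < c₀ * r := by
    have h5 : |curv S θ' (x, t') - curv S θ (x, t)| ≤ 2 * b := by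
      refine (abs_sub _ _).trans ?_
      linarith
    have h6 : 4 / c₀ * b ≤ r :=
      (mul_le_mul_of_nonneg_right hC0 ((abs_nonneg _).trans hb)).trans hr
    have h7 : 4 * b ≤ c₀ * r := by
      calc 4 * b = c₀ * (4 / c₀ * b) := by field_simp
        _ ≤ _ := by gcongr
    have h8 : 0 < c₀ * r := by positivity
    linarith
  have h5 : c₀ * r ≤ ‖phaseGrad S θ' (x, t') - phaseGrad S θ (x, t)‖ := by
    rcases le_max_iff.1 h3 with h | h
    · exact h
    · linarith
  exact (mul_le_mul_of_nonneg_right (min_le_right _ _) hr0.le).trans h5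

end LowerBounds

end FoldBlowdown
end

noncomputable section

namespace FoldBlowdown

/-! ### The volume of tubes around the curves `S(·, t) = w` -/

/-- The inverse of F on F(W) is Lipschitz with constant 1/c, and for the sup norm the d-dimensional
Hausdorff measure is Lebesgue measure. -/
theorem volume_le_of_antilipschitz {d : ℕ} {F : (Fin d → ℝ) → (Fin d → ℝ)} {W : Set (Fin d → ℝ)}
    {c : ℝ} (hc : 0 < c) (h : ∀ x ∈ W, ∀ x' ∈ W, c * ‖x - x'‖ ≤ ‖F x - F x'‖) :
    volume W ≤ ENNReal.ofReal (c⁻¹ ^ d) * volume (F '' W) := by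
  have hinj : Set.InjOn F W := by
    intro x hx x' hx' he
    have := h x hx x' hx'
    rw [he, sub_self, norm_zero] at this
    have h0 : ‖x - x'‖ ≤ 0 := by
      by_contra! h1
      have := mul_pos hc h1
      linarith
    exact sub_eq_zero.1 (norm_le_zero_iff.1 h0)
  set g := Function.invFunOn F W with hg
  have hgF : ∀ x ∈ W, g (F x) = x := fun x hx => hinj.leftInvOn_invFunOn hx
  have hlip : LipschitzOnWith (Real.toNNReal c⁻¹) g (F '' W) := by
    refine LipschitzOnWith.of_dist_le_mul ?_
    rintro _ ⟨x, hx, rfl⟩ _ ⟨x', hx', rfl⟩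
    rw [hgF x hx, hgF x' hx', dist_eq_norm, dist_eq_norm, Real.coe_toNNReal _ (by positivity),
      le_inv_mul_iff₀ hc]
    exact h x hx x' hx'
  have himg : g '' (F '' W) = W := by
    ext x
    constructor
    · rintro ⟨_, ⟨x', hx', rfl⟩, rfl⟩
      rwa [hgF x' hx']
    · exact fun hx => ⟨F x, ⟨x, hx, rfl⟩, hgF x hx⟩
  have h1 := hlip.hausdorffMeasure_image_le (d := (d : ℝ)) (by positivity)
  rw [himg] at h1
  have h2 : (μH[(d : ℝ)] : Measure (Fin d → ℝ)) = volume := by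
    simpa using hausdorffMeasure_pi_real (ι := Fin d)
  rw [h2] at h1
  refine h1.trans (le_of_eq ?_)
  rw [ENNReal.rpow_natCast, ENNReal.ofReal_pow (by positivity)]
  rfl

/-- S^1_x, S^2_x and n form a basis: |n|²u is an explicit combination of the three pairings. -/
theorem nrm_frame_injective {S : (Fin 3 → ℝ) × ℝ → (Fin 2 → ℝ)} {z : (Fin 3 → ℝ) × ℝ}
    (hn : nrm S z ≠ 0) {u : Fin 3 → ℝ} (h : ∀ i, ∑ j, u j * dx S i j z = 0)
    (h' : ∑ j, nrm S z j * u j = 0) : u = 0 := by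
  have n0 : nrm S z 0 = dx S 0 1 z * dx S 1 2 z - dx S 0 2 z * dx S 1 1 z := rfl
  have n1 : nrm S z 1 = dx S 0 2 z * dx S 1 0 z - dx S 0 0 z * dx S 1 2 z := rfl
  have n2 : nrm S z 2 = dx S 0 0 z * dx S 1 1 z - dx S 0 1 z * dx S 1 0 z := rfl
  have ha := h 0
  have hb := h 1
  simp only [Fin.sum_univ_three] at ha hb h'
  have hq : nrm S z 0 ^ 2 + nrm S z 1 ^ 2 + nrm S z 2 ^ 2 ≠ 0 := by
    intro h0
    apply hn
    have p0 := sq_nonneg (nrm S z 0)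
    have p1 := sq_nonneg (nrm S z 1)
    have p2 := sq_nonneg (nrm S z 2)
    ext j
    fin_cases j
    · exact (pow_eq_zero_iff two_ne_zero).1 (by linarith : nrm S z 0 ^ 2 = 0)
    · exact (pow_eq_zero_iff two_ne_zero).1 (by linarith : nrm S z 1 ^ 2 = 0)
    · exact (pow_eq_zero_iff two_ne_zero).1 (by linarith : nrm S z 2 ^ 2 = 0)
  have key : ∀ j, (nrm S z 0 ^ 2 + nrm S z 1 ^ 2 + nrm S z 2 ^ 2) * u j = 0 := by
    refine Fin.forall_fin_succ.2 ⟨?_, Fin.forall_fin_two.2 ⟨?_, ?_⟩⟩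
    · rw [n0, n1, n2] at *
      linear_combination
        (dx S 1 1 z * (dx S 0 0 z * dx S 1 1 z - dx S 0 1 z * dx S 1 0 z) -
          dx S 1 2 z * (dx S 0 2 z * dx S 1 0 z - dx S 0 0 z * dx S 1 2 z)) * ha +
        ((dx S 0 2 z * dx S 1 0 z - dx S 0 0 z * dx S 1 2 z) * dx S 0 2 z -
          (dx S 0 0 z * dx S 1 1 z - dx S 0 1 z * dx S 1 0 z) * dx S 0 1 z) * hb +
        (dx S 0 1 z * dx S 1 2 z - dx S 0 2 z * dx S 1 1 z) * h'
    · change (nrm S z 0 ^ 2 + nrm S z 1 ^ 2 + nrm S z 2 ^ 2) * u 1 = 0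
      rw [n0, n1, n2] at *
      linear_combination
        (dx S 1 2 z * (dx S 0 1 z * dx S 1 2 z - dx S 0 2 z * dx S 1 1 z) -
          dx S 1 0 z * (dx S 0 0 z * dx S 1 1 z - dx S 0 1 z * dx S 1 0 z)) * ha +
        ((dx S 0 0 z * dx S 1 1 z - dx S 0 1 z * dx S 1 0 z) * dx S 0 0 z -
          (dx S 0 1 z * dx S 1 2 z - dx S 0 2 z * dx S 1 1 z) * dx S 0 2 z) * hb +
        (dx S 0 2 z * dx S 1 0 z - dx S 0 0 z * dx S 1 2 z) * h'
    · change (nrm S z 0 ^ 2 + nrm S z 1 ^ 2 + nrm S z 2 ^ 2) * u 2 = 0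
      rw [n0, n1, n2] at *
      linear_combination
        (dx S 1 0 z * (dx S 0 2 z * dx S 1 0 z - dx S 0 0 z * dx S 1 2 z) -
          dx S 1 1 z * (dx S 0 1 z * dx S 1 2 z - dx S 0 2 z * dx S 1 1 z)) * ha +
        ((dx S 0 1 z * dx S 1 2 z - dx S 0 2 z * dx S 1 1 z) * dx S 0 1 z -
          (dx S 0 2 z * dx S 1 0 z - dx S 0 0 z * dx S 1 2 z) * dx S 0 0 z) * hb +
        (dx S 0 0 z * dx S 1 1 z - dx S 0 1 z * dx S 1 0 z) * h'
  ext j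
  exact (mul_eq_zero.1 (key j)).resolve_left hq

section Tubes

variable {S : (Fin 3 → ℝ) × ℝ → (Fin 2 → ℝ)} {Kx : Set (Fin 3 → ℝ)} {Kt : Set ℝ}
  {O : Set ((Fin 3 → ℝ) × ℝ)} {κ : (Fin 3 → ℝ) × ℝ → ℝ}

/-- The functions S^1, S^2 and ν·x with ν = n(z₀) are local coordinates in x, uniformly in t near
z₀. In these coordinates the tube lies in a box with two sides of length 2r and one of bounded
length. -/
theorem exists_local_tube_bound (hS : ContDiff ℝ ∞ S) {z₀ : (Fin 3 → ℝ) × ℝ}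
    (hn : nrm S z₀ ≠ 0) :
    ∃ ε > 0, ∃ C ≥ 0, ∀ (t : ℝ) (w : Fin 2 → ℝ) (r : ℝ), 0 ≤ r →
      volume {x | (x, t) ∈ Metric.ball z₀ ε ∧ ‖S (x, t) - w‖ ≤ r} ≤
        ENNReal.ofReal (C * r ^ 2) := by
  set ν := nrm S z₀ with hν
  set ℓ : (Fin 3 → ℝ) → ℝ := fun x => ∑ j, ν j * x j with hℓ
  set F : (Fin 3 → ℝ) × ℝ → (Fin 3 → ℝ) := fun z => ![S z 0, S z 1, ℓ z.1] with hF
  have hFi : ∀ a, ContDiff ℝ ∞ fun z => F z a := by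
    refine Fin.forall_fin_succ.2 ⟨contDiff_component hS 0, Fin.forall_fin_two.2
      ⟨contDiff_component hS 1, ?_⟩⟩
    change ContDiff ℝ ∞ fun z : (Fin 3 → ℝ) × ℝ => ∑ j, ν j * z.1 j
    fun_prop
  have hFs : ContDiff ℝ ∞ F := contDiff_pi.2 hFi
  have hinj : ∀ u : Fin 3 → ℝ, fderiv ℝ F z₀ (u, 0) = 0 → u = 0 := by
    intro u hu
    have hcomp : ∀ a, fderiv ℝ (fun z => F z a) z₀ (u, 0) = 0 := fun a => by
      have h1 : fderiv ℝ (fun z => F z a) z₀ (u, 0) = fderiv ℝ F z₀ (u, 0) a := by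
        rw [fderiv_apply ((hFs.differentiable (by simp)) z₀)]
        rfl
      rw [h1, hu]
      rfl
    refine nrm_frame_injective hn (Fin.forall_fin_two.2 ⟨?_, ?_⟩) ?_
    · have h1 : fderiv ℝ (fun z => S z 0) z₀ (u, 0) = 0 := hcomp 0
      rw [clm_apply_prod, zero_mul, add_zero] at h1
      exact h1
    · have h1 : fderiv ℝ (fun z => S z 1) z₀ (u, 0) = 0 := hcomp 1
      rw [clm_apply_prod, zero_mul, add_zero] at h1
      exact h1
    · have h1 : fderiv ℝ (fun z : (Fin 3 → ℝ) × ℝ => ℓ z.1) z₀ (u, 0) = 0 := hcomp 2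
      set A : (Fin 3 → ℝ) × ℝ →L[ℝ] ℝ := ∑ j, ν j •
        (ContinuousLinearMap.proj (R := ℝ) (φ := fun _ : Fin 3 => ℝ) j).comp
          (ContinuousLinearMap.fst ℝ _ _) with hA
      have h2 : (fun z : (Fin 3 → ℝ) × ℝ => ℓ z.1) = A := by
        ext z
        simp [hA, hℓ]
      rw [h2, A.fderiv] at h1
      simpa [hA] using h1
  obtain ⟨c, hc, ε, hε, h⟩ := exists_local_antilipschitz hFs hinj
  set B := (∑ j, |ν j|) * ε with hB
  have hB0 : 0 ≤ B := by positivity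
  refine ⟨ε, hε, c⁻¹ ^ 3 * (8 * B), by positivity, fun t w r hr => ?_⟩
  set W := {x | (x, t) ∈ Metric.ball z₀ ε ∧ ‖S (x, t) - w‖ ≤ r} with hW
  refine (volume_le_of_antilipschitz (F := fun x => F (x, t)) hc
    fun x hx x' hx' => h x x' t hx.1 hx'.1).trans ?_
  have hsub : (fun x => F (x, t)) '' W ⊆ Set.Icc ![w 0 - r, w 1 - r, ℓ z₀.1 - B]
      ![w 0 + r, w 1 + r, ℓ z₀.1 + B] := by
    rintro _ ⟨x, ⟨hx, hxw⟩, rfl⟩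
    have h01 : ∀ i, |S (x, t) i - w i| ≤ r := fun i =>
      (norm_le_pi_norm (S (x, t) - w) i).trans hxw
    have hx0 : ‖x - z₀.1‖ ≤ ε := by
      have h1 : dist (x, t) z₀ < ε := hx
      rw [Prod.dist_eq] at h1
      rw [← dist_eq_norm]
      exact (le_max_left _ _).trans h1.le
    have h2 : |ℓ x - ℓ z₀.1| ≤ B := by
      rw [hB, hℓ, ← Finset.sum_sub_distrib, Finset.sum_mul]
      refine (Finset.abs_sum_le_sum_abs _ _).trans (Finset.sum_le_sum fun j _ => ?_)
      rw [← mul_sub, abs_mul]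
      exact mul_le_mul_of_nonneg_left ((norm_le_pi_norm (x - z₀.1) j).trans hx0) (abs_nonneg _)
    have a0 := abs_le.1 (h01 0)
    have a1 := abs_le.1 (h01 1)
    have a2 := abs_le.1 h2
    constructor <;> intro a <;> fin_cases a <;> simp [hF] <;> linarith
  refine (mul_le_mul_right (measure_mono hsub) _).trans ?_
  rw [Real.volume_Icc_pi, Fin.prod_univ_three, ← ENNReal.ofReal_mul (by simp; linarith),
    ← ENNReal.ofReal_mul (by simp; positivity), ← ENNReal.ofReal_mul (by positivity)]
  refine ENNReal.ofReal_le_ofReal (le_of_eq ?_)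
  simp
  ring

theorem IsModel.exists_tube_bound (hM : IsModel S Kx Kt O κ) :
    ∃ C ≥ 0, ∀ t ∈ Kt, ∀ (w : Fin 2 → ℝ) (r : ℝ), 0 ≤ r →
      volume {x | x ∈ Kx ∧ ‖S (x, t) - w‖ ≤ r} ≤ ENNReal.ofReal (C * r ^ 2) := by
  have key : ∃ C ≥ 0, ∀ (t : ℝ) (w : Fin 2 → ℝ) (r : ℝ), 0 ≤ r →
      volume {x | (x, t) ∈ Kx ×ˢ Kt ∧ ‖S (x, t) - w‖ ≤ r} ≤ ENNReal.ofReal (C * r ^ 2) := by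
    refine (hM.compact_x.prod hM.compact_t).induction_on
      (p := fun s => ∃ C ≥ 0, ∀ (t : ℝ) (w : Fin 2 → ℝ) (r : ℝ), 0 ≤ r →
        volume {x | (x, t) ∈ s ∧ ‖S (x, t) - w‖ ≤ r} ≤ ENNReal.ofReal (C * r ^ 2)) ?_ ?_ ?_ ?_
    · exact ⟨0, le_rfl, by simp⟩
    · rintro s s' hs ⟨C, hC, h⟩
      refine ⟨C, hC, fun t w r hr => le_trans (measure_mono ?_) (h t w r hr)⟩
      exact fun x hx => ⟨hs hx.1, hx.2⟩
    · rintro s s' ⟨C, hC, h⟩ ⟨C', hC', h'⟩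
      refine ⟨C + C', add_nonneg hC hC', fun t w r hr => ?_⟩
      rw [add_mul, ENNReal.ofReal_add (by positivity) (by positivity)]
      refine (measure_mono ?_).trans ((measure_union_le _ _).trans
        (add_le_add (h t w r hr) (h' t w r hr)))
      rintro x ⟨hx | hx, hx'⟩
      · exact Or.inl ⟨hx, hx'⟩
      · exact Or.inr ⟨hx, hx'⟩
    · intro z hz
      obtain ⟨ε, hε, C, hC, h⟩ := exists_local_tube_bound hM.smooth
        (hM.geometry z (hM.subset hz)).nrm_ne_zero
      exact ⟨_, mem_nhdsWithin_of_mem_nhds (Metric.ball_mem_nhds z hε), C, hC, h⟩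
  obtain ⟨C, hC, h⟩ := key
  refine ⟨C, hC, fun t ht w r hr => le_trans (measure_mono ?_) (h t w r hr)⟩
  exact fun x hx => ⟨⟨hx.1, ht⟩, hx.2⟩

end Tubes

end FoldBlowdown
end

noncomputable section

namespace FoldBlowdown

/-! ### Kernel estimates -/

/-- The gradient in `x` of the curvature `θ · Δ`. -/
def curvGrad (S : (Fin 3 → ℝ) × ℝ → (Fin 2 → ℝ)) (θ : Fin 2 → ℝ) (z : (Fin 3 → ℝ) × ℝ)
    (j : Fin 3) : ℝ :=
  θ 0 * fderiv ℝ (Delta S 0) z (Pi.single j 1, 0) + θ 1 * fderiv ℝ (Delta S 1) z (Pi.single j 1, 0)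

/-- The difference `θ' · S(x, t') - θ · S(x, t)`. -/
def phaseDiff (S : (Fin 3 → ℝ) × ℝ → (Fin 2 → ℝ)) (z z' : (Fin 2 → ℝ) × ℝ)
    (x : Fin 3 → ℝ) : ℝ :=
  (z'.1 0 * S (x, z'.2) 0 + z'.1 1 * S (x, z'.2) 1) - (z.1 0 * S (x, z.2) 0 + z.1 1 * S (x, z.2) 1)

/-- The parameters on which the kernels depend. -/
abbrev KernelParam : Type :=
  ((Fin 2 → ℝ) × ℝ) × ((Fin 2 → ℝ) × ℝ) × ((Fin 2 → ℝ) × ℝ) × ℝ × ℝ × ℝ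

/-- The space of the point `x`, the rescaled curvatures, the rescaled tube coordinate, and the
parameters. -/
abbrev KernelCoord : Type := ((Fin 3 → ℝ) × ℝ × ℝ × (Fin 2 → ℝ)) × KernelParam

/-- The point of `KernelCoord` belonging to `x`. -/
def kernelCoord (S : (Fin 3 → ℝ) × ℝ → (Fin 2 → ℝ)) (h e : ℝ) (z z' : (Fin 2 → ℝ) × ℝ) (tI : ℝ)
    (w : Fin 2 → ℝ) (p : KernelParam) (x : Fin 3 → ℝ) : KernelCoord :=
  ((x, h⁻¹ * curv S z.1 (x, z.2), h⁻¹ * curv S z'.1 (x, z'.2), e • (S (x, tI) - w)), p)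

/-- The amplitude of the kernel as a function on `KernelCoord`. -/
def kernelAmplitude (χ : (Fin 3 → ℝ) → ℝ) (η : ℝ → ℝ) (ψ : (Fin 2 → ℝ) → ℝ)
    (y : KernelCoord) : ℝ :=
  χ y.1.1 ^ 2 * (η y.1.2.1 * η y.1.2.2.1) * ψ y.1.2.2.2 ^ 2

/-- The amplitude of the kernel as a function of `x`. -/
def amplitude (S : (Fin 3 → ℝ) × ℝ → (Fin 2 → ℝ)) (χ : (Fin 3 → ℝ) → ℝ) (η : ℝ → ℝ)
    (ψ : (Fin 2 → ℝ) → ℝ) (h e : ℝ) (z z' : (Fin 2 → ℝ) × ℝ) (tI : ℝ) (w : Fin 2 → ℝ)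
    (x : Fin 3 → ℝ) : ℝ :=
  χ x ^ 2 * (η (h⁻¹ * curv S z.1 (x, z.2)) * η (h⁻¹ * curv S z'.1 (x, z'.2))) *
    ψ (e • (S (x, tI) - w)) ^ 2

/-- A closed set which contains the support of the amplitude. -/
def cutRegion (S : (Fin 3 → ℝ) × ℝ → (Fin 2 → ℝ)) (Kx : Set (Fin 3 → ℝ)) (η : ℝ → ℝ)
    (ψ : (Fin 2 → ℝ) → ℝ) (h e : ℝ) (z z' : (Fin 2 → ℝ) × ℝ) (tI : ℝ) (w : Fin 2 → ℝ) :
    Set (Fin 3 → ℝ) :=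
  {x | x ∈ Kx ∧ h⁻¹ * curv S z.1 (x, z.2) ∈ tsupport η ∧
    h⁻¹ * curv S z'.1 (x, z'.2) ∈ tsupport η ∧ e • (S (x, tI) - w) ∈ tsupport ψ}

/-- The oscillatory integral in `x`. -/
def oscIntegral (S : (Fin 3 → ℝ) × ℝ → (Fin 2 → ℝ)) (χ : (Fin 3 → ℝ) → ℝ) (η : ℝ → ℝ)
    (ψ : (Fin 2 → ℝ) → ℝ) (lam h e : ℝ) (z z' : (Fin 2 → ℝ) × ℝ) (tI : ℝ) (w : Fin 2 → ℝ) : ℂ :=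
  ∫ x, Complex.exp (Complex.I * ((lam * phaseDiff S z z' x : ℝ) : ℂ)) *
    (amplitude S χ η ψ h e z z' tI w x : ℂ)

section Derivatives

variable {S : (Fin 3 → ℝ) × ℝ → (Fin 2 → ℝ)}

theorem hasFDerivAt_slice {G : Type} [NormedAddCommGroup G] [NormedSpace ℝ G]
    {g : (Fin 3 → ℝ) × ℝ → G} (hg : ContDiff ℝ ∞ g) (x : Fin 3 → ℝ) (t : ℝ) :
    HasFDerivAt (fun x => g (x, t))
      ((fderiv ℝ g (x, t)).comp (ContinuousLinearMap.inl ℝ (Fin 3 → ℝ) ℝ)) x :=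
  ((hg.differentiable (by simp)) (x, t)).hasFDerivAt.comp x (hasFDerivAt_prodMk_left x t)

theorem contDiff_curv (hS : ContDiff ℝ ∞ S) (θ : Fin 2 → ℝ) : ContDiff ℝ ∞ (curv S θ) :=
  (contDiff_const.mul (contDiff_Delta hS 0)).add (contDiff_const.mul (contDiff_Delta hS 1))

theorem fderiv_curv_slice (hS : ContDiff ℝ ∞ S) (θ : Fin 2 → ℝ) (t : ℝ) (x v : Fin 3 → ℝ) :
    fderiv ℝ (curv S θ) (x, t) (v, 0) = ∑ j, v j * curvGrad S θ (x, t) j := by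
  have h0 := ((contDiff_Delta hS 0).differentiable (by simp) (x, t)).hasFDerivAt
  have h1 := ((contDiff_Delta hS 1).differentiable (by simp) (x, t)).hasFDerivAt
  have h : HasFDerivAt (curv S θ) _ (x, t) := (h0.const_mul (θ 0)).add (h1.const_mul (θ 1))
  rw [h.fderiv]
  simp only [add_apply, smul_apply, smul_eq_mul]
  rw [clm_apply_prod (fderiv ℝ (Delta S 0) (x, t)), clm_apply_prod (fderiv ℝ (Delta S 1) (x, t))]
  simp only [curvGrad, Fin.sum_univ_three, zero_mul, add_zero]
  ring

theorem contDiff_kernelCoord (hS : ContDiff ℝ ∞ S) (h e : ℝ) (z z' : (Fin 2 → ℝ) × ℝ) (tI : ℝ)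
    (w : Fin 2 → ℝ) (p : KernelParam) : ContDiff ℝ ∞ (kernelCoord S h e z z' tI w p) := by
  have h1 : ∀ t : ℝ, ContDiff ℝ ∞ fun x : Fin 3 → ℝ => (x, t) := fun t => by fun_prop
  have h2 : ∀ (θ : Fin 2 → ℝ) (t : ℝ), ContDiff ℝ ∞ fun x : Fin 3 → ℝ => h⁻¹ * curv S θ (x, t) :=
    fun θ t => contDiff_const.mul ((contDiff_curv hS θ).comp (h1 t))
  have h3 : ContDiff ℝ ∞ fun x : Fin 3 → ℝ => S (x, tI) := hS.comp (h1 tI)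
  have h4 : ContDiff ℝ ∞ fun x : Fin 3 → ℝ => e • (S (x, tI) - w) :=
    (h3.sub contDiff_const).const_smul e
  exact (contDiff_id.prodMk ((h2 z.1 z.2).prodMk ((h2 z'.1 z'.2).prodMk h4))).prodMk contDiff_const

theorem fderiv_kernelCoord (hS : ContDiff ℝ ∞ S) (h e : ℝ) (z z' : (Fin 2 → ℝ) × ℝ) (tI : ℝ)
    (w : Fin 2 → ℝ) (p : KernelParam) (x v : Fin 3 → ℝ) :
    fderiv ℝ (kernelCoord S h e z z' tI w p) x v =
      ((v, h⁻¹ * ∑ j, v j * curvGrad S z.1 (x, z.2) j,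
        h⁻¹ * ∑ j, v j * curvGrad S z'.1 (x, z'.2) j,
        fun i => e * ∑ j, v j * dx S i j (x, tI)), 0) := by
  have hd : HasFDerivAt (kernelCoord S h e z z' tI w p) _ x :=
    ((hasFDerivAt_id x).prodMk
      (((hasFDerivAt_slice (contDiff_curv hS z.1) x z.2).const_mul h⁻¹).prodMk
      (((hasFDerivAt_slice (contDiff_curv hS z'.1) x z'.2).const_mul h⁻¹).prodMk
      (((hasFDerivAt_slice hS x tI).sub_const w).const_smul e)))).prodMk (hasFDerivAt_const p x)
  rw [hd.fderiv]
  refine Prod.ext (Prod.ext rfl (Prod.ext ?_ (Prod.ext ?_ ?_))) rfl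
  · simp [fderiv_curv_slice hS]
  · simp [fderiv_curv_slice hS]
  · ext i
    have h1 : fderiv ℝ S (x, tI) (v, 0) i = ∑ j, v j * dx S i j (x, tI) := by
      have h2 : fderiv ℝ (fun z => S z i) (x, tI) (v, 0) = fderiv ℝ S (x, tI) (v, 0) i := by
        rw [fderiv_apply ((hS.differentiable (by simp)) _)]
        rfl
      rw [← h2, clm_apply_prod, zero_mul, add_zero]
      rfl
    simp [h1]

theorem contDiff_phaseDiff (hS : ContDiff ℝ ∞ S) (z z' : (Fin 2 → ℝ) × ℝ) :
    ContDiff ℝ ∞ (phaseDiff S z z') := by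
  have h1 : ∀ (i : Fin 2) (t : ℝ), ContDiff ℝ ∞ fun x : Fin 3 → ℝ => S (x, t) i := fun i t =>
    (contDiff_component hS i).comp (by fun_prop)
  exact ((contDiff_const.mul (h1 0 _)).add (contDiff_const.mul (h1 1 _))).sub
    ((contDiff_const.mul (h1 0 _)).add (contDiff_const.mul (h1 1 _)))

theorem fderiv_phaseDiff (hS : ContDiff ℝ ∞ S) (lam : ℝ) (z z' : (Fin 2 → ℝ) × ℝ)
    (x v : Fin 3 → ℝ) : fderiv ℝ (fun x => lam * phaseDiff S z z' x) x v =
      lam * ∑ j, v j * (phaseGrad S z'.1 (x, z'.2) j - phaseGrad S z.1 (x, z.2) j) := by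
  have h1 := fun (i : Fin 2) (t : ℝ) => hasFDerivAt_slice (contDiff_component hS i) x t
  have h2 : ∀ (i : Fin 2) (t : ℝ), fderiv ℝ (fun w => S w i) (x, t) (v, 0) =
      ∑ j, v j * dx S i j (x, t) := fun i t => by
    rw [clm_apply_prod, zero_mul, add_zero]
    rfl
  have hd : HasFDerivAt (fun x => lam * phaseDiff S z z' x) _ x :=
    ((((h1 0 z'.2).const_mul (z'.1 0)).add ((h1 1 z'.2).const_mul (z'.1 1))).sub
      (((h1 0 z.2).const_mul (z.1 0)).add ((h1 1 z.2).const_mul (z.1 1)))).const_mul lam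
  rw [hd.fderiv]
  simp only [smul_apply, sub_apply, add_apply,
    ContinuousLinearMap.comp_apply, ContinuousLinearMap.inl_apply, smul_eq_mul, h2, phaseGrad,
    Fin.sum_univ_three]
  ring

theorem isCompact_cutRegion {Kx : Set (Fin 3 → ℝ)} (hK : IsCompact Kx) (hS : ContDiff ℝ ∞ S)
    (η : ℝ → ℝ) (ψ : (Fin 2 → ℝ) → ℝ) (h e : ℝ) (z z' : (Fin 2 → ℝ) × ℝ) (tI : ℝ)
    (w : Fin 2 → ℝ) : IsCompact (cutRegion S Kx η ψ h e z z' tI w) := by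
  have hc := (contDiff_kernelCoord hS h e z z' tI w 0).continuous
  have h1 : Continuous fun x => h⁻¹ * curv S z.1 (x, z.2) := hc.fst.snd.fst
  have h2 : Continuous fun x => h⁻¹ * curv S z'.1 (x, z'.2) := hc.fst.snd.snd.fst
  have h3 : Continuous fun x => e • (S (x, tI) - w) := hc.fst.snd.snd.snd
  exact hK.inter_right (((isClosed_tsupport η).preimage h1).inter
    (((isClosed_tsupport η).preimage h2).inter ((isClosed_tsupport ψ).preimage h3)))

theorem amplitude_eq_zero {Kx : Set (Fin 3 → ℝ)} {χ : (Fin 3 → ℝ) → ℝ} (hχ : tsupport χ ⊆ Kx)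
    (η : ℝ → ℝ) (ψ : (Fin 2 → ℝ) → ℝ) (h e : ℝ) (z z' : (Fin 2 → ℝ) × ℝ) (tI : ℝ)
    (w : Fin 2 → ℝ) {x : Fin 3 → ℝ} (hx : x ∉ cutRegion S Kx η ψ h e z z' tI w) :
    amplitude S χ η ψ h e z z' tI w x = 0 := by
  by_contra h0
  simp only [amplitude, mul_eq_zero, not_or, pow_eq_zero_iff two_ne_zero] at h0
  exact hx ⟨hχ (subset_tsupport _ h0.1.1), subset_tsupport _ h0.1.2.1,
    subset_tsupport _ h0.1.2.2, subset_tsupport _ h0.2⟩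

theorem contDiff_kernelAmplitude {χ : (Fin 3 → ℝ) → ℝ} {η : ℝ → ℝ} {ψ : (Fin 2 → ℝ) → ℝ}
    (hχ : ContDiff ℝ ∞ χ) (hη : ContDiff ℝ ∞ η) (hψ : ContDiff ℝ ∞ ψ) :
    ContDiff ℝ ∞ (kernelAmplitude χ η ψ) :=
  (((hχ.comp (by fun_prop)).pow 2).mul ((hη.comp (by fun_prop)).mul
    (hη.comp (by fun_prop)))).mul ((hψ.comp (by fun_prop)).pow 2)

end Derivatives

section Bounds

variable {S : (Fin 3 → ℝ) × ℝ → (Fin 2 → ℝ)} {Kx : Set (Fin 3 → ℝ)} {Kt : Set ℝ}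
  {O : Set ((Fin 3 → ℝ) × ℝ)} {κ : (Fin 3 → ℝ) × ℝ → ℝ}
  {χ : (Fin 3 → ℝ) → ℝ} {η : ℝ → ℝ} {ψ : (Fin 2 → ℝ) → ℝ}

theorem contDiff_curvGrad (hS : ContDiff ℝ ∞ S) (j : Fin 3) :
    ContDiff ℝ ∞ fun y : (Fin 2 → ℝ) × ((Fin 3 → ℝ) × ℝ) => curvGrad S y.1 y.2 j := by
  have h : ∀ i, ContDiff ℝ ∞ fun y : (Fin 2 → ℝ) × ((Fin 3 → ℝ) × ℝ) =>
      fderiv ℝ (Delta S i) y.2 (Pi.single j 1, 0) := fun i =>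
    (((contDiff_Delta hS i).fderiv_right (m := ∞) (by simp)).comp contDiff_snd).clm_apply
      contDiff_const
  have h0 := h 0
  have h1 := h 1
  simp only [curvGrad]
  fun_prop

/-- The field is h times the x-gradient of the phase difference divided by λ|z' - z|. The factor h
absorbs the h^{-1} from the curvature cutoffs, and e·h ≤ 1 absorbs the derivative of the tube
cutoff. Its action on the phase is λh|z' - z| times a squared length bounded below. -/
theorem IsModel.exists_gradient_phase_bound (hM : IsModel S Kx Kt O κ) (hχ : ContDiff ℝ ∞ χ)
    (hχK : tsupport χ ⊆ Kx) (hη : ContDiff ℝ ∞ η) (hηc : HasCompactSupport η)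
    (hψ : ContDiff ℝ ∞ ψ) (hψc : HasCompactSupport ψ) (T : ℝ) {c : ℝ} (hc : 0 < c) (N : ℕ) :
    ∃ C ≥ 0, ∀ (lam h e : ℝ) (z z' : (Fin 2 → ℝ) × ℝ) (tI : ℝ) (w : Fin 2 → ℝ),
      0 < lam → 0 < h → h ≤ 1 → 0 ≤ e → e * h ≤ 1 → z ∈ freqAnnulus ×ˢ Kt →
      z' ∈ freqAnnulus ×ˢ Kt → |tI| ≤ T → 0 < ‖z' - z‖ →
      (∀ x ∈ cutRegion S Kx η ψ h e z z' tI w, c * ‖z' - z‖ ≤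
        ‖phaseGrad S z'.1 (x, z'.2) - phaseGrad S z.1 (x, z.2)‖) →
      ‖oscIntegral S χ η ψ lam h e z z' tI w‖ ≤
        C * (lam * h * ‖z' - z‖)⁻¹ ^ N *
          volume.real (cutRegion S Kx η ψ h e z z' tI w) := by
  have hS := hM.smooth
  choose H hH hHd _ using fun i j => exists_smooth_dividedDifference (contDiff_dx hS i j)
  -- the normalized gradient of the phase, as a function of `x` and the parameters
  set g : Fin 3 → (Fin 3 → ℝ) × KernelParam → ℝ := fun j y =>
    (y.2.2.2.1.1 0 * dx S 0 j (y.1, y.2.1.2) + y.2.2.2.1.1 1 * dx S 1 j (y.1, y.2.1.2)) +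
      y.2.2.2.1.2 * (y.2.2.1.1 0 * H 0 j (y.1, y.2.1.2, y.2.2.1.2) +
        y.2.2.1.1 1 * H 1 j (y.1, y.2.1.2, y.2.2.1.2)) with hg
  have hgs : ∀ j, ContDiff ℝ ∞ (g j) := by
    intro j
    have h1 : ∀ i, ContDiff ℝ ∞ fun y : (Fin 3 → ℝ) × KernelParam => dx S i j (y.1, y.2.1.2) :=
      fun i => (contDiff_dx hS i j).comp (by fun_prop)
    have h2 : ∀ i, ContDiff ℝ ∞ fun y : (Fin 3 → ℝ) × KernelParam =>
      H i j (y.1, y.2.1.2, y.2.2.1.2) := fun i => (hH i j).comp (by fun_prop)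
    have a0 := h1 0
    have a1 := h1 1
    have b0 := h2 0
    have b1 := h2 1
    simp only [hg]
    fun_prop
  set q : KernelCoord → (Fin 3 → ℝ) × KernelParam := fun y => (y.1.1, y.2) with hq
  have hqs : ContDiff ℝ ∞ q := by simp only [hq]; fun_prop
  have hgq : ∀ j, ContDiff ℝ ∞ fun y => g j (q y) := fun j => (hgs j).comp hqs
  set V : KernelCoord → KernelCoord := fun y =>
    ((fun j => y.2.2.2.2.2.1 * g j (q y),
      ∑ j, g j (q y) * curvGrad S y.2.1.1 (y.1.1, y.2.1.2) j,
      ∑ j, g j (q y) * curvGrad S y.2.2.1.1 (y.1.1, y.2.2.1.2) j,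
      fun i => y.2.2.2.2.2.2 * ∑ j, g j (q y) * dx S i j (y.1.1, y.2.2.2.2.1)), 0) with hV
  have hVs : ContDiff ℝ ∞ V := by
    refine ContDiff.prodMk (ContDiff.prodMk ?_ (ContDiff.prodMk ?_ (ContDiff.prodMk ?_ ?_)))
      contDiff_const
    · exact contDiff_pi.2 fun j => ContDiff.mul (by fun_prop) (hgq j)
    · exact ContDiff.sum fun j _ => (hgq j).mul ((contDiff_curvGrad hS j).comp
        (by fun_prop : ContDiff ℝ ∞ fun y : KernelCoord => (y.2.1.1, (y.1.1, y.2.1.2))))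
    · exact ContDiff.sum fun j _ => (hgq j).mul ((contDiff_curvGrad hS j).comp
        (by fun_prop : ContDiff ℝ ∞ fun y : KernelCoord => (y.2.2.1.1, (y.1.1, y.2.2.1.2))))
    · exact contDiff_pi.2 fun i => ContDiff.mul (by fun_prop) (ContDiff.sum fun j _ =>
        (hgq j).mul ((contDiff_dx hS i j).comp
          (by fun_prop : ContDiff ℝ ∞ fun y : KernelCoord => (y.1.1, y.2.2.2.2.1))))
  set d : KernelCoord → ℝ := fun y =>
    y.2.2.2.2.2.1 * ∑ j, fderiv ℝ (g j) (q y) (Pi.single j 1, 0) with hd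
  have hds : ContDiff ℝ ∞ d := ContDiff.mul (by fun_prop) (ContDiff.sum fun j _ =>
    (((hgs j).fderiv_right (m := ∞) (by simp)).comp hqs).clm_apply contDiff_const)
  set f : KernelCoord → ℝ := fun y => ∑ j, g j (q y) ^ 2 with hf
  have hfs : ContDiff ℝ ∞ f := ContDiff.sum fun j _ => (hgq j).pow 2
  have hK : IsCompact ((Kx ×ˢ tsupport η ×ˢ tsupport η ×ˢ tsupport ψ) ×ˢ
      ((freqAnnulus ×ˢ Kt) ×ˢ (freqAnnulus ×ˢ Kt) ×ˢ
        (Metric.closedBall (0 : (Fin 2 → ℝ) × ℝ) 1) ×ˢ (Set.Icc (-T) T) ×ˢ (Set.Icc (0 : ℝ) 1) ×ˢ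
          (Set.Icc (0 : ℝ) 1))) :=
    (hM.compact_x.prod (hηc.isCompact.prod (hηc.isCompact.prod hψc.isCompact))).prod
      ((isCompact_freqAnnulus.prod hM.compact_t).prod
        ((isCompact_freqAnnulus.prod hM.compact_t).prod
          ((isCompact_closedBall _ _).prod (isCompact_Icc.prod (isCompact_Icc.prod isCompact_Icc)))))
  obtain ⟨C, hC0, hC⟩ := exists_nonstationary_bound (d := 3) hVs hds hfs (pow_pos hc 2) hK N
    (contDiff_kernelAmplitude hχ hη hψ)
  refine ⟨C, hC0, ?_⟩
  intro lam h e z z' tI w hlam hh hh1 he heh hz hz' htI hr hlow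
  set r := ‖z' - z‖ with hrdef
  -- The unit direction of z' - z is an independent parameter: by divided differences the gradient
  -- over |z' - z| is smooth in it, with no singularity as z' → z.
  set p : KernelParam := (z, z', r⁻¹ • (z' - z), tI, h, e * h) with hp
  have hgval : ∀ x j, g j (x, p) =
      r⁻¹ * (phaseGrad S z'.1 (x, z'.2) j - phaseGrad S z.1 (x, z.2) j) := by
    intro x j
    have e0 := hHd 0 j x z.2 z'.2
    have e1 := hHd 1 j x z.2 z'.2
    simp only [smul_eq_mul] at e0 e1
    simp only [hg, hp, phaseGrad, Prod.smul_fst, Prod.smul_snd, Pi.smul_apply, Prod.fst_sub,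
      Prod.snd_sub, Pi.sub_apply, smul_eq_mul]
    linear_combination (-r⁻¹ * z'.1 0) * e0 + (-r⁻¹ * z'.1 1) * e1
  have hqY : ∀ x, q (kernelCoord S h e z z' tI w p x) = (x, p) := fun x => rfl
  set X : (Fin 3 → ℝ) → (Fin 3 → ℝ) := fun x j => h * g j (x, p) with hX
  have hXs : ContDiff ℝ ∞ X := contDiff_pi.2 fun j => contDiff_const.mul
    ((hgs j).comp (by fun_prop : ContDiff ℝ ∞ fun x : Fin 3 → ℝ => (x, p)))
  have hLam : lam * h * r ≠ 0 := by positivity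
  have main := hC (lam * h * r) (fun x => lam * phaseDiff S z z' x)
    (amplitude S χ η ψ h e z z' tI w) X (kernelCoord S h e z z' tI w p) Set.univ
    (cutRegion S Kx η ψ h e z z' tI w) hLam (contDiff_const.mul (contDiff_phaseDiff hS z z')) hXs
    (contDiff_kernelCoord hS h e z z' tI w p) isOpen_univ
    (isCompact_cutRegion hM.compact_x hS η ψ h e z z' tI w) (Set.subset_univ _)
    (fun x _ => rfl) (fun x hx => amplitude_eq_zero hχK η ψ h e z z' tI w hx) ?_ ?_ ?_ ?_ ?_
  · rwa [abs_of_pos (by positivity)] at main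
  · intro x _
    rw [fderiv_kernelCoord hS]
    refine Prod.ext (Prod.ext rfl (Prod.ext ?_ (Prod.ext ?_ ?_))) rfl
    · simp only [hV, hX, hqY]
      simp only [kernelCoord, hp]
      rw [Finset.mul_sum]
      refine Finset.sum_congr rfl fun j _ => ?_
      field_simp
    · simp only [hV, hX, hqY]
      simp only [kernelCoord, hp]
      rw [Finset.mul_sum]
      refine Finset.sum_congr rfl fun j _ => ?_
      field_simp
    · ext i
      simp only [hV, hX, hqY]
      simp only [kernelCoord, hp]
      rw [Finset.mul_sum, Finset.mul_sum]
      refine Finset.sum_congr rfl fun j _ => ?_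
      ring
  · intro x _
    simp only [divergence, hd, hqY]
    rw [Finset.mul_sum]
    refine Finset.sum_congr rfl fun j _ => ?_
    have h1 : HasFDerivAt (fun x : Fin 3 → ℝ => h * g j (x, p))
        (h • (fderiv ℝ (g j) (x, p)).comp (ContinuousLinearMap.inl ℝ (Fin 3 → ℝ) KernelParam)) x := by
      have h0 : HasFDerivAt (fun x : Fin 3 → ℝ => g j (x, p))
          ((fderiv ℝ (g j) (x, p)).comp (ContinuousLinearMap.inl ℝ (Fin 3 → ℝ) KernelParam)) x :=
        HasFDerivAt.comp (g := g j) x ((hgs j).differentiable (by simp) (x, p)).hasFDerivAt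
          (hasFDerivAt_prodMk_left x p)
      exact h0.const_mul h
    have h2 : fderiv ℝ X x (Pi.single j 1) j = fderiv ℝ (fun x => X x j) x (Pi.single j 1) := by
      rw [fderiv_apply ((hXs.differentiable (by simp)) x)]
      rfl
    rw [h2]
    simp only [hX]
    rw [h1.fderiv]
    rfl
  · intro x _
    rw [fderiv_phaseDiff hS]
    simp only [hf, hqY, hX]
    rw [Finset.mul_sum, Finset.mul_sum]
    refine Finset.sum_congr rfl fun j _ => ?_
    rw [hgval x j]
    field_simp
  · intro x hx
    refine ⟨⟨hx.1, hx.2.1, hx.2.2.1, hx.2.2.2⟩, hz, hz', ?_, abs_le.1 htI,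
      ⟨hh.le, hh1⟩, ⟨mul_nonneg he hh.le, heh⟩⟩
    simp only [kernelCoord, hp, mem_closedBall_zero_iff, norm_smul, norm_inv, norm_norm, hrdef]
    rw [inv_mul_cancel₀ hr.ne']
  · intro x hx
    have h1 := hlow x hx
    set D := phaseGrad S z'.1 (x, z'.2) - phaseGrad S z.1 (x, z.2) with hD
    have h2 : ∃ j, ‖D‖ = |D j| := by
      obtain ⟨j, -, hj⟩ := Finset.exists_mem_eq_sup (Finset.univ : Finset (Fin 3))
        Finset.univ_nonempty fun j => ‖D j‖₊
      refine ⟨j, ?_⟩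
      rw [Pi.norm_def, hj]
      rfl
    obtain ⟨j, hj⟩ := h2
    have h3 : c ≤ |g j (x, p)| := by
      rw [hgval x j, abs_mul, abs_inv, abs_of_pos hr, ← Pi.sub_apply, ← hD, ← hj,
        le_inv_mul_iff₀ hr, mul_comm]
      exact h1
    simp only [hf, hqY]
    have h4 : c ^ 2 ≤ g j (x, p) ^ 2 := by
      rw [← sq_abs (g j (x, p))]
      exact pow_le_pow_left₀ hc.le h3 2
    exact (h4.trans (Finset.single_le_sum (f := fun j => g j (x, p) ^ 2)
      (fun j _ => sq_nonneg _) (Finset.mem_univ j))).trans (le_abs_self _)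

end Bounds

end FoldBlowdown
end

/-! ### Integration by parts along the kernel direction of S_x. -/

noncomputable section

namespace FoldBlowdown

section Transport

variable {S : (Fin 3 → ℝ) × ℝ → (Fin 2 → ℝ)} {Kx : Set (Fin 3 → ℝ)} {Kt : Set ℝ}
  {O : Set ((Fin 3 → ℝ) × ℝ)} {κ : (Fin 3 → ℝ) × ℝ → ℝ}
  {χ : (Fin 3 → ℝ) → ℝ} {η : ℝ → ℝ} {ψ : (Fin 2 → ℝ) → ℝ}

/-- Differentiation along the field `nrm S (·, t)`: the phase difference has the derivative
`(t' - t) (θ' · Δ(x, t') + (t' - t) E)`. -/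
theorem exists_phase_remainder (hS : ContDiff ℝ ∞ S) :
    ∃ E : Fin 2 → ((Fin 3 → ℝ) × ℝ × ℝ) → ℝ, (∀ i, ContDiff ℝ ∞ (E i)) ∧
      ∀ (θ' θ : Fin 2 → ℝ) (x : Fin 3 → ℝ) (t t' : ℝ),
        ∑ j, nrm S (x, t) j * (phaseGrad S θ' (x, t') j - phaseGrad S θ (x, t) j) =
          (t' - t) * (curv S θ' (x, t') + (t' - t) * ∑ i, θ' i * E i (x, t, t')) := by
  choose H hH hHd hH0 using fun i j => exists_smooth_dividedDifference (contDiff_dx hS i j)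
  choose D hD hDd _ using fun i => exists_smooth_dividedDifference (contDiff_Delta hS i)
  -- Since n(x,t) annihilates S^i_x(x,t), its pairing with S^i_x(x,t') is divisible by t' - t; this
  -- is the quotient, equal to Δ^i on the diagonal.
  set P : Fin 2 → ((Fin 3 → ℝ) × ℝ) × ℝ → ℝ := fun i y =>
    ∑ j, nrm S y.1 j * H i j (y.1.1, y.1.2, y.2) with hP
  have hPs : ∀ i, ContDiff ℝ ∞ (P i) := fun i => ContDiff.sum fun j _ =>
    ((contDiff_pi.1 (contDiff_nrm hS) j).comp contDiff_fst).mul ((hH i j).comp (by fun_prop))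
  choose Q hQ hQd _ using fun i => exists_smooth_dividedDifference (hPs i)
  refine ⟨fun i y => Q i ((y.1, y.2.1), y.2.1, y.2.2) - D i y, fun i =>
    ((hQ i).comp (by fun_prop)).sub (hD i), fun θ' θ x t t' => ?_⟩
  have hdiag : ∀ i, P i ((x, t), t) = Delta S i (x, t) := fun i => by
    rw [Delta_eq_sum]
    refine Finset.sum_congr rfl fun j _ => ?_
    rw [hH0, dxdy]
  have hn : ∀ i, ∑ j, nrm S (x, t) j * dx S i j (x, t') = (t' - t) * P i ((x, t), t') := by
    intro i
    have h0 := sum_nrm_mul_dx S i (x, t)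
    have : ∑ j, nrm S (x, t) j * dx S i j (x, t') =
        ∑ j, nrm S (x, t) j * dx S i j (x, t) + (t' - t) * P i ((x, t), t') := by
      simp only [hP]
      rw [Finset.mul_sum, ← Finset.sum_add_distrib]
      refine Finset.sum_congr rfl fun j _ => ?_
      have := hHd i j x t t'
      rw [smul_eq_mul] at this
      linear_combination nrm S (x, t) j * this
    rw [this, h0, zero_add]
  -- Both the quotient and Δ^i are expanded from t to t', so that the main term is the curvature at
  -- t', where the cutoff η controls it.
  have hE : ∀ i, P i ((x, t), t') = Delta S i (x, t') +
      (t' - t) * (Q i ((x, t), t, t') - D i (x, t, t')) := by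
    intro i
    have h1 := hQd i (x, t) t t'
    have h2 := hDd i x t t'
    rw [smul_eq_mul] at h1 h2
    rw [hdiag] at h1
    linear_combination h1 - h2
  have e0 := hn 0
  have e1 := hn 1
  have z0 := sum_nrm_mul_dx S 0 (x, t)
  have z1 := sum_nrm_mul_dx S 1 (x, t)
  rw [hE] at e0 e1
  simp only [Fin.sum_univ_three] at e0 e1 z0 z1
  simp only [Fin.sum_univ_three, Fin.sum_univ_two, phaseGrad, curv]
  linear_combination θ' 0 * e0 + θ' 1 * e1 - θ 0 * z0 - θ 1 * z1

/-- Differentiation along n(x,t) with no factor h. The blowdown identity makes the derivative of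
h^{-1}θ·Δ a bounded multiple of itself; the mismatch between n at t and the curvature at t' costs
(t' - t)/h = O(1); the tube coordinate changes by e(t_I - t) = O(1). The phase derivative is λ(t' -
t)(θ'·Δ + O(t' - t)), and the curvature term dominates because |θ'·Δ| ≥ ch and |t' - t| ≤ δh. -/
theorem IsModel.exists_transport_phase_bound (hM : IsModel S Kx Kt O κ) (hχ : ContDiff ℝ ∞ χ)
    (hχK : tsupport χ ⊆ Kx) (hη : ContDiff ℝ ∞ η) (hηc : HasCompactSupport η)
    (hψ : ContDiff ℝ ∞ ψ) (hψc : HasCompactSupport ψ) (T : ℝ) {c : ℝ} (hc : 0 < c)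
    (hηc0 : ∀ v ∈ tsupport η, c ≤ |v|) (N : ℕ) :
    ∃ C ≥ 0, ∃ δ > 0, ∀ (lam h e : ℝ) (z z' : (Fin 2 → ℝ) × ℝ) (tI : ℝ) (w : Fin 2 → ℝ),
      0 < lam → 0 < h → h ≤ 1 → z ∈ freqAnnulus ×ˢ Kt → z' ∈ freqAnnulus ×ˢ Kt → |tI| ≤ T →
      |e * (tI - z.2)| ≤ 1 → z'.2 ≠ z.2 → |z'.2 - z.2| ≤ δ * h →
      ‖oscIntegral S χ η ψ lam h e z z' tI w‖ ≤
        C * (lam * h * |z'.2 - z.2|)⁻¹ ^ N *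
          volume.real (cutRegion S Kx η ψ h e z z' tI w) := by
  have hS := hM.smooth
  choose H hH hHd _ using fun i j => exists_smooth_dividedDifference (contDiff_dx hS i j)
  obtain ⟨Hn, hHn, hHnd, _⟩ := exists_smooth_dividedDifference (contDiff_nrm hS)
  obtain ⟨E, hE, hEd⟩ := exists_phase_remainder hS
  have hn : ∀ j, ContDiff ℝ ∞ fun z => nrm S z j := fun j => contDiff_pi.1 (contDiff_nrm hS) j
  -- bound for the remainder
  obtain ⟨B, hB⟩ : ∃ B, ∀ y ∈ freqAnnulus ×ˢ (Kx ×ˢ Kt ×ˢ Kt), ‖∑ i, y.1 i * E i y.2‖ ≤ B := by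
    refine IsCompact.exists_bound_of_continuousOn (f := fun y : (Fin 2 → ℝ) × _ =>
      ∑ i, y.1 i * E i y.2) (isCompact_freqAnnulus.prod
      (hM.compact_x.prod (hM.compact_t.prod hM.compact_t))) (Continuous.continuousOn ?_)
    exact continuous_finsetSum _ fun i _ => Continuous.mul (by fun_prop)
      ((hE i).continuous.comp (by fun_prop))
  set B' := max B 0 with hB'
  have hB'0 : 0 ≤ B' := le_max_right _ _
  set V : KernelCoord → KernelCoord := fun y =>
    ((fun j => nrm S (y.1.1, y.2.1.2) j,
      κ (y.1.1, y.2.1.2) * y.1.2.1,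
      κ (y.1.1, y.2.2.1.2) * y.1.2.2.1 - y.2.2.2.2.2.1 *
        ∑ j, Hn (y.1.1, y.2.1.2, y.2.2.1.2) j * curvGrad S y.2.2.1.1 (y.1.1, y.2.2.1.2) j,
      fun i => y.2.2.2.2.2.2 *
        ∑ j, nrm S (y.1.1, y.2.1.2) j * H i j (y.1.1, y.2.1.2, y.2.2.2.2.1)), 0) with hV
  have hny : ∀ j, ContDiff ℝ ∞ fun y : KernelCoord => nrm S (y.1.1, y.2.1.2) j := fun j =>
    (hn j).comp (by fun_prop : ContDiff ℝ ∞ fun y : KernelCoord => (y.1.1, y.2.1.2))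
  have hVs : ContDiff ℝ ∞ V := by
    refine ContDiff.prodMk (ContDiff.prodMk ?_ (ContDiff.prodMk ?_ (ContDiff.prodMk ?_ ?_)))
      contDiff_const
    · exact contDiff_pi.2 hny
    · exact (hM.smooth_kappa.comp (by fun_prop)).mul (by fun_prop)
    · refine ((hM.smooth_kappa.comp (by fun_prop)).mul (by fun_prop)).sub
        (ContDiff.mul (by fun_prop) (ContDiff.sum fun j _ => ContDiff.mul ?_
          ((contDiff_curvGrad hS j).comp
          (by fun_prop : ContDiff ℝ ∞ fun y : KernelCoord => (y.2.2.1.1, (y.1.1, y.2.2.1.2))))))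
      exact (contDiff_pi.1 hHn j).comp
        (by fun_prop : ContDiff ℝ ∞ fun y : KernelCoord => (y.1.1, y.2.1.2, y.2.2.1.2))
    · exact contDiff_pi.2 fun i => ContDiff.mul (by fun_prop) (ContDiff.sum fun j _ =>
        (hny j).mul ((hH i j).comp
          (by fun_prop : ContDiff ℝ ∞ fun y : KernelCoord => (y.1.1, y.2.1.2, y.2.2.2.2.1))))
  set d : KernelCoord → ℝ := fun y =>
    ∑ j, fderiv ℝ (fun z => nrm S z j) (y.1.1, y.2.1.2) (Pi.single j 1, 0) with hd
  have hds : ContDiff ℝ ∞ d := ContDiff.sum fun j _ =>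
    (((hn j).fderiv_right (m := ∞) (by simp)).comp
      (by fun_prop : ContDiff ℝ ∞ fun y : KernelCoord => (y.1.1, y.2.1.2))).clm_apply contDiff_const
  set f : KernelCoord → ℝ := fun y => y.1.2.2.1 + y.2.2.2.2.2.1 *
    ∑ i, y.2.2.1.1 i * E i (y.1.1, y.2.1.2, y.2.2.1.2) with hf
  have hfs : ContDiff ℝ ∞ f := ContDiff.add (by fun_prop) (ContDiff.mul (by fun_prop)
    (ContDiff.sum fun i _ => ContDiff.mul (by fun_prop) ((hE i).comp
      (by fun_prop : ContDiff ℝ ∞ fun y : KernelCoord => (y.1.1, y.2.1.2, y.2.2.1.2)))))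
  have hK : IsCompact ((Kx ×ˢ tsupport η ×ˢ tsupport η ×ˢ tsupport ψ) ×ˢ
      ((freqAnnulus ×ˢ Kt) ×ˢ (freqAnnulus ×ˢ Kt) ×ˢ
        ({0} : Set ((Fin 2 → ℝ) × ℝ)) ×ˢ (Set.Icc (-T) T) ×ˢ (Set.Icc (-1 : ℝ) 1) ×ˢ
          (Set.Icc (-1 : ℝ) 1))) :=
    (hM.compact_x.prod (hηc.isCompact.prod (hηc.isCompact.prod hψc.isCompact))).prod
      ((isCompact_freqAnnulus.prod hM.compact_t).prod
        ((isCompact_freqAnnulus.prod hM.compact_t).prod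
          (isCompact_singleton.prod (isCompact_Icc.prod (isCompact_Icc.prod isCompact_Icc)))))
  obtain ⟨C, hC0, hC⟩ := exists_nonstationary_bound (d := 3) hVs hds hfs (half_pos hc) hK N
    (contDiff_kernelAmplitude hχ hη hψ)
  -- With this δ the remainder is at most c/2 after division by h, half of the lower bound for the
  -- rescaled curvature.
  refine ⟨C, hC0, min 1 (c / (2 * (B' + 1))), lt_min one_pos (by positivity), ?_⟩
  intro lam h e z z' tI w hlam hh hh1 hz hz' htI hqI hne hs
  set s := z'.2 - z.2 with hsdef
  have hs0 : s ≠ 0 := sub_ne_zero.2 hne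
  have hq : |s / h| ≤ min 1 (c / (2 * (B' + 1))) := by
    rw [abs_div, abs_of_pos hh, div_le_iff₀ hh]
    exact hs
  -- The bounded ratios (t' - t)/h and e(t_I - t) are the parameters. The slot for the direction of
  -- z' - z plays no role here and is set to 0.
  set p : KernelParam := (z, z', 0, tI, s / h, e * (tI - z.2)) with hp
  set X : (Fin 3 → ℝ) → (Fin 3 → ℝ) := fun x => nrm S (x, z.2) with hX
  have hXs : ContDiff ℝ ∞ X := (contDiff_nrm hS).comp (by fun_prop)
  have hLam : lam * h * s ≠ 0 := mul_ne_zero (mul_pos hlam hh).ne' hs0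
  have hcont : ∀ t : ℝ, Continuous fun x : Fin 3 → ℝ => (x, t) := fun t => by fun_prop
  have hker : ∀ (θ : Fin 2 → ℝ) (v : (Fin 3 → ℝ) × ℝ), v ∈ O →
      ∑ j, nrm S v j * curvGrad S θ v j = κ v * curv S θ v := by
    intro θ v hv
    have e0 := hM.kappa v hv 0
    have e1 := hM.kappa v hv 1
    simp only [Fin.sum_univ_three] at e0 e1
    simp only [Fin.sum_univ_three, curvGrad, curv]
    linear_combination θ 0 * e0 + θ 1 * e1
  have main := hC (lam * h * s) (fun x => lam * phaseDiff S z z' x)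
    (amplitude S χ η ψ h e z z' tI w) X (kernelCoord S h e z z' tI w p)
    -- The identity n·∇Δ = κΔ is known on O only, so U consists of the x for which both (x,t) and
    -- (x,t') lie in O.
    ((fun x => (x, z.2)) ⁻¹' O ∩ (fun x => (x, z'.2)) ⁻¹' O)
    (cutRegion S Kx η ψ h e z z' tI w) hLam (contDiff_const.mul (contDiff_phaseDiff hS z z')) hXs
    (contDiff_kernelCoord hS h e z z' tI w p)
    ((hM.isOpen.preimage (hcont _)).inter (hM.isOpen.preimage (hcont _)))
    (isCompact_cutRegion hM.compact_x hS η ψ h e z z' tI w)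
    (fun x hx => ⟨hM.subset ⟨hx.1, hz.2⟩, hM.subset ⟨hx.1, hz'.2⟩⟩)
    (fun x _ => rfl) (fun x hx => amplitude_eq_zero hχK η ψ h e z z' tI w hx) ?_ ?_ ?_ ?_ ?_
  · rwa [abs_mul, abs_of_pos (mul_pos hlam hh)] at main
  · intro x hx
    rw [fderiv_kernelCoord hS]
    refine Prod.ext (Prod.ext rfl (Prod.ext ?_ (Prod.ext ?_ ?_))) rfl
    · simp only [hV, hX, kernelCoord, hp]
      rw [hker z.1 _ hx.1]
      ring
    · simp only [hV, hX, kernelCoord, hp]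
      have h1 := hker z'.1 _ hx.2
      -- The blowdown identity at t' involves n(x,t'); the difference from n(x,t) has the factor t'
      -- - t.
      have h2 : ∀ j, nrm S (x, z.2) j = nrm S (x, z'.2) j - s * Hn (x, z.2, z'.2) j := fun j => by
        have := congrFun (hHnd x z.2 z'.2) j
        simp only [Pi.sub_apply, Pi.smul_apply, smul_eq_mul] at this
        linear_combination -this
      simp only [Fin.sum_univ_three] at h1 ⊢
      rw [h2 0, h2 1, h2 2]
      field_simp
      linear_combination h1
    · ext i
      simp only [hV, hX, kernelCoord, hp]
      have h0 := sum_nrm_mul_dx S i (x, z.2)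
      -- Since S_x(x,t) n(x,t) = 0, only the change of S_x from t to t_I contributes.
      have h2 : ∀ j, dx S i j (x, tI) = dx S i j (x, z.2) + (tI - z.2) * H i j (x, z.2, tI) :=
        fun j => by
        have := hHd i j x z.2 tI
        rw [smul_eq_mul] at this
        linear_combination this
      simp only [Fin.sum_univ_three] at h0 ⊢
      rw [h2 0, h2 1, h2 2]
      linear_combination e * h0
  · intro x _
    simp only [divergence, hd, kernelCoord, hp]
    refine Finset.sum_congr rfl fun j _ => ?_
    have h2 : fderiv ℝ X x (Pi.single j 1) j = fderiv ℝ (fun x => X x j) x (Pi.single j 1) := by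
      rw [fderiv_apply ((hXs.differentiable (by simp)) x)]
      rfl
    rw [h2, (hasFDerivAt_slice (hn j) x z.2).fderiv]
    rfl
  · intro x _
    rw [fderiv_phaseDiff hS]
    simp only [hX, hf, kernelCoord, hp]
    rw [hEd, ← hsdef]
    field_simp
  · intro x hx
    refine ⟨⟨hx.1, hx.2.1, hx.2.2.1, hx.2.2.2⟩, hz, hz', rfl, abs_le.1 htI,
      abs_le.1 (hq.trans (min_le_left _ _)), abs_le.1 hqI⟩
  · intro x hx
    simp only [hf, kernelCoord, hp]
    have h1 := hηc0 _ hx.2.2.1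
    have h2 : |∑ i, z'.1 i * E i (x, z.2, z'.2)| ≤ B' :=
      (hB (z'.1, x, z.2, z'.2) ⟨hz'.1, hx.1, hz.2, hz'.2⟩).trans (le_max_left _ _)
    have h3 : |s / h * ∑ i, z'.1 i * E i (x, z.2, z'.2)| ≤ c / 2 := by
      rw [abs_mul]
      calc _ ≤ c / (2 * (B' + 1)) * B' :=
            mul_le_mul (hq.trans (min_le_right _ _)) h2 (abs_nonneg _) (by positivity)
        _ ≤ c / (2 * (B' + 1)) * (B' + 1) := by gcongr; linarith
        _ = c / 2 := by field_simp
    have h4 := abs_sub_abs_le_abs_add (h⁻¹ * curv S z'.1 (x, z'.2))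
      (s / h * ∑ i, z'.1 i * E i (x, z.2, z'.2))
    linarith

end Transport

end FoldBlowdown
end

/-! ### Decay of the kernel of T*T for near and for far times. -/

noncomputable section

namespace FoldBlowdown

/-- The trivial bound serves a ≤ 1 and the decay serves a > 1; the constant comes from 1 + a ≤ 2
max(1, a). -/
theorem le_min_decay {X A B a v : ℝ} (hA : 0 ≤ A) (hB : 0 ≤ B) (ha : 0 ≤ a) (hv : 0 ≤ v)
    (h1 : X ≤ A * v) (h2 : 0 < a → X ≤ B * a⁻¹ ^ 6 * v) :
    X ≤ 2 ^ 6 * (A + B) * (1 + a)⁻¹ ^ 6 * v := by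
  rcases le_or_gt a 1 with h | h
  · have h3 : (1 / 2 : ℝ) ^ 6 ≤ (1 + a)⁻¹ ^ 6 := by
      refine pow_le_pow_left₀ (by norm_num) ?_ 6
      rw [one_div]
      exact inv_anti₀ (by linarith) (by linarith)
    refine h1.trans (mul_le_mul_of_nonneg_right ?_ hv)
    have : (A + B) * (1 / 2 : ℝ) ^ 6 ≤ (A + B) * (1 + a)⁻¹ ^ 6 :=
      mul_le_mul_of_nonneg_left h3 (by linarith)
    linarith
  · have h3 : (2⁻¹ * a⁻¹) ^ 6 ≤ (1 + a)⁻¹ ^ 6 := by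
      refine pow_le_pow_left₀ (by positivity) ?_ 6
      rw [← mul_inv]
      exact inv_anti₀ (by linarith) (by linarith)
    refine (h2 (by linarith)).trans (mul_le_mul_of_nonneg_right ?_ hv)
    rw [mul_pow] at h3
    have h4 : 0 ≤ a⁻¹ ^ 6 := by positivity
    have h5 : (A + B) * (2⁻¹ ^ 6 * a⁻¹ ^ 6) ≤ (A + B) * (1 + a)⁻¹ ^ 6 :=
      mul_le_mul_of_nonneg_left h3 (by linarith)
    have h6 : 0 ≤ A * a⁻¹ ^ 6 := by positivity
    linarith

section NearFar

variable {S : (Fin 3 → ℝ) × ℝ → (Fin 2 → ℝ)} {Kx : Set (Fin 3 → ℝ)} {Kt : Set ℝ}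
  {O : Set ((Fin 3 → ℝ) × ℝ)} {κ : (Fin 3 → ℝ) × ℝ → ℝ}
  {χ : (Fin 3 → ℝ) → ℝ} {η : ℝ → ℝ} {ψ : (Fin 2 → ℝ) → ℝ}

theorem exists_lipschitz_slice (hS : ContDiff ℝ ∞ S) (hK : IsCompact Kx) (T : ℝ) :
    ∃ L ≥ 0, ∀ x ∈ Kx, ∀ t t' : ℝ, |t| ≤ T → |t'| ≤ T → ‖S (x, t') - S (x, t)‖ ≤ L * |t' - t| := by
  obtain ⟨H, hH, hHd, _⟩ := exists_smooth_dividedDifference hS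
  obtain ⟨L, hL⟩ := (hK.prod ((isCompact_Icc (a := -T) (b := T)).prod
    (isCompact_Icc (a := -T) (b := T)))).exists_bound_of_continuousOn hH.continuous.continuousOn
  refine ⟨max L 0, le_max_right _ _, fun x hx t t' ht ht' => ?_⟩
  rw [hHd, norm_smul, Real.norm_eq_abs, mul_comm]
  exact mul_le_mul_of_nonneg_right ((hL (x, t, t') ⟨hx, abs_le.1 ht, abs_le.1 ht'⟩).trans
    (le_max_left _ _)) (abs_nonneg _)

/-- The support lies in a tube of radius (1 + L)h about the curve at time t. One passes from t_I to
t because the volume bound is available for times in Kt, and t_I need not belong to Kt. -/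
theorem IsModel.exists_volume_cutRegion_le (hM : IsModel S Kx Kt O κ)
    (hψ : tsupport ψ ⊆ Metric.closedBall 0 1) {T : ℝ} (hT : ∀ t ∈ Kt, |t| ≤ T) (η : ℝ → ℝ) :
    ∃ C ≥ 0, ∀ (h : ℝ) (z z' : (Fin 2 → ℝ) × ℝ) (tI : ℝ) (w : Fin 2 → ℝ), 0 < h → z.2 ∈ Kt →
      |tI| ≤ T → |z.2 - tI| ≤ h →
      volume.real (cutRegion S Kx η ψ h h⁻¹ z z' tI w) ≤ C * h ^ 2 := by
  obtain ⟨L, hL, hLip⟩ := exists_lipschitz_slice hM.smooth hM.compact_x T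
  obtain ⟨C, hC, hvol⟩ := hM.exists_tube_bound
  refine ⟨C * (1 + L) ^ 2, by positivity, fun h z z' tI w hh hz htI hzt => ?_⟩
  have hsub : cutRegion S Kx η ψ h h⁻¹ z z' tI w ⊆
      {x | x ∈ Kx ∧ ‖S (x, z.2) - w‖ ≤ (1 + L) * h} := by
    intro x hx
    refine ⟨hx.1, ?_⟩
    have h1 := hψ hx.2.2.2
    rw [mem_closedBall_zero_iff, norm_smul, norm_inv, Real.norm_eq_abs, abs_of_pos hh,
      inv_mul_le_iff₀ hh, mul_one] at h1
    have h2 := hLip x hx.1 tI z.2 htI (hT _ hz)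
    calc ‖S (x, z.2) - w‖ = ‖(S (x, z.2) - S (x, tI)) + (S (x, tI) - w)‖ := by congr 1; abel
      _ ≤ L * h + h := (norm_add_le _ _).trans (add_le_add
          (h2.trans (mul_le_mul_of_nonneg_left hzt hL)) h1)
      _ = (1 + L) * h := by ring
  have h3 := (measure_mono hsub).trans (hvol z.2 hz w ((1 + L) * h) (by positivity))
  rw [Measure.real]
  refine ENNReal.toReal_le_of_le_ofReal (by positivity) (h3.trans_eq ?_)
  congr 1
  ring

theorem exists_norm_oscIntegral_le (hS : ContDiff ℝ ∞ S) (hK : IsCompact Kx)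
    (hχ : ContDiff ℝ ∞ χ) (hχK : tsupport χ ⊆ Kx) (hη : ContDiff ℝ ∞ η)
    (hηc : HasCompactSupport η) (hψ : ContDiff ℝ ∞ ψ) (hψc : HasCompactSupport ψ) :
    ∃ A ≥ 0, ∀ (lam h e : ℝ) (z z' : (Fin 2 → ℝ) × ℝ) (tI : ℝ) (w : Fin 2 → ℝ),
      ‖oscIntegral S χ η ψ lam h e z z' tI w‖ ≤
        A * volume.real (cutRegion S Kx η ψ h e z z' tI w) := by
  obtain ⟨a, ha⟩ := hχ.continuous.bounded_above_of_compact_support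
    (hK.of_isClosed_subset (isClosed_tsupport χ) hχK)
  obtain ⟨b, hb⟩ := hη.continuous.bounded_above_of_compact_support hηc
  obtain ⟨c, hc⟩ := hψ.continuous.bounded_above_of_compact_support hψc
  have ha0 : 0 ≤ a := (norm_nonneg _).trans (ha 0)
  have hb0 : 0 ≤ b := (norm_nonneg _).trans (hb 0)
  have hc0 : 0 ≤ c := (norm_nonneg _).trans (hc 0)
  refine ⟨a ^ 2 * (b * b) * c ^ 2, by positivity, fun lam h e z z' tI w => ?_⟩
  set W := cutRegion S Kx η ψ h e z z' tI w with hW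
  have hWc : IsCompact W := isCompact_cutRegion hK hS η ψ h e z z' tI w
  have hset : oscIntegral S χ η ψ lam h e z z' tI w = ∫ x in W,
      Complex.exp (Complex.I * ((lam * phaseDiff S z z' x : ℝ) : ℂ)) *
        (amplitude S χ η ψ h e z z' tI w x : ℂ) := by
    rw [setIntegral_eq_integral_of_forall_compl_eq_zero]
    · rfl
    · intro x hx
      rw [amplitude_eq_zero hχK η ψ h e z z' tI w hx, Complex.ofReal_zero, mul_zero]
  rw [hset]
  refine norm_setIntegral_le_of_norm_le_const hWc.measure_lt_top fun x _ => ?_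
  rw [norm_mul, mul_comm Complex.I, Complex.norm_exp_ofReal_mul_I, one_mul, Complex.norm_real,
    amplitude, norm_mul, norm_mul, norm_mul, norm_pow, norm_pow]
  gcongr <;> first | exact ha _ | exact hb _ | exact hc _

/-- Decay of the kernel if the transport argument or the trivial bound is available when `θ' - θ`
is small compared to `t' - t`. -/
theorem IsModel.exists_near_bound_aux (hM : IsModel S Kx Kt O κ) (hχ : ContDiff ℝ ∞ χ)
    (hχK : tsupport χ ⊆ Kx) (hη : ContDiff ℝ ∞ η) (hηc : HasCompactSupport η)
    (hψ : ContDiff ℝ ∞ ψ) (hψs : tsupport ψ ⊆ Metric.closedBall 0 1)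
    {T : ℝ} (hT : ∀ t ∈ Kt, |t| ≤ T) {B : ℝ} (hB : 0 ≤ B) :
    ∃ C ≥ 0, ∀ (lam h : ℝ) (z z' : (Fin 2 → ℝ) × ℝ) (tI : ℝ) (w : Fin 2 → ℝ),
      0 < lam → 0 < h → h ≤ 1 → z ∈ freqAnnulus ×ˢ Kt → z' ∈ freqAnnulus ×ˢ Kt → |tI| ≤ T →
      |z.2 - tI| ≤ h →
      (z'.2 ≠ z.2 → lam * h * |z'.2 - z.2| ≤ 1 ∨ ‖oscIntegral S χ η ψ lam h h⁻¹ z z' tI w‖ ≤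
        B * (lam * h * |z'.2 - z.2|)⁻¹ ^ 6 *
          volume.real (cutRegion S Kx η ψ h h⁻¹ z z' tI w)) →
      ‖oscIntegral S χ η ψ lam h h⁻¹ z z' tI w‖ ≤
        C * h ^ 2 * (1 + lam * h * ‖z' - z‖)⁻¹ ^ 6 := by
  have hψc : HasCompactSupport ψ :=
    (isCompact_closedBall _ _).of_isClosed_subset (isClosed_tsupport ψ) hψs
  obtain ⟨A, hA, hAb⟩ := exists_norm_oscIntegral_le hM.smooth hM.compact_x hχ hχK hη hηc hψ hψc
  obtain ⟨c, hc, δ, hδ, C₁, hC₁, hgrad⟩ := hM.exists_gradient_bound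
  obtain ⟨G, hG, hGb⟩ := hM.exists_gradient_phase_bound hχ hχK hη hηc hψ hψc T hc 6
  obtain ⟨D, hD, hvol⟩ := hM.exists_volume_cutRegion_le hψs hT η
  refine ⟨2 ^ 6 * (A + (G + (B * C₁ ^ 6 + A * C₁ ^ 6))) * D, by positivity, ?_⟩
  intro lam h z z' tI w hlam hh hh1 hz hz' htI hzt hs
  set v := volume.real (cutRegion S Kx η ψ h h⁻¹ z z' tI w) with hv
  have hv0 : 0 ≤ v := measureReal_nonneg
  set X := ‖oscIntegral S χ η ψ lam h h⁻¹ z z' tI w‖ with hX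
  set a := lam * h * ‖z' - z‖ with ha
  have ha0 : 0 ≤ a := by positivity
  have key : X ≤ 2 ^ 6 * (A + (G + (B * C₁ ^ 6 + A * C₁ ^ 6))) * (1 + a)⁻¹ ^ 6 * v := by
    refine le_min_decay hA (by positivity) ha0 hv0 (hAb _ _ _ _ _ _ _) fun hapos => ?_
    have hr : 0 < ‖z' - z‖ := by
      rcases (norm_nonneg (z' - z)).eq_or_lt with h0 | h0
      · rw [ha, ← h0, mul_zero] at hapos
        exact absurd hapos (lt_irrefl _)
      · exact h0
    have hp : 0 ≤ a⁻¹ ^ 6 := by positivity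
    -- If θ' - θ dominates, the gradient bound applies. Otherwise |z' - z| ≤ C₁|t' - t|, and decay
    -- in t' - t is decay in z' - z.
    rcases le_or_gt (C₁ * |z'.2 - z.2|) ‖z'.1 - z.1‖ with h1 | h1
    · have h2 := hGb lam h h⁻¹ z z' tI w hlam hh hh1 (by positivity)
        (by rw [inv_mul_cancel₀ hh.ne']) hz hz' htI hr fun x hx =>
          (hgrad x hx.1 z.2 hz.2 z'.2 hz'.2 z.1 hz.1 z'.1 hz'.1).1 h1
      refine h2.trans (mul_le_mul_of_nonneg_right (mul_le_mul_of_nonneg_right ?_ hp) hv0)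
      have : 0 ≤ B * C₁ ^ 6 + A * C₁ ^ 6 := by positivity
      linarith
    · have hs0 : 0 < |z'.2 - z.2| := by
        by_contra h0
        have := (norm_nonneg _).trans_lt h1
        have h3 : |z'.2 - z.2| = 0 := le_antisymm (not_lt.1 h0) (abs_nonneg _)
        rw [h3, mul_zero] at this
        exact lt_irrefl _ this
      have hrs : ‖z' - z‖ ≤ C₁ * |z'.2 - z.2| := by
        refine max_le h1.le ?_
        change |z'.2 - z.2| ≤ _
        nlinarith
      have hac : a ≤ C₁ * (lam * h * |z'.2 - z.2|) := by
        calc a ≤ lam * h * (C₁ * |z'.2 - z.2|) := mul_le_mul_of_nonneg_left hrs (by positivity)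
          _ = _ := by ring
      have hle : C₁⁻¹ * a ≤ lam * h * |z'.2 - z.2| := by
        rw [inv_mul_le_iff₀ (by linarith)]
        exact hac
      rcases hs (fun h0 => by rw [h0, sub_self, abs_zero] at hs0; exact lt_irrefl _ hs0)
        with h2 | h2
      -- No oscillation is needed: a is bounded, so the trivial bound already has the required form.
      · have h3 : a ≤ C₁ := hac.trans (by nlinarith)
        have h4 : 1 ≤ C₁ ^ 6 * a⁻¹ ^ 6 := by
          rw [← mul_pow]
          refine one_le_pow₀ ?_
          rw [← div_eq_mul_inv, one_le_div hapos]
          exact h3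
        refine (hAb _ _ _ _ _ _ _).trans (mul_le_mul_of_nonneg_right ?_ hv0)
        have h5 : 0 ≤ (G + B * C₁ ^ 6) * a⁻¹ ^ 6 := by positivity
        nlinarith
      · refine h2.trans (mul_le_mul_of_nonneg_right ?_ hv0)
        have h3 : (lam * h * |z'.2 - z.2|)⁻¹ ^ 6 ≤ (C₁⁻¹ * a)⁻¹ ^ 6 :=
          pow_le_pow_left₀ (by positivity) (inv_anti₀ (by positivity) hle) 6
        rw [mul_inv C₁⁻¹, inv_inv, mul_pow] at h3
        have h4 : 0 ≤ (G + A * C₁ ^ 6) * a⁻¹ ^ 6 := by positivity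
        have h5 := mul_le_mul_of_nonneg_left h3 hB
        nlinarith
  have hv1 := hvol h z z' tI w hh hz.2 htI hzt
  refine key.trans ((mul_le_mul_of_nonneg_left hv1 (by positivity)).trans_eq ?_)
  ring

/-- The lower bound for |v| on the support of η makes transport available whenever both times are
close to t_I; half of the transport range for each of them suffices. -/
theorem IsModel.exists_near_bound (hM : IsModel S Kx Kt O κ) (hχ : ContDiff ℝ ∞ χ)
    (hχK : tsupport χ ⊆ Kx) (hη : ContDiff ℝ ∞ η) (hηc : HasCompactSupport η)
    (hψ : ContDiff ℝ ∞ ψ) (hψs : tsupport ψ ⊆ Metric.closedBall 0 1)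
    {T : ℝ} (hT : ∀ t ∈ Kt, |t| ≤ T) {c : ℝ} (hc : 0 < c) (hηc0 : ∀ v ∈ tsupport η, c ≤ |v|) :
    ∃ C ≥ 0, ∃ δ > 0, ∀ (lam h : ℝ) (z z' : (Fin 2 → ℝ) × ℝ) (tI : ℝ) (w : Fin 2 → ℝ),
      0 < lam → 0 < h → h ≤ 1 → z ∈ freqAnnulus ×ˢ Kt → z' ∈ freqAnnulus ×ˢ Kt → |tI| ≤ T →
      |z.2 - tI| ≤ δ * h → |z'.2 - tI| ≤ δ * h →
      ‖oscIntegral S χ η ψ lam h h⁻¹ z z' tI w‖ ≤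
        C * h ^ 2 * (1 + lam * h * ‖z' - z‖)⁻¹ ^ 6 := by
  have hψc : HasCompactSupport ψ :=
    (isCompact_closedBall _ _).of_isClosed_subset (isClosed_tsupport ψ) hψs
  obtain ⟨B, hB, δ, hδ, hb⟩ :=
    hM.exists_transport_phase_bound hχ hχK hη hηc hψ hψc T hc hηc0 6
  obtain ⟨C, hC, hCb⟩ := hM.exists_near_bound_aux hχ hχK hη hηc hψ hψs hT hB
  refine ⟨C, hC, min 1 (δ / 2), lt_min one_pos (by positivity), ?_⟩
  intro lam h z z' tI w hlam hh hh1 hz hz' htI hzt hzt'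
  have h1 : |z.2 - tI| ≤ h := hzt.trans (by
    have := min_le_left 1 (δ / 2)
    nlinarith)
  refine hCb lam h z z' tI w hlam hh hh1 hz hz' htI h1 fun hne => Or.inr ?_
  refine hb lam h h⁻¹ z z' tI w hlam hh hh1 hz hz' htI ?_ hne ?_
  · rw [abs_mul, abs_inv, abs_of_pos hh, inv_mul_le_iff₀ hh, mul_one, abs_sub_comm]
    exact h1
  · have h2 : |z'.2 - z.2| ≤ |z'.2 - tI| + |z.2 - tI| := by
      rw [abs_sub_comm z.2 tI]
      exact abs_sub_le _ _ _
    have := min_le_right 1 (δ / 2)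
    nlinarith

/-- Without a lower bound on the curvature transport is unavailable. The restriction λh|t' - t| ≤ 1
makes decay in t' - t unnecessary, and decay in θ' - θ comes from the gradient. -/
theorem IsModel.exists_near_bound_central (hM : IsModel S Kx Kt O κ) (hχ : ContDiff ℝ ∞ χ)
    (hχK : tsupport χ ⊆ Kx) (hη : ContDiff ℝ ∞ η) (hηc : HasCompactSupport η)
    (hψ : ContDiff ℝ ∞ ψ) (hψs : tsupport ψ ⊆ Metric.closedBall 0 1)
    {T : ℝ} (hT : ∀ t ∈ Kt, |t| ≤ T) :
    ∃ C ≥ 0, ∀ (lam h : ℝ) (z z' : (Fin 2 → ℝ) × ℝ) (tI : ℝ) (w : Fin 2 → ℝ),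
      0 < lam → 0 < h → h ≤ 1 → z ∈ freqAnnulus ×ˢ Kt → z' ∈ freqAnnulus ×ˢ Kt → |tI| ≤ T →
      |z.2 - tI| ≤ h → lam * h * |z'.2 - z.2| ≤ 1 →
      ‖oscIntegral S χ η ψ lam h h⁻¹ z z' tI w‖ ≤
        C * h ^ 2 * (1 + lam * h * ‖z' - z‖)⁻¹ ^ 6 := by
  obtain ⟨C, hC, hCb⟩ := hM.exists_near_bound_aux hχ hχK hη hηc hψ hψs hT le_rfl
  exact ⟨C, hC, fun lam h z z' tI w hlam hh hh1 hz hz' htI h1 h2 =>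
    hCb lam h z z' tI w hlam hh hh1 hz hz' htI h1 fun _ => Or.inl h2⟩

/-- This is where the fold condition enters. On the support both curvatures are O(h); once |t' - t|
is a large multiple of h, the immersion property bounds the gradient below by c|z' - z| ≥ ch, and
each step gains at least λh². No tube localization is required, so e = 0. -/
theorem IsModel.exists_far_bound (hM : IsModel S Kx Kt O κ) (hχ : ContDiff ℝ ∞ χ)
    (hχK : tsupport χ ⊆ Kx) (hη : ContDiff ℝ ∞ η) (hηc : HasCompactSupport η)
    (hψ : ContDiff ℝ ∞ ψ) (hψc : HasCompactSupport ψ) (N : ℕ) :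
    ∃ C ≥ 0, ∃ δ > 0, ∃ C₁ ≥ 1, ∀ (lam h : ℝ) (z z' : (Fin 2 → ℝ) × ℝ),
      0 < lam → 0 < h → h ≤ 1 → z ∈ freqAnnulus ×ˢ Kt → z' ∈ freqAnnulus ×ˢ Kt →
      C₁ * h ≤ |z'.2 - z.2| → |z'.2 - z.2| ≤ δ →
      ‖oscIntegral S χ η ψ lam h 0 z z' 0 0‖ ≤ C * (lam * h ^ 2)⁻¹ ^ N := by
  obtain ⟨c, hc, δ, hδ, C₁, hC₁, hgrad⟩ := hM.exists_gradient_bound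
  obtain ⟨G, hG, hGb⟩ := hM.exists_gradient_phase_bound hχ hχK hη hηc hψ hψc 0 hc N
  obtain ⟨M, hM1⟩ := hηc.isCompact.exists_bound_of_continuousOn (f := id) continuousOn_id
  have hM0 : ∀ v ∈ tsupport η, |v| ≤ max M 0 := fun v hv => (hM1 v hv).trans (le_max_left _ _)
  -- The separation must exceed C₁ times the curvature bound Mh, and also h itself, so that λh|z' -
  -- z| ≥ λh².
  refine ⟨G * volume.real Kx, by positivity, δ, hδ, max 1 (C₁ * max M 0), le_max_left _ _, ?_⟩
  intro lam h z z' hlam hh hh1 hz hz' hlow hup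
  have hrs : |z'.2 - z.2| ≤ ‖z' - z‖ := norm_snd_le (z' - z)
  have hr1 : h ≤ ‖z' - z‖ := by
    have := le_max_left 1 (C₁ * max M 0)
    nlinarith
  have hr : 0 < ‖z' - z‖ := hh.trans_le hr1
  have hcurv : ∀ (θ : Fin 2 → ℝ) (v : (Fin 3 → ℝ) × ℝ), h⁻¹ * curv S θ v ∈ tsupport η →
      |curv S θ v| ≤ max M 0 * h := by
    intro θ v hv
    have := hM0 _ hv
    rw [abs_mul, abs_inv, abs_of_pos hh, inv_mul_le_iff₀ hh] at this
    linarith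
  have h2 := hGb lam h 0 z z' 0 0 hlam hh hh1 le_rfl (by simp) hz hz' (by simp) hr fun x hx => by
    refine (hgrad x hx.1 z.2 hz.2 z'.2 hz'.2 z.1 hz.1 z'.1 hz'.1).2 hup (max M 0 * h)
      (hcurv _ _ hx.2.1) (hcurv _ _ hx.2.2.1) ?_
    have h4 : C₁ * max M 0 * h ≤ max 1 (C₁ * max M 0) * h :=
      mul_le_mul_of_nonneg_right (le_max_right _ _) hh.le
    have h5 : ‖(z'.1, z'.2) - (z.1, z.2)‖ = ‖z' - z‖ := rfl
    rw [h5]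
    linarith
  refine h2.trans ?_
  have h3 : (lam * h * ‖z' - z‖)⁻¹ ^ N ≤ (lam * h ^ 2)⁻¹ ^ N := by
    refine pow_le_pow_left₀ (by positivity) (inv_anti₀ (by positivity) ?_) N
    have : 0 < lam * h := by positivity
    nlinarith
  have h4 : volume.real (cutRegion S Kx η ψ h 0 z z' 0 0) ≤ volume.real Kx :=
    measureReal_mono (fun x hx => hx.1) hM.compact_x.measure_lt_top.ne
  calc _ ≤ G * (lam * h ^ 2)⁻¹ ^ N * volume.real Kx :=
        mul_le_mul (mul_le_mul_of_nonneg_left h3 hG) h4 measureReal_nonneg (by positivity)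
    _ = _ := by ring

end NearFar

end FoldBlowdown
end

noncomputable section

namespace FoldBlowdown

/-! ### Integral operators on `L²` -/

section Schur

theorem ennreal_mul_le_sq_add_sq (a b : ℝ≥0∞) : a * b ≤ a ^ 2 + b ^ 2 := by
  rcases le_total a b with h | h
  · calc a * b ≤ b * b := by gcongr
      _ ≤ _ := by rw [← sq]; exact le_add_self
  · calc a * b ≤ a * a := by gcongr
      _ ≤ _ := by rw [← sq]; exact le_self_add

theorem ennreal_add_sq_le (a b : ℝ≥0∞) : (a + b) ^ 2 ≤ 4 * (a ^ 2 + b ^ 2) := by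
  rcases le_total a b with h | h
  · calc (a + b) ^ 2 ≤ (b + b) ^ 2 := by gcongr
      _ = 4 * b ^ 2 := by ring
      _ ≤ _ := by gcongr; exact le_add_self
  · calc (a + b) ^ 2 ≤ (a + a) ^ 2 := by gcongr
      _ = 4 * a ^ 2 := by ring
      _ ≤ _ := by gcongr; exact le_self_add

theorem ennreal_sum_sq_le {ι : Type*} (s : Finset ι) (f : ι → ℝ≥0∞) :
    (∑ i ∈ s, f i) ^ 2 ≤ s.card * ∑ i ∈ s, f i ^ 2 := by
  have h := ENNReal.rpow_sum_le_const_mul_sum_rpow s f (p := 2) (by norm_num)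
  norm_num at h
  exact h

theorem sq_lintegral_le {α : Type*} [MeasurableSpace α] {μ : Measure α} {f : α → ℝ≥0∞}
    (hf : AEMeasurable f μ) {s : Set α} (hs : MeasurableSet s) (hfs : ∀ x ∉ s, f x = 0) :
    (∫⁻ x, f x ∂μ) ^ 2 ≤ μ s * ∫⁻ x, f x ^ 2 ∂μ := by
  have h := ENNReal.lintegral_mul_le_Lp_mul_Lq μ (p := 2) (q := 2)
    ⟨by norm_num, by norm_num, by norm_num⟩
    (f := s.indicator 1) (g := f) (aemeasurable_one.indicator hs) hf
  have h1 : ∀ x, (s.indicator (1 : α → ℝ≥0∞) * f) x = f x := fun x => by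
    by_cases hx : x ∈ s
    · simp [hx]
    · simp [hfs x hx]
  have h2 : ∫⁻ x, (s.indicator (1 : α → ℝ≥0∞) x) ^ (2 : ℝ) ∂μ = μ s := by
    rw [← lintegral_indicator_one hs]
    refine lintegral_congr fun x => ?_
    by_cases hx : x ∈ s <;> simp [hx]
  simp only [h1, h2] at h
  have h3 : ∀ a : ℝ≥0∞, (a ^ (1 / 2 : ℝ)) ^ 2 = a := fun a => by
    rw [← ENNReal.rpow_natCast, ← ENNReal.rpow_mul]
    norm_num
  refine (pow_le_pow_left' h 2).trans_eq ?_
  rw [mul_pow, h3, h3]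
  norm_num

variable {X Z : Type*} [MeasurableSpace X] [MeasurableSpace Z] {μ : Measure X} {ν : Measure Z}
  [SFinite μ] [SFinite ν] {k : X × Z → ℂ} {b : X → ℝ} {g g' : Z → ℂ}

theorem integrable_kernel_product (hk : Measurable k) (hb : Integrable (fun x => b x ^ 2) μ)
    (hkb : ∀ x z, ‖k (x, z)‖ ≤ b x) (hg : Integrable g ν) (hg' : Integrable g' ν) :
    Integrable (fun q : X × Z × Z => (starRingEnd ℂ) (k (q.1, q.2.1) * g q.2.1) *
      (k (q.1, q.2.2) * g' q.2.2)) (μ.prod (ν.prod ν)) := by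
  have h1 := hb.mul_prod ((hg.norm).mul_prod (hg'.norm))
  have m1 : AEStronglyMeasurable (fun q : X × Z × Z => g q.2.1) (μ.prod (ν.prod ν)) :=
    (hg.aestronglyMeasurable.comp_fst (ν := ν)).comp_snd (μ := μ)
  have m2 : AEStronglyMeasurable (fun q : X × Z × Z => g' q.2.2) (μ.prod (ν.prod ν)) :=
    (hg'.aestronglyMeasurable.comp_snd (μ := ν)).comp_snd (μ := μ)
  have m3 : Measurable fun q : X × Z × Z => k (q.1, q.2.1) := by fun_prop
  have m4 : Measurable fun q : X × Z × Z => k (q.1, q.2.2) := by fun_prop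
  refine h1.mono' ?_ (Filter.Eventually.of_forall fun q => ?_)
  · exact (Complex.continuous_conj.comp_aestronglyMeasurable
      (m3.aestronglyMeasurable.mul m1)).mul (m4.aestronglyMeasurable.mul m2)
  · rw [norm_mul, RCLike.norm_conj, norm_mul, norm_mul]
    have := hkb q.1 q.2.1
    have := hkb q.1 q.2.2
    have hb0 := (norm_nonneg _).trans this
    calc _ ≤ (b q.1 * ‖g q.2.1‖) * (b q.1 * ‖g' q.2.2‖) := by gcongr
      _ = _ := by ring

theorem conj_integral_mul_integral (x : X) :
    (starRingEnd ℂ) (∫ z, k (x, z) * g z ∂ν) * ∫ z, k (x, z) * g' z ∂ν =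
      ∫ p : Z × Z, (starRingEnd ℂ) (k (x, p.1) * g p.1) * (k (x, p.2) * g' p.2) ∂ν.prod ν := by
  rw [← integral_conj]
  exact (integral_prod_mul (fun z => (starRingEnd ℂ) (k (x, z) * g z))
    (fun z => k (x, z) * g' z)).symm

theorem integrable_pairing (hk : Measurable k) (hb : Integrable (fun x => b x ^ 2) μ)
    (hkb : ∀ x z, ‖k (x, z)‖ ≤ b x) (hg : Integrable g ν) (hg' : Integrable g' ν) :
    Integrable (fun x => (starRingEnd ℂ) (∫ z, k (x, z) * g z ∂ν) *
      ∫ z, k (x, z) * g' z ∂ν) μ := by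
  simp only [conj_integral_mul_integral]
  exact (integrable_kernel_product hk hb hkb hg hg').integral_prod_left

/-- Fubini moves the x-integral inside. Two different functions are allowed because the almost
orthogonality of distant slabs pairs different data. -/
theorem enorm_integral_pairing_le (hk : Measurable k) (hb : Integrable (fun x => b x ^ 2) μ)
    (hkb : ∀ x z, ‖k (x, z)‖ ≤ b x) (hg : Integrable g ν) (hg' : Integrable g' ν) :
    ‖∫ x, (starRingEnd ℂ) (∫ z, k (x, z) * g z ∂ν) * ∫ z, k (x, z) * g' z ∂ν ∂μ‖ₑ ≤
      ∫⁻ p : Z × Z, ‖g p.1‖ₑ * ‖g' p.2‖ₑ *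
        ‖∫ x, (starRingEnd ℂ) (k (x, p.1)) * k (x, p.2) ∂μ‖ₑ ∂ν.prod ν := by
  simp only [conj_integral_mul_integral]
  rw [integral_integral_swap (integrable_kernel_product hk hb hkb hg hg')]
  refine (enorm_integral_le_lintegral_enorm _).trans_eq (lintegral_congr fun p => ?_)
  have : ∫ x, (starRingEnd ℂ) (k (x, p.1) * g p.1) * (k (x, p.2) * g' p.2) ∂μ =
      ((starRingEnd ℂ) (g p.1) * g' p.2) *
        ∫ x, (starRingEnd ℂ) (k (x, p.1)) * k (x, p.2) ∂μ := by
    rw [← integral_const_mul]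
    refine integral_congr_ae (Filter.Eventually.of_forall fun x => ?_)
    simp only [map_mul]
    ring
  rw [this, enorm_mul, enorm_mul, RCLike.enorm_conj]

theorem lintegral_enorm_sq_eq {f : X → ℂ} (hf : Integrable (fun x => (starRingEnd ℂ) (f x) * f x) μ) :
    ∫⁻ x, ‖f x‖ₑ ^ 2 ∂μ = ‖∫ x, (starRingEnd ℂ) (f x) * f x ∂μ‖ₑ := by
  have h1 : ∀ x, (starRingEnd ℂ) (f x) * f x = ((‖(starRingEnd ℂ) (f x) * f x‖ : ℝ) : ℂ) := by
    intro x
    rw [Complex.conj_mul', norm_pow, Complex.norm_real, norm_norm]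
    push_cast
    rfl
  have h2 : ∫ x, (starRingEnd ℂ) (f x) * f x ∂μ =
      ((∫ x, ‖(starRingEnd ℂ) (f x) * f x‖ ∂μ : ℝ) : ℂ) := by
    refine Eq.trans ?_ (integral_ofReal (𝕜 := ℂ))
    exact integral_congr_ae (Filter.Eventually.of_forall h1)
  have h3 : 0 ≤ ∫ x, ‖(starRingEnd ℂ) (f x) * f x‖ ∂μ := integral_nonneg fun _ => norm_nonneg _
  rw [h2, ← ofReal_norm, Complex.norm_real, Real.norm_of_nonneg h3,
    ofReal_integral_norm_eq_lintegral_enorm hf]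
  refine lintegral_congr fun x => ?_
  rw [enorm_mul, RCLike.enorm_conj, sq]

/-- Schur's test for `T* T`. -/
theorem lintegral_enorm_sq_le_of_schur (hk : Measurable k) (hb : Integrable (fun x => b x ^ 2) μ)
    (hkb : ∀ x z, ‖k (x, z)‖ ≤ b x) (hg : Integrable g ν) (hgm : Measurable g) {s : Set Z}
    (hgs : ∀ z ∉ s, g z = 0) {K : Z × Z → ℝ≥0∞} (hK : Measurable K)
    (hkK : ∀ z ∈ s, ∀ z' ∈ s, ‖∫ x, (starRingEnd ℂ) (k (x, z)) * k (x, z') ∂μ‖ₑ ≤ K (z, z'))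
    {A : ℝ≥0∞} (h1 : ∀ z, ∫⁻ z', K (z, z') ∂ν ≤ A) (h2 : ∀ z', ∫⁻ z, K (z, z') ∂ν ≤ A) :
    ∫⁻ x, ‖∫ z, k (x, z) * g z ∂ν‖ₑ ^ 2 ∂μ ≤ 2 * A * ∫⁻ z, ‖g z‖ₑ ^ 2 ∂ν := by
  rw [lintegral_enorm_sq_eq (integrable_pairing hk hb hkb hg hg)]
  refine (enorm_integral_pairing_le hk hb hkb hg hg).trans ?_
  have m1 : Measurable fun p : Z × Z => ‖g p.1‖ₑ ^ 2 * K p := by fun_prop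
  have m2 : Measurable fun p : Z × Z => ‖g p.2‖ₑ ^ 2 * K p := by fun_prop
  calc _ ≤ ∫⁻ p : Z × Z, (‖g p.1‖ₑ ^ 2 * K p + ‖g p.2‖ₑ ^ 2 * K p) ∂ν.prod ν := by
        refine lintegral_mono fun p => ?_
        by_cases hp : p.1 ∈ s ∧ p.2 ∈ s
        · rw [← add_mul]
          exact mul_le_mul' (ennreal_mul_le_sq_add_sq _ _) (hkK _ hp.1 _ hp.2)
        · have : ‖g p.1‖ₑ * ‖g p.2‖ₑ = 0 := by
            rw [not_and_or] at hp
            rcases hp with hp | hp <;> simp [hgs _ hp]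
          simp [this]
    _ = ∫⁻ z, ‖g z‖ₑ ^ 2 * ∫⁻ z', K (z, z') ∂ν ∂ν + ∫⁻ z', ‖g z'‖ₑ ^ 2 * ∫⁻ z, K (z, z') ∂ν ∂ν := by
        rw [lintegral_add_left m1, lintegral_prod _ m1.aemeasurable,
          lintegral_prod_symm _ m2.aemeasurable]
        congr 1 <;> refine lintegral_congr fun z => ?_
        · exact lintegral_const_mul (‖g z‖ₑ ^ 2) (hK.comp measurable_prodMk_left)
        · exact lintegral_const_mul (‖g z‖ₑ ^ 2) (hK.comp measurable_prodMk_right)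
    _ ≤ ∫⁻ z, ‖g z‖ₑ ^ 2 * A ∂ν + ∫⁻ z, ‖g z‖ₑ ^ 2 * A ∂ν := by
        gcongr with z z
        · exact h1 z
        · exact h2 z
    _ = _ := by
        rw [lintegral_mul_const _ (by fun_prop)]
        ring

theorem lintegral_comp_smul {E : Type*} [NormedAddCommGroup E] [NormedSpace ℝ E]
    [MeasurableSpace E] [BorelSpace E] [FiniteDimensional ℝ E] (ρ : Measure E)
    [ρ.IsAddHaarMeasure] {f : E → ℝ≥0∞} (hf : Measurable f) {r : ℝ} (hr : r ≠ 0) :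
    ∫⁻ x, f (r • x) ∂ρ = ENNReal.ofReal |(r ^ Module.finrank ℝ E)⁻¹| * ∫⁻ x, f x ∂ρ := by
  rw [← lintegral_map hf (measurable_const_smul r), Measure.map_addHaar_smul ρ hr,
    lintegral_smul_measure, smul_eq_mul]

/-- The integral of `(1 + r |x|)^(-m)`. -/
theorem exists_lintegral_decay_le (E : Type*) [NormedAddCommGroup E] [NormedSpace ℝ E]
    [MeasurableSpace E] [BorelSpace E] [FiniteDimensional ℝ E] (ρ : Measure E)
    [ρ.IsAddHaarMeasure] {m : ℕ} (hm : Module.finrank ℝ E < m) :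
    ∃ C ≥ 0, ∀ r : ℝ, 0 < r → ∀ y : E,
      ∫⁻ x, ENNReal.ofReal ((1 + r * ‖x - y‖)⁻¹ ^ m) ∂ρ ≤
        ENNReal.ofReal (C * r⁻¹ ^ Module.finrank ℝ E) := by
  have h0 : ∫⁻ x : E, ENNReal.ofReal ((1 + ‖x‖) ^ (-(m : ℝ))) ∂ρ < ⊤ :=
    finite_integral_one_add_norm (by exact_mod_cast hm)
  have h1 : ∀ x : E, (1 + ‖x‖) ^ (-(m : ℝ)) = (1 + ‖x‖)⁻¹ ^ m := fun x => by
    rw [Real.rpow_neg (by positivity), Real.rpow_natCast, inv_pow]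
  simp only [h1] at h0
  refine ⟨(∫⁻ x : E, ENNReal.ofReal ((1 + ‖x‖)⁻¹ ^ m) ∂ρ).toReal, ENNReal.toReal_nonneg,
    fun r hr y => ?_⟩
  rw [lintegral_sub_right_eq_self (fun x => ENNReal.ofReal ((1 + r * ‖x‖)⁻¹ ^ m)) y]
  have h2 : ∀ x : E, ENNReal.ofReal ((1 + r * ‖x‖)⁻¹ ^ m) =
      ENNReal.ofReal ((1 + ‖r • x‖)⁻¹ ^ m) := fun x => by
    rw [norm_smul, Real.norm_eq_abs, abs_of_pos hr]
  simp only [h2]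
  rw [lintegral_comp_smul ρ (f := fun x => ENNReal.ofReal ((1 + ‖x‖)⁻¹ ^ m)) (by fun_prop) hr.ne',
    ENNReal.ofReal_mul ENNReal.toReal_nonneg, ENNReal.ofReal_toReal h0.ne, mul_comm,
    abs_of_pos (by positivity), inv_pow]

end Schur

end FoldBlowdown
end

noncomputable section

namespace FoldBlowdown

/-! ### The Fourier transform in `y'` -/

/-- The bilinear form `θ · v`. -/
def dot (θ v : Fin 2 → ℝ) : ℝ := θ 0 * v 0 + θ 1 * v 1

/-- The integral in the frequency variable. -/
def freqKernel (ϑ : (Fin 2 → ℝ) → ℝ) (η : ℝ → ℝ) (lam h : ℝ) (v D : Fin 2 → ℝ) : ℂ :=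
  ∫ θ : Fin 2 → ℝ, Complex.exp (Complex.I * ((lam * dot θ v : ℝ) : ℂ)) *
    ((ϑ θ * η (h⁻¹ * dot θ D) : ℝ) : ℂ)

/-- The rescaled Fourier transform in `y'` with a cutoff. -/
def freqSide (ϑ : (Fin 2 → ℝ) → ℝ) (lam : ℝ) (F : (Fin 2 → ℝ) × ℝ → ℂ)
    (z : (Fin 2 → ℝ) × ℝ) : ℂ :=
  (ϑ z.1 : ℂ) * ∫ y : Fin 2 → ℝ,
    Complex.exp (Complex.I * ((-(lam * dot z.1 y) : ℝ) : ℂ)) * F (y, z.2)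

theorem norm_exp_I_mul_ofReal (a : ℝ) : ‖Complex.exp (Complex.I * (a : ℂ))‖ = 1 := by
  rw [mul_comm, Complex.norm_exp_ofReal_mul_I]

theorem continuous_dot {Y : Type*} [TopologicalSpace Y] {f g : Y → Fin 2 → ℝ} (hf : Continuous f)
    (hg : Continuous g) : Continuous fun y => dot (f y) (g y) := by
  unfold dot
  fun_prop

theorem fderiv_dot_right (v θ u : Fin 2 → ℝ) : fderiv ℝ (fun θ => dot θ v) θ u = dot u v := by
  have h : ∀ i, HasFDerivAt (fun θ : Fin 2 → ℝ => θ i)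
      (ContinuousLinearMap.proj (R := ℝ) (φ := fun _ : Fin 2 => ℝ) i) θ := fun i =>
    (ContinuousLinearMap.proj (R := ℝ) (φ := fun _ : Fin 2 => ℝ) i).hasFDerivAt
  have h2 : HasFDerivAt (fun θ => dot θ v) _ θ :=
    ((h 0).mul_const (v 0)).add ((h 1).mul_const (v 1))
  rw [h2.fderiv]
  simp [dot, mul_comm]

theorem contDiff_dot_left (v : Fin 2 → ℝ) : ContDiff ℝ ∞ fun θ => dot θ v := by
  unfold dot
  fun_prop

section Kernel

variable {ϑ : (Fin 2 → ℝ) → ℝ} {η : ℝ → ℝ}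

/-- Nonstationary phase in θ along the constant field h·v/|v|, for which the phase derivative is
λh|v| times a constant at least 1; the factor h compensates the scale of η. -/
theorem exists_freqKernel_bound (hϑ : ContDiff ℝ ∞ ϑ) (hϑs : tsupport ϑ ⊆ freqAnnulus)
    (hη : ContDiff ℝ ∞ η) (hηc : HasCompactSupport η) (M : ℝ) (N : ℕ) :
    ∃ C ≥ 0, ∀ (lam h : ℝ) (v D : Fin 2 → ℝ), 0 < lam → 0 < h → h ≤ 1 → v ≠ 0 → ‖D‖ ≤ M →
      ‖freqKernel ϑ η lam h v D‖ ≤ C * (lam * h * ‖v‖)⁻¹ ^ N := by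
  set V : ((Fin 2 → ℝ) × ℝ) × ((Fin 2 → ℝ) × ℝ × (Fin 2 → ℝ)) →
      ((Fin 2 → ℝ) × ℝ) × ((Fin 2 → ℝ) × ℝ × (Fin 2 → ℝ)) := fun y =>
    ((y.2.2.1 • y.2.1, y.2.1 0 * y.2.2.2 0 + y.2.1 1 * y.2.2.2 1), 0) with hV
  set f : ((Fin 2 → ℝ) × ℝ) × ((Fin 2 → ℝ) × ℝ × (Fin 2 → ℝ)) → ℝ := fun y =>
    y.2.1 0 ^ 2 + y.2.1 1 ^ 2 with hf
  set G : ((Fin 2 → ℝ) × ℝ) × ((Fin 2 → ℝ) × ℝ × (Fin 2 → ℝ)) → ℝ := fun y =>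
    ϑ y.1.1 * η y.1.2 with hG
  have hVs : ContDiff ℝ ∞ V := by
    simp only [hV]
    fun_prop
  have hfs : ContDiff ℝ ∞ f := by
    simp only [hf]
    fun_prop
  have hGs : ContDiff ℝ ∞ G := (hϑ.comp (by fun_prop)).mul (hη.comp (by fun_prop))
  have hK : IsCompact ((freqAnnulus ×ˢ tsupport η) ×ˢ ((Metric.closedBall (0 : Fin 2 → ℝ) 1) ×ˢ
      (Set.Icc (0 : ℝ) 1) ×ˢ (Metric.closedBall (0 : Fin 2 → ℝ) M))) :=
    (isCompact_freqAnnulus.prod hηc.isCompact).prod ((isCompact_closedBall _ _).prod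
      (isCompact_Icc.prod (isCompact_closedBall _ _)))
  obtain ⟨C, hC0, hC⟩ := exists_nonstationary_bound (d := 2) (δ := fun _ => 0) hVs contDiff_const
    hfs one_pos hK N hGs
  refine ⟨C * volume.real freqAnnulus, by positivity, fun lam h v D hlam hh hh1 hv hD => ?_⟩
  have hr : 0 < ‖v‖ := norm_pos_iff.2 hv
  set u : Fin 2 → ℝ := ‖v‖⁻¹ • v with hu
  have hu1 : ‖u‖ = 1 := by rw [hu, norm_smul, norm_inv, norm_norm, inv_mul_cancel₀ hr.ne']
  set W : Set (Fin 2 → ℝ) := {θ | θ ∈ freqAnnulus ∧ h⁻¹ * dot θ D ∈ tsupport η} with hW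
  have hcd : Continuous fun θ => h⁻¹ * dot θ D :=
    continuous_const.mul (continuous_dot continuous_id continuous_const)
  have hWc : IsCompact W := isCompact_freqAnnulus.inter_right
    ((isClosed_tsupport η).preimage hcd)
  set Y : (Fin 2 → ℝ) → ((Fin 2 → ℝ) × ℝ) × ((Fin 2 → ℝ) × ℝ × (Fin 2 → ℝ)) := fun θ =>
    ((θ, h⁻¹ * dot θ D), (u, h, D)) with hY
  have hYs : ContDiff ℝ ∞ Y := (contDiff_id.prodMk
    (contDiff_const.mul (contDiff_dot_left D))).prodMk contDiff_const
  have main := hC (lam * h * ‖v‖) (fun θ => lam * dot θ v) (fun θ => ϑ θ * η (h⁻¹ * dot θ D))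
    (fun _ => h • u) Y Set.univ W (by positivity) (contDiff_const.mul (contDiff_dot_left v))
    contDiff_const hYs isOpen_univ hWc (Set.subset_univ _) (fun _ _ => rfl) ?_ ?_ ?_ ?_ ?_ ?_
  · rw [abs_of_pos (by positivity)] at main
    refine main.trans ?_
    have : volume.real W ≤ volume.real freqAnnulus :=
      measureReal_mono (fun x hx => hx.1) isCompact_freqAnnulus.measure_lt_top.ne
    calc _ ≤ C * (lam * h * ‖v‖)⁻¹ ^ N * volume.real freqAnnulus := by gcongr
      _ = _ := by ring
  · intro θ hθ
    by_contra h0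
    rw [mul_eq_zero, not_or] at h0
    exact hθ ⟨hϑs (subset_tsupport _ h0.1), subset_tsupport _ h0.2⟩
  · intro θ _
    have hd : HasFDerivAt Y _ θ := ((hasFDerivAt_id θ).prodMk
      ((((contDiff_dot_left D).differentiable (by simp) θ).hasFDerivAt).const_mul h⁻¹)).prodMk
        (hasFDerivAt_const (u, h, D) θ)
    rw [hd.fderiv]
    refine Prod.ext (Prod.ext rfl ?_) rfl
    change h⁻¹ * fderiv ℝ (fun θ => dot θ D) θ (h • u) = u 0 * D 0 + u 1 * D 1
    rw [fderiv_dot_right]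
    simp only [dot, Pi.smul_apply, smul_eq_mul]
    field_simp
  · intro θ _
    simp [divergence]
  · intro θ _
    rw [fderiv_const_mul ((contDiff_dot_left v).differentiable (by simp) θ)]
    change lam * fderiv ℝ (fun θ => dot θ v) θ (h • u) = _
    rw [fderiv_dot_right]
    have hvu : ∀ i, v i = ‖v‖ * u i := fun i => by
      rw [hu, Pi.smul_apply, smul_eq_mul, mul_inv_cancel_left₀ hr.ne']
    simp only [dot, hf, hY, Pi.smul_apply, smul_eq_mul]
    rw [hvu 0, hvu 1]
    ring
  · intro θ hθ
    exact ⟨⟨hθ.1, hθ.2⟩, by simp [hY, hu1], ⟨hh.le, hh1⟩, by simpa [hY] using hD⟩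
  · intro θ _
    simp only [hf, hY]
    obtain ⟨i, hi⟩ : ∃ i, ‖u i‖ = 1 := by
      by_contra! h0
      have h2 : ∀ i, ‖u i‖ < 1 := fun i =>
        lt_of_le_of_ne ((norm_le_pi_norm u i).trans hu1.le) (h0 i)
      exact absurd hu1 ((pi_norm_lt_iff one_pos).2 h2).ne
    have h1 : u i ^ 2 = 1 := by rw [← sq_abs, ← Real.norm_eq_abs, hi, one_pow]
    refine le_trans ?_ (le_abs_self _)
    fin_cases i <;> simp only [Fin.zero_eta, Fin.mk_one] at h1 <;> nlinarith [sq_nonneg (u 0), sq_nonneg (u 1)]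

/-- The localized form of Plancherel's theorem is obtained from Schur's test: the kernel of the
adjoint composition is the Fourier integral of ϑ², which decays like (1 + λ|y - y'|)^{-6} and has
integral O(λ^{-2}). -/
theorem exists_plancherel_bound (hϑ : ContDiff ℝ ∞ ϑ) (hϑs : tsupport ϑ ⊆ freqAnnulus) :
    ∃ C ≥ 0, ∀ (lam : ℝ) (u : (Fin 2 → ℝ) → ℂ), 0 < lam → Measurable u → Integrable u →
      ∫⁻ θ, ‖(ϑ θ : ℂ) * ∫ y : Fin 2 → ℝ,
        Complex.exp (Complex.I * ((-(lam * dot θ y) : ℝ) : ℂ)) * u y‖ₑ ^ 2 ≤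
        ENNReal.ofReal (C * lam⁻¹ ^ 2) * ∫⁻ y, ‖u y‖ₑ ^ 2 := by
  have hϑc : HasCompactSupport ϑ :=
    isCompact_freqAnnulus.of_isClosed_subset (isClosed_tsupport ϑ) hϑs
  -- With D = 0 and η(0) = 1 the curvature cutoff in `freqKernel` becomes trivial, and its decay
  -- bound can be reused.
  obtain ⟨η, hη1, hηc, hη, -⟩ : ∃ η : ℝ → ℝ, η 0 = 1 ∧ HasCompactSupport η ∧ ContDiff ℝ ∞ η ∧
      True := by
    let b : ContDiffBump (0 : ℝ) := ⟨1, 2, one_pos, one_lt_two⟩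
    exact ⟨b, b.one_of_mem_closedBall (by simpa using b.rIn_pos.le), b.hasCompactSupport, b.contDiff, trivial⟩
  have hϑ2 : ContDiff ℝ ∞ fun θ => ϑ θ ^ 2 := hϑ.pow 2
  have hϑ2s : tsupport (fun θ => ϑ θ ^ 2) ⊆ freqAnnulus := by
    refine (closure_mono fun θ hθ => ?_).trans hϑs
    simpa using hθ
  obtain ⟨B, hB, hb⟩ := exists_freqKernel_bound hϑ2 hϑ2s hη hηc 0 6
  have hϑ2c : HasCompactSupport fun θ => ϑ θ ^ 2 :=
    isCompact_freqAnnulus.of_isClosed_subset (isClosed_tsupport _) hϑ2s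
  have hi : Integrable fun θ => ϑ θ ^ 2 := hϑ2.continuous.integrable_of_hasCompactSupport hϑ2c
  set A := ∫ θ, ϑ θ ^ 2 with hA
  have hA0 : 0 ≤ A := integral_nonneg fun _ => sq_nonneg _
  obtain ⟨D, hD, hdec⟩ := exists_lintegral_decay_le (Fin 2 → ℝ) volume (m := 6) (by simp)
  refine ⟨2 * (2 ^ 6 * (A + B) * D), by positivity, fun lam u hlam hum hui => ?_⟩
  set k : (Fin 2 → ℝ) × (Fin 2 → ℝ) → ℂ := fun q =>
    (ϑ q.1 : ℂ) * Complex.exp (Complex.I * ((-(lam * dot q.1 q.2) : ℝ) : ℂ)) with hk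
  have hkm : Measurable k := by
    have h1 : Continuous fun q : (Fin 2 → ℝ) × (Fin 2 → ℝ) => dot q.1 q.2 :=
      continuous_dot continuous_fst continuous_snd
    have h2 := hϑ.continuous
    exact Continuous.measurable (by fun_prop)
  have hkey : ∀ y y', ∫ θ, (starRingEnd ℂ) (k (θ, y)) * k (θ, y') =
      freqKernel (fun θ => ϑ θ ^ 2) η lam 1 (y - y') 0 := by
    intro y y'
    refine integral_congr_ae (Filter.Eventually.of_forall fun θ => ?_)
    simp only [hk, map_mul, Complex.conj_ofReal, ← Complex.exp_conj, Complex.conj_I]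
    have h2 : (1 : ℝ)⁻¹ * dot θ 0 = 0 := by simp [dot]
    rw [h2, hη1, mul_one]
    have h3 : Complex.exp (Complex.I * ((lam * dot θ (y - y') : ℝ) : ℂ)) =
        Complex.exp (-Complex.I * ((-(lam * dot θ y) : ℝ) : ℂ)) *
          Complex.exp (Complex.I * ((-(lam * dot θ y') : ℝ) : ℂ)) := by
      rw [← Complex.exp_add]
      congr 1
      simp only [dot, Pi.sub_apply]
      push_cast
      ring
    rw [h3]
    push_cast
    ring
  have hbound : ∀ y y', ‖freqKernel (fun θ => ϑ θ ^ 2) η lam 1 (y - y') 0‖ ≤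
      2 ^ 6 * (A + B) * (1 + lam * ‖y - y'‖)⁻¹ ^ 6 := by
    intro y y'
    have h0 := le_min_decay (X := ‖freqKernel (fun θ => ϑ θ ^ 2) η lam 1 (y - y') 0‖) (v := 1)
      (a := lam * ‖y - y'‖) hA0 hB (by positivity) zero_le_one ?_ ?_
    · rwa [mul_one] at h0
    · rw [← hkey, mul_one]
      refine norm_integral_le_of_norm_le hi (Filter.Eventually.of_forall fun θ => ?_)
      simp only [hk, norm_mul, RCLike.norm_conj, norm_exp_I_mul_ofReal, Complex.norm_real, mul_one]
      rw [← sq, Real.norm_eq_abs, sq_abs]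
    · intro ha
      have hne : y - y' ≠ 0 := by
        intro h0
        rw [h0, norm_zero, mul_zero] at ha
        exact lt_irrefl _ ha
      have := hb lam 1 (y - y') 0 hlam one_pos le_rfl hne (by simp)
      simpa using this
  have main := lintegral_enorm_sq_le_of_schur (μ := (volume : Measure (Fin 2 → ℝ)))
    (ν := (volume : Measure (Fin 2 → ℝ))) (k := k) (b := fun θ => |ϑ θ|) (g := u) (s := Set.univ)
    (K := fun q => ENNReal.ofReal (2 ^ 6 * (A + B)) *
      ENNReal.ofReal ((1 + lam * ‖q.1 - q.2‖)⁻¹ ^ 6))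
    (A := ENNReal.ofReal (2 ^ 6 * (A + B)) * ENNReal.ofReal (D * lam⁻¹ ^ 2))
    hkm (by simpa using hi) (fun θ y => by
      simp only [hk, norm_mul, norm_exp_I_mul_ofReal, Complex.norm_real, mul_one]
      exact le_rfl) hui hum (by simp) (by fun_prop) ?_ ?_ ?_
  · refine le_trans (le_of_eq ?_) (main.trans_eq ?_)
    · refine lintegral_congr fun θ => ?_
      rw [← integral_const_mul]
      simp only [hk, mul_assoc]
    · congr 1
      rw [← ENNReal.ofReal_mul (by positivity), ← ENNReal.ofReal_ofNat 2,
        ← ENNReal.ofReal_mul (by positivity)]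
      congr 1
      ring
  · intro y _ y' _
    rw [hkey, ← ofReal_norm, ← ENNReal.ofReal_mul (by positivity)]
    exact ENNReal.ofReal_le_ofReal (hbound y y')
  · intro y
    rw [lintegral_const_mul _ (by fun_prop)]
    gcongr
    have := hdec lam hlam y
    simp only [norm_sub_rev y]
    simpa using this
  · intro y
    rw [lintegral_const_mul _ (by fun_prop)]
    gcongr
    have := hdec lam hlam y
    simpa using this

end Kernel

end FoldBlowdown
end

noncomputable section

namespace FoldBlowdown

/-! ### The operators on the physical side and on the frequency side -/

/-- An integrable function supported in `Ky × Kt`. -/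
structure IsDatum (Ky : Set (Fin 2 → ℝ)) (Kt : Set ℝ) (F : (Fin 2 → ℝ) × ℝ → ℂ) : Prop where
  measurable : Measurable F
  integrable : Integrable F
  support : ∀ p ∉ Ky ×ˢ Kt, F p = 0

/-- The kernel of the operator on the frequency side. -/
def waveKernel (S : (Fin 3 → ℝ) × ℝ → (Fin 2 → ℝ)) (χ : (Fin 3 → ℝ) → ℝ) (η : ℝ → ℝ)
    (ψ : (Fin 2 → ℝ) → ℝ) (lam h e tI : ℝ) (w : Fin 2 → ℝ)
    (q : (Fin 3 → ℝ) × ((Fin 2 → ℝ) × ℝ)) : ℂ :=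
  Complex.exp (Complex.I * ((lam * dot q.2.1 (S (q.1, q.2.2)) : ℝ) : ℂ)) *
    ((χ q.1 * η (h⁻¹ * curv S q.2.1 (q.1, q.2.2)) * ψ (e • (S (q.1, tI) - w)) : ℝ) : ℂ)

/-- The operator applied to a function of `y = (y', y₃)`, after integration over the frequencies. -/
def physOp (S : (Fin 3 → ℝ) × ℝ → (Fin 2 → ℝ)) (χ : (Fin 3 → ℝ) → ℝ) (η : ℝ → ℝ)
    (ϑ : (Fin 2 → ℝ) → ℝ) (lam h : ℝ) (F : (Fin 2 → ℝ) × ℝ → ℂ) (x : Fin 3 → ℝ) : ℂ :=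
  (χ x : ℂ) * ∫ p : (Fin 2 → ℝ) × ℝ,
    freqKernel ϑ η lam h (S (x, p.2) - p.1) (fun i => Delta S i (x, p.2)) * F p

theorem curv_eq_dot (S : (Fin 3 → ℝ) × ℝ → (Fin 2 → ℝ)) (θ : Fin 2 → ℝ) (z : (Fin 3 → ℝ) × ℝ) :
    curv S θ z = dot θ fun i => Delta S i z := rfl

section Datum

variable {Ky : Set (Fin 2 → ℝ)} {Kt : Set ℝ} {F : (Fin 2 → ℝ) × ℝ → ℂ} {ϑ : (Fin 2 → ℝ) → ℝ}

theorem IsDatum.indicator (hF : IsDatum Ky Kt F) {A : Set ((Fin 2 → ℝ) × ℝ)}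
    (hA : MeasurableSet A) : IsDatum Ky Kt (A.indicator F) :=
  ⟨hF.measurable.indicator hA, hF.integrable.indicator hA, fun p hp => by
    by_cases h : p ∈ A <;> simp [h, hF.support p hp]⟩

theorem IsDatum.sq_lintegral_le (hF : IsDatum Ky Kt F) (hKy : MeasurableSet Ky)
    (hKt : MeasurableSet Kt) :
    (∫⁻ p, ‖F p‖ₑ) ^ 2 ≤ volume (Ky ×ˢ Kt) * ∫⁻ p, ‖F p‖ₑ ^ 2 :=
  FoldBlowdown.sq_lintegral_le hF.measurable.enorm.aemeasurable (hKy.prod hKt) fun p hp => by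
    rw [hF.support p hp, enorm_zero]

theorem measurable_freqSide (hϑ : Continuous ϑ) (lam : ℝ) (hF : Measurable F) :
    Measurable (freqSide ϑ lam F) := by
  have h1 : Measurable fun q : ((Fin 2 → ℝ) × ℝ) × (Fin 2 → ℝ) =>
      Complex.exp (Complex.I * ((-(lam * dot q.1.1 q.2) : ℝ) : ℂ)) * F (q.2, q.1.2) := by
    have h2 : Continuous fun q : ((Fin 2 → ℝ) × ℝ) × (Fin 2 → ℝ) => dot q.1.1 q.2 :=
      continuous_dot (by fun_prop) (by fun_prop)
    refine Measurable.mul (Continuous.measurable (by fun_prop)) (hF.comp (by fun_prop))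
  have h3 := h1.stronglyMeasurable.integral_prod_right' (ν := (volume : Measure (Fin 2 → ℝ)))
  have h4 : Measurable fun z : (Fin 2 → ℝ) × ℝ => (ϑ z.1 : ℂ) :=
    Continuous.measurable (by fun_prop)
  exact h4.mul h3.measurable

theorem norm_freqSide_le (lam : ℝ) (z : (Fin 2 → ℝ) × ℝ) :
    ‖freqSide ϑ lam F z‖ ≤ ‖ϑ z.1‖ * ∫ y, ‖F (y, z.2)‖ := by
  rw [freqSide, norm_mul, Complex.norm_real]
  refine mul_le_mul_of_nonneg_left ((norm_integral_le_integral_norm _).trans_eq ?_) (norm_nonneg _)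
  refine integral_congr_ae (Filter.Eventually.of_forall fun y => ?_)
  simp only [norm_mul, norm_exp_I_mul_ofReal, one_mul]

theorem IsDatum.integrable_freqSide (hF : IsDatum Ky Kt F) (hϑ : Continuous ϑ)
    (hϑc : HasCompactSupport ϑ) (lam : ℝ) : Integrable (freqSide ϑ lam F) := by
  have h1 : Integrable fun t : ℝ => ∫ y, ‖F (y, t)‖ := hF.integrable.norm.integral_prod_right
  have h2 := (hϑ.integrable_of_hasCompactSupport hϑc (μ := volume)).norm.mul_prod h1
  exact h2.mono' (measurable_freqSide hϑ lam hF.measurable).aestronglyMeasurable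
    (Filter.Eventually.of_forall fun z => norm_freqSide_le lam z)

theorem lintegral_freqSide_le (hϑ : Continuous ϑ) (lam : ℝ) (hF : Measurable F) :
    ∫⁻ z, ‖freqSide ϑ lam F z‖ₑ ≤ (∫⁻ θ, ‖ϑ θ‖ₑ) * ∫⁻ p, ‖F p‖ₑ := by
  have h1 : ∀ z, ‖freqSide ϑ lam F z‖ₑ ≤ ‖ϑ z.1‖ₑ * ∫⁻ y, ‖F (y, z.2)‖ₑ := fun z => by
    rw [freqSide, enorm_mul]
    refine mul_le_mul' (le_of_eq ?_) ((enorm_integral_le_lintegral_enorm _).trans_eq ?_)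
    · rw [← ofReal_norm, ← ofReal_norm, Complex.norm_real]
    · refine lintegral_congr fun y => ?_
      rw [enorm_mul, ← ofReal_norm, norm_exp_I_mul_ofReal, ENNReal.ofReal_one, one_mul]
  have h2 : Measurable fun t : ℝ => ∫⁻ y, ‖F (y, t)‖ₑ :=
    Measurable.lintegral_prod_left' (f := fun p : (Fin 2 → ℝ) × ℝ => ‖F p‖ₑ) hF.enorm
  refine (lintegral_mono h1).trans_eq ?_
  have h3 := lintegral_prod_mul (μ := (volume : Measure (Fin 2 → ℝ)))
    (ν := (volume : Measure ℝ)) (hϑ.measurable.enorm.aemeasurable) h2.aemeasurable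
  refine h3.trans ?_
  congr 1
  exact (lintegral_prod_symm (μ := (volume : Measure (Fin 2 → ℝ)))
    (ν := (volume : Measure ℝ)) (fun p => ‖F p‖ₑ) hF.enorm.aemeasurable).symm

theorem IsDatum.freqSide_eq_zero (hF : IsDatum Ky Kt F) (hϑs : tsupport ϑ ⊆ freqAnnulus) (lam : ℝ)
    {z : (Fin 2 → ℝ) × ℝ} (hz : z ∉ freqAnnulus ×ˢ Kt) : freqSide ϑ lam F z = 0 := by
  rw [Set.mem_prod, not_and_or] at hz
  rcases hz with h | h
  · have : ϑ z.1 = 0 := by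
      by_contra h0
      exact h (hϑs (subset_tsupport _ h0))
    simp [freqSide, this]
  · have : ∀ y, F (y, z.2) = 0 := fun y => hF.support _ fun h0 => h h0.2
    simp [freqSide, this]

theorem exists_lintegral_freqSide_sq_le (hϑ : ContDiff ℝ ∞ ϑ) (hϑs : tsupport ϑ ⊆ freqAnnulus) :
    ∃ C ≥ 0, ∀ (lam : ℝ) (F : (Fin 2 → ℝ) × ℝ → ℂ), 0 < lam → Measurable F → Integrable F →
      ∫⁻ z, ‖freqSide ϑ lam F z‖ₑ ^ 2 ≤ ENNReal.ofReal (C * lam⁻¹ ^ 2) * ∫⁻ p, ‖F p‖ₑ ^ 2 := by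
  obtain ⟨C, hC, hb⟩ := exists_plancherel_bound hϑ hϑs
  refine ⟨C, hC, fun lam F hlam hF hFi => ?_⟩
  have m1 := ((measurable_freqSide hϑ.continuous lam hF).enorm.pow_const 2).aemeasurable
    (μ := (volume : Measure ((Fin 2 → ℝ) × ℝ)))
  have m2 := (hF.enorm.pow_const 2).aemeasurable (μ := (volume : Measure ((Fin 2 → ℝ) × ℝ)))
  have e1 := lintegral_prod_symm (μ := (volume : Measure (Fin 2 → ℝ)))
    (ν := (volume : Measure ℝ)) (fun z => ‖freqSide ϑ lam F z‖ₑ ^ 2) m1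
  have e2 := lintegral_prod_symm (μ := (volume : Measure (Fin 2 → ℝ)))
    (ν := (volume : Measure ℝ)) (fun z => ‖F z‖ₑ ^ 2) m2
  refine e1.trans_le ?_
  have hae : ∀ᵐ t : ℝ, Integrable fun y : Fin 2 → ℝ => F (y, t) := hFi.prod_left_ae
  refine (lintegral_mono_ae (g := fun t : ℝ => ENNReal.ofReal (C * lam⁻¹ ^ 2) *
    ∫⁻ y, ‖F (y, t)‖ₑ ^ 2) ?_).trans_eq ?_
  · filter_upwards [hae] with t ht
    exact hb lam (fun y => F (y, t)) hlam (hF.comp measurable_prodMk_right) ht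
  · rw [lintegral_const_mul _ (Measurable.lintegral_prod_left'
      (f := fun p : (Fin 2 → ℝ) × ℝ => ‖F p‖ₑ ^ 2) (hF.enorm.pow_const 2))]
    exact congrArg _ e2.symm

end Datum

section WaveKernel

variable {S : (Fin 3 → ℝ) × ℝ → (Fin 2 → ℝ)} {χ : (Fin 3 → ℝ) → ℝ} {η : ℝ → ℝ}
  {ψ : (Fin 2 → ℝ) → ℝ} {ϑ : (Fin 2 → ℝ) → ℝ}

theorem continuous_curv_uncurry (hS : ContDiff ℝ ∞ S) :
    Continuous fun q : (Fin 3 → ℝ) × ((Fin 2 → ℝ) × ℝ) => curv S q.2.1 (q.1, q.2.2) := by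
  simp only [curv_eq_dot]
  exact continuous_dot (by fun_prop)
    (continuous_pi fun i => (contDiff_Delta hS i).continuous.comp (by fun_prop))

theorem continuous_waveKernel (hS : ContDiff ℝ ∞ S) (hχ : Continuous χ) (hη : Continuous η)
    (hψ : Continuous ψ) (lam h e tI : ℝ) (w : Fin 2 → ℝ) :
    Continuous (waveKernel S χ η ψ lam h e tI w) := by
  have h1 := continuous_curv_uncurry hS
  have h0 := hS.continuous
  have h2 : Continuous fun q : (Fin 3 → ℝ) × ((Fin 2 → ℝ) × ℝ) => dot q.2.1 (S (q.1, q.2.2)) :=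
    continuous_dot (by fun_prop) (by fun_prop)
  unfold waveKernel
  fun_prop

theorem norm_waveKernel (lam h e tI : ℝ) (w : Fin 2 → ℝ) (x : Fin 3 → ℝ) (z : (Fin 2 → ℝ) × ℝ) :
    ‖waveKernel S χ η ψ lam h e tI w (x, z)‖ =
      |χ x| * |η (h⁻¹ * curv S z.1 (x, z.2))| * |ψ (e • (S (x, tI) - w))| := by
  rw [waveKernel, norm_mul, norm_exp_I_mul_ofReal, one_mul, Complex.norm_real, Real.norm_eq_abs,
    abs_mul, abs_mul]

theorem integral_conj_waveKernel_mul (lam h e tI : ℝ) (w : Fin 2 → ℝ) (z z' : (Fin 2 → ℝ) × ℝ) :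
    ∫ x, (starRingEnd ℂ) (waveKernel S χ η ψ lam h e tI w (x, z)) *
      waveKernel S χ η ψ lam h e tI w (x, z') = oscIntegral S χ η ψ lam h e z z' tI w := by
  refine integral_congr_ae (Filter.Eventually.of_forall fun x => ?_)
  have h3 : Complex.exp (Complex.I * ((lam * phaseDiff S z z' x : ℝ) : ℂ)) =
      Complex.exp (-Complex.I * ((lam * dot z.1 (S (x, z.2)) : ℝ) : ℂ)) *
        Complex.exp (Complex.I * ((lam * dot z'.1 (S (x, z'.2)) : ℝ) : ℂ)) := by
    rw [← Complex.exp_add]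
    congr 1
    simp only [dot, phaseDiff]
    push_cast
    ring
  simp only [waveKernel, map_mul, Complex.conj_ofReal, ← Complex.exp_conj, Complex.conj_I, h3,
    amplitude]
  push_cast
  ring

variable {Ky : Set (Fin 2 → ℝ)} {Kt : Set ℝ} {F : (Fin 2 → ℝ) × ℝ → ℂ}

/-- The integrand of all the forms of the operator is integrable. -/
theorem integrable_operator_integrand (hS : ContDiff ℝ ∞ S) (hη : Continuous η)
    (hηc : HasCompactSupport η) (hϑ : Continuous ϑ) (hϑc : HasCompactSupport ϑ)
    (hF : IsDatum Ky Kt F) (lam h : ℝ) (x : Fin 3 → ℝ) :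
    Integrable (fun q : (Fin 2 → ℝ) × ((Fin 2 → ℝ) × ℝ) =>
      Complex.exp (Complex.I * ((lam * dot q.1 (S (x, q.2.2) - q.2.1) : ℝ) : ℂ)) *
        ((ϑ q.1 * η (h⁻¹ * dot q.1 fun i => Delta S i (x, q.2.2)) : ℝ) : ℂ) * F q.2)
      (volume.prod volume) := by
  obtain ⟨b, hb⟩ := hη.bounded_above_of_compact_support hηc
  have h1 := ((hϑ.integrable_of_hasCompactSupport hϑc (μ := volume)).norm.mul_const b).mul_prod
    hF.integrable.norm
  have h0 := hS.continuous
  have hD : ∀ i, Continuous (Delta S i) := fun i => (contDiff_Delta hS i).continuous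
  have c1 : Continuous fun q : (Fin 2 → ℝ) × ((Fin 2 → ℝ) × ℝ) =>
      dot q.1 (S (x, q.2.2) - q.2.1) := continuous_dot (by fun_prop) (by fun_prop)
  have c2 : Continuous fun q : (Fin 2 → ℝ) × ((Fin 2 → ℝ) × ℝ) =>
      dot q.1 (fun i => Delta S i (x, q.2.2)) :=
    continuous_dot (by fun_prop) (continuous_pi fun i => (hD i).comp (by fun_prop))
  have hm := hF.measurable
  refine h1.mono' (Measurable.aestronglyMeasurable ?_) (Filter.Eventually.of_forall fun q => ?_)
  · exact Measurable.mul (Continuous.measurable (by fun_prop)) (by fun_prop)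
  · rw [norm_mul, norm_mul, norm_exp_I_mul_ofReal, one_mul, Complex.norm_real, norm_mul]
    gcongr
    exact hb _

theorem integrable_freqKernel_mul (hS : ContDiff ℝ ∞ S) (hη : Continuous η)
    (hηc : HasCompactSupport η) (hϑ : Continuous ϑ) (hϑc : HasCompactSupport ϑ)
    (hF : IsDatum Ky Kt F) (lam h : ℝ) (x : Fin 3 → ℝ) :
    Integrable fun p : (Fin 2 → ℝ) × ℝ =>
      freqKernel ϑ η lam h (S (x, p.2) - p.1) (fun i => Delta S i (x, p.2)) * F p := by
  refine (integrable_operator_integrand hS hη hηc hϑ hϑc hF lam h x).integral_prod_right.congr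
    (Filter.Eventually.of_forall fun p => ?_)
  simp only [freqKernel]
  rw [integral_mul_const]

/-- Fubini identifies the frequency form with the physical form. The tube cutoff depends on x only
and factors out, so localization in x commutes with the passage between the two. -/
theorem integral_waveKernel_mul_freqSide (hS : ContDiff ℝ ∞ S) (hχ : Continuous χ)
    (hη : Continuous η) (hηc : HasCompactSupport η) (hψ : Continuous ψ) (hϑ : Continuous ϑ)
    (hϑc : HasCompactSupport ϑ) (hF : IsDatum Ky Kt F) (lam h e tI : ℝ) (w : Fin 2 → ℝ)
    (x : Fin 3 → ℝ) :
    ∫ z, waveKernel S χ η ψ lam h e tI w (x, z) * freqSide ϑ lam F z =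
      (ψ (e • (S (x, tI) - w)) : ℂ) * physOp S χ η ϑ lam h F x := by
  set G : (Fin 2 → ℝ) × ((Fin 2 → ℝ) × ℝ) → ℂ := fun q =>
      Complex.exp (Complex.I * ((lam * dot q.1 (S (x, q.2.2) - q.2.1) : ℝ) : ℂ)) *
        ((ϑ q.1 * η (h⁻¹ * dot q.1 fun i => Delta S i (x, q.2.2)) : ℝ) : ℂ) * F q.2 with hG
  have hGi : Integrable G (volume.prod volume) :=
    integrable_operator_integrand hS hη hηc hϑ hϑc hF lam h x
  set a : ℂ := (ψ (e • (S (x, tI) - w)) : ℂ) * (χ x : ℂ) with ha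
  have hpt : ∀ z : (Fin 2 → ℝ) × ℝ, waveKernel S χ η ψ lam h e tI w (x, z) * freqSide ϑ lam F z =
      a * ∫ y, G (z.1, (y, z.2)) := by
    intro z
    rw [waveKernel, freqSide, ← integral_const_mul, ← integral_const_mul, ← integral_const_mul]
    refine integral_congr_ae (Filter.Eventually.of_forall fun y => ?_)
    have h3 : Complex.exp (Complex.I * ((lam * dot z.1 (S (x, z.2) - y) : ℝ) : ℂ)) =
      Complex.exp (Complex.I * ((lam * dot z.1 (S (x, z.2)) : ℝ) : ℂ)) *
        Complex.exp (Complex.I * ((-(lam * dot z.1 y) : ℝ) : ℂ)) := by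
      rw [← Complex.exp_add]
      congr 1
      simp only [dot, Pi.sub_apply]
      push_cast
      ring
    simp only [hG, h3, ha, ← curv_eq_dot]
    push_cast
    ring
  have hint : Integrable (fun z => waveKernel S χ η ψ lam h e tI w (x, z) * freqSide ϑ lam F z)
      (volume.prod volume) := by
    obtain ⟨b, hb⟩ := hη.bounded_above_of_compact_support hηc
    have hc := (continuous_waveKernel hS hχ hη hψ lam h e tI w).comp
      (Continuous.prodMk_right x)
    refine Integrable.bdd_mul (c := |χ x| * b * |ψ (e • (S (x, tI) - w))|)
      (hF.integrable_freqSide hϑ hϑc lam) hc.aestronglyMeasurable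
      (Filter.Eventually.of_forall fun z => ?_)
    change ‖waveKernel S χ η ψ lam h e tI w (x, z)‖ ≤ _
    rw [norm_waveKernel]
    have := hb (h⁻¹ * curv S z.1 (x, z.2))
    rw [Real.norm_eq_abs] at this
    gcongr
  have e1 : ∫ z, waveKernel S χ η ψ lam h e tI w (x, z) * freqSide ϑ lam F z =
      ∫ θ, ∫ t, a * ∫ y, G (θ, (y, t)) := by
    have := integral_prod _ hint
    refine this.trans ?_
    simp only [hpt]
  have e2 : ∫ p : (Fin 2 → ℝ) × ℝ,
      freqKernel ϑ η lam h (S (x, p.2) - p.1) (fun i => Delta S i (x, p.2)) * F p =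
        ∫ θ, ∫ p, G (θ, p) := by
    rw [integral_integral_swap hGi]
    refine integral_congr_ae (Filter.Eventually.of_forall fun p => ?_)
    simp only [freqKernel, hG]
    rw [integral_mul_const]
  have e3 : (fun θ => ∫ p, G (θ, p)) =ᵐ[volume] fun θ => ∫ t, ∫ y, G (θ, (y, t)) := by
    filter_upwards [hGi.prod_right_ae] with θ hθ
    exact integral_prod_symm _ hθ
  rw [e1, physOp, e2, integral_congr_ae e3, ← mul_assoc, ← integral_const_mul]
  refine integral_congr_ae (Filter.Eventually.of_forall fun θ => ?_)
  simp only []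
  rw [integral_const_mul]

theorem physOp_finset_sum (hS : ContDiff ℝ ∞ S) (hη : Continuous η)
    (hηc : HasCompactSupport η) (hϑ : Continuous ϑ) (hϑc : HasCompactSupport ϑ) {ι : Type*}
    (J : Finset ι) {f : ι → (Fin 2 → ℝ) × ℝ → ℂ} (hf : ∀ j, IsDatum Ky Kt (f j)) (lam h : ℝ)
    (x : Fin 3 → ℝ) : physOp S χ η ϑ lam h (fun p => ∑ j ∈ J, f j p) x =
      ∑ j ∈ J, physOp S χ η ϑ lam h (f j) x := by
  simp only [physOp, Finset.mul_sum]
  rw [integral_finsetSum J fun j _ =>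
    integrable_freqKernel_mul hS hη hηc hϑ hϑc (hf j) lam h x, Finset.mul_sum]

end WaveKernel

end FoldBlowdown
end

noncomputable section

namespace FoldBlowdown

/-! ### The estimate on a short interval in `y₃` -/

/-- The decay of the localized kernel for `t, t'` in an interval of length `q`. -/
def NearDecay (S : (Fin 3 → ℝ) × ℝ → (Fin 2 → ℝ)) (χ : (Fin 3 → ℝ) → ℝ) (η : ℝ → ℝ)
    (ψ : (Fin 2 → ℝ) → ℝ) (Kt : Set ℝ) (T D lam h q : ℝ) : Prop :=
  ∀ z ∈ freqAnnulus ×ˢ Kt, ∀ z' ∈ freqAnnulus ×ˢ Kt, ∀ (tI : ℝ) (w : Fin 2 → ℝ), |tI| ≤ T →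
    |z.2 - tI| ≤ q → |z'.2 - tI| ≤ q → |z'.2 - z.2| ≤ q →
    ‖oscIntegral S χ η ψ lam h h⁻¹ z z' tI w‖ ≤ D * h ^ 2 * (1 + lam * h * ‖z' - z‖)⁻¹ ^ 6

theorem IsDatum.mono {Ky : Set (Fin 2 → ℝ)} {Kt Kt' : Set ℝ} {F : (Fin 2 → ℝ) × ℝ → ℂ}
    (hF : IsDatum Ky Kt F) (h : Kt ⊆ Kt') : IsDatum Ky Kt' F :=
  ⟨hF.measurable, hF.integrable, fun p hp => hF.support p fun h0 => hp ⟨h0.1, h h0.2⟩⟩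

section ShortInterval

variable {S : (Fin 3 → ℝ) × ℝ → (Fin 2 → ℝ)} {Kx : Set (Fin 3 → ℝ)} {Kt : Set ℝ}
  {O : Set ((Fin 3 → ℝ) × ℝ)} {κ : (Fin 3 → ℝ) × ℝ → ℝ} {Ky : Set (Fin 2 → ℝ)}
  {χ : (Fin 3 → ℝ) → ℝ} {η : ℝ → ℝ} {ψ : (Fin 2 → ℝ) → ℝ} {ϑ : (Fin 2 → ℝ) → ℝ}
  {F F' : (Fin 2 → ℝ) × ℝ → ℂ}

theorem measurable_physOp (hS : ContDiff ℝ ∞ S) (hχ : Continuous χ) (hη : Continuous η)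
    (hηc : HasCompactSupport η) (hϑ : Continuous ϑ) (hϑc : HasCompactSupport ϑ)
    (hF : IsDatum Ky Kt F) (lam h : ℝ) : Measurable (physOp S χ η ϑ lam h F) := by
  have h1 := fun x => integral_waveKernel_mul_freqSide hS hχ hη hηc
    (continuous_const : Continuous fun _ : Fin 2 → ℝ => (1 : ℝ)) hϑ hϑc hF lam h 0 0 0 x
  have h2 : physOp S χ η ϑ lam h F = fun x =>
      ∫ z, waveKernel S χ η (fun _ => 1) lam h 0 0 0 (x, z) * freqSide ϑ lam F z := by
    funext x
    rw [h1 x, Complex.ofReal_one, one_mul]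
  rw [h2]
  have h3 : Measurable fun q : (Fin 3 → ℝ) × ((Fin 2 → ℝ) × ℝ) =>
      waveKernel S χ η (fun _ => 1) lam h 0 0 0 q * freqSide ϑ lam F q.2 :=
    (continuous_waveKernel hS hχ hη continuous_const lam h 0 0 0).measurable.mul
      ((measurable_freqSide hϑ lam hF.measurable).comp measurable_snd)
  exact (h3.stronglyMeasurable.integral_prod_right'
    (ν := (volume : Measure ((Fin 2 → ℝ) × ℝ)))).measurable

theorem physOp_add (hS : ContDiff ℝ ∞ S) (hη : Continuous η)
    (hηc : HasCompactSupport η) (hϑ : Continuous ϑ) (hϑc : HasCompactSupport ϑ)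
    (hF : IsDatum Ky Kt F) (hF' : IsDatum Ky Kt F') (lam h : ℝ) (x : Fin 3 → ℝ) :
    physOp S χ η ϑ lam h (F + F') x = physOp S χ η ϑ lam h F x + physOp S χ η ϑ lam h F' x := by
  simp only [physOp, Pi.add_apply, mul_add]
  rw [integral_add (integrable_freqKernel_mul hS hη hηc hϑ hϑc hF lam h x)
    (integrable_freqKernel_mul hS hη hηc hϑ hϑc hF' lam h x), mul_add]

/-- The estimate after localization to a tube. -/
theorem exists_tube_estimate (hS : ContDiff ℝ ∞ S) (hχ : Continuous χ) (hχc : HasCompactSupport χ)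
    (hη : Continuous η) (hηc : HasCompactSupport η) (hψ : Continuous ψ)
    (hψc : HasCompactSupport ψ) (hϑ : ContDiff ℝ ∞ ϑ) (hϑs : tsupport ϑ ⊆ freqAnnulus)
    {T D : ℝ} (hD : 0 ≤ D) :
    ∃ C ≥ 0, ∀ (lam h q tI : ℝ) (w : Fin 2 → ℝ) (F : (Fin 2 → ℝ) × ℝ → ℂ), 0 < lam → 0 < h →
      |tI| ≤ T → NearDecay S χ η ψ Kt T D lam h q → IsDatum Ky (Kt ∩ Set.Ico tI (tI + q)) F →
      ∫⁻ x, ‖(ψ (h⁻¹ • (S (x, tI) - w)) : ℂ) * physOp S χ η ϑ lam h F x‖ₑ ^ 2 ≤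
        ENNReal.ofReal (C * lam⁻¹ ^ 5 * h⁻¹) * ∫⁻ p, ‖F p‖ₑ ^ 2 := by
  have hϑc : HasCompactSupport ϑ :=
    isCompact_freqAnnulus.of_isClosed_subset (isClosed_tsupport ϑ) hϑs
  obtain ⟨A, hA, hpl⟩ := exists_lintegral_freqSide_sq_le hϑ hϑs
  have hhaar : (volume : Measure ((Fin 2 → ℝ) × ℝ)).IsAddHaarMeasure :=
    Measure.prod.instIsAddHaarMeasure _ _
  obtain ⟨B, hB, hdec⟩ := exists_lintegral_decay_le ((Fin 2 → ℝ) × ℝ) volume (m := 6) (by simp)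
  obtain ⟨b₁, hb₁⟩ := hη.bounded_above_of_compact_support hηc
  obtain ⟨b₂, hb₂⟩ := hψ.bounded_above_of_compact_support hψc
  have hb₁0 : 0 ≤ b₁ := (norm_nonneg _).trans (hb₁ 0)
  have hχi : Integrable fun x => (|χ x| * b₁ * b₂) ^ 2 := by
    refine Continuous.integrable_of_hasCompactSupport (by fun_prop) ?_
    exact hχc.mono fun x hx => by
      simp only [Function.mem_support] at hx ⊢
      contrapose! hx
      simp [hx]
  -- Schur's test gives 2 · Dh² · B(λh)^{-3}, the exponent 3 being the dimension of (θ,t), and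
  -- Plancherel gives Aλ^{-2}; the product is of order λ^{-5}h^{-1}.
  refine ⟨2 * (D * B) * A, by positivity, ?_⟩
  intro lam h q tI w F hlam hh htI hnear hF
  have main := lintegral_enorm_sq_le_of_schur (μ := (volume : Measure (Fin 3 → ℝ)))
    (ν := (volume : Measure ((Fin 2 → ℝ) × ℝ))) (k := waveKernel S χ η ψ lam h h⁻¹ tI w)
    (b := fun x => |χ x| * b₁ * b₂) (g := freqSide ϑ lam F)
    (s := freqAnnulus ×ˢ (Kt ∩ Set.Ico tI (tI + q)))
    (K := fun z => ENNReal.ofReal (D * h ^ 2) *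
      ENNReal.ofReal ((1 + lam * h * ‖z.2 - z.1‖)⁻¹ ^ 6))
    (A := ENNReal.ofReal (D * h ^ 2) * ENNReal.ofReal (B * (lam * h)⁻¹ ^ 3))
    (continuous_waveKernel hS hχ hη hψ _ _ _ _ _).measurable hχi
    (fun x z => by
      rw [norm_waveKernel]
      have h1 := hb₁ (h⁻¹ * curv S z.1 (x, z.2))
      have h2 := hb₂ (h⁻¹ • (S (x, tI) - w))
      rw [Real.norm_eq_abs] at h1 h2
      gcongr)
    (hF.integrable_freqSide hϑ.continuous hϑc lam)
    (measurable_freqSide hϑ.continuous lam hF.measurable)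
    (fun z hz => hF.freqSide_eq_zero hϑs lam hz) (by fun_prop) ?_ ?_ ?_
  · simp only [integral_waveKernel_mul_freqSide hS hχ hη hηc hψ hϑ.continuous hϑc hF] at main
    refine main.trans ((mul_le_mul_right (hpl lam F hlam hF.measurable hF.integrable) _).trans_eq ?_)
    rw [← mul_assoc, ← ENNReal.ofReal_mul (by positivity), ← ENNReal.ofReal_ofNat 2,
      ← ENNReal.ofReal_mul (by positivity), ← ENNReal.ofReal_mul (by positivity)]
    congr 2
    field_simp
  · intro z hz z' hz'
    rw [integral_conj_waveKernel_mul, ← ofReal_norm, ← ENNReal.ofReal_mul (by positivity)]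
    refine ENNReal.ofReal_le_ofReal (hnear z ⟨hz.1, hz.2.1⟩ z' ⟨hz'.1, hz'.2.1⟩ tI w htI ?_ ?_ ?_)
    all_goals
      have h1 := hz.2.2
      have h2 := hz'.2.2
      rw [abs_le]
      constructor <;> linarith [h1.1, h1.2, h2.1, h2.2]
  · intro z
    rw [lintegral_const_mul _ (by fun_prop)]
    gcongr
    have := hdec (lam * h) (by positivity) z
    simpa using this
  · intro z
    rw [lintegral_const_mul _ (by fun_prop)]
    gcongr
    have := hdec (lam * h) (by positivity) z
    simp only [norm_sub_rev z]
    simpa using this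

/-- The part of the operator away from the tube. -/
theorem IsModel.exists_off_tube_bound (hM : IsModel S Kx Kt O κ)
    (hχK : tsupport χ ⊆ Kx) (hη : ContDiff ℝ ∞ η) (hηc : HasCompactSupport η)
    (hψs : tsupport ψ ⊆ Metric.closedBall 0 1) (hϑ : ContDiff ℝ ∞ ϑ)
    (hϑs : tsupport ϑ ⊆ freqAnnulus) {T : ℝ} (hT : ∀ t ∈ Kt, |t| ≤ T) (N : ℕ) :
    ∃ C ≥ 0, ∃ ρ > 0, ∀ (lam h q tI : ℝ) (w : Fin 2 → ℝ) (F : (Fin 2 → ℝ) × ℝ → ℂ) (x : Fin 3 → ℝ),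
      0 < lam → 0 < h → h ≤ 1 → q ≤ h → |tI| ≤ T → IsDatum Ky (Kt ∩ Set.Ico tI (tI + q)) F →
      (∀ p, ‖p.1 - w‖ ≤ ρ * h → F p = 0) →
      ‖(ψ (h⁻¹ • (S (x, tI) - w)) : ℂ) * physOp S χ η ϑ lam h F x‖ₑ ≤
        ENNReal.ofReal (C * (lam * h ^ 2)⁻¹ ^ N) * (‖ψ (h⁻¹ • (S (x, tI) - w))‖ₑ * ‖χ x‖ₑ) *
          ∫⁻ p, ‖F p‖ₑ := by
  obtain ⟨L, hL, hLip⟩ := exists_lipschitz_slice hM.smooth hM.compact_x T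
  have hΔ : Continuous fun z => fun i => Delta S i z :=
    continuous_pi fun i => (contDiff_Delta hM.smooth i).continuous
  obtain ⟨M, hMb⟩ := (hM.compact_x.prod hM.compact_t).exists_bound_of_continuousOn
    hΔ.continuousOn
  obtain ⟨C, hC, hCb⟩ := exists_freqKernel_bound hϑ hϑs hη hηc M N
  -- With |y' - w| > (L + 2)h, the tube cutoff accounts for h and the motion of S over the slab for
  -- Lh; the remaining h is a lower bound for |S(x,t) - y'|, so the θ-integral is nonstationary.
  refine ⟨C, hC, L + 2, by positivity, ?_⟩
  intro lam h q tI w F x hlam hh hh1 hq htI hF hFw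
  have e1 : ‖(ψ (h⁻¹ • (S (x, tI) - w)) : ℂ) * physOp S χ η ϑ lam h F x‖ₑ =
      ‖ψ (h⁻¹ • (S (x, tI) - w))‖ₑ * ‖χ x‖ₑ * ‖∫ p : (Fin 2 → ℝ) × ℝ,
        freqKernel ϑ η lam h (S (x, p.2) - p.1) (fun i => Delta S i (x, p.2)) * F p‖ₑ := by
    rw [physOp, enorm_mul, enorm_mul, ← mul_assoc, ← ofReal_norm (ψ _), ← ofReal_norm (χ _),
      ← ofReal_norm (ψ _ : ℂ), ← ofReal_norm (χ _ : ℂ), Complex.norm_real, Complex.norm_real]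
  rw [e1]
  by_cases h0 : ψ (h⁻¹ • (S (x, tI) - w)) = 0 ∨ χ x = 0
  · rcases h0 with h0 | h0 <;> simp [h0]
  rw [not_or] at h0
  have hx : x ∈ Kx := hχK (subset_tsupport _ h0.2)
  have hψ1 : ‖S (x, tI) - w‖ ≤ h := by
    have := hψs (subset_tsupport _ h0.1)
    rwa [mem_closedBall_zero_iff, norm_smul, norm_inv, Real.norm_eq_abs, abs_of_pos hh,
      inv_mul_le_iff₀ hh, mul_one] at this
  have key : ‖∫ p : (Fin 2 → ℝ) × ℝ,
        freqKernel ϑ η lam h (S (x, p.2) - p.1) (fun i => Delta S i (x, p.2)) * F p‖ₑ ≤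
      ENNReal.ofReal (C * (lam * h ^ 2)⁻¹ ^ N) * ∫⁻ p, ‖F p‖ₑ := by
    refine (enorm_integral_le_lintegral_enorm _).trans ?_
    rw [← lintegral_const_mul _ hF.measurable.enorm]
    refine lintegral_mono fun p => ?_
    simp only []
    rw [enorm_mul]
    by_cases hp : F p = 0
    · simp [hp]
    gcongr
    have hpK : p.2 ∈ Kt ∩ Set.Ico tI (tI + q) := by
      by_contra h1
      exact hp (hF.support p fun h2 => h1 h2.2)
    have hpw : (L + 2) * h < ‖p.1 - w‖ := by
      by_contra h1
      exact hp (hFw p (not_lt.1 h1))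
    have hpt : |p.2 - tI| ≤ h := by
      rw [abs_le]
      constructor <;> linarith [hpK.2.1, hpK.2.2]
    have h3 := hLip x hx tI p.2 htI (hT _ hpK.1)
    have h4 : h ≤ ‖S (x, p.2) - p.1‖ := by
      have h5 : ‖p.1 - w‖ ≤ ‖S (x, p.2) - p.1‖ + ‖S (x, p.2) - S (x, tI)‖ + ‖S (x, tI) - w‖ := by
        calc ‖p.1 - w‖ = ‖-(S (x, p.2) - p.1) + (S (x, p.2) - S (x, tI)) + (S (x, tI) - w)‖ := by
              congr 1
              abel
          _ ≤ _ := by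
              refine (norm_add_le _ _).trans (add_le_add_left ?_ _)
              refine (norm_add_le _ _).trans_eq ?_
              rw [norm_neg]
      nlinarith
    rw [← ofReal_norm]
    refine ENNReal.ofReal_le_ofReal ?_
    refine (hCb lam h _ _ hlam hh hh1 (norm_pos_iff.1 (hh.trans_le h4))
      (hMb (x, p.2) ⟨hx, hpK.1⟩)).trans ?_
    refine mul_le_mul_of_nonneg_left (pow_le_pow_left₀ (by positivity)
      (inv_anti₀ (by positivity) ?_) N) hC
    have : 0 < lam * h := by positivity
    nlinarith
  calc _ ≤ ‖ψ (h⁻¹ • (S (x, tI) - w))‖ₑ * ‖χ x‖ₑ *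
        (ENNReal.ofReal (C * (lam * h ^ 2)⁻¹ ^ N) * ∫⁻ p, ‖F p‖ₑ) := by gcongr
    _ = _ := by ring

theorem lintegral_tube_cutoff (hψ : Continuous ψ) (v : Fin 2 → ℝ) {h : ℝ} (hh : 0 < h) :
    ∫⁻ w, ‖ψ (h⁻¹ • (v - w))‖ₑ ^ 2 = ENNReal.ofReal (h ^ 2) * ∫⁻ w, ‖ψ w‖ₑ ^ 2 := by
  rw [lintegral_sub_left_eq_self (fun w => ‖ψ (h⁻¹ • w)‖ₑ ^ 2) v,
    lintegral_comp_smul volume (f := fun w => ‖ψ w‖ₑ ^ 2) (by fun_prop) (inv_ne_zero hh.ne')]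
  congr 2
  simp [abs_of_pos hh]

/-- By Fubini each point is counted by the area of a sup-norm ball of radius r. This is the almost
orthogonality of the tubes. -/
theorem lintegral_lintegral_tube (hF : Measurable F) {r : ℝ} (hr : 0 ≤ r) :
    ∫⁻ w : Fin 2 → ℝ, ∫⁻ p, ‖{p : (Fin 2 → ℝ) × ℝ | ‖p.1 - w‖ ≤ r}.indicator F p‖ₑ ^ 2 =
      ENNReal.ofReal ((2 * r) ^ 2) * ∫⁻ p, ‖F p‖ₑ ^ 2 := by
  have hset : MeasurableSet {q : (Fin 2 → ℝ) × ((Fin 2 → ℝ) × ℝ) | ‖q.2.1 - q.1‖ ≤ r} :=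
    (isClosed_le (by fun_prop) continuous_const).measurableSet
  have hm : Measurable fun q : (Fin 2 → ℝ) × ((Fin 2 → ℝ) × ℝ) =>
      {q : (Fin 2 → ℝ) × ((Fin 2 → ℝ) × ℝ) | ‖q.2.1 - q.1‖ ≤ r}.indicator
        (fun q => ‖F q.2‖ₑ ^ 2) q :=
    Measurable.indicator (by fun_prop) hset
  have e : ∀ (w : Fin 2 → ℝ) (p : (Fin 2 → ℝ) × ℝ),
      ‖{p : (Fin 2 → ℝ) × ℝ | ‖p.1 - w‖ ≤ r}.indicator F p‖ₑ ^ 2 =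
      {q : (Fin 2 → ℝ) × ((Fin 2 → ℝ) × ℝ) | ‖q.2.1 - q.1‖ ≤ r}.indicator
        (fun q => ‖F q.2‖ₑ ^ 2) (w, p) := by
    intro w p
    by_cases h : ‖p.1 - w‖ ≤ r <;> simp [h]
  simp only [e]
  rw [lintegral_lintegral_swap hm.aemeasurable, ← lintegral_const_mul _ (by fun_prop)]
  refine lintegral_congr fun p => ?_
  have e2 : ∀ w, {q : (Fin 2 → ℝ) × ((Fin 2 → ℝ) × ℝ) | ‖q.2.1 - q.1‖ ≤ r}.indicator
        (fun q => ‖F q.2‖ₑ ^ 2) (w, p) =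
      (Metric.closedBall p.1 r).indicator (fun _ => ‖F p‖ₑ ^ 2) w := by
    intro w
    by_cases h : ‖p.1 - w‖ ≤ r
    · have h' : dist w p.1 ≤ r := by rwa [dist_comm, dist_eq_norm]
      simp [h, h']
    · have h' : ¬ dist w p.1 ≤ r := by rwa [dist_comm, dist_eq_norm]
      simp [h, h']
  simp only [e2]
  rw [lintegral_indicator_const Metric.isClosed_closedBall.measurableSet,
    Real.volume_pi_closedBall _ hr, mul_comm]
  simp

/-- Averaging over all tube centres w gives h²cψ on the left. On the right the data inside the tubes
give (2ρh)² and those outside a negligible error, so the two factors h² cancel and the tube estimate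
holds without localization. -/
theorem IsModel.exists_short_interval_estimate (hM : IsModel S Kx Kt O κ) (hχ : Continuous χ)
    (hχK : tsupport χ ⊆ Kx) (hη : ContDiff ℝ ∞ η) (hηc : HasCompactSupport η)
    (hψ : Continuous ψ) (hψs : tsupport ψ ⊆ Metric.closedBall 0 1) (hψ0 : ψ 0 = 1)
    (hϑ : ContDiff ℝ ∞ ϑ) (hϑs : tsupport ϑ ⊆ freqAnnulus) (hKy : IsCompact Ky)
    {T D : ℝ} (hT : ∀ t ∈ Kt, |t| ≤ T) (hD : 0 ≤ D) (N : ℕ) :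
    ∃ C ≥ 0, ∀ (lam h q tI : ℝ) (F : (Fin 2 → ℝ) × ℝ → ℂ), 1 ≤ lam → 0 < h → h ≤ 1 → q ≤ h →
      (lam * h ^ 2)⁻¹ ^ N ≤ lam⁻¹ ^ 3 → |tI| ≤ T → NearDecay S χ η ψ Kt T D lam h q →
      IsDatum Ky (Kt ∩ Set.Ico tI (tI + q)) F →
      ∫⁻ x, ‖physOp S χ η ϑ lam h F x‖ₑ ^ 2 ≤
        ENNReal.ofReal (C * lam⁻¹ ^ 5 * h⁻¹) * ∫⁻ p, ‖F p‖ₑ ^ 2 := by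
  have hχc : HasCompactSupport χ := hM.compact_x.of_isClosed_subset (isClosed_tsupport χ) hχK
  have hψc : HasCompactSupport ψ :=
    (isCompact_closedBall _ _).of_isClosed_subset (isClosed_tsupport ψ) hψs
  have hϑc : HasCompactSupport ϑ :=
    isCompact_freqAnnulus.of_isClosed_subset (isClosed_tsupport ϑ) hϑs
  obtain ⟨A, hA, hAb⟩ := exists_tube_estimate (Kt := Kt) (Ky := Ky) (T := T) hM.smooth hχ hχc
    hη.continuous hηc hψ hψc hϑ hϑs hD
  obtain ⟨B, hB, ρ, hρ, hBb⟩ := hM.exists_off_tube_bound (Ky := Ky) hχK hη hηc hψs hϑ hϑs hT N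
  -- the constants coming from the cutoffs
  have sq_int : ∀ {E : Type} [NormedAddCommGroup E] [NormedSpace ℝ E] [FiniteDimensional ℝ E]
      [MeasurableSpace E] [BorelSpace E] (ρ : Measure E) [IsFiniteMeasureOnCompacts ρ] {f : E → ℝ},
      Continuous f → HasCompactSupport f →
        ∫⁻ x, ‖f x‖ₑ ^ 2 ∂ρ = ENNReal.ofReal (∫ x, f x ^ 2 ∂ρ) := by
    intro E _ _ _ _ _ ρ _ f hf hfc
    have hi : Integrable (fun x => f x ^ 2) ρ := by
      refine (hf.pow 2).integrable_of_hasCompactSupport (hfc.mono fun x hx => ?_)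
      simp only [Function.mem_support] at hx ⊢
      contrapose! hx
      simp [hx]
    rw [ofReal_integral_eq_lintegral_ofReal hi (Filter.Eventually.of_forall fun _ => sq_nonneg _)]
    refine lintegral_congr fun x => ?_
    rw [← ofReal_norm, ← ENNReal.ofReal_pow (norm_nonneg _), Real.norm_eq_abs, sq_abs]
  set cψ := ∫ w, ψ w ^ 2 with hcψ
  have hcψ0 : 0 < cψ := by
    refine Continuous.integral_pos_of_hasCompactSupport_nonneg_nonzero (hψ.pow 2)
      (hψc.mono fun x hx => ?_) (fun _ => sq_nonneg _) (x := 0) (by simp [hψ0])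
    simp only [Function.mem_support] at hx ⊢
    contrapose! hx
    simp [hx]
  set cχ := ∫ x, χ x ^ 2 with hcχ
  have hcχ0 : 0 ≤ cχ := integral_nonneg fun _ => sq_nonneg _
  set vK := (volume (Ky ×ˢ Kt)).toReal with hvK
  have hvK1 : volume (Ky ×ˢ Kt) = ENNReal.ofReal vK :=
    (ENNReal.ofReal_toReal (hKy.prod hM.compact_t).measure_lt_top.ne).symm
  have hvK0 : 0 ≤ vK := ENNReal.toReal_nonneg
  refine ⟨cψ⁻¹ * (4 * (A * (2 * ρ) ^ 2 + B ^ 2 * cψ * cχ * vK)), by positivity, ?_⟩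
  intro lam h q tI F hlam hh hh1 hq hN htI hnear hF
  have hlam0 : 0 < lam := by linarith
  set J := ∫⁻ p, ‖F p‖ₑ ^ 2 with hJ
  set I := ∫⁻ x, ‖physOp S χ η ϑ lam h F x‖ₑ ^ 2 with hI
  set tube : (Fin 2 → ℝ) → Set ((Fin 2 → ℝ) × ℝ) := fun w => {p | ‖p.1 - w‖ ≤ ρ * h} with htube
  have htm : ∀ w, MeasurableSet (tube w) := fun w =>
    (isClosed_le (by fun_prop) continuous_const).measurableSet
  set E := ENNReal.ofReal (B * (lam * h ^ 2)⁻¹ ^ N) * ∫⁻ p, ‖F p‖ₑ with hE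
  have hpm := measurable_physOp hM.smooth hχ hη.continuous hηc hϑ.continuous hϑc hF lam h
  have hψm : Measurable fun q : (Fin 3 → ℝ) × (Fin 2 → ℝ) => ‖ψ (h⁻¹ • (S (q.1, tI) - q.2))‖ₑ := by
    have := hM.smooth.continuous
    exact (Continuous.measurable (by fun_prop)).enorm
  -- averaging over the tubes
  have e1 : ENNReal.ofReal (h ^ 2 * cψ) * I =
      ∫⁻ w, ∫⁻ x, ‖(ψ (h⁻¹ • (S (x, tI) - w)) : ℂ) * physOp S χ η ϑ lam h F x‖ₑ ^ 2 := by
    have e0 : ∀ (w : Fin 2 → ℝ) (x : Fin 3 → ℝ),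
        ‖(ψ (h⁻¹ • (S (x, tI) - w)) : ℂ) * physOp S χ η ϑ lam h F x‖ₑ ^ 2 =
        ‖ψ (h⁻¹ • (S (x, tI) - w))‖ₑ ^ 2 * ‖physOp S χ η ϑ lam h F x‖ₑ ^ 2 := fun w x => by
      rw [enorm_mul, mul_pow, ← ofReal_norm (ψ _), ← ofReal_norm (ψ _ : ℂ), Complex.norm_real]
    simp only [e0]
    rw [lintegral_lintegral_swap, hI, ← lintegral_const_mul _ (by fun_prop)]
    · refine lintegral_congr fun x => ?_
      have m1 : Measurable fun w => ‖ψ (h⁻¹ • (S (x, tI) - w))‖ₑ ^ 2 :=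
        (hψm.comp measurable_prodMk_left).pow_const 2
      rw [lintegral_mul_const _ m1, lintegral_tube_cutoff hψ _ hh, sq_int volume hψ hψc, ENNReal.ofReal_mul (by positivity)]
    · refine Measurable.aemeasurable ?_
      exact ((hψm.comp measurable_swap).pow_const 2).mul ((hpm.comp measurable_snd).enorm.pow_const 2)
  -- For each w the datum is split at |y' - w| = ρh. The inner part obeys the tube estimate, the
  -- outer part the rapid decay of the frequency integral.
  have e2 : ∀ w, ∫⁻ x, ‖(ψ (h⁻¹ • (S (x, tI) - w)) : ℂ) * physOp S χ η ϑ lam h F x‖ₑ ^ 2 ≤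
      4 * (ENNReal.ofReal (A * lam⁻¹ ^ 5 * h⁻¹) * ∫⁻ p, ‖(tube w).indicator F p‖ₑ ^ 2) +
        4 * ∫⁻ x, E ^ 2 * (‖ψ (h⁻¹ • (S (x, tI) - w))‖ₑ ^ 2 * ‖χ x‖ₑ ^ 2) := by
    intro w
    have hin := hF.indicator (htm w)
    have hout := hF.indicator (htm w).compl
    have hsplit : ∀ x, physOp S χ η ϑ lam h F x =
        physOp S χ η ϑ lam h ((tube w).indicator F) x +
          physOp S χ η ϑ lam h ((tube w)ᶜ.indicator F) x := fun x => by
      rw [← physOp_add hM.smooth hη.continuous hηc hϑ.continuous hϑc hin hout,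
        Set.indicator_self_add_compl]
    have hmB : Measurable fun x => E ^ 2 * (‖ψ (h⁻¹ • (S (x, tI) - w))‖ₑ ^ 2 * ‖χ x‖ₑ ^ 2) :=
      (((hψm.comp measurable_prodMk_right).pow_const 2).mul
        (hχ.measurable.enorm.pow_const 2)).const_mul _
    calc _ ≤ ∫⁻ x, (4 * ‖(ψ (h⁻¹ • (S (x, tI) - w)) : ℂ) *
            physOp S χ η ϑ lam h ((tube w).indicator F) x‖ₑ ^ 2 +
          4 * (E ^ 2 * (‖ψ (h⁻¹ • (S (x, tI) - w))‖ₑ ^ 2 * ‖χ x‖ₑ ^ 2))) := by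
          refine lintegral_mono fun x => ?_
          simp only []
          rw [hsplit x, mul_add, ← mul_add 4]
          refine (pow_le_pow_left' (enorm_add_le _ _) 2).trans
            ((ennreal_add_sq_le _ _).trans ?_)
          gcongr
          have h5 := hBb lam h q tI w _ x hlam0 hh hh1 hq htI hout (fun p hp => by
            rw [Set.indicator_of_notMem]
            exact fun h0 => h0 hp)
          have h6 : ∫⁻ p, ‖(tube w)ᶜ.indicator F p‖ₑ ≤ ∫⁻ p, ‖F p‖ₑ :=
            lintegral_mono fun p => by
              simp only []
              rw [enorm_indicator_eq_indicator_enorm]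
              exact Set.indicator_le_self _ _ p
          refine (pow_le_pow_left' h5 2).trans ?_
          rw [hE, ← mul_pow, ← mul_pow]
          gcongr ?_ ^ 2
          calc _ ≤ ENNReal.ofReal (B * (lam * h ^ 2)⁻¹ ^ N) *
                (‖ψ (h⁻¹ • (S (x, tI) - w))‖ₑ * ‖χ x‖ₑ) * ∫⁻ p, ‖F p‖ₑ := by gcongr
            _ = _ := by ring
      _ = 4 * (∫⁻ x, ‖(ψ (h⁻¹ • (S (x, tI) - w)) : ℂ) *
            physOp S χ η ϑ lam h ((tube w).indicator F) x‖ₑ ^ 2) +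
          4 * ∫⁻ x, E ^ 2 * (‖ψ (h⁻¹ • (S (x, tI) - w))‖ₑ ^ 2 * ‖χ x‖ₑ ^ 2) := by
          rw [lintegral_add_right _ (hmB.const_mul 4), lintegral_const_mul' _ _ (by simp),
            lintegral_const_mul' _ _ (by simp)]
      _ ≤ _ := by
          gcongr
          exact hAb lam h q tI w _ hlam0 hh htI hnear hin
  have e3 : ∫⁻ w, ∫⁻ x, E ^ 2 * (‖ψ (h⁻¹ • (S (x, tI) - w))‖ₑ ^ 2 * ‖χ x‖ₑ ^ 2) =
      E ^ 2 * (ENNReal.ofReal (h ^ 2 * cψ) * ENNReal.ofReal cχ) := by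
    have hm3 : Measurable fun q : (Fin 2 → ℝ) × (Fin 3 → ℝ) =>
        E ^ 2 * (‖ψ (h⁻¹ • (S (q.2, tI) - q.1))‖ₑ ^ 2 * ‖χ q.2‖ₑ ^ 2) :=
      (((hψm.comp measurable_swap).pow_const 2).mul
        ((hχ.measurable.comp measurable_snd).enorm.pow_const 2)).const_mul _
    rw [lintegral_lintegral_swap hm3.aemeasurable]
    have : ∀ x, ∫⁻ w, E ^ 2 * (‖ψ (h⁻¹ • (S (x, tI) - w))‖ₑ ^ 2 * ‖χ x‖ₑ ^ 2) =
        E ^ 2 * ENNReal.ofReal (h ^ 2 * cψ) * ‖χ x‖ₑ ^ 2 := fun x => by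
      have m1 : Measurable fun w => ‖ψ (h⁻¹ • (S (x, tI) - w))‖ₑ ^ 2 :=
        (hψm.comp measurable_prodMk_left).pow_const 2
      rw [lintegral_const_mul _ (m1.mul_const _), lintegral_mul_const _ m1,
        lintegral_tube_cutoff hψ _ hh, sq_int volume hψ hψc, ENNReal.ofReal_mul (by positivity)]
      ring
    simp only [this]
    rw [lintegral_const_mul _ (by fun_prop), sq_int volume hχ hχc, mul_assoc]
  have hmt : Measurable fun w : Fin 2 → ℝ => ∫⁻ p, ‖(tube w).indicator F p‖ₑ ^ 2 := by
    have hset : MeasurableSet {q : (Fin 2 → ℝ) × ((Fin 2 → ℝ) × ℝ) | ‖q.2.1 - q.1‖ ≤ ρ * h} :=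
      (isClosed_le (by fun_prop) continuous_const).measurableSet
    have hm0 := hF.measurable
    have hm4 : Measurable fun q : (Fin 2 → ℝ) × ((Fin 2 → ℝ) × ℝ) =>
        ‖{q : (Fin 2 → ℝ) × ((Fin 2 → ℝ) × ℝ) | ‖q.2.1 - q.1‖ ≤ ρ * h}.indicator
          (fun q => F q.2) q‖ₑ ^ 2 :=
      ((Measurable.indicator (by fun_prop) hset).enorm.pow_const 2)
    exact hm4.lintegral_prod_right'
  have e4 : ENNReal.ofReal (h ^ 2 * cψ) * I ≤
      4 * (ENNReal.ofReal (A * lam⁻¹ ^ 5 * h⁻¹) * (ENNReal.ofReal ((2 * (ρ * h)) ^ 2) * J)) +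
        4 * (E ^ 2 * (ENNReal.ofReal (h ^ 2 * cψ) * ENNReal.ofReal cχ)) := by
    rw [e1]
    refine (lintegral_mono e2).trans_eq ?_
    rw [lintegral_add_left ((hmt.const_mul _).const_mul _), lintegral_const_mul' _ _ (by simp),
      lintegral_const_mul' _ _ (by simp), lintegral_const_mul' _ _ (by simp), e3,
      lintegral_lintegral_tube hF.measurable (by positivity)]
  -- The squared error is at most λ^{-6}, which is below λ^{-5}h^{-1}; passing from L¹ to L² costs
  -- the volume of the fixed compact set.
  have e5 : E ^ 2 ≤ ENNReal.ofReal (B ^ 2 * lam⁻¹ ^ 5 * h⁻¹) * (ENNReal.ofReal vK * J) := by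
    rw [hE, mul_pow]
    refine mul_le_mul' ?_ ?_
    · rw [← ENNReal.ofReal_pow (by positivity)]
      refine ENNReal.ofReal_le_ofReal ?_
      rw [mul_pow, mul_assoc]
      refine mul_le_mul_of_nonneg_left ?_ (sq_nonneg _)
      have h7 : ((lam * h ^ 2)⁻¹ ^ N) ^ 2 ≤ (lam⁻¹ ^ 3) ^ 2 :=
        pow_le_pow_left₀ (by positivity) hN 2
      have h8 : lam⁻¹ ≤ 1 := inv_le_one_of_one_le₀ hlam
      have h9 : 1 ≤ h⁻¹ := (one_le_inv₀ hh).2 hh1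
      calc _ ≤ (lam⁻¹ ^ 3) ^ 2 := h7
        _ = lam⁻¹ ^ 5 * lam⁻¹ := by ring
        _ ≤ lam⁻¹ ^ 5 * h⁻¹ := by gcongr; linarith
    · rw [← hvK1]
      exact (hF.mono Set.inter_subset_left).sq_lintegral_le hKy.measurableSet
        hM.compact_t.measurableSet
  have hpos : 0 < h ^ 2 * cψ := by positivity
  have e6 : I = ENNReal.ofReal ((h ^ 2 * cψ)⁻¹) * (ENNReal.ofReal (h ^ 2 * cψ) * I) := by
    rw [← mul_assoc, ← ENNReal.ofReal_mul (by positivity), inv_mul_cancel₀ hpos.ne',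
      ENNReal.ofReal_one, one_mul]
  rw [e6]
  calc _ ≤ ENNReal.ofReal ((h ^ 2 * cψ)⁻¹) *
        (4 * (ENNReal.ofReal (A * lam⁻¹ ^ 5 * h⁻¹) * (ENNReal.ofReal ((2 * (ρ * h)) ^ 2) * J)) +
        4 * (ENNReal.ofReal (B ^ 2 * lam⁻¹ ^ 5 * h⁻¹) * (ENNReal.ofReal vK * J) *
          (ENNReal.ofReal (h ^ 2 * cψ) * ENNReal.ofReal cχ))) := by
        gcongr
        refine e4.trans ?_
        gcongr
    _ = ENNReal.ofReal ((h ^ 2 * cψ)⁻¹ * (4 * (A * lam⁻¹ ^ 5 * h⁻¹ * (2 * (ρ * h)) ^ 2 +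
          B ^ 2 * lam⁻¹ ^ 5 * h⁻¹ * vK * (h ^ 2 * cψ * cχ)))) * J := by
        rw [ENNReal.ofReal_mul (p := (h ^ 2 * cψ)⁻¹) (by positivity),
          ENNReal.ofReal_mul (p := 4) (by positivity),
          ENNReal.ofReal_add (by positivity) (by positivity),
          ENNReal.ofReal_mul (p := A * lam⁻¹ ^ 5 * h⁻¹) (by positivity),
          ENNReal.ofReal_mul (p := B ^ 2 * lam⁻¹ ^ 5 * h⁻¹ * vK) (by positivity),
          ENNReal.ofReal_mul (p := B ^ 2 * lam⁻¹ ^ 5 * h⁻¹) (by positivity),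
          ENNReal.ofReal_mul (p := h ^ 2 * cψ) (by positivity), ENNReal.ofReal_ofNat]
        ring
    _ = _ := by
        congr 2
        field_simp

end ShortInterval

end FoldBlowdown
end

noncomputable section

namespace FoldBlowdown

/-! ### Summation over the intervals in `y₃` -/

/-- The restriction of `F` to the `j`-th interval of length `q`. -/
def slabPart (q : ℝ) (j : ℤ) (F : (Fin 2 → ℝ) × ℝ → ℂ) : (Fin 2 → ℝ) × ℝ → ℂ :=
  {p : (Fin 2 → ℝ) × ℝ | ⌊p.2 / q⌋ = j}.indicator F

theorem measurableSet_slab (q : ℝ) (j : ℤ) :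
    MeasurableSet {p : (Fin 2 → ℝ) × ℝ | ⌊p.2 / q⌋ = j} :=
  (Int.measurable_floor.comp (measurable_snd.div_const q)) (measurableSet_singleton j)

/-- The left endpoints jq serve as reference times t_I and must satisfy |t_I| ≤ T; the extra q in
the second condition leaves room for rounding down. -/
theorem exists_slab_indices {q : ℝ} (hq : 0 < q) (T : ℝ) :
    ∃ J : Finset ℤ, (∀ j ∈ J, |(j : ℝ) * q| ≤ T) ∧ ∀ t : ℝ, |t| + q ≤ T → ⌊t / q⌋ ∈ J := by
  refine ⟨(Finset.Icc (-⌈T / q⌉) ⌈T / q⌉).filter fun j => |(j : ℝ) * q| ≤ T,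
    fun j hj => (Finset.mem_filter.1 hj).2, fun t ht => ?_⟩
  have h1 : |(⌊t / q⌋ : ℝ) * q| ≤ T := by
    have h2 := Int.floor_le (t / q)
    have h3 := Int.lt_floor_add_one (t / q)
    rw [le_div_iff₀ hq] at h2
    rw [div_lt_iff₀ hq] at h3
    have h4 := abs_le.1 (le_refl |t|)
    rw [abs_le]
    constructor <;> nlinarith
  refine Finset.mem_filter.2 ⟨?_, h1⟩
  rw [abs_mul, abs_of_pos hq, ← le_div_iff₀ hq] at h1
  have h5 := abs_le.1 (h1.trans (Int.le_ceil _))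
  rw [Finset.mem_Icc]
  exact ⟨by exact_mod_cast h5.1, by exact_mod_cast h5.2⟩

section Slabs

variable {Ky : Set (Fin 2 → ℝ)} {Kt : Set ℝ} {F : (Fin 2 → ℝ) × ℝ → ℂ}

theorem sum_slabPart (q : ℝ) {J : Finset ℤ} (hJ : ∀ p, F p ≠ 0 → ⌊p.2 / q⌋ ∈ J) :
    (fun p => ∑ j ∈ J, slabPart q j F p) = F := by
  funext p
  by_cases hp : F p = 0
  · rw [hp]
    refine Finset.sum_eq_zero fun j _ => ?_
    by_cases h : ⌊p.2 / q⌋ = j <;> simp [slabPart, h, hp]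
  · rw [Finset.sum_eq_single_of_mem _ (hJ p hp)]
    · simp [slabPart]
    · intro j _ hj
      simp [slabPart, hj.symm]

theorem sum_lintegral_slabPart_le (q : ℝ) (J : Finset ℤ) (hF : Measurable F) {m : ℕ}
    (hm : m ≠ 0) : ∑ j ∈ J, ∫⁻ p, ‖slabPart q j F p‖ₑ ^ m ≤ ∫⁻ p, ‖F p‖ₑ ^ m := by
  have hm1 : ∀ j, Measurable (slabPart q j F) := fun j => hF.indicator (measurableSet_slab q j)
  rw [← lintegral_finsetSum _ fun j _ => (hm1 j).enorm.pow_const m]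
  refine lintegral_mono fun p => ?_
  have h : ∀ j, ‖slabPart q j F p‖ₑ ^ m = if ⌊p.2 / q⌋ = j then ‖F p‖ₑ ^ m else 0 := by
    intro j
    by_cases h : ⌊p.2 / q⌋ = j <;> simp [slabPart, h, hm]
  simp only [h]
  rw [Finset.sum_ite_eq]
  split_ifs
  · exact le_rfl
  · exact zero_le

theorem IsDatum.slabPart (hF : IsDatum Ky Kt F) {q : ℝ} (hq : 0 < q) (j : ℤ) :
    IsDatum Ky (Kt ∩ Set.Ico (j * q) (j * q + q)) (slabPart q j F) := by
  have h := hF.indicator (measurableSet_slab q j)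
  refine ⟨h.measurable, h.integrable, fun p hp => ?_⟩
  by_contra h0
  have h1 : ⌊p.2 / q⌋ = j := by
    by_contra h2
    exact h0 (by simp [FoldBlowdown.slabPart, h2])
  have h2 : F p ≠ 0 := by
    intro h2
    exact h0 (by simp [FoldBlowdown.slabPart, h1, h2])
  have h3 : p ∈ Ky ×ˢ Kt := by
    by_contra h3
    exact h2 (hF.support p h3)
  have h4 := Int.floor_eq_iff.1 h1
  rw [le_div_iff₀ hq, div_lt_iff₀ hq] at h4
  exact hp ⟨h3.1, h3.2, h4.1, by linarith [h4.2]⟩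

end Slabs

theorem sum_near_le (J : Finset ℤ) (m : ℕ) (I : ℤ → ℝ≥0∞) :
    ∑ i ∈ J, ∑ j ∈ J, (if |i - j| ≤ (m : ℤ) then I i + I j else 0) ≤
      2 * (2 * m + 1) * ∑ i ∈ J, I i := by
  have hcard : ∀ i : ℤ, ((J.filter fun j => |i - j| ≤ (m : ℤ)).card : ℝ≥0∞) ≤ 2 * m + 1 := by
    intro i
    have h1 : (J.filter fun j => |i - j| ≤ (m : ℤ)) ⊆ Finset.Icc (i - m) (i + m) := by
      intro j hj
      have := abs_le.1 (Finset.mem_filter.1 hj).2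
      rw [Finset.mem_Icc]
      omega
    have h2 := Finset.card_le_card h1
    rw [Int.card_Icc] at h2
    have h3 : (J.filter fun j => |i - j| ≤ (m : ℤ)).card ≤ 2 * m + 1 := by omega
    exact_mod_cast h3
  have h1 : ∀ i, ∑ j ∈ J, (if |i - j| ≤ (m : ℤ) then I i else 0) ≤ (2 * m + 1) * I i := by
    intro i
    rw [← Finset.sum_filter, Finset.sum_const, nsmul_eq_mul]
    gcongr
    exact hcard i
  have h2 : ∀ i j, (if |i - j| ≤ (m : ℤ) then I i + I j else 0) =
      (if |i - j| ≤ (m : ℤ) then I i else 0) + (if |j - i| ≤ (m : ℤ) then I j else 0) := by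
    intro i j
    rw [abs_sub_comm j i]
    split_ifs <;> simp
  simp only [h2, Finset.sum_add_distrib]
  have h3 : ∑ i ∈ J, ∑ j ∈ J, (if |j - i| ≤ (m : ℤ) then I j else 0) =
      ∑ i ∈ J, ∑ j ∈ J, (if |i - j| ≤ (m : ℤ) then I i else 0) := Finset.sum_comm
  rw [h3, ← two_mul, mul_assoc]
  refine mul_le_mul' le_rfl ((Finset.sum_le_sum fun i _ => h1 i).trans_eq ?_)
  rw [Finset.mul_sum]

section LongInterval

variable {S : (Fin 3 → ℝ) × ℝ → (Fin 2 → ℝ)} {Kx : Set (Fin 3 → ℝ)} {Kt : Set ℝ}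
  {O : Set ((Fin 3 → ℝ) × ℝ)} {κ : (Fin 3 → ℝ) × ℝ → ℝ} {Ky : Set (Fin 2 → ℝ)}
  {χ : (Fin 3 → ℝ) → ℝ} {η : ℝ → ℝ} {ψ : (Fin 2 → ℝ) → ℝ} {ϑ : (Fin 2 → ℝ) → ℝ}

/-- The kernel of T*T between separated time sets is uniformly small, so the pairing is bounded by
that size times the L¹ norms. -/
theorem IsModel.exists_far_pairing_bound (hM : IsModel S Kx Kt O κ) (hχ : ContDiff ℝ ∞ χ)
    (hχK : tsupport χ ⊆ Kx) (hη : ContDiff ℝ ∞ η) (hηc : HasCompactSupport η)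
    (hϑ : ContDiff ℝ ∞ ϑ) (hϑs : tsupport ϑ ⊆ freqAnnulus) (N : ℕ) :
    ∃ C ≥ 0, ∃ δ > 0, ∃ C₁ ≥ 1, ∀ (lam h : ℝ) (A A' : Set ℝ) (F F' : (Fin 2 → ℝ) × ℝ → ℂ),
      0 < lam → 0 < h → h ≤ 1 → IsDatum Ky (Kt ∩ A) F → IsDatum Ky (Kt ∩ A') F' →
      (∀ t ∈ A, ∀ t' ∈ A', C₁ * h ≤ |t' - t| ∧ |t' - t| ≤ δ) →
      ‖∫ x, (starRingEnd ℂ) (physOp S χ η ϑ lam h F x) * physOp S χ η ϑ lam h F' x‖ₑ ≤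
        ENNReal.ofReal (C * (lam * h ^ 2)⁻¹ ^ N) * ((∫⁻ p, ‖F p‖ₑ) * ∫⁻ p, ‖F' p‖ₑ) := by
  have hϑc : HasCompactSupport ϑ :=
    isCompact_freqAnnulus.of_isClosed_subset (isClosed_tsupport ϑ) hϑs
  have hχc : HasCompactSupport χ := hM.compact_x.of_isClosed_subset (isClosed_tsupport χ) hχK
  -- A tube cutoff with ψ(0) = 1, used with e = 0, is identically 1 in the kernels, so the far bound
  -- applies as it stands.
  obtain ⟨ψ, hψ1, hψc, hψ, -⟩ : ∃ ψ : (Fin 2 → ℝ) → ℝ, ψ 0 = 1 ∧ HasCompactSupport ψ ∧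
      ContDiff ℝ ∞ ψ ∧ True := by
    let b : ContDiffBump (0 : Fin 2 → ℝ) := ⟨1, 2, one_pos, one_lt_two⟩
    exact ⟨b, b.one_of_mem_closedBall (by simpa using b.rIn_pos.le), b.hasCompactSupport,
      b.contDiff, trivial⟩
  obtain ⟨C, hC, δ, hδ, C₁, hC₁, hb⟩ := hM.exists_far_bound hχ hχK hη hηc hψ hψc N
  obtain ⟨b₁, hb₁⟩ := hη.continuous.bounded_above_of_compact_support hηc
  have hχi : Integrable fun x => (|χ x| * b₁) ^ 2 := by
    have := hχ.continuous
    refine Continuous.integrable_of_hasCompactSupport (by fun_prop) (hχc.mono fun x hx => ?_)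
    simp only [Function.mem_support] at hx ⊢
    contrapose! hx
    simp [hx]
  set cϑ := ∫ θ, |ϑ θ| with hcϑ
  have hcϑ0 : 0 ≤ cϑ := integral_nonneg fun _ => abs_nonneg _
  have hcϑ1 : ∫⁻ θ, ‖ϑ θ‖ₑ = ENNReal.ofReal cϑ :=
    (ofReal_integral_norm_eq_lintegral_enorm
      (hϑ.continuous.integrable_of_hasCompactSupport hϑc)).symm
  refine ⟨C * cϑ ^ 2, by positivity, δ, hδ, C₁, hC₁, ?_⟩
  intro lam h A A' F F' hlam hh hh1 hF hF' hsep
  have hop : ∀ {B : Set ℝ} {G : (Fin 2 → ℝ) × ℝ → ℂ}, IsDatum Ky (Kt ∩ B) G → ∀ x,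
      physOp S χ η ϑ lam h G x =
        ∫ z, waveKernel S χ η ψ lam h 0 0 0 (x, z) * freqSide ϑ lam G z := fun hG x => by
    rw [integral_waveKernel_mul_freqSide hM.smooth hχ.continuous hη.continuous hηc hψ.continuous
      hϑ.continuous hϑc hG, zero_smul, hψ1, Complex.ofReal_one, one_mul]
  simp only [hop hF, hop hF']
  have hE0 : 0 ≤ C * (lam * h ^ 2)⁻¹ ^ N := by positivity
  refine (enorm_integral_pairing_le (b := fun x => |χ x| * b₁)
    (continuous_waveKernel hM.smooth hχ.continuous hη.continuous hψ.continuous _ _ _ _ _).measurable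
    hχi (fun x z => ?_) (hF.integrable_freqSide hϑ.continuous hϑc lam)
    (hF'.integrable_freqSide hϑ.continuous hϑc lam)).trans ?_
  · rw [norm_waveKernel, zero_smul, hψ1, abs_one, mul_one]
    have := hb₁ (h⁻¹ * curv S z.1 (x, z.2))
    rw [Real.norm_eq_abs] at this
    gcongr
  · have m1 := measurable_freqSide hϑ.continuous lam hF.measurable
    have m2 := measurable_freqSide hϑ.continuous lam hF'.measurable
    calc _ ≤ ∫⁻ p : ((Fin 2 → ℝ) × ℝ) × ((Fin 2 → ℝ) × ℝ), ‖freqSide ϑ lam F p.1‖ₑ *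
          ‖freqSide ϑ lam F' p.2‖ₑ * ENNReal.ofReal (C * (lam * h ^ 2)⁻¹ ^ N)
            ∂(volume.prod volume) := by
          refine lintegral_mono fun p => ?_
          simp only []
          by_cases h1 : p.1 ∈ freqAnnulus ×ˢ (Kt ∩ A)
          · by_cases h2 : p.2 ∈ freqAnnulus ×ˢ (Kt ∩ A')
            · gcongr
              rw [integral_conj_waveKernel_mul, ← ofReal_norm]
              have h3 := hsep _ h1.2.2 _ h2.2.2
              exact ENNReal.ofReal_le_ofReal (hb lam h p.1 p.2 hlam hh hh1 ⟨h1.1, h1.2.1⟩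
                ⟨h2.1, h2.2.1⟩ h3.1 h3.2)
            · simp [hF'.freqSide_eq_zero hϑs lam h2]
          · simp [hF.freqSide_eq_zero hϑs lam h1]
      _ = (∫⁻ z, ‖freqSide ϑ lam F z‖ₑ) * (∫⁻ z, ‖freqSide ϑ lam F' z‖ₑ) *
          ENNReal.ofReal (C * (lam * h ^ 2)⁻¹ ^ N) := by
          rw [lintegral_mul_const _ (by fun_prop), lintegral_prod_mul
            (f := fun z => ‖freqSide ϑ lam F z‖ₑ) (g := fun z => ‖freqSide ϑ lam F' z‖ₑ)
            (by fun_prop) (by fun_prop)]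
      _ ≤ (ENNReal.ofReal cϑ * ∫⁻ p, ‖F p‖ₑ) * (ENNReal.ofReal cϑ * ∫⁻ p, ‖F' p‖ₑ) *
          ENNReal.ofReal (C * (lam * h ^ 2)⁻¹ ^ N) := by
          rw [← hcϑ1]
          gcongr
          · exact lintegral_freqSide_le hϑ.continuous lam hF.measurable
          · exact lintegral_freqSide_le hϑ.continuous lam hF'.measurable
      _ = _ := by
          have e : C * cϑ ^ 2 * (lam * h ^ 2)⁻¹ ^ N = cϑ * (cϑ * (C * (lam * h ^ 2)⁻¹ ^ N)) := by
            ring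
          rw [e, ENNReal.ofReal_mul hcϑ0, ENNReal.ofReal_mul hcϑ0]
          ring

theorem integrable_physOp_pairing (hM : IsModel S Kx Kt O κ) (hχ : Continuous χ)
    (hχK : tsupport χ ⊆ Kx) (hη : Continuous η) (hηc : HasCompactSupport η)
    (hϑ : Continuous ϑ) (hϑc : HasCompactSupport ϑ) {lam h : ℝ} {F F' : (Fin 2 → ℝ) × ℝ → ℂ}
    (hF : IsDatum Ky Kt F) (hF' : IsDatum Ky Kt F') :
    Integrable fun x =>
      (starRingEnd ℂ) (physOp S χ η ϑ lam h F x) * physOp S χ η ϑ lam h F' x := by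
  have hχc : HasCompactSupport χ := hM.compact_x.of_isClosed_subset (isClosed_tsupport χ) hχK
  have hop : ∀ {G : (Fin 2 → ℝ) × ℝ → ℂ}, IsDatum Ky Kt G → ∀ x,
      physOp S χ η ϑ lam h G x =
        ∫ z, waveKernel S χ η (fun _ => 1) lam h 0 0 0 (x, z) * freqSide ϑ lam G z := fun hG x => by
    rw [integral_waveKernel_mul_freqSide hM.smooth hχ hη hηc continuous_const
      hϑ hϑc hG, Complex.ofReal_one, one_mul]
  obtain ⟨b₁, hb₁⟩ := hη.bounded_above_of_compact_support hηc
  have hχi : Integrable fun x => (|χ x| * b₁) ^ 2 := by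
    refine Continuous.integrable_of_hasCompactSupport (by fun_prop) (hχc.mono fun x hx => ?_)
    simp only [Function.mem_support] at hx ⊢
    contrapose! hx
    simp [hx]
  simp only [hop hF, hop hF']
  refine integrable_pairing (b := fun x => |χ x| * b₁)
    (continuous_waveKernel hM.smooth hχ hη continuous_const _ _ _ _ _).measurable
    hχi (fun x z => ?_) (hF.integrable_freqSide hϑ hϑc lam) (hF'.integrable_freqSide hϑ hϑc lam)
  rw [norm_waveKernel, abs_one, mul_one]
  have := hb₁ (h⁻¹ * curv S z.1 (x, z.2))
  rw [Real.norm_eq_abs] at this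
  gcongr

/-- Expand the squared norm over pairs of slabs of length q. Pairs within C₁h number O(h/q) for each
slab and are bounded through the short-interval estimate; all other pairs are almost orthogonal. -/
theorem IsModel.exists_long_interval_estimate (hM : IsModel S Kx Kt O κ) (hχ : ContDiff ℝ ∞ χ)
    (hχK : tsupport χ ⊆ Kx) (hη : ContDiff ℝ ∞ η) (hηc : HasCompactSupport η)
    (hψ : Continuous ψ) (hψs : tsupport ψ ⊆ Metric.closedBall 0 1) (hψ0 : ψ 0 = 1)
    (hϑ : ContDiff ℝ ∞ ϑ) (hϑs : tsupport ϑ ⊆ freqAnnulus) (hKy : IsCompact Ky)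
    {T D : ℝ} (hT : ∀ t ∈ Kt, |t| + 1 ≤ T) (hD : 0 ≤ D) (N : ℕ) :
    ∃ C ≥ 0, ∃ δ > 0, ∀ (lam h q a : ℝ) (F : (Fin 2 → ℝ) × ℝ → ℂ), 1 ≤ lam → 0 < h → h ≤ 1 →
      0 < q → q ≤ h → (lam * h ^ 2)⁻¹ ^ N ≤ lam⁻¹ ^ 5 → NearDecay S χ η ψ Kt T D lam h q →
      IsDatum Ky (Kt ∩ Set.Ico a (a + δ)) F →
      ∫⁻ x, ‖physOp S χ η ϑ lam h F x‖ₑ ^ 2 ≤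
        ENNReal.ofReal (C * (h / q) * lam⁻¹ ^ 5 * h⁻¹) * ∫⁻ p, ‖F p‖ₑ ^ 2 := by
  have hϑc : HasCompactSupport ϑ :=
    isCompact_freqAnnulus.of_isClosed_subset (isClosed_tsupport ϑ) hϑs
  obtain ⟨B, hB, hshort⟩ := hM.exists_short_interval_estimate (Ky := Ky) (T := T) hχ.continuous hχK
    hη hηc hψ hψs hψ0 hϑ hϑs hKy (fun t ht => by linarith [hT t ht]) hD N
  obtain ⟨E, hE, δ, hδ, C₁, hC₁, hfar⟩ :=
    hM.exists_far_pairing_bound (Ky := Ky) hχ hχK hη hηc hϑ hϑs N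
  set vK := (volume (Ky ×ˢ Kt)).toReal with hvK
  have hvK1 : volume (Ky ×ˢ Kt) = ENNReal.ofReal vK :=
    (ENNReal.ofReal_toReal (hKy.prod hM.compact_t).measure_lt_top.ne).symm
  have hvK0 : 0 ≤ vK := ENNReal.toReal_nonneg
  refine ⟨2 * (2 * C₁ + 3) * B + E * vK, by positivity, δ, hδ, ?_⟩
  intro lam h q a F hlam hh hh1 hq hqh hN hnear hF
  have hlam0 : 0 < lam := by linarith
  have hlami : lam⁻¹ ≤ 1 := inv_le_one_of_one_le₀ hlam
  have hN3 : (lam * h ^ 2)⁻¹ ^ N ≤ lam⁻¹ ^ 3 :=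
    hN.trans (pow_le_pow_of_le_one (by positivity) hlami (by norm_num))
  obtain ⟨J, hJ1, hJ2⟩ := exists_slab_indices hq T
  set f : ℤ → (Fin 2 → ℝ) × ℝ → ℂ := fun j => slabPart q j F with hf
  have hfd := fun j => hF.slabPart hq j
  have hfK : ∀ j, IsDatum Ky Kt (f j) := fun j =>
    (hfd j).mono (Set.inter_subset_left.trans Set.inter_subset_left)
  have hsum : F = fun p => ∑ j ∈ J, f j p := by
    refine (sum_slabPart q fun p hp => hJ2 _ ?_).symm
    have : p ∈ Ky ×ˢ (Kt ∩ Set.Ico a (a + δ)) := by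
      by_contra h0
      exact hp (hF.support p h0)
    linarith [hT _ this.2.1]
  -- An index gap of at least m + 1 separates two slabs by at least mq ≥ C₁h; one slab length is
  -- lost to positions inside the slabs.
  set m := ⌈C₁ * h / q⌉₊ with hm
  set I : ℤ → ℝ≥0∞ := fun j => ∫⁻ x, ‖physOp S χ η ϑ lam h (f j) x‖ₑ ^ 2 with hI
  set G : ℤ → ℝ≥0∞ := fun j => ∫⁻ p, ‖f j p‖ₑ with hG
  have hpm : ∀ j, Measurable (physOp S χ η ϑ lam h (f j)) := fun j =>
    measurable_physOp hM.smooth hχ.continuous hη.continuous hηc hϑ.continuous hϑc (hfK j) lam h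
  have hint : ∀ i j, Integrable fun x => (starRingEnd ℂ) (physOp S χ η ϑ lam h (f i) x) *
      physOp S χ η ϑ lam h (f j) x := fun i j =>
    integrable_physOp_pairing hM hχ.continuous hχK hη.continuous hηc hϑ.continuous hϑc
      (hfK i) (hfK j)
  have hop : ∀ x, physOp S χ η ϑ lam h F x = ∑ j ∈ J, physOp S χ η ϑ lam h (f j) x := fun x => by
    conv_lhs => rw [hsum]
    exact physOp_finset_sum hM.smooth hη.continuous hηc hϑ.continuous hϑc J hfK lam h x
  have hexp : ∀ x, (starRingEnd ℂ) (physOp S χ η ϑ lam h F x) * physOp S χ η ϑ lam h F x =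
      ∑ i ∈ J, ∑ j ∈ J, (starRingEnd ℂ) (physOp S χ η ϑ lam h (f i) x) *
        physOp S χ η ϑ lam h (f j) x := fun x => by
    rw [hop, map_sum, Finset.sum_mul_sum]
  -- near and far pairs
  have hpair : ∀ i ∈ J, ∀ j ∈ J, ‖∫ x, (starRingEnd ℂ) (physOp S χ η ϑ lam h (f i) x) *
      physOp S χ η ϑ lam h (f j) x‖ₑ ≤ (if |i - j| ≤ (m : ℤ) then I i + I j else 0) +
        ENNReal.ofReal (E * (lam * h ^ 2)⁻¹ ^ N) * (G i * G j) := by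
    intro i _ j _
    split_ifs with hij
    · refine le_trans ?_ le_self_add
      refine (enorm_integral_le_lintegral_enorm _).trans ?_
      simp only [hI]
      rw [← lintegral_add_left ((hpm i).enorm.pow_const 2)]
      refine lintegral_mono fun x => ?_
      simp only []
      rw [enorm_mul, RCLike.enorm_conj]
      exact ennreal_mul_le_sq_add_sq _ _
    · rw [zero_add]
      have hi := hfd i
      have hj := hfd j
      rw [Set.inter_assoc] at hi hj
      refine hfar lam h _ _ (f i) (f j) hlam0 hh hh1 hi hj ?_
      rintro t ⟨⟨h1, h2⟩, h3, h4⟩ t' ⟨⟨h1', h2'⟩, h3', h4'⟩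
      constructor
      · have h5 : C₁ * h ≤ m * q := by
          rw [← div_le_iff₀ hq]
          exact Nat.le_ceil _
        have h6 : (m : ℤ) + 1 ≤ |i - j| := by omega
        have h7 : (m : ℝ) + 1 ≤ |(i : ℝ) - j| := by exact_mod_cast h6
        refine h5.trans ?_
        rcases le_total (j : ℝ) i with h8 | h8
        · rw [abs_of_nonneg (by linarith)] at h7
          refine le_trans ?_ (neg_le_abs _)
          nlinarith
        · rw [abs_of_nonpos (by linarith)] at h7
          refine le_trans ?_ (le_abs_self _)
          nlinarith
      · rw [abs_le]
        constructor <;> linarith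
  have e1 : ∫⁻ x, ‖physOp S χ η ϑ lam h F x‖ₑ ^ 2 ≤ ∑ i ∈ J, ∑ j ∈ J,
      ‖∫ x, (starRingEnd ℂ) (physOp S χ η ϑ lam h (f i) x) *
        physOp S χ η ϑ lam h (f j) x‖ₑ := by
    rw [lintegral_enorm_sq_eq]
    · simp only [hexp]
      rw [integral_finsetSum _ fun i _ => integrable_finsetSum _ fun j _ => hint i j]
      refine (enorm_sum_le _ _).trans (Finset.sum_le_sum fun i _ => ?_)
      rw [integral_finsetSum _ fun j _ => hint i j]
      exact enorm_sum_le _ _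
    · simp only [hexp]
      exact integrable_finsetSum _ fun i _ => integrable_finsetSum _ fun j _ => hint i j
  have e2 : ∑ i ∈ J, I i ≤ ENNReal.ofReal (B * lam⁻¹ ^ 5 * h⁻¹) * ∫⁻ p, ‖F p‖ₑ ^ 2 := by
    calc ∑ i ∈ J, I i ≤ ∑ i ∈ J, ENNReal.ofReal (B * lam⁻¹ ^ 5 * h⁻¹) * ∫⁻ p, ‖f i p‖ₑ ^ 2 := by
          refine Finset.sum_le_sum fun i hi => ?_
          refine hshort lam h q (i * q) (f i) hlam hh hh1 hqh hN3 (hJ1 i hi) hnear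
            ((hfd i).mono ?_)
          exact Set.inter_subset_inter_left _ Set.inter_subset_left
      _ ≤ _ := by
          rw [← Finset.mul_sum]
          gcongr
          exact sum_lintegral_slabPart_le q J hF.measurable two_ne_zero
  -- The L¹ norms of the slabs add up to that of F, so the number of far pairs does not enter.
  have e3 : ∑ i ∈ J, ∑ j ∈ J, ENNReal.ofReal (E * (lam * h ^ 2)⁻¹ ^ N) * (G i * G j) ≤
      ENNReal.ofReal (E * lam⁻¹ ^ 5) * (ENNReal.ofReal vK * ∫⁻ p, ‖F p‖ₑ ^ 2) := by
    have h1 : ∑ i ∈ J, ∑ j ∈ J, ENNReal.ofReal (E * (lam * h ^ 2)⁻¹ ^ N) * (G i * G j) =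
        ENNReal.ofReal (E * (lam * h ^ 2)⁻¹ ^ N) * (∑ i ∈ J, G i) ^ 2 := by
      rw [sq (∑ i ∈ J, G i), Finset.sum_mul_sum]
      simp only [Finset.mul_sum]
    have h2 : ∑ i ∈ J, G i ≤ ∫⁻ p, ‖F p‖ₑ := by
      have := sum_lintegral_slabPart_le q J hF.measurable one_ne_zero
      simpa only [pow_one] using this
    rw [h1]
    gcongr
    refine (pow_le_pow_left' h2 2).trans ?_
    rw [← hvK1]
    exact (hF.mono Set.inter_subset_left).sq_lintegral_le hKy.measurableSet
      hM.compact_t.measurableSet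
  -- The bounds m < C₁h/q + 1 and 1 ≤ h/q give the constant.
  have e4 : (2 * (2 * m + 1) : ℝ≥0∞) ≤ ENNReal.ofReal (2 * (2 * C₁ + 3) * (h / q)) := by
    have h1 : (2 * (2 * m + 1) : ℝ≥0∞) = ENNReal.ofReal (2 * (2 * m + 1)) := by
      rw [ENNReal.ofReal_mul (by norm_num), ENNReal.ofReal_add (by positivity) (by norm_num),
        ENNReal.ofReal_mul (by norm_num), ENNReal.ofReal_natCast, ENNReal.ofReal_ofNat,
        ENNReal.ofReal_one]
    rw [h1]
    refine ENNReal.ofReal_le_ofReal ?_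
    have h2 : (m : ℝ) < C₁ * h / q + 1 := Nat.ceil_lt_add_one (by positivity)
    have h3 : 1 ≤ h / q := (one_le_div hq).2 hqh
    have h4 : C₁ * h / q = C₁ * (h / q) := by ring
    rw [h4] at h2
    linarith
  have h3 : 1 ≤ h / q := (one_le_div hq).2 hqh
  have h9 : 1 ≤ h⁻¹ := (one_le_inv₀ hh).2 hh1
  calc _ ≤ ∑ i ∈ J, ∑ j ∈ J, ((if |i - j| ≤ (m : ℤ) then I i + I j else 0) +
        ENNReal.ofReal (E * (lam * h ^ 2)⁻¹ ^ N) * (G i * G j)) :=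
        e1.trans (Finset.sum_le_sum fun i hi => Finset.sum_le_sum fun j hj => hpair i hi j hj)
    _ ≤ ENNReal.ofReal (2 * (2 * C₁ + 3) * (h / q)) *
          (ENNReal.ofReal (B * lam⁻¹ ^ 5 * h⁻¹) * ∫⁻ p, ‖F p‖ₑ ^ 2) +
        ENNReal.ofReal (E * lam⁻¹ ^ 5) * (ENNReal.ofReal vK * ∫⁻ p, ‖F p‖ₑ ^ 2) := by
        simp only [Finset.sum_add_distrib]
        refine add_le_add ((sum_near_le J m I).trans (mul_le_mul' e4 e2)) e3
    _ = ENNReal.ofReal (2 * (2 * C₁ + 3) * (h / q) * (B * lam⁻¹ ^ 5 * h⁻¹) +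
          E * lam⁻¹ ^ 5 * vK) * ∫⁻ p, ‖F p‖ₑ ^ 2 := by
        rw [ENNReal.ofReal_add (by positivity) (by positivity),
          ENNReal.ofReal_mul (p := 2 * (2 * C₁ + 3) * (h / q)) (by positivity),
          ENNReal.ofReal_mul (p := E * lam⁻¹ ^ 5) (by positivity)]
        ring
    _ ≤ _ := by
        gcongr
        have h10 : 1 ≤ h / q * h⁻¹ := one_le_mul_of_one_le_of_one_le h3 h9
        have h11 : 0 ≤ E * lam⁻¹ ^ 5 * vK := by positivity
        nlinarith

end LongInterval

end FoldBlowdown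
end

/-! ### Bounds for the noncentral and the central pieces on the whole time range. -/

noncomputable section

namespace FoldBlowdown

section OperatorBounds

variable {S : (Fin 3 → ℝ) × ℝ → (Fin 2 → ℝ)} {Kx : Set (Fin 3 → ℝ)} {Kt : Set ℝ}
  {O : Set ((Fin 3 → ℝ) × ℝ)} {κ : (Fin 3 → ℝ) × ℝ → ℝ} {Ky : Set (Fin 2 → ℝ)}
  {χ : (Fin 3 → ℝ) → ℝ} {η : ℝ → ℝ} {ψ : (Fin 2 → ℝ) → ℝ} {ϑ : (Fin 2 → ℝ) → ℝ}

/-- The immersion bound is local in time. A fixed number of intervals of length δ covers Kt, and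
Cauchy–Schwarz over them costs only their number. -/
theorem IsModel.exists_estimate_of_nearDecay (hM : IsModel S Kx Kt O κ) (hχ : ContDiff ℝ ∞ χ)
    (hχK : tsupport χ ⊆ Kx) (hη : ContDiff ℝ ∞ η) (hηc : HasCompactSupport η)
    (hψ : Continuous ψ) (hψs : tsupport ψ ⊆ Metric.closedBall 0 1) (hψ0 : ψ 0 = 1)
    (hϑ : ContDiff ℝ ∞ ϑ) (hϑs : tsupport ϑ ⊆ freqAnnulus) (hKy : IsCompact Ky)
    {T D : ℝ} (hT : ∀ t ∈ Kt, |t| + 1 ≤ T) (hD : 0 ≤ D) (N : ℕ) :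
    ∃ C ≥ 0, ∀ (lam h q : ℝ) (F : (Fin 2 → ℝ) × ℝ → ℂ), 1 ≤ lam → 0 < h → h ≤ 1 →
      0 < q → q ≤ h → (lam * h ^ 2)⁻¹ ^ N ≤ lam⁻¹ ^ 5 → NearDecay S χ η ψ Kt T D lam h q →
      IsDatum Ky Kt F →
      ∫⁻ x, ‖physOp S χ η ϑ lam h F x‖ₑ ^ 2 ≤
        ENNReal.ofReal (C * (h / q) * lam⁻¹ ^ 5 * h⁻¹) * ∫⁻ p, ‖F p‖ₑ ^ 2 := by
  have hϑc : HasCompactSupport ϑ :=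
    isCompact_freqAnnulus.of_isClosed_subset (isClosed_tsupport ϑ) hϑs
  obtain ⟨C, hC, δ, hδ, hb⟩ := hM.exists_long_interval_estimate (Ky := Ky) hχ hχK hη hηc hψ hψs hψ0
    hϑ hϑs hKy hT hD N
  obtain ⟨J, -, hJ⟩ := exists_slab_indices hδ (T + δ)
  refine ⟨J.card * C, by positivity, fun lam h q F hlam hh hh1 hq hqh hN hnear hF => ?_⟩
  have hfd := fun j => hF.slabPart hδ j
  have hsum : F = fun p => ∑ j ∈ J, slabPart δ j F p := by
    refine (sum_slabPart δ fun p hp => hJ _ ?_).symm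
    have : p ∈ Ky ×ˢ Kt := by
      by_contra h0
      exact hp (hF.support p h0)
    linarith [hT _ this.2]
  have hop : ∀ x, physOp S χ η ϑ lam h F x =
      ∑ j ∈ J, physOp S χ η ϑ lam h (slabPart δ j F) x := fun x => by
    conv_lhs => rw [hsum]
    exact physOp_finset_sum hM.smooth hη.continuous hηc hϑ.continuous hϑc J
      (fun j => (hfd j).mono Set.inter_subset_left) lam h x
  have hpm : ∀ j, Measurable (physOp S χ η ϑ lam h (slabPart δ j F)) := fun j =>
    measurable_physOp hM.smooth hχ.continuous hη.continuous hηc hϑ.continuous hϑc (hfd j) lam h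
  calc _ ≤ ∫⁻ x, J.card * ∑ j ∈ J, ‖physOp S χ η ϑ lam h (slabPart δ j F) x‖ₑ ^ 2 := by
        refine lintegral_mono fun x => ?_
        simp only [hop x]
        exact (pow_le_pow_left' (enorm_sum_le _ _) 2).trans (ennreal_sum_sq_le _ _)
    _ = J.card * ∑ j ∈ J, ∫⁻ x, ‖physOp S χ η ϑ lam h (slabPart δ j F) x‖ₑ ^ 2 := by
        rw [lintegral_const_mul' _ _ (by simp),
          lintegral_finsetSum _ fun j _ => (hpm j).enorm.pow_const 2]
    _ ≤ J.card * ∑ j ∈ J, ENNReal.ofReal (C * (h / q) * lam⁻¹ ^ 5 * h⁻¹) *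
          ∫⁻ p, ‖slabPart δ j F p‖ₑ ^ 2 := by
        gcongr with j
        exact hb lam h q _ _ hlam hh hh1 hq hqh hN hnear (hfd j)
    _ ≤ J.card * (ENNReal.ofReal (C * (h / q) * lam⁻¹ ^ 5 * h⁻¹) * ∫⁻ p, ‖F p‖ₑ ^ 2) := by
        rw [← Finset.mul_sum]
        gcongr
        exact sum_lintegral_slabPart_le δ J hF.measurable two_ne_zero
    _ = _ := by
        have e : J.card * C * (h / q) * lam⁻¹ ^ 5 * h⁻¹ =
            J.card * (C * (h / q) * lam⁻¹ ^ 5 * h⁻¹) := by ring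
        rw [e, ENNReal.ofReal_mul (p := (J.card : ℝ)) (Nat.cast_nonneg _), ENNReal.ofReal_natCast,
          ← mul_assoc (J.card : ℝ≥0∞)]

theorem exists_tube_cutoff : ∃ ψ : (Fin 2 → ℝ) → ℝ, ContDiff ℝ ∞ ψ ∧
    tsupport ψ ⊆ Metric.closedBall 0 1 ∧ ψ 0 = 1 := by
  let b : ContDiffBump (0 : Fin 2 → ℝ) := ⟨1 / 2, 1, by norm_num, by norm_num⟩
  exact ⟨b, b.contDiff, b.tsupport_eq.subset, b.one_of_mem_closedBall (by simpa using b.rIn_pos.le)⟩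

theorem lintegral_enorm_const_mul_sq {α : Type*} [MeasurableSpace α] {μ : Measure α} {g : α → ℂ}
    {lam A : ℝ} {B : ℝ≥0∞} (hlam : 0 ≤ lam)
    (h : ∫⁻ x, ‖g x‖ₑ ^ 2 ∂μ ≤ ENNReal.ofReal A * B) :
    ∫⁻ x, ‖(lam : ℂ) ^ 2 * g x‖ₑ ^ 2 ∂μ ≤ ENNReal.ofReal (lam ^ 4 * A) * B := by
  have e : ∀ x, ‖(lam : ℂ) ^ 2 * g x‖ₑ ^ 2 = ENNReal.ofReal (lam ^ 4) * ‖g x‖ₑ ^ 2 := fun x => by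
    rw [enorm_mul, mul_pow, ← ofReal_norm ((lam : ℂ) ^ 2), norm_pow, Complex.norm_real,
      Real.norm_of_nonneg hlam, ← ENNReal.ofReal_pow (by positivity), ← pow_mul]
  simp only [e]
  rw [lintegral_const_mul' _ _ (by simp), ENNReal.ofReal_mul (by positivity), mul_assoc]
  gcongr

/-- The estimate for the part of the operator where `|θ · Δ| ≈ h`. -/
theorem IsModel.exists_noncentral_estimate (hM : IsModel S Kx Kt O κ) (hχ : ContDiff ℝ ∞ χ)
    (hχK : tsupport χ ⊆ Kx) (hη : ContDiff ℝ ∞ η) (hηc : HasCompactSupport η)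
    {c : ℝ} (hc : 0 < c) (hηc0 : ∀ v ∈ tsupport η, c ≤ |v|)
    (hϑ : ContDiff ℝ ∞ ϑ) (hϑs : tsupport ϑ ⊆ freqAnnulus) (hKy : IsCompact Ky) (N : ℕ) :
    ∃ C ≥ 0, ∀ (lam h : ℝ) (F : (Fin 2 → ℝ) × ℝ → ℂ), 1 ≤ lam → 0 < h → h ≤ 1 →
      (lam * h ^ 2)⁻¹ ^ N ≤ lam⁻¹ ^ 5 → IsDatum Ky Kt F →
      ∫⁻ x, ‖(lam : ℂ) ^ 2 * physOp S χ η ϑ lam h F x‖ₑ ^ 2 ≤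
        ENNReal.ofReal (C * (lam⁻¹ * h⁻¹)) * ∫⁻ p, ‖F p‖ₑ ^ 2 := by
  obtain ⟨ψ, hψ, hψs, hψ0⟩ := exists_tube_cutoff
  obtain ⟨T, hT0⟩ := hM.compact_t.exists_bound_of_continuousOn (f := id) continuousOn_id
  have hT : ∀ t ∈ Kt, |t| + 1 ≤ T + 1 := fun t ht => by
    have := hT0 t ht
    simp only [id_eq, Real.norm_eq_abs] at this
    linarith
  obtain ⟨D, hD, δ, hδ, hnear⟩ := hM.exists_near_bound hχ hχK hη hηc hψ hψs (T := T + 1)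
    (fun t ht => by linarith [hT t ht]) hc hηc0
  obtain ⟨C, hC, hb⟩ := hM.exists_estimate_of_nearDecay (Ky := Ky) hχ hχK hη hηc hψ.continuous hψs
    hψ0 hϑ hϑs hKy hT hD N
  -- Slabs of length ρh fit the transport range, and h/q = 1/ρ is bounded.
  set ρ := min 1 δ with hρ
  have hρ0 : 0 < ρ := lt_min one_pos hδ
  refine ⟨C * ρ⁻¹, by positivity, fun lam h F hlam hh hh1 hN hF => ?_⟩
  have hlam0 : 0 < lam := by linarith
  have hle : ρ * h ≤ δ * h := mul_le_mul_of_nonneg_right (min_le_right _ _) hh.le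
  have h1 := hb lam h (ρ * h) F hlam hh hh1 (by positivity)
    (by nlinarith [min_le_left 1 δ]) hN
    (fun z hz z' hz' tI w htI a1 a2 _ => hnear lam h z z' tI w hlam0 hh hh1 hz hz' htI
      (a1.trans hle) (a2.trans hle)) hF
  refine (lintegral_enorm_const_mul_sq hlam0.le h1).trans_eq ?_
  congr 2
  field_simp

/-- The estimate for the part of the operator where `|θ · Δ| ≲ h`. -/
theorem IsModel.exists_central_estimate (hM : IsModel S Kx Kt O κ) (hχ : ContDiff ℝ ∞ χ)
    (hχK : tsupport χ ⊆ Kx) (hη : ContDiff ℝ ∞ η) (hηc : HasCompactSupport η)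
    (hϑ : ContDiff ℝ ∞ ϑ) (hϑs : tsupport ϑ ⊆ freqAnnulus) (hKy : IsCompact Ky) (N : ℕ) :
    ∃ C ≥ 0, ∀ (lam h : ℝ) (F : (Fin 2 → ℝ) × ℝ → ℂ), 1 ≤ lam → 0 < h → h ≤ 1 →
      1 ≤ lam * h ^ 2 → (lam * h ^ 2)⁻¹ ^ N ≤ lam⁻¹ ^ 5 → IsDatum Ky Kt F →
      ∫⁻ x, ‖(lam : ℂ) ^ 2 * physOp S χ η ϑ lam h F x‖ₑ ^ 2 ≤
        ENNReal.ofReal (C * h) * ∫⁻ p, ‖F p‖ₑ ^ 2 := by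
  obtain ⟨ψ, hψ, hψs, hψ0⟩ := exists_tube_cutoff
  obtain ⟨T, hT0⟩ := hM.compact_t.exists_bound_of_continuousOn (f := id) continuousOn_id
  have hT : ∀ t ∈ Kt, |t| + 1 ≤ T + 1 := fun t ht => by
    have := hT0 t ht
    simp only [id_eq, Real.norm_eq_abs] at this
    linarith
  obtain ⟨D, hD, hnear⟩ := hM.exists_near_bound_central hχ hχK hη hηc hψ hψs (T := T + 1)
    (fun t ht => by linarith [hT t ht])
  obtain ⟨C, hC, hb⟩ := hM.exists_estimate_of_nearDecay (Ky := Ky) hχ hχK hη hηc hψ.continuous hψs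
    hψ0 hϑ hϑs hKy hT hD N
  refine ⟨C, hC, fun lam h F hlam hh hh1 hlh hN hF => ?_⟩
  have hlam0 : 0 < lam := by linarith
  -- The slab length q = (λh)^{-1} is the resolution of the kernel in t. The loss h/q = λh² turns λ⁴
  -- · λ^{-5}h^{-1} into h.
  have hq : (lam * h)⁻¹ ≤ h := by
    rw [inv_le_iff_one_le_mul₀ (by positivity)]
    nlinarith
  have h1 := hb lam h (lam * h)⁻¹ F hlam hh hh1 (by positivity) hq hN
    (fun z hz z' hz' tI w htI a1 _ a3 => hnear lam h z z' tI w hlam0 hh hh1 hz hz' htI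
      (a1.trans hq) (by
        calc lam * h * |z'.2 - z.2| ≤ lam * h * (lam * h)⁻¹ := by gcongr
          _ = 1 := mul_inv_cancel₀ (by positivity))) hF
  refine (lintegral_enorm_const_mul_sq hlam0.le h1).trans_eq ?_
  congr 2
  field_simp

end OperatorBounds

end FoldBlowdown
end

noncomputable section

namespace FoldBlowdown

/-! ### The dyadic decomposition of the symbol -/

section Dyadic

variable {χ₀ : ℝ → ℝ}

theorem IsDyadicCutoff.eq_zero (hχ : IsDyadicCutoff χ₀) {v : ℝ} (hv : v < 1 / 4 ∨ 4 < v) :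
    χ₀ v = 0 := by
  by_contra h
  have := hχ.support h
  rcases hv with hv | hv <;> linarith [this.1, this.2]

/-- The even extension of the dyadic cutoff. -/
def evenCutoff (χ₀ : ℝ → ℝ) (v : ℝ) : ℝ := χ₀ v + χ₀ (-v)

/-- The sum of the even dyadic cutoffs at the scales below `1`. -/
def lowCutoff (χ₀ : ℝ → ℝ) (v : ℝ) : ℝ :=
  if |v| < 1 / 2 then 1 else ∑ m ∈ Finset.range 4, evenCutoff χ₀ (2 ^ m * v)

theorem IsDyadicCutoff.evenCutoff_eq_zero (hχ : IsDyadicCutoff χ₀) {v : ℝ}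
    (hv : |v| < 1 / 4 ∨ 4 < |v|) : evenCutoff χ₀ v = 0 := by
  have h1 : χ₀ v = 0 := by
    rcases hv with hv | hv
    · exact hχ.eq_zero (Or.inl (lt_of_abs_lt hv))
    · rcases lt_abs.1 hv with h | h
      · exact hχ.eq_zero (Or.inr h)
      · exact hχ.eq_zero (Or.inl (by linarith))
  have h2 : χ₀ (-v) = 0 := by
    rcases hv with hv | hv
    · exact hχ.eq_zero (Or.inl (by linarith [(abs_lt.1 hv).1]))
    · rcases lt_abs.1 hv with h | h
      · exact hχ.eq_zero (Or.inl (by linarith))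
      · exact hχ.eq_zero (Or.inr h)
  rw [evenCutoff, h1, h2, add_zero]

theorem evenCutoff_abs (v : ℝ) : evenCutoff χ₀ |v| = evenCutoff χ₀ v := by
  rcases abs_choice v with h | h <;> rw [h]
  rw [evenCutoff, evenCutoff, neg_neg, add_comm]

/-- For 1/4 ≤ |v| < 1/2 the support of χ₀ excludes all scales j < 0 and j ≥ 5, so these five terms
are the whole partition of unity. -/
theorem IsDyadicCutoff.sum_range_five (hχ : IsDyadicCutoff χ₀) {v : ℝ} (h1 : 1 / 4 ≤ |v|)
    (h2 : |v| < 1 / 2) : ∑ m ∈ Finset.range 5, evenCutoff χ₀ (2 ^ m * v) = 1 := by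
  have hpos : 0 < |v| := by linarith
  have h3 : ∀ m : ℕ, evenCutoff χ₀ (2 ^ m * v) = χ₀ ((2 : ℝ) ^ (m : ℤ) * |v|) := fun m => by
    rw [← evenCutoff_abs, abs_mul, abs_of_pos (by positivity : (0 : ℝ) < 2 ^ m), evenCutoff,
      hχ.eq_zero (v := -(2 ^ m * |v|)), add_zero, zpow_natCast]
    left
    have : 0 < 2 ^ m * |v| := by positivity
    linarith
  simp only [h3]
  have h4 := hχ.sum_eq_one |v| hpos
  have h5 : ∑ j ∈ (Finset.range 5).map Nat.castEmbedding, χ₀ ((2 : ℝ) ^ (j : ℤ) * |v|) = 1 := by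
    refine (hasSum_sum_of_ne_finset_zero fun j hj => ?_).unique h4
    rcases lt_or_ge j 0 with hj0 | hj0
    · refine hχ.eq_zero (Or.inl ?_)
      have : (2 : ℝ) ^ j ≤ 2 ^ (-1 : ℤ) := zpow_le_zpow_right₀ (by norm_num) (by omega)
      norm_num at this
      nlinarith
    · have hj5 : 5 ≤ j := by
        by_contra h6
        refine hj (Finset.mem_map.2 ⟨j.toNat, Finset.mem_range.2 (by omega), ?_⟩)
        simp [hj0]
      refine hχ.eq_zero (Or.inr ?_)
      have : (2 : ℝ) ^ (5 : ℤ) ≤ 2 ^ j := zpow_le_zpow_right₀ (by norm_num) hj5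
      norm_num at this
      nlinarith
  rw [Finset.sum_map] at h5
  exact h5

/-- The two formulas in `lowCutoff` overlap on 1/4 < |v| < 1/2, because 16|v| > 4 removes the fifth
term; the function is therefore smooth. -/
theorem IsDyadicCutoff.lowCutoff_eq_sum (hχ : IsDyadicCutoff χ₀) {v : ℝ} (h : 1 / 4 < |v|) :
    lowCutoff χ₀ v = ∑ m ∈ Finset.range 4, evenCutoff χ₀ (2 ^ m * v) := by
  rw [lowCutoff]
  split_ifs with h1
  · have h2 := hχ.sum_range_five h.le h1
    rw [Finset.sum_range_succ, hχ.evenCutoff_eq_zero (v := 2 ^ 4 * v), add_zero] at h2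
    · exact h2.symm
    · right
      rw [abs_mul]
      norm_num
      linarith
  · rfl

theorem contDiff_evenCutoff (hχ : ContDiff ℝ ∞ χ₀) : ContDiff ℝ ∞ (evenCutoff χ₀) :=
  hχ.add (hχ.comp contDiff_neg)

theorem IsDyadicCutoff.contDiff_lowCutoff (hχ : IsDyadicCutoff χ₀) :
    ContDiff ℝ ∞ (lowCutoff χ₀) := by
  rw [contDiff_iff_contDiffAt]
  intro v
  rcases lt_or_ge |v| (1 / 2) with h | h
  · have : lowCutoff χ₀ =ᶠ[nhds v] fun _ => 1 := by
      filter_upwards [(isOpen_lt continuous_abs continuous_const).mem_nhds h] with u hu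
      exact if_pos hu
    exact contDiffAt_const.congr_of_eventuallyEq this
  · have h1 : 1 / 4 < |v| := by linarith
    have : lowCutoff χ₀ =ᶠ[nhds v] fun v => ∑ m ∈ Finset.range 4, evenCutoff χ₀ (2 ^ m * v) := by
      filter_upwards [(isOpen_lt continuous_const continuous_abs).mem_nhds h1] with u hu
      exact hχ.lowCutoff_eq_sum hu
    refine ContDiffAt.congr_of_eventuallyEq (ContDiff.contDiffAt ?_) this
    exact ContDiff.sum fun m _ => (contDiff_evenCutoff hχ.smooth).comp (by fun_prop)

theorem IsDyadicCutoff.hasCompactSupport_lowCutoff (hχ : IsDyadicCutoff χ₀) :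
    HasCompactSupport (lowCutoff χ₀) := by
  refine HasCompactSupport.of_support_subset_isCompact (isCompact_Icc (a := -4) (b := 4))
    fun v hv => ?_
  by_contra h
  have h1 : 4 < |v| := by
    by_contra h2
    exact h (abs_le.1 (not_lt.1 h2))
  refine hv ?_
  rw [hχ.lowCutoff_eq_sum (by linarith)]
  refine Finset.sum_eq_zero fun m _ => hχ.evenCutoff_eq_zero (Or.inr ?_)
  rw [abs_mul, abs_of_pos (by positivity : (0 : ℝ) < 2 ^ m)]
  have : (1 : ℝ) ≤ 2 ^ m := one_le_pow₀ (by norm_num)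
  nlinarith

/-- For v ≠ 0 the low cutoff is the sum of the even cutoffs of 2^m v over m ≥ 0; splitting off m = 0
gives the telescoping relation. -/
theorem IsDyadicCutoff.lowCutoff_two_mul (hχ : IsDyadicCutoff χ₀) (v : ℝ) :
    lowCutoff χ₀ v = lowCutoff χ₀ (2 * v) + evenCutoff χ₀ v := by
  have h2 : |2 * v| = 2 * |v| := by rw [abs_mul, abs_two]
  rcases lt_or_ge |v| (1 / 4) with h | h
  · rw [hχ.evenCutoff_eq_zero (Or.inl h), lowCutoff, lowCutoff, if_pos (by linarith),
      if_pos (by rw [h2]; linarith), add_zero]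
  · have h3 : ∀ m : ℕ, evenCutoff χ₀ (2 ^ m * (2 * v)) = evenCutoff χ₀ (2 ^ (m + 1) * v) :=
      fun m => by
      congr 1
      ring
    have h4 : lowCutoff χ₀ (2 * v) + evenCutoff χ₀ v =
        ∑ m ∈ Finset.range 5, evenCutoff χ₀ (2 ^ m * v) := by
      rw [lowCutoff, if_neg (by rw [h2]; linarith), Finset.sum_range_succ' _ 4]
      simp only [h3, pow_zero, one_mul]
    rw [h4]
    rcases lt_or_ge |v| (1 / 2) with h5 | h5
    · rw [hχ.sum_range_five h h5, lowCutoff, if_pos h5]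
    · rw [lowCutoff, if_neg (by linarith), Finset.sum_range_succ _ 4,
        hχ.evenCutoff_eq_zero (v := 2 ^ 4 * v), add_zero]
      right
      rw [abs_mul]
      norm_num
      linarith

theorem IsDyadicCutoff.lowCutoff_eq (hχ : IsDyadicCutoff χ₀) (n : ℕ) (v : ℝ) :
    lowCutoff χ₀ v =
      lowCutoff χ₀ (2 ^ n * v) + ∑ m ∈ Finset.range n, evenCutoff χ₀ (2 ^ m * v) := by
  induction n with
  | zero => simp
  | succ n ih =>
    rw [Finset.sum_range_succ, ih, hχ.lowCutoff_two_mul (2 ^ n * v), pow_succ]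
    ring_nf

/-- The last symbol of the dyadic decomposition. -/
theorem IsDyadicCutoff.one_sub_sum_eq (hχ : IsDyadicCutoff χ₀) (n : ℕ) {s : ℝ}
    (hs : s = 1 ∨ s = -1) (v : ℝ) :
    1 - ∑ m ∈ Finset.range n, χ₀ (s * (2 ^ m * v)) =
      (1 - lowCutoff χ₀ v) + lowCutoff χ₀ (2 ^ n * v) +
        ∑ m ∈ Finset.range n, χ₀ (-s * (2 ^ m * v)) := by
  have h : ∀ u, evenCutoff χ₀ u = χ₀ (s * u) + χ₀ (-s * u) := fun u => by
    rcases hs with rfl | rfl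
    · simp [evenCutoff]
    · simp [evenCutoff, add_comm]
  rw [hχ.lowCutoff_eq n v]
  simp only [h, Finset.sum_add_distrib]
  ring

end Dyadic

/-! ### The operators of the dyadic decomposition -/

/-- The splitting `y = (y', y₃)`. -/
def splitEquiv : (Fin 3 → ℝ) ≃ᵐ (Fin 2 → ℝ) × ℝ :=
  (MeasurableEquiv.piFinSuccAbove (fun _ : Fin 3 => ℝ) 2).trans MeasurableEquiv.prodComm

theorem splitEquiv_apply (y : Fin 3 → ℝ) : splitEquiv y = (fun j => y ((2 : Fin 3).succAbove j), y 2) :=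
  rfl

theorem measurePreserving_splitEquiv : MeasurePreserving splitEquiv volume volume :=
  Measure.measurePreserving_swap.comp (volume_preserving_piFinSuccAbove (fun _ : Fin 3 => ℝ) 2)

/-- The datum of a function of `y`. -/
def splitDatum (χR : (Fin 3 → ℝ) → ℝ) (f : (Fin 3 → ℝ) → ℂ) (p : (Fin 2 → ℝ) × ℝ) : ℂ :=
  (χR (splitEquiv.symm p) : ℂ) * f (splitEquiv.symm p)

/-- The radial cutoff in the frequency. -/
def radialCutoff (χ₀ : ℝ → ℝ) (θ : Fin 2 → ℝ) : ℝ := χ₀ (Real.sqrt (θ 0 ^ 2 + θ 1 ^ 2))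

theorem IsDyadicCutoff.tsupport_radialCutoff {χ₀ : ℝ → ℝ} (hχ : IsDyadicCutoff χ₀) :
    tsupport (radialCutoff χ₀) ⊆ freqAnnulus :=
  closure_minimal (fun _ hθ => hχ.support hθ) isClosed_freqAnnulus

theorem IsDyadicCutoff.contDiff_radialCutoff {χ₀ : ℝ → ℝ} (hχ : IsDyadicCutoff χ₀) :
    ContDiff ℝ ∞ (radialCutoff χ₀) := by
  rw [contDiff_iff_contDiffAt]
  intro θ
  by_cases h : θ 0 ^ 2 + θ 1 ^ 2 = 0
  · have hc : Continuous fun θ : Fin 2 → ℝ => Real.sqrt (θ 0 ^ 2 + θ 1 ^ 2) := by fun_prop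
    have h1 : Real.sqrt (θ 0 ^ 2 + θ 1 ^ 2) < 1 / 4 := by
      rw [h, Real.sqrt_zero]
      norm_num
    have : radialCutoff χ₀ =ᶠ[nhds θ] fun _ => 0 := by
      filter_upwards [(isOpen_lt hc continuous_const).mem_nhds h1] with u hu
      exact hχ.eq_zero (Or.inl hu)
    exact contDiffAt_const.congr_of_eventuallyEq this
  · have h1 : ContDiffAt ℝ ∞ (fun θ : Fin 2 → ℝ => θ 0 ^ 2 + θ 1 ^ 2) θ :=
      ContDiff.contDiffAt (by fun_prop)
    exact hχ.smooth.contDiffAt.comp θ (h1.sqrt h)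

section Link

variable {S S' : (Fin 3 → ℝ) × ℝ → (Fin 2 → ℝ)} {Kx : Set (Fin 3 → ℝ)} {Kt : Set ℝ}
  {χ₀ : ℝ → ℝ} {χL χR : (Fin 3 → ℝ) → ℝ} {f : (Fin 3 → ℝ) → ℂ}

theorem isDatum_splitDatum (hχR : Continuous χR) (hχRc : HasCompactSupport χR)
    (hf : Measurable f) (hfL : MemLp f 2 volume) :
    IsDatum ((fun y => (splitEquiv y).1) '' tsupport χR) ((fun y => y 2) '' tsupport χR)
      (splitDatum χR f) := by
  have hi : Integrable fun y => (χR y : ℂ) * f y := by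
    have h1 : MemLp (fun y => (χR y : ℂ)) 2 volume :=
      (Continuous.memLp_of_hasCompactSupport (by fun_prop) (hχRc.comp_left Complex.ofReal_zero))
    exact h1.integrable_mul hfL
  refine ⟨?_, ?_, fun p hp => ?_⟩
  · have h1 : Measurable fun y => (χR y : ℂ) * f y := by
      have := hχR.measurable
      fun_prop
    exact h1.comp splitEquiv.symm.measurable
  · have := (measurePreserving_splitEquiv.symm).integrable_comp_emb
      (g := fun y => (χR y : ℂ) * f y) splitEquiv.symm.measurableEmbedding
    exact this.2 hi
  · by_contra h0
    have h1 : χR (splitEquiv.symm p) ≠ 0 := by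
      intro h1
      exact h0 (by simp [splitDatum, h1])
    have h2 := subset_tsupport _ h1
    refine hp ⟨⟨_, h2, ?_⟩, ⟨_, h2, ?_⟩⟩
    · simp
    · have : (splitEquiv (splitEquiv.symm p)).2 = p.2 := by simp
      rw [splitEquiv_apply] at this
      exact this

theorem lintegral_splitDatum_le {b : ℝ} (hb : ∀ y, ‖χR y‖ ≤ b) :
    ∫⁻ p, ‖splitDatum χR f p‖ₑ ^ 2 ≤ ENNReal.ofReal (b ^ 2) * ∫⁻ y, ‖f y‖ₑ ^ 2 := by
  have hb0 : 0 ≤ b := (norm_nonneg _).trans (hb 0)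
  have e := (measurePreserving_splitEquiv.symm).lintegral_comp_emb
    splitEquiv.symm.measurableEmbedding (fun y => ‖(χR y : ℂ) * f y‖ₑ ^ 2)
  refine e.trans_le ?_
  rw [← lintegral_const_mul' _ _ (by simp)]
  refine lintegral_mono fun y => ?_
  simp only []
  rw [enorm_mul, mul_pow, ENNReal.ofReal_pow hb0]
  gcongr
  rw [← ofReal_norm, Complex.norm_real]
  exact ENNReal.ofReal_le_ofReal (hb y)

/-- The substitution τ = 2^kθ produces the factor λ². On the supports of the cutoffs the phase
agrees with that of the extended S', and the symbol is a finite sum of functions of the rescaled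
curvature. -/
theorem R_eq_sum (hS' : ContDiff ℝ ∞ S') (hχL : tsupport χL ⊆ Kx)
    (hχ₀ : IsDyadicCutoff χ₀) (hχR : Continuous χR) (hχRc : HasCompactSupport χR)
    (hKt : ∀ y ∈ tsupport χR, y 2 ∈ Kt) (hSS : ∀ z ∈ Kx ×ˢ Kt, S' z = S z)
    {ε : ℝ} {k ℓ : ℕ} {s : ℝ} {ι : Type*} (J : Finset ι) {η : ι → ℝ → ℝ} {h : ι → ℝ}
    (hη : ∀ i, Continuous (η i)) (hηc : ∀ i, HasCompactSupport (η i))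
    (hsymb : ∀ z ∈ Kx ×ˢ Kt, ∀ θ ∈ freqAnnulus, symbol χ₀ S ε k ℓ s z ((2 : ℝ) ^ k • θ) =
      ∑ i ∈ J, η i ((h i)⁻¹ * curv S' θ z)) (hf : Measurable f) (hfL : MemLp f 2 volume)
    (x : Fin 3 → ℝ) :
    R χ₀ χL χR S ε k ℓ s f x = ∑ i ∈ J, (((2 : ℝ) ^ k : ℝ) : ℂ) ^ 2 *
      physOp S' χL (η i) (radialCutoff χ₀) (2 ^ k) (h i) (splitDatum χR f) x := by
  by_cases hx0 : χL x = 0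
  · simp [R, physOp, hx0]
  have hx : x ∈ Kx := hχL (subset_tsupport _ hx0)
  have hϑ := hχ₀.contDiff_radialCutoff.continuous
  have hϑc : HasCompactSupport (radialCutoff χ₀) := isCompact_freqAnnulus.of_isClosed_subset
    (isClosed_tsupport _) hχ₀.tsupport_radialCutoff
  set lam : ℝ := 2 ^ k with hlam
  have hlam0 : 0 < lam := by positivity
  set F := splitDatum χR f with hF
  have hFd := isDatum_splitDatum hχR hχRc hf hfL
  set G : ι → (Fin 2 → ℝ) × ((Fin 2 → ℝ) × ℝ) → ℂ := fun i q =>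
      Complex.exp (Complex.I * ((lam * dot q.1 (S' (x, q.2.2) - q.2.1) : ℝ) : ℂ)) *
        ((radialCutoff χ₀ q.1 * η i ((h i)⁻¹ * dot q.1 fun i => Delta S' i (x, q.2.2)) : ℝ) : ℂ) *
        F q.2 with hG
  have hGi : ∀ i, Integrable (G i) (volume.prod volume) := fun i =>
    integrable_operator_integrand hS' (hη i) (hηc i) hϑ hϑc hFd lam (h i) x
  -- the inner integral
  have hinner : ∀ θ : Fin 2 → ℝ, ∫ y : Fin 3 → ℝ,
      Complex.exp (Complex.I * (((lam • θ) 0 * (S (x, y 2) 0 - y 0) +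
        (lam • θ) 1 * (S (x, y 2) 1 - y 1) : ℝ) : ℂ)) * (χR y : ℂ) * f y *
      (χ₀ ((2 : ℝ) ^ (-(k : ℤ)) * Real.sqrt ((lam • θ) 0 ^ 2 + (lam • θ) 1 ^ 2)) : ℂ) *
      (symbol χ₀ S ε k ℓ s (x, y 2) (lam • θ) : ℂ) = ∫ p, ∑ i ∈ J, G i (θ, p) := by
    intro θ
    rw [← measurePreserving_splitEquiv.symm.integral_comp splitEquiv.symm.measurableEmbedding]
    refine integral_congr_ae (Filter.Eventually.of_forall fun p => ?_)
    have hsp : splitEquiv (splitEquiv.symm p) = p := by simp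
    set y := splitEquiv.symm p with hy
    rw [splitEquiv_apply] at hsp
    have hp2 : p.2 = y 2 := by rw [← hsp]
    have hp0 : p.1 0 = y 0 := by
      rw [← hsp]
      rfl
    have hp1 : p.1 1 = y 1 := by
      rw [← hsp]
      rfl
    have hrad : χ₀ ((2 : ℝ) ^ (-(k : ℤ)) * Real.sqrt ((lam • θ) 0 ^ 2 + (lam • θ) 1 ^ 2)) =
        radialCutoff χ₀ θ := by
      rw [radialCutoff]
      congr 1
      have : (lam • θ) 0 ^ 2 + (lam • θ) 1 ^ 2 = lam ^ 2 * (θ 0 ^ 2 + θ 1 ^ 2) := by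
        simp only [Pi.smul_apply, smul_eq_mul]
        ring
      rw [this, Real.sqrt_mul (sq_nonneg _), Real.sqrt_sq hlam0.le, zpow_neg, zpow_natCast, ← hlam,
        inv_mul_cancel_left₀ hlam0.ne']
    simp only []
    rw [hrad]
    -- The identities for S' and for the symbol are known only over Kx × Kt and the annulus;
    -- elsewhere both integrands vanish.
    by_cases hy0 : χR y = 0
    · have hF0 : F p = 0 := by simp [hF, splitDatum, ← hy, hy0]
      have hy1 : χR (splitEquiv.symm p) = 0 := hy0
      simp [hG, hF0, hy1]
    by_cases hθ0 : radialCutoff χ₀ θ = 0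
    · simp [hG, hθ0]
    have hyK : (x, y 2) ∈ Kx ×ˢ Kt := ⟨hx, hKt y (subset_tsupport _ hy0)⟩
    have hθ : θ ∈ freqAnnulus := hχ₀.tsupport_radialCutoff (subset_tsupport _ hθ0)
    have hFy : F p = (χR y : ℂ) * f y := rfl
    simp only [hG, hFy]
    rw [hsymb _ hyK θ hθ, ← Finset.sum_mul, ← Finset.mul_sum, hp2, hSS _ hyK]
    have hph : (lam • θ) 0 * (S (x, y 2) 0 - y 0) + (lam • θ) 1 * (S (x, y 2) 1 - y 1) =
        lam * dot θ (S (x, y 2) - p.1) := by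
      simp only [dot, Pi.smul_apply, Pi.sub_apply, smul_eq_mul, hp0, hp1]
      ring
    rw [hph]
    simp only [curv_eq_dot]
    push_cast
    rw [← Finset.mul_sum]
    ring
  have hsub := Measure.integral_comp_smul (volume : Measure (Fin 2 → ℝ)) (fun τ : Fin 2 → ℝ =>
    ∫ y : Fin 3 → ℝ, Complex.exp (Complex.I * ((τ 0 * (S (x, y 2) 0 - y 0) +
        τ 1 * (S (x, y 2) 1 - y 1) : ℝ) : ℂ)) * (χR y : ℂ) * f y *
      (χ₀ ((2 : ℝ) ^ (-(k : ℤ)) * Real.sqrt (τ 0 ^ 2 + τ 1 ^ 2)) : ℂ) *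
      (symbol χ₀ S ε k ℓ s (x, y 2) τ : ℂ)) lam
  simp only [hinner] at hsub
  have hfin : Module.finrank ℝ (Fin 2 → ℝ) = 2 := by simp
  rw [hfin, abs_of_pos (by positivity), eq_comm, inv_smul_eq_iff₀ (by positivity)] at hsub
  rw [R, hsub]
  have hsum : ∫ θ, ∫ p, ∑ i ∈ J, G i (θ, p) = ∑ i ∈ J, ∫ p : (Fin 2 → ℝ) × ℝ,
      freqKernel (radialCutoff χ₀) (η i) lam (h i) (S' (x, p.2) - p.1)
        (fun i => Delta S' i (x, p.2)) * F p := by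
    have h1 := integral_prod (μ := (volume : Measure (Fin 2 → ℝ)))
      (ν := (volume : Measure ((Fin 2 → ℝ) × ℝ))) (fun q => ∑ i ∈ J, G i q)
      (integrable_finsetSum J fun i _ => hGi i)
    rw [← h1, integral_finsetSum J fun i _ => hGi i]
    refine Finset.sum_congr rfl fun i _ => ?_
    rw [integral_prod_symm _ (hGi i)]
    refine integral_congr_ae (Filter.Eventually.of_forall fun p => ?_)
    simp only [freqKernel, hG]
    rw [integral_mul_const]
  rw [hsum, ← Finset.mul_sum]
  simp only [physOp]
  rw [← Finset.mul_sum, Complex.real_smul]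
  push_cast
  ring

end Link

end FoldBlowdown
end

noncomputable section

namespace FoldBlowdown

/-! ### `L²` norms -/

theorem eLpNorm_two_sq {α E : Type*} [MeasurableSpace α] {μ : Measure α} [NormedAddCommGroup E]
    (g : α → E) : eLpNorm g 2 μ ^ 2 = ∫⁻ x, ‖g x‖ₑ ^ 2 ∂μ := by
  have := eLpNorm_nnreal_pow_eq_lintegral (μ := μ) (f := g) (p := 2) two_ne_zero
  simpa using this

theorem eLpNorm_two_le_of_lintegral_le {α β E E' : Type*} [MeasurableSpace α] [MeasurableSpace β]
    {μ : Measure α} {ν : Measure β} [NormedAddCommGroup E] [NormedAddCommGroup E'] {g : α → E}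
    {F : β → E'} {A : ℝ}
    (h : ∫⁻ x, ‖g x‖ₑ ^ 2 ∂μ ≤ ENNReal.ofReal A * ∫⁻ p, ‖F p‖ₑ ^ 2 ∂ν) :
    eLpNorm g 2 μ ≤ ENNReal.ofReal (Real.sqrt A) * eLpNorm F 2 ν := by
  have h0 : ENNReal.ofReal A = ENNReal.ofReal (Real.sqrt A) ^ 2 := by
    rw [← ENNReal.ofReal_pow (Real.sqrt_nonneg _)]
    rcases le_total 0 A with hA | hA
    · rw [Real.sq_sqrt hA]
    · simp [Real.sqrt_eq_zero_of_nonpos hA, ENNReal.ofReal_of_nonpos hA]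
  rw [← eLpNorm_two_sq, ← eLpNorm_two_sq, h0, ← mul_pow] at h
  exact (ENNReal.pow_le_pow_left_iff two_ne_zero).1 h

/-! ### The dyadic scales -/

theorem mul_ell0_le {ε : ℝ} (hε : 0 < ε) (k : ℕ) : (2 + ε) * ell0 ε k ≤ k := by
  have := Nat.floor_le (a := (k : ℝ) / (2 + ε)) (by positivity)
  rw [le_div_iff₀ (by positivity)] at this
  rw [ell0]
  linarith

theorem lt_mul_ell0_add_one {ε : ℝ} (hε : 0 < ε) (k : ℕ) : k < (2 + ε) * (ell0 ε k + 1) := by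
  have := Nat.lt_floor_add_one ((k : ℝ) / (2 + ε))
  rw [div_lt_iff₀ (by positivity)] at this
  rw [ell0]
  linarith

/-- The dyadic scales `h = 2^{-m}` with `m ≤ ℓ₀` are larger than `λ^{-1/2}` by a power of
`λ = 2^k`. -/
theorem dyadic_scale_bounds {ε : ℝ} (hε : 0 < ε) {N : ℕ} (hN : 5 * (2 + ε) ≤ ε * N) {k m : ℕ}
    (hm : m ≤ ell0 ε k) :
    1 ≤ (2 : ℝ) ^ k * ((2 ^ m)⁻¹) ^ 2 ∧
      ((2 : ℝ) ^ k * ((2 ^ m)⁻¹) ^ 2)⁻¹ ^ N ≤ ((2 : ℝ) ^ k)⁻¹ ^ 5 := by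
  have hk : (2 + ε) * m ≤ k := by
    refine le_trans ?_ (mul_ell0_le hε k)
    gcongr
  have hm0 : (0 : ℝ) ≤ m := Nat.cast_nonneg m
  have h2m : 2 * m ≤ k := by
    have : (2 : ℝ) * m ≤ k := by nlinarith
    exact_mod_cast this
  -- With d = k - 2m one has λh² = 2^d and d ≥ εm; the choice of N then yields 5k ≤ dN.
  obtain ⟨d, rfl⟩ := Nat.exists_eq_add_of_le h2m
  have he : (2 : ℝ) ^ (2 * m + d) * ((2 ^ m)⁻¹) ^ 2 = 2 ^ d := by
    rw [pow_add, inv_pow, ← pow_mul, mul_comm m 2]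
    field_simp
  rw [he]
  refine ⟨one_le_pow₀ (by norm_num), ?_⟩
  rw [inv_pow, inv_pow, ← pow_mul, ← pow_mul]
  refine inv_anti₀ (by positivity) (pow_le_pow_right₀ (by norm_num) ?_)
  push_cast at hk
  have hd : ε * m ≤ d := by linarith
  have hd0 : (0 : ℝ) ≤ d := Nat.cast_nonneg d
  have h1 : (2 * (m : ℝ) + d) * 5 * ε ≤ d * N * ε := by nlinarith
  have h2 : (2 * (m : ℝ) + d) * 5 ≤ d * N := le_of_mul_le_mul_right h1 hε
  exact_mod_cast h2

/-- A geometric sum of ratio √2. The constant 3 is preserved by the induction because 3 + 1 ≤ 3√2.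
-/
theorem sum_two_rpow_half_le (n : ℕ) (a : ℝ) :
    ∑ m ∈ Finset.range n, (2 : ℝ) ^ (((m : ℝ) - a) / 2) ≤ 3 * (2 : ℝ) ^ (((n : ℝ) - a) / 2) := by
  induction n with
  | zero =>
    simp only [Finset.range_zero, Finset.sum_empty]
    positivity
  | succ n ih =>
    rw [Finset.sum_range_succ]
    have e : (2 : ℝ) ^ ((((n + 1 : ℕ) : ℝ) - a) / 2) =
        Real.sqrt 2 * (2 : ℝ) ^ (((n : ℝ) - a) / 2) := by
      rw [Real.sqrt_eq_rpow, ← Real.rpow_add two_pos]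
      congr 1
      push_cast
      ring
    have h1 : (4 / 3 : ℝ) ≤ Real.sqrt 2 := Real.le_sqrt_of_sq_le (by norm_num)
    have h2 : (0 : ℝ) < 2 ^ (((n : ℝ) - a) / 2) := by positivity
    rw [e]
    nlinarith

theorem sqrt_const_mul_two_rpow (A b : ℝ) (hA : 0 ≤ A) :
    Real.sqrt (A * 2 ^ b) = Real.sqrt A * 2 ^ (b / 2) := by
  rw [Real.sqrt_mul hA, Real.sqrt_eq_rpow ((2 : ℝ) ^ b), ← Real.rpow_mul two_pos.le]
  congr 2
  ring

theorem inv_pow_mul_inv_inv (k m : ℕ) :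
    ((2 : ℝ) ^ k)⁻¹ * ((2 ^ m)⁻¹)⁻¹ = (2 : ℝ) ^ ((m : ℝ) - k) := by
  rw [inv_inv, Real.rpow_sub two_pos, Real.rpow_natCast, Real.rpow_natCast]
  field_simp

theorem inv_two_pow_eq_rpow (m : ℕ) : ((2 : ℝ) ^ m)⁻¹ = (2 : ℝ) ^ (-(m : ℝ)) := by
  rw [Real.rpow_neg two_pos.le, Real.rpow_natCast]

/-! ### The decomposition of the operators -/

theorem dyadic_argument_eq (S : (Fin 3 → ℝ) × ℝ → (Fin 2 → ℝ)) (k m : ℕ) (s : ℝ)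
    (z : (Fin 3 → ℝ) × ℝ) (θ : Fin 2 → ℝ) :
    (2 : ℝ) ^ ((m : ℤ) - (k : ℤ)) * (s * (((2 : ℝ) ^ k • θ) 0 * Delta S 0 z +
      ((2 : ℝ) ^ k • θ) 1 * Delta S 1 z)) = s * (2 ^ m * curv S θ z) := by
  rw [zpow_sub₀ two_ne_zero, zpow_natCast, zpow_natCast, curv]
  simp only [Pi.smul_apply, smul_eq_mul]
  field_simp

theorem exists_bound_curv {S : (Fin 3 → ℝ) × ℝ → (Fin 2 → ℝ)} (hS : ContDiff ℝ ∞ S)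
    {Kx : Set (Fin 3 → ℝ)} {Kt : Set ℝ} (hx : IsCompact Kx) (ht : IsCompact Kt) :
    ∃ M > 0, ∀ z ∈ Kx ×ˢ Kt, ∀ θ ∈ freqAnnulus, |curv S θ z| ≤ M := by
  have hc : Continuous fun q : (Fin 2 → ℝ) × ((Fin 3 → ℝ) × ℝ) => curv S q.1 q.2 := by
    have h0 := (contDiff_Delta hS 0).continuous
    have h1 := (contDiff_Delta hS 1).continuous
    unfold curv
    fun_prop
  obtain ⟨M, hM⟩ := (isCompact_freqAnnulus.prod (hx.prod ht)).exists_bound_of_continuousOn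
    hc.continuousOn
  refine ⟨max M 1, by positivity, fun z hz θ hθ => ?_⟩
  exact (hM (θ, z) ⟨hθ, hz⟩).trans (le_max_left _ _)

/-- A cutoff that agrees with `1 - lowCutoff` on a given interval. -/
theorem IsDyadicCutoff.exists_highCutoff {χ₀ : ℝ → ℝ} (hχ : IsDyadicCutoff χ₀) {M : ℝ}
    (hM : 0 < M) : ∃ η : ℝ → ℝ, ContDiff ℝ ∞ η ∧ HasCompactSupport η ∧
      (∀ v ∈ tsupport η, 1 / 2 ≤ |v|) ∧ ∀ v, |v| ≤ M → η v = 1 - lowCutoff χ₀ v := by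
  -- The function 1 - `lowCutoff` is not compactly supported; multiplying by a bump equal to 1 on
  -- |v| ≤ M changes nothing in the range of θ·Δ.
  let b : ContDiffBump (0 : ℝ) := ⟨M, M + 1, hM, by linarith⟩
  refine ⟨fun v => (1 - lowCutoff χ₀ v) * b v,
    (contDiff_const.sub hχ.contDiff_lowCutoff).mul b.contDiff, b.hasCompactSupport.mul_left,
    fun v hv => ?_, fun v hv => ?_⟩
  · refine closure_minimal (t := {v : ℝ | 1 / 2 ≤ |v|}) (fun u hu => ?_)
      (isClosed_le continuous_const continuous_abs) hv
    by_contra h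
    have h1 : |u| < 1 / 2 := lt_of_not_ge h
    exact hu (by simp only [lowCutoff, if_pos h1, sub_self, zero_mul])
  · simp only
    rw [b.one_of_mem_closedBall (by simpa using hv), mul_one]

section Decomposition

variable {S S' : (Fin 3 → ℝ) × ℝ → (Fin 2 → ℝ)} {Kx : Set (Fin 3 → ℝ)} {Kt : Set ℝ}
  {O : Set ((Fin 3 → ℝ) × ℝ)} {κ : (Fin 3 → ℝ) × ℝ → ℝ} {Ky : Set (Fin 2 → ℝ)}
  {χ : (Fin 3 → ℝ) → ℝ} {χ₀ : ℝ → ℝ} {ϑ : (Fin 2 → ℝ) → ℝ}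

theorem IsDyadicCutoff.signed (hχ₀ : IsDyadicCutoff χ₀) {s : ℝ} (hs : s = 1 ∨ s = -1) :
    ContDiff ℝ ∞ (fun v => χ₀ (s * v)) ∧ HasCompactSupport (fun v => χ₀ (s * v)) ∧
      ∀ v ∈ tsupport (fun v => χ₀ (s * v)), 1 / 4 ≤ |v| := by
  have habs : ∀ v, |s * v| = |v| := fun v => by rcases hs with rfl | rfl <;> simp
  have hsub : ∀ v, χ₀ (s * v) ≠ 0 → 1 / 4 ≤ |v| ∧ |v| ≤ 4 := fun v hv => by
    have := hχ₀.support hv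
    rw [← habs v, abs_of_nonneg (by linarith [this.1])]
    exact this
  refine ⟨hχ₀.smooth.comp (by fun_prop), ?_, fun v hv => ?_⟩
  · exact HasCompactSupport.of_support_subset_isCompact (isCompact_Icc (a := -4) (b := 4))
      fun v hv => abs_le.1 (hsub v hv).2
  · exact closure_minimal (t := {v : ℝ | 1 / 4 ≤ |v|}) (fun u hu => (hsub u hu).1)
      (isClosed_le continuous_const continuous_abs) hv

theorem IsModel.exists_signed_estimate (hM : IsModel S Kx Kt O κ) (hχ : ContDiff ℝ ∞ χ)
    (hχK : tsupport χ ⊆ Kx) (hχ₀ : IsDyadicCutoff χ₀)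
    (hϑ : ContDiff ℝ ∞ ϑ) (hϑs : tsupport ϑ ⊆ freqAnnulus) (hKy : IsCompact Ky) (N : ℕ) :
    ∃ C ≥ 0, ∀ s : ℝ, s = 1 ∨ s = -1 → ∀ (lam h : ℝ) (F : (Fin 2 → ℝ) × ℝ → ℂ),
      1 ≤ lam → 0 < h → h ≤ 1 → (lam * h ^ 2)⁻¹ ^ N ≤ lam⁻¹ ^ 5 → IsDatum Ky Kt F →
      ∫⁻ x, ‖(lam : ℂ) ^ 2 * physOp S χ (fun v => χ₀ (s * v)) ϑ lam h F x‖ₑ ^ 2 ≤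
        ENNReal.ofReal (C * (lam⁻¹ * h⁻¹)) * ∫⁻ p, ‖F p‖ₑ ^ 2 := by
  have h1 := hχ₀.signed (s := 1) (Or.inl rfl)
  have h2 := hχ₀.signed (s := -1) (Or.inr rfl)
  obtain ⟨C₁, hC₁, hb₁⟩ := hM.exists_noncentral_estimate hχ hχK h1.1 h1.2.1
    (by norm_num : (0 : ℝ) < 1 / 4) h1.2.2 hϑ hϑs hKy N
  obtain ⟨C₂, hC₂, hb₂⟩ := hM.exists_noncentral_estimate hχ hχK h2.1 h2.2.1
    (by norm_num : (0 : ℝ) < 1 / 4) h2.2.2 hϑ hϑs hKy N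
  refine ⟨max C₁ C₂, hC₁.le.trans (le_max_left _ _), fun s hs lam h F hlam hh hh1 hN hF => ?_⟩
  rcases hs with rfl | rfl
  · refine (hb₁ lam h F hlam hh hh1 hN hF).trans ?_
    gcongr
    exact le_max_left _ _
  · refine (hb₂ lam h F hlam hh hh1 hN hF).trans ?_
    gcongr
    exact le_max_right _ _

/-- Each operator is a sum of operators with symbols localized to a dyadic size of the
curvature, and the sum of their norms obeys the asserted bound. -/
theorem IsModel.exists_decomposition (hM : IsModel S' Kx Kt O κ)
    (hΔ : ∀ z ∈ Kx ×ˢ Kt, ∀ i, Delta S' i z = Delta S i z) (hχ : ContDiff ℝ ∞ χ)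
    (hχK : tsupport χ ⊆ Kx) (hχ₀ : IsDyadicCutoff χ₀) (hϑ : ContDiff ℝ ∞ ϑ)
    (hϑs : tsupport ϑ ⊆ freqAnnulus) (hKy : IsCompact Ky) {ε : ℝ} (hε : 0 < ε) :
    ∃ C ≥ 0, ∀ k ℓ : ℕ, ℓ ≤ ell0 ε k → ∀ s : ℝ, s = 1 ∨ s = -1 →
      ∃ (J : Finset (ℕ ⊕ Bool)) (η : ℕ ⊕ Bool → ℝ → ℝ) (h B : ℕ ⊕ Bool → ℝ),
        (∀ i, Continuous (η i)) ∧ (∀ i, HasCompactSupport (η i)) ∧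
        (∀ z ∈ Kx ×ˢ Kt, ∀ θ ∈ freqAnnulus, symbol χ₀ S ε k ℓ s z ((2 : ℝ) ^ k • θ) =
          ∑ i ∈ J, η i ((h i)⁻¹ * curv S' θ z)) ∧ (∀ i, 0 ≤ B i) ∧
        (∀ i ∈ J, ∀ F, IsDatum Ky Kt F →
          eLpNorm (fun x => (((2 : ℝ) ^ k : ℝ) : ℂ) ^ 2 *
            physOp S' χ (η i) ϑ (2 ^ k) (h i) F x) 2 volume ≤
              ENNReal.ofReal (B i) * eLpNorm F 2 volume) ∧
        ∑ i ∈ J, B i ≤ C * (2 : ℝ) ^ (((ℓ : ℝ) - (k : ℝ)) / 2 + (ℓ : ℝ) * ε) := by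
  -- So many integrations by parts turn the gain λh² into λ^{-5} at every scale up to ℓ₀.
  obtain ⟨N, hN⟩ := exists_nat_ge (5 * (2 + ε) / ε)
  rw [div_le_iff₀ hε, mul_comm (N : ℝ)] at hN
  obtain ⟨M, hM0, hMb⟩ := exists_bound_curv hM.smooth hM.compact_x hM.compact_t
  obtain ⟨ζ, hζ, hζc, hζs, hζe⟩ := hχ₀.exists_highCutoff hM0
  obtain ⟨A₁, hA₁, hb₁⟩ := hM.exists_signed_estimate (Ky := Ky) hχ hχK hχ₀ hϑ hϑs hKy N
  obtain ⟨A₂, hA₂, hb₂⟩ := hM.exists_central_estimate (Ky := Ky) hχ hχK hχ₀.contDiff_lowCutoff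
    hχ₀.hasCompactSupport_lowCutoff hϑ hϑs hKy N
  obtain ⟨A₃, hA₃, hb₃⟩ := hM.exists_noncentral_estimate (Ky := Ky) hχ hχK hζ hζc
    (by norm_num : (0 : ℝ) < 1 / 2) hζs hϑ hϑs hKy N
  have hcurv : ∀ z ∈ Kx ×ˢ Kt, ∀ θ, curv S θ z = curv S' θ z := fun z hz θ => by
    simp only [curv, hΔ z hz]
  have hone : ∀ n : ℕ, (1 : ℝ) ≤ 2 ^ n := fun n => one_le_pow₀ (by norm_num)
  have hsigned : ∀ k m : ℕ, m ≤ ell0 ε k → ∀ s : ℝ, s = 1 ∨ s = -1 → ∀ F, IsDatum Ky Kt F →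
      eLpNorm (fun x => (((2 : ℝ) ^ k : ℝ) : ℂ) ^ 2 *
        physOp S' χ (fun v => χ₀ (s * v)) ϑ (2 ^ k) (2 ^ m)⁻¹ F x) 2 volume ≤
      ENNReal.ofReal (Real.sqrt A₁ * 2 ^ (((m : ℝ) - k) / 2)) * eLpNorm F 2 volume := by
    intro k m hm s hs F hF
    rw [← sqrt_const_mul_two_rpow _ _ hA₁, ← inv_pow_mul_inv_inv]
    exact eLpNorm_two_le_of_lintegral_le (hb₁ s hs _ _ F (hone k) (by positivity)
      (inv_le_one_of_one_le₀ (hone m)) (dyadic_scale_bounds hε hN hm).2 hF)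
  refine ⟨3 * Real.sqrt A₁ + Real.sqrt A₂ * 2 ^ ((2 + ε) / 2) + Real.sqrt A₃, by positivity,
    fun k ℓ hℓ s hs => ?_⟩
  have hℓ0 : (0 : ℝ) ≤ ℓ := Nat.cast_nonneg ℓ
  have hpow : (2 : ℝ) ^ (((ℓ : ℝ) - k) / 2) ≤ 2 ^ (((ℓ : ℝ) - k) / 2 + ℓ * ε) :=
    Real.rpow_le_rpow_of_exponent_le (by norm_num) (by nlinarith)
  rcases hℓ.lt_or_eq with hlt | heq
  · refine ⟨{Sum.inl ℓ}, fun _ v => χ₀ (s * v), fun _ => (2 ^ ℓ)⁻¹,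
      fun _ => Real.sqrt A₁ * 2 ^ (((ℓ : ℝ) - k) / 2), fun _ => (hχ₀.signed hs).1.continuous,
      fun _ => (hχ₀.signed hs).2.1, fun z hz θ _ => ?_, fun _ => by positivity,
      fun i _ F hF => hsigned k ℓ hℓ s hs F hF, ?_⟩
    · rw [symbol, if_pos hlt, dyadic_argument_eq, Finset.sum_singleton, inv_inv, hcurv z hz]
    · rw [Finset.sum_singleton]
      refine mul_le_mul ?_ hpow (by positivity) (by positivity)
      have h1 := Real.sqrt_nonneg A₁
      have h2 := Real.sqrt_nonneg A₃
      have h3 : 0 ≤ Real.sqrt A₂ * 2 ^ ((2 + ε) / 2) := by positivity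
      linarith
  · have hs' : -s = 1 ∨ -s = -1 := by
      rcases hs with rfl | rfl <;> simp
    -- At ℓ = ℓ₀ the left summands are the dyadic pieces of the opposite sign. `true` is the piece 1
    -- - `lowCutoff` at scale 1, and `false` is the central piece at scale 2^{-ℓ}.
    refine ⟨(Finset.range ℓ).disjSum Finset.univ,
      Sum.elim (fun _ v => χ₀ (-s * v)) (fun b => cond b ζ (lowCutoff χ₀)),
      Sum.elim (fun m => (2 ^ m)⁻¹) (fun b => cond b 1 (2 ^ ℓ)⁻¹),
      Sum.elim (fun m => Real.sqrt A₁ * 2 ^ (((m : ℝ) - k) / 2))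
        (fun b => cond b (Real.sqrt A₃ * 2 ^ (((0 : ℝ) - k) / 2))
          (Real.sqrt A₂ * 2 ^ (-(ℓ : ℝ) / 2))), ?_, ?_, fun z hz θ hθ => ?_, ?_, ?_, ?_⟩
    · rintro (m | _ | _)
      exacts [(hχ₀.signed hs').1.continuous, hχ₀.contDiff_lowCutoff.continuous, hζ.continuous]
    · rintro (m | _ | _)
      exacts [(hχ₀.signed hs').2.1, hχ₀.hasCompactSupport_lowCutoff, hζc]
    · rw [symbol, if_neg (by omega), ← heq]
      simp only [dyadic_argument_eq, hcurv z hz]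
      rw [hχ₀.one_sub_sum_eq ℓ hs, Finset.sum_disjSum]
      simp only [Sum.elim_inl, Sum.elim_inr, Fintype.sum_bool, cond_true, cond_false, inv_inv,
        inv_one, one_mul]
      rw [hζe _ (hMb z hz θ hθ)]
      ring
    · rintro (m | _ | _) <;> simp only [Sum.elim_inl, Sum.elim_inr, cond_true, cond_false] <;>
        positivity
    · rintro (m | _ | _) hi F hF
      · rw [Finset.inl_mem_disjSum, Finset.mem_range] at hi
        exact hsigned k m (by omega) (-s) hs' F hF
      · have hd := dyadic_scale_bounds hε hN hℓ
        simp only [Sum.elim_inr, cond_false]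
        rw [← sqrt_const_mul_two_rpow _ _ hA₂, ← inv_two_pow_eq_rpow]
        exact eLpNorm_two_le_of_lintegral_le (hb₂ _ _ F (hone k) (by positivity)
          (inv_le_one_of_one_le₀ (hone ℓ)) hd.1 hd.2 hF)
      · have hd := dyadic_scale_bounds hε hN (Nat.zero_le (ell0 ε k))
        have e := inv_pow_mul_inv_inv k 0
        rw [pow_zero, inv_one] at hd
        rw [pow_zero, inv_one, Nat.cast_zero] at e
        simp only [Sum.elim_inr, cond_true]
        rw [← sqrt_const_mul_two_rpow _ _ hA₃, ← e]
        exact eLpNorm_two_le_of_lintegral_le (hb₃ _ _ F (hone k) one_pos le_rfl hd.2 hF)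
    · rw [Finset.sum_disjSum]
      simp only [Sum.elim_inl, Sum.elim_inr, Fintype.sum_bool, cond_true, cond_false]
      rw [← Finset.mul_sum]
      have h1 := sum_two_rpow_half_le ℓ (k : ℝ)
      have h3 : (2 : ℝ) ^ (((0 : ℝ) - k) / 2) ≤ 2 ^ (((ℓ : ℝ) - k) / 2 + ℓ * ε) :=
        Real.rpow_le_rpow_of_exponent_le (by norm_num) (by nlinarith)
      -- The central bound h^{1/2} is compared with (λh)^{-1/2} by means of k < (2+ε)(ℓ+1): the
      -- excess (λh²)^{1/2} is at most 2^{(2+ε)/2} 2^{ℓε/2}.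
      have h2 : (2 : ℝ) ^ (-(ℓ : ℝ) / 2) ≤
          2 ^ ((2 + ε) / 2) * 2 ^ (((ℓ : ℝ) - k) / 2 + ℓ * ε) := by
        rw [← Real.rpow_add two_pos]
        refine Real.rpow_le_rpow_of_exponent_le (by norm_num) ?_
        have := lt_mul_ell0_add_one hε k
        rw [← heq] at this
        nlinarith
      calc _ ≤ Real.sqrt A₁ * (3 * 2 ^ (((ℓ : ℝ) - k) / 2 + ℓ * ε)) +
            (Real.sqrt A₃ * 2 ^ (((ℓ : ℝ) - k) / 2 + ℓ * ε) +
              Real.sqrt A₂ * (2 ^ ((2 + ε) / 2) * 2 ^ (((ℓ : ℝ) - k) / 2 + ℓ * ε))) := by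
            gcongr
            exact h1.trans (by gcongr)
        _ = _ := by ring

end Decomposition

end FoldBlowdown
end

/-! ### Passage from the decomposition to the operators, and orthogonality of slabs. -/

noncomputable section

namespace FoldBlowdown

section OperatorBound

variable {S : (Fin 3 → ℝ) × ℝ → (Fin 2 → ℝ)} {Ω : Set ((Fin 3 → ℝ) × ℝ)} {χ₀ : ℝ → ℝ}
  {χL χR : (Fin 3 → ℝ) → ℝ} {ε : ℝ}

theorem R_congr_ae {f g : (Fin 3 → ℝ) → ℂ} (h : f =ᵐ[volume] g) (k ℓ : ℕ) (s : ℝ) :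
    R χ₀ χL χR S ε k ℓ s f = R χ₀ χL χR S ε k ℓ s g := by
  funext x
  simp only [R]
  congr 1
  refine integral_congr_ae (Filter.Eventually.of_forall fun τ => integral_congr_ae ?_)
  filter_upwards [h] with y hy
  rw [hy]

/-- The operators are bounded on measurable square integrable functions, and additive there. -/
theorem IsAdmissible.exists_operator_bound (hS : IsAdmissible S Ω) (hχ₀ : IsDyadicCutoff χ₀)
    (hχL : ContDiff ℝ ∞ χL) (hχR : ContDiff ℝ ∞ χR) (hχLc : HasCompactSupport χL)
    (hχRc : HasCompactSupport χR) (hΩ : ∀ x ∈ tsupport χL, ∀ y ∈ tsupport χR, (x, y 2) ∈ Ω)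
    (hε : 0 < ε) :
    ∃ C : ℝ, 0 < C ∧ ∀ k ℓ : ℕ, ℓ ≤ ell0 ε k → ∀ s : ℝ, s = 1 ∨ s = -1 →
      (∀ f : (Fin 3 → ℝ) → ℂ, Measurable f → MemLp f 2 volume →
        MemLp (R χ₀ χL χR S ε k ℓ s f) 2 volume ∧
        eLpNorm (R χ₀ χL χR S ε k ℓ s f) 2 volume ≤
          ENNReal.ofReal (C * (2 : ℝ) ^ (((ℓ : ℝ) - (k : ℝ)) / 2 + (ℓ : ℝ) * ε)) *
            eLpNorm f 2 volume) ∧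
      ∀ (ι : Type) (I : Finset ι) (f : ι → (Fin 3 → ℝ) → ℂ), (∀ i, Measurable (f i)) →
        (∀ i, MemLp (f i) 2 volume) → ∀ x,
        R χ₀ χL χR S ε k ℓ s (fun y => ∑ i ∈ I, f i y) x =
          ∑ i ∈ I, R χ₀ χL χR S ε k ℓ s (f i) x := by
  set Kx := tsupport χL with hKx
  set Kt := (fun y : Fin 3 → ℝ => y 2) '' tsupport χR with hKt
  set Ky := (fun y : Fin 3 → ℝ => (splitEquiv y).1) '' tsupport χR with hKy
  have hKyc : IsCompact Ky := by
    refine hχRc.image ?_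
    simp only [splitEquiv_apply]
    fun_prop
  have hKtc : IsCompact Kt := hχRc.image (by fun_prop)
  have hK : Kx ×ˢ Kt ⊆ Ω := by
    rintro ⟨x, t⟩ ⟨hx, y, hy, rfl⟩
    exact hΩ x hx y hy
  obtain ⟨S', O, κ, hM, heq⟩ := hS.exists_model hχLc hKtc hK
  have hϑ := hχ₀.contDiff_radialCutoff
  have hϑs := hχ₀.tsupport_radialCutoff
  have hϑc : HasCompactSupport (radialCutoff χ₀) := isCompact_freqAnnulus.of_isClosed_subset
    (isClosed_tsupport _) hϑs
  obtain ⟨C, hC, hdec⟩ := hM.exists_decomposition (Ky := Ky) (S := S)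
    (fun z hz i => Delta_eqOn hM.isOpen heq i z (hM.subset hz)) hχL subset_rfl hχ₀ hϑ hϑs hKyc hε
  obtain ⟨b, hb⟩ := hχR.continuous.bounded_above_of_compact_support hχRc
  -- The factor √(b²) bounds multiplication by χR, and the added 1 makes the constant positive.
  refine ⟨C * Real.sqrt (b ^ 2) + 1, by positivity, fun k ℓ hℓ s hs => ?_⟩
  obtain ⟨J, η, h, B, hη, hηc, hsymb, hB, hest, hsum⟩ := hdec k ℓ hℓ s hs
  have hR : ∀ f : (Fin 3 → ℝ) → ℂ, Measurable f → MemLp f 2 volume → ∀ x,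
      R χ₀ χL χR S ε k ℓ s f x = ∑ i ∈ J, (((2 : ℝ) ^ k : ℝ) : ℂ) ^ 2 *
        physOp S' χL (η i) (radialCutoff χ₀) (2 ^ k) (h i) (splitDatum χR f) x :=
    fun f hf hfL x => R_eq_sum hM.smooth subset_rfl hχ₀ hχR.continuous hχRc
      (Kt := Kt) (fun y hy => ⟨y, hy, rfl⟩) (fun z hz => heq z (hM.subset hz)) J hη hηc hsymb hf hfL x
  refine ⟨fun f hf hfL => ?_, fun ι I f hf hfL x => ?_⟩
  · have hFd : IsDatum Ky Kt (splitDatum χR f) := isDatum_splitDatum hχR.continuous hχRc hf hfL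
    set G : ℕ ⊕ Bool → (Fin 3 → ℝ) → ℂ := fun i x => (((2 : ℝ) ^ k : ℝ) : ℂ) ^ 2 *
        physOp S' χL (η i) (radialCutoff χ₀) (2 ^ k) (h i) (splitDatum χR f) x with hG
    have hGm : ∀ i, Measurable (G i) := fun i => measurable_const.mul
      (measurable_physOp hM.smooth hχL.continuous (hη i) (hηc i) hϑ.continuous hϑc hFd _ _)
    have hRG : R χ₀ χL χR S ε k ℓ s f = ∑ i ∈ J, G i := by
      funext x
      rw [hR f hf hfL x, Finset.sum_apply]
    have hbound : eLpNorm (R χ₀ χL χR S ε k ℓ s f) 2 volume ≤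
        ENNReal.ofReal ((C * Real.sqrt (b ^ 2) + 1) *
          (2 : ℝ) ^ (((ℓ : ℝ) - (k : ℝ)) / 2 + (ℓ : ℝ) * ε)) * eLpNorm f 2 volume := by
      calc _ ≤ ∑ i ∈ J, eLpNorm (G i) 2 volume := by
            rw [hRG]
            exact eLpNorm_sum_le (fun i _ => (hGm i).aestronglyMeasurable) (by norm_num)
        _ ≤ ∑ i ∈ J, ENNReal.ofReal (B i) * eLpNorm (splitDatum χR f) 2 volume :=
            Finset.sum_le_sum fun i hi => hest i hi _ hFd
        _ = ENNReal.ofReal (∑ i ∈ J, B i) * eLpNorm (splitDatum χR f) 2 volume := by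
            rw [ENNReal.ofReal_sum_of_nonneg fun i _ => hB i, Finset.sum_mul]
        _ ≤ ENNReal.ofReal (C * (2 : ℝ) ^ (((ℓ : ℝ) - (k : ℝ)) / 2 + (ℓ : ℝ) * ε)) *
              (ENNReal.ofReal (Real.sqrt (b ^ 2)) * eLpNorm f 2 volume) := by
            gcongr
            exact eLpNorm_two_le_of_lintegral_le (lintegral_splitDatum_le hb)
        _ = ENNReal.ofReal (C * Real.sqrt (b ^ 2) *
              (2 : ℝ) ^ (((ℓ : ℝ) - (k : ℝ)) / 2 + (ℓ : ℝ) * ε)) * eLpNorm f 2 volume := by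
            rw [← mul_assoc, ← ENNReal.ofReal_mul (by positivity)]
            congr 2
            ring
        _ ≤ _ := by
            gcongr
            linarith
    refine ⟨⟨?_, hbound.trans_lt (ENNReal.mul_lt_top ENNReal.ofReal_lt_top hfL.2)⟩, hbound⟩
    rw [hRG, Finset.sum_fn]
    exact (Finset.measurable_sum J fun i _ => hGm i).aestronglyMeasurable
  · have hsplit : splitDatum χR (fun y => ∑ i ∈ I, f i y) =
        fun p => ∑ i ∈ I, splitDatum χR (f i) p := by
      funext p
      simp only [splitDatum, Finset.mul_sum]
    rw [hR _ (Finset.measurable_fun_sum I fun i _ => hf i) (memLp_finsetSum I fun i _ => hfL i) x,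
      hsplit, Finset.sum_congr rfl fun i _ => hR (f i) (hf i) (hfL i) x, Finset.sum_comm]
    refine Finset.sum_congr rfl fun j _ => ?_
    rw [physOp_finset_sum hM.smooth (hη j) (hηc j) hϑ.continuous hϑc I
      (fun i => isDatum_splitDatum hχR.continuous hχRc (hf i) (hfL i)), Finset.mul_sum]

end OperatorBound

/-! ### Decompositions into slabs -/

/-- The endpoints of an interval correspond to null hyperplanes in y, so intervals may be replaced
by their interiors, which are open and pairwise disjoint. -/
theorem slab_interior_ae_eq {δ : ℝ} {I : Set ℝ} (hI : IsIntervalOfLength δ I)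
    {f g : (Fin 3 → ℝ) → ℂ} (h : f =ᵐ[volume] g) :
    slab I f =ᵐ[volume] slab (interior I) g := by
  obtain ⟨a, h1, h2⟩ := hI
  have hne : ∀ c : ℝ, ∀ᵐ y : Fin 3 → ℝ, y 2 ≠ c := fun c =>
    (Measure.quasiMeasurePreserving_eval (fun _ : Fin 3 => (volume : Measure ℝ)) 2).ae
      (Measure.ae_ne volume c)
  filter_upwards [h, hne a, hne (a + δ)] with y hy hya hyb
  have hiff : y 2 ∈ I ↔ y 2 ∈ interior I := by
    refine ⟨fun hyI => ?_, fun hyI => interior_subset hyI⟩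
    have h3 := h2 hyI
    exact interior_maximal h1 isOpen_Ioo ⟨lt_of_le_of_ne h3.1 hya.symm, lt_of_le_of_ne h3.2 hyb⟩
  by_cases hyI : y 2 ∈ I
  · rw [slab, slab, Set.indicator_of_mem (by exact hyI), Set.indicator_of_mem (by exact hiff.1 hyI),
      hy]
  · rw [slab, slab, Set.indicator_of_notMem (by exact hyI),
      Set.indicator_of_notMem (by exact fun h => hyI (hiff.2 h))]

/-- At each point at most one summand is nonzero. -/
theorem enorm_sum_slab_sq (𝓘 : Finset (Set ℝ)) (f : (Fin 3 → ℝ) → ℂ)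
    (hd : ∀ I ∈ 𝓘, ∀ J ∈ 𝓘, I ≠ J → Disjoint (interior I) (interior J)) (y : Fin 3 → ℝ) :
    ‖∑ I ∈ 𝓘, slab (interior I) f y‖ₑ ^ 2 = ∑ I ∈ 𝓘, ‖slab (interior I) f y‖ₑ ^ 2 := by
  by_cases h : ∃ J ∈ 𝓘, y 2 ∈ interior J
  · obtain ⟨J, hJ, hyJ⟩ := h
    have h0 : ∀ I ∈ 𝓘, I ≠ J → slab (interior I) f y = 0 := fun I hI hIJ =>
      Set.indicator_of_notMem (s := {y : Fin 3 → ℝ | y 2 ∈ interior I}) (a := y)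
        (fun hyI => Set.disjoint_left.1 (hd I hI J hJ hIJ) hyI hyJ) f
    rw [Finset.sum_eq_single_of_mem J hJ h0, Finset.sum_eq_single_of_mem J hJ]
    intro I hI hIJ
    simp [h0 I hI hIJ]
  · have h0 : ∀ I ∈ 𝓘, slab (interior I) f y = 0 := fun I hI =>
      Set.indicator_of_notMem (s := {y : Fin 3 → ℝ | y 2 ∈ interior I}) (a := y)
        (fun hyI => h ⟨I, hI, hyI⟩) f
    rw [Finset.sum_eq_zero h0, Finset.sum_eq_zero fun I hI => by simp [h0 I hI]]
    simp

theorem eLpNorm_sum_slab (𝓘 : Finset (Set ℝ)) {f : (Fin 3 → ℝ) → ℂ}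
    (hf : ∀ I, Measurable (slab (interior I) f))
    (hd : ∀ I ∈ 𝓘, ∀ J ∈ 𝓘, I ≠ J → Disjoint (interior I) (interior J)) :
    eLpNorm (fun y => ∑ I ∈ 𝓘, slab (interior I) f y) 2 volume =
      (∑ I ∈ 𝓘, eLpNorm (slab (interior I) f) 2 volume ^ 2) ^ (1 / 2 : ℝ) := by
  have h1 : eLpNorm (fun y => ∑ I ∈ 𝓘, slab (interior I) f y) 2 volume ^ 2 =
      ∑ I ∈ 𝓘, eLpNorm (slab (interior I) f) 2 volume ^ 2 := by
    simp only [eLpNorm_two_sq, enorm_sum_slab_sq 𝓘 f hd]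
    exact lintegral_finsetSum _ fun I _ => (hf I).enorm.pow_const 2
  rw [← h1, ← ENNReal.rpow_natCast, ← ENNReal.rpow_mul]
  norm_num

end FoldBlowdown

end

theorem proposition4p2
    (S : (Fin 3 → ℝ) × ℝ → (Fin 2 → ℝ)) (Ω : Set ((Fin 3 → ℝ) × ℝ))
    (hS : FoldBlowdown.IsAdmissible S Ω)
    (χ₀ : ℝ → ℝ) (hχ₀ : FoldBlowdown.IsDyadicCutoff χ₀)
    (χL χR : (Fin 3 → ℝ) → ℝ)
    (hχL : ContDiff ℝ ∞ χL) (hχR : ContDiff ℝ ∞ χR)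
    (hχLc : HasCompactSupport χL) (hχRc : HasCompactSupport χR)
    (hΩ : ∀ x ∈ tsupport χL, ∀ y ∈ tsupport χR, (x, y 2) ∈ Ω)
    (ε : ℝ) (hε : 0 < ε) :
    ∃ C : ℝ, 0 < C ∧
      ∀ k : ℕ, 1 ≤ k → ∀ ℓ : ℕ, ℓ ≤ FoldBlowdown.ell0 ε k →
      ∀ s : ℝ, s = 1 ∨ s = -1 →
      ∀ f : (Fin 3 → ℝ) → ℂ, MemLp f 2 volume →
        (MemLp (FoldBlowdown.R χ₀ χL χR S ε k ℓ s f) 2 volume ∧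
          eLpNorm (FoldBlowdown.R χ₀ χL χR S ε k ℓ s f) 2 volume ≤
            ENNReal.ofReal (C * (2 : ℝ) ^ (((ℓ : ℝ) - (k : ℝ)) / 2 + (ℓ : ℝ) * ε)) *
              eLpNorm f 2 volume) ∧
        ∀ 𝓘 : Finset (Set ℝ),
          (∀ I ∈ 𝓘, FoldBlowdown.IsIntervalOfLength ((2 : ℝ) ^ (-(ℓ : ℤ))) I) →
          (∀ I ∈ 𝓘, ∀ J ∈ 𝓘, I ≠ J → Disjoint (interior I) (interior J)) →
          eLpNorm (fun x => ∑ I ∈ 𝓘,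
              FoldBlowdown.R χ₀ χL χR S ε k ℓ s (FoldBlowdown.slab I f) x) 2 volume ≤
            ENNReal.ofReal (C * (2 : ℝ) ^ (((ℓ : ℝ) - (k : ℝ)) / 2 + (ℓ : ℝ) * ε)) *
              (∑ I ∈ 𝓘, eLpNorm (FoldBlowdown.slab I f) 2 volume ^ 2) ^ (1 / 2 : ℝ) := by
  obtain ⟨C, hC, hbound⟩ := hS.exists_operator_bound hχ₀ hχL hχR hχLc hχRc hΩ hε
  refine ⟨C, hC, fun k _ ℓ hℓ s hs f hf => ?_⟩
  obtain ⟨hb, hadd⟩ := hbound k ℓ hℓ s hs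
  -- The operator does not change when f is altered on a null set, so a Borel representative may be
  -- used.
  obtain ⟨g, hgm, hfg⟩ : ∃ g, Measurable g ∧ f =ᵐ[volume] g :=
    ⟨_, hf.1.stronglyMeasurable_mk.measurable, hf.1.ae_eq_mk⟩
  have hg : MemLp g 2 volume := (memLp_congr_ae hfg).1 hf
  refine ⟨?_, fun 𝓘 hI hd => ?_⟩
  · rw [FoldBlowdown.R_congr_ae hfg, eLpNorm_congr_ae hfg]
    exact hb g hgm hg
  · have hset : ∀ I : Set ℝ, MeasurableSet {y : Fin 3 → ℝ | y 2 ∈ interior I} := fun I =>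
      measurable_pi_apply 2 isOpen_interior.measurableSet
    have hsm : ∀ I, Measurable (FoldBlowdown.slab (interior I) g) := fun I =>
      hgm.indicator (hset I)
    have hsL : ∀ I, MemLp (FoldBlowdown.slab (interior I) g) 2 volume := fun I =>
      hg.indicator (hset I)
    have hae : ∀ I ∈ 𝓘, FoldBlowdown.slab I f =ᵐ[volume] FoldBlowdown.slab (interior I) g :=
      fun I hI' => FoldBlowdown.slab_interior_ae_eq (hI I hI') hfg
    -- By additivity the sum is the operator applied to a single function, and the orthogonality of
    -- the slabs evaluates the norm of that function.
    have h1 : (fun x => ∑ I ∈ 𝓘, FoldBlowdown.R χ₀ χL χR S ε k ℓ s (FoldBlowdown.slab I f) x) =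
        FoldBlowdown.R χ₀ χL χR S ε k ℓ s
          (fun y => ∑ I ∈ 𝓘, FoldBlowdown.slab (interior I) g y) := by
      funext x
      rw [hadd _ 𝓘 _ hsm hsL x]
      exact Finset.sum_congr rfl fun I hI' => by rw [FoldBlowdown.R_congr_ae (hae I hI')]
    rw [h1, Finset.sum_congr rfl fun I hI' => by rw [eLpNorm_congr_ae (hae I hI')],
      ← FoldBlowdown.eLpNorm_sum_slab 𝓘 hsm hd]
    exact (hb _ (Finset.measurable_fun_sum 𝓘 fun I _ => hsm I)
      (memLp_finsetSum 𝓘 fun I _ => hsL I)).2
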